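/- **Setting.** Let $n\ge 1$, let $(M,g)$ be a smooth ($C^\infty$) Riemannian manifold of dimension $n$ without boundary (not assumed complete), $d$ its distance, $B(x,r)$ and $\bar B(x,r)$ its open and closed balls, $x_0\in M$, and let $(\Omega,\varphi)$ be a chart with $x_0\in\Omega$. Laplacians are $\Delta=-\operatorname{div}\nabla$, i.e. $\Delta f=-\frac1{\sqrt{\det g}}\partial_i(g^{ij}\sqrt{\det g}\,\partial_j f)$ in coordinates. An orthonormal basis $b$ of $T_xM$ identifies $T_xM$ with $\mathbb R^n$, and we write $\exp_x(y)$ for $\exp_x(\sum_i y_ib_i)$, $y\in\mathbb R^n$; $B^0_r$ is the open ball of radius $r$ about $0$ in $\mathbb R^n$, $g_{x,kl}(y)$ are the components of $\exp_x^*g$ at $y$, and $J(x,r,\theta)=\sqrt{\det g_{x,kl}(r\theta)}$ for $\theta\in\mathbb S^{n-1}$. For a chart $\psi$ of $\mathbb S^{n-1}$ with inverse $u\mapsto\theta(u)$ put $b_i^k=\partial\theta^k/\partial u_i$, $\alpha(u)=\sqrt{\det(\langle\partial_i\theta,\partial_j\theta\rangle)}$, let $\partial_r,\partial_{\theta_i}$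 be the coordinate fields of $(r,u)\mapsto\exp_x(r\theta(u))$, $g_{ij}=g(\partial_{\theta_i},\partial_{\theta_j})$, and $\tilde g_{ij}(x,r,u)=\sum_{k,l}b_i^kb_j^l\,g_{x,kl}(r\theta(u))$, $|\tilde g|=\det(\tilde g_{ij})$ (also for $r\le 0$). **Statement.** There is $\varepsilon>0$ such that for every $x\in B(x_0,\varepsilon)$ one has $B(x,\varepsilon)\subset\Omega$ and, for every orthonormal basis $b$ of $T_xM$: 1. (Normal chart, geodesic balls.) $\exp_x$ is a smooth diffeomorphism from $B^0_\varepsilon$ onto $B(x,\varepsilon)$, so that its inverse is a chart; $\exp_x(0)=x$, $g_{x,ij}(0)=\delta_{ij}$ and $\partial_kg_{x,ij}(0)=0$. For $|\theta|=1$, $t\mapsto\exp_x(t\theta)$ is on $(-\varepsilon,\varepsilon)$ the geodesic with initial velocity $\theta$, and its length on $[0,r]$ is $d(x,\exp_x(r\theta))$ for $0\le r<\varepsilon$. $\exp_x$ maps the open ball of radius $r\in(0,\varepsilon]$ onto $B(x,r)$, and, for $0\le r<\varepsilon$, the closed ball and the sphere of radius $r$ onto $\bar B(x,r)$ and $S_r(x)=\{d(x,\cdot)=r\}$.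 2. (Orientation and normal.) If $b$ is direct with respect to the coordinate frame of $\varphi$ at $x$, then at each point of $B(x,\varepsilon)$ the frame of the exponential chart is direct with respect to the frame of $\varphi$. For $0<r<\varepsilon$ and $p=\exp_x(r\theta(u))$, $\partial_r$ is the unique outward unit normal to $B(x,r)$ at $p$. The frame $(\partial_r,\partial_{\theta_1},\dots,\partial_{\theta_{n-1}})$ is direct with respect to the frame of the exponential chart if and only if $(\theta,\partial_1\theta,\dots,\partial_{n-1}\theta)$ is direct in $\mathbb R^n$; in this case $\partial_r$ is the only unit vector $\nu\in T_pM$ orthogonal to all $\partial_{\theta_i}$ for which $(\nu,\partial_{\theta_1},\dots,\partial_{\theta_{n-1}})$ is direct, and the volume form of the ball (oriented by the exponential chart) takes on $(\partial_r,\partial_{\theta_1},\dots,\partial_{\theta_{n-1}})$ the value $\sqrt{\det(g_{ij})}$. 3. (Gauss's lemma.) $\langle\partial_r,\partial_r\rangle=1$ and $\langle\partial_r,\partial_{\theta_i}\rangle=0$ for $0<r<\varepsilon$. 4. (Metric components and volume density.) On $(-\varepsilon,\varepsilon)\times\psi(U)$, where $U\subset\mathbb S^{n-1}$ is the domain of $\psi$,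 the $\tilde g_{ij}$ are smooth, $(\tilde g_{ij})$ is positive definite, $\alpha>0$, and $\sqrt{|\tilde g|}=\alpha(u)\,J(x,r,\theta(u))$. For $0<r<\varepsilon$, $g_{ij}=r^2\tilde g_{ij}$ and $\partial_r\log\sqrt{|\tilde g|}=\partial_r\log J$. At $r=0$, for all $u$ and all indices, $$\partial_r\tilde g_{ij}=\partial_r\partial_{\theta_m}\tilde g_{ij}=0,\qquad \partial_r|\tilde g|=\partial_r\partial_{\theta_m}|\tilde g|=0,$$ $$\partial_r\frac{\sqrt{|\tilde g|}}{\alpha}=\partial_r\partial_{\theta_m}\frac{\sqrt{|\tilde g|}}{\alpha}=\partial_r\partial_{\theta_m}\partial_{\theta_{m'}}\frac{\sqrt{|\tilde g|}}{\alpha}=0.$$ 5. (Laplacian.) For $0<r<\varepsilon$ let $L_\theta(x,r)=r^2\Delta_{S_r(x)}$, where $\Delta_{S_r(x)}$ is the Laplacian of the metric induced by $g$ on $S_r(x)$, transported to $\mathbb S^{n-1}$ by $\theta\mapsto\exp_x(r\theta)$. If $w$ is $C^2$ near $\exp_x(r\theta)$ and $\bar w(\rho,\theta')=w(\exp_x(\rho\theta'))$,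 then at $(r,\theta)$ $$-\Delta w=\partial_{rr}\bar w+\frac{n-1}{r}\partial_r\bar w+\partial_r(\log J)\,\partial_r\bar w-\frac1{r^2}L_\theta(x,r)\bar w .$$ On functions that are $C^2$ near the point considered, $L_\theta(x,r)$ is the Laplacian of the metric $g_{x,r}=r^{-2}(\theta\mapsto\exp_x(r\theta))^*g$, which is a smooth Riemannian metric on $\mathbb S^{n-1}$; in every chart $\psi$ the components of $g_{x,r}$ are $\tilde g_{ij}$, and $L_\theta(x,r)=-\frac1{\sqrt{|\tilde g|}}\partial_{\theta_i}\big(\tilde g^{ij}\sqrt{|\tilde g|}\,\partial_{\theta_j}\big)$. Moreover, with the same $\varepsilon$: if $b=b(x)$ is a smooth field of orthonormal frames on an open set $V\subset B(x_0,\varepsilon)$, then $\exp_x(y)$ and $g_{x,kl}(y)$ are smooth functions of $(x,y)\in V\times B^0_\varepsilon$, and $\tilde g_{ij}(x,r,u)$ is a smooth function of $(x,r,u)\in V\times(-\varepsilon,\varepsilon)\times\psi(U)$. -/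

import Mathlib

open Set Bundle
open scoped Manifold ContDiff Topology ENNReal

namespace PolarGeo

noncomputable section

/-! ### Riemannian calculus in coordinates -/

/-- The `i`-th partial derivative of a real function on `ℝᵏ`. -/
def pd {k : ℕ} (i : Fin k) (f : EuclideanSpace ℝ (Fin k) → ℝ) (y : EuclideanSpace ℝ (Fin k)) : ℝ :=
  fderiv ℝ f y (EuclideanSpace.single i 1)

/-- The components `h (∂ᵢF, ∂ⱼF)` at `y` of the pull-back by a parametrization `F : ℝᵏ → N` of a
field `h` of bilinear forms on the tangent spaces of a manifold `N`. If `F` is the inverse of a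
chart, these are the components of `h` in this chart. -/
def pullGram {d k : ℕ} {N : Type*} [TopologicalSpace N]
    [ChartedSpace (EuclideanSpace ℝ (Fin d)) N]
    (h : ∀ p : N, TangentSpace (𝓡 d) p → TangentSpace (𝓡 d) p → ℝ)
    (F : EuclideanSpace ℝ (Fin k) → N) (y : EuclideanSpace ℝ (Fin k)) :
    Matrix (Fin k) (Fin k) ℝ :=
  Matrix.of fun i j =>
    h (F y) (mfderiv (𝓡 k) (𝓡 d) F y (EuclideanSpace.single i 1 : EuclideanSpace ℝ (Fin k)))
      (mfderiv (𝓡 k) (𝓡 d) F y (EuclideanSpace.single j 1 : EuclideanSpace ℝ (Fin k)))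

/-- The Christoffel symbol `Γᵏᵢⱼ` at `y` of the metric with components `G` on `ℝᵈ`. -/
def christoffel {d : ℕ} (G : EuclideanSpace ℝ (Fin d) → Matrix (Fin d) (Fin d) ℝ)
    (y : EuclideanSpace ℝ (Fin d)) (k i j : Fin d) : ℝ :=
  (1 / 2) * ∑ l, (G y)⁻¹ k l *
    (pd i (fun z => G z j l) y + pd j (fun z => G z i l) y - pd l (fun z => G z i j) y)

/-- The (geometer's, nonnegative) Laplacian in coordinates,
`Δ f = - (det G)^{-1/2} ∂ᵢ (Gⁱʲ (det G)^{1/2} ∂ⱼ f)`. -/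
def coordLaplacian {d : ℕ} (G : EuclideanSpace ℝ (Fin d) → Matrix (Fin d) (Fin d) ℝ)
    (f : EuclideanSpace ℝ (Fin d) → ℝ) (y : EuclideanSpace ℝ (Fin d)) : ℝ :=
  -(1 / √(G y).det *
    ∑ i, pd i (fun z => ∑ j, (G z)⁻¹ i j * √(G z).det * pd j f z) y)

/-- The Laplace–Beltrami operator `Δ = -div grad` of the metric `h` on a `d`-dimensional manifold:
at `p` it is computed in the preferred chart around `p`. -/
def laplaceBeltrami {d : ℕ} {N : Type*} [TopologicalSpace N]
    [ChartedSpace (EuclideanSpace ℝ (Fin d)) N]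
    (h : ∀ p : N, TangentSpace (𝓡 d) p → TangentSpace (𝓡 d) p → ℝ) (f : N → ℝ) (p : N) : ℝ :=
  coordLaplacian (pullGram h (chartAt (EuclideanSpace ℝ (Fin d)) p).symm)
    (f ∘ (chartAt (EuclideanSpace ℝ (Fin d)) p).symm) (chartAt (EuclideanSpace ℝ (Fin d)) p p)

/-- `d` is the determinant of the family `v` expressed in the basis `B`. -/
def HasDet {k : ℕ} {V : Type*} [AddCommGroup V] [Module ℝ V] (B v : Fin k → V) (d : ℝ) : Prop :=
  ∃ A : Matrix (Fin k) (Fin k) ℝ, (∀ j, v j = ∑ i, A i j • B i) ∧ A.det = d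

/-- The basis `v` is direct (positively oriented) with respect to the basis `B`. -/
def IsDirect {k : ℕ} {V : Type*} [AddCommGroup V] [Module ℝ V] (B v : Fin k → V) : Prop :=
  ∃ d : ℝ, 0 < d ∧ HasDet B v d

/-- The frame `∂₁F, …, ∂ₖF` at `y` of a map `F : ℝᵏ → N`. If `F` is the inverse of a chart, these
are the coordinate vector fields of the chart. -/
def coordFrame {d k : ℕ} {N : Type*} [TopologicalSpace N]
    [ChartedSpace (EuclideanSpace ℝ (Fin d)) N]
    (F : EuclideanSpace ℝ (Fin k) → N) (y : EuclideanSpace ℝ (Fin k)) (i : Fin k) :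
    TangentSpace (𝓡 d) (F y) :=
  mfderiv (𝓡 k) (𝓡 d) F y (EuclideanSpace.single i 1 : EuclideanSpace ℝ (Fin k))

/-! ### Geodesics and the exponential map of a Riemannian manifold -/

section Riemannian

variable {n : ℕ} {M : Type*} [TopologicalSpace M] [ChartedSpace (EuclideanSpace ℝ (Fin n)) M]

/-- The point `γ t` together with the velocity of `γ` at `t`, in the tangent bundle. -/
def velocity (γ : ℝ → M) (t : ℝ) : TangentBundle (𝓡 n) M :=
  ⟨γ t, mfderiv 𝓘(ℝ, ℝ) (𝓡 n) γ t (1 : ℝ)⟩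

variable [RiemannianBundle (fun x : M => TangentSpace (𝓡 n) x)]

/-- The Riemannian metric of `M`, as a field of bilinear forms. -/
def metric (p : M) (v w : TangentSpace (𝓡 n) p) : ℝ := inner ℝ v w

/-- `γ` is a geodesic on the open set `s` of times: it is `C²` there and satisfies, in every chart
of the maximal atlas, the equation `γ''ᵏ + Γᵏᵢⱼ γ'ⁱ γ'ʲ = 0`. -/
def IsGeodesicOn (γ : ℝ → M) (s : Set ℝ) : Prop :=
  ContMDiffOn 𝓘(ℝ, ℝ) (𝓡 n) 2 γ s ∧
  ∀ e ∈ IsManifold.maximalAtlas (𝓡 n) ∞ M, ∀ t ∈ s, γ t ∈ e.source → ∀ k : Fin n,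
    deriv (deriv fun τ => e (γ τ) k) t +
      ∑ i, ∑ j, christoffel (pullGram (metric (n := n) (M := M)) e.symm) (e (γ t)) k i j *
        deriv (fun τ => e (γ τ) i) t * deriv (fun τ => e (γ τ) j) t = 0

open Classical in
/-- The exponential map: `exp_x v` is the value at time `1` of the geodesic with initial position
`x` and initial velocity `v` (and the junk value `x` if there is no such geodesic). -/
def expMap (x : M) (v : TangentSpace (𝓡 n) x) : M :=
  if h : ∃ γ : ℝ → M, (∃ δ > 0, IsGeodesicOn (n := n) γ (Ioo (-δ) (1 + δ))) ∧ velocity γ 0 = ⟨x, v⟩ then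
    h.choose 1
  else x

/-- The exponential map at `x` read on `ℝⁿ` through a family `b` of `n` vectors of `T_x M`
(an orthonormal basis, in the applications): `y ↦ exp_x (∑ yᵢ bᵢ)`. -/
def expChart {x : M} (b : Fin n → TangentSpace (𝓡 n) x) (y : EuclideanSpace ℝ (Fin n)) : M :=
  expMap x (∑ i, y i • b i)

/-- The components `g_{x,ij}` of the metric in the exponential chart at `x`, as functions of the
normal coordinates `y ∈ ℝⁿ`. -/
def expGram {x : M} (b : Fin n → TangentSpace (𝓡 n) x) (y : EuclideanSpace ℝ (Fin n)) :
    Matrix (Fin n) (Fin n) ℝ :=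
  pullGram (metric (n := n) (M := M)) (expChart b) y

/-- The volume density `J(x, y) = √det g_{x,ij}` in the exponential chart; in polar coordinates
`J(x, r, θ)` is its value at `y = r θ`. -/
def expJ {x : M} (b : Fin n → TangentSpace (𝓡 n) x) (y : EuclideanSpace ℝ (Fin n)) : ℝ :=
  √(expGram b y).det

/-- `ν` is the outward unit normal at `p` to the domain `D`: near `p`, `D` is `{f < 0}` for a
smooth `f` with `f p = 0`, and `ν` is the normalized gradient of `f` at `p`. -/
def IsOutwardUnitNormal (D : Set M) (p : M) (ν : TangentSpace (𝓡 n) p) : Prop :=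
  ‖ν‖ = 1 ∧ ∃ f : M → ℝ, ContMDiffAt (𝓡 n) 𝓘(ℝ, ℝ) ∞ f p ∧ f p = 0 ∧
    (∀ᶠ q in 𝓝 p, q ∈ D ↔ f q < 0) ∧
    ∃ c : ℝ, 0 < c ∧ ∀ w : TangentSpace (𝓡 n) p,
      (mfderiv (𝓡 n) 𝓘(ℝ, ℝ) f p w : ℝ) = c * inner ℝ ν w

end Riemannian

/-! ### Geodesic polar coordinates -/

section Polar

variable {m : ℕ}

/-- The unit sphere `S^{n-1}` of `ℝⁿ`, with `n = m + 1`. -/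
abbrev USphere (m : ℕ) : Type := Metric.sphere (0 : EuclideanSpace ℝ (Fin (m + 1))) 1

/-- For a chart `ψ` of the sphere, the vector `∂(ψ⁻¹)/∂θᵢ` of `ℝⁿ`; its components are the
functions `bᵢᵏ(θ)`. -/
def sphFrame (ψ : OpenPartialHomeomorph (USphere m) (EuclideanSpace ℝ (Fin m)))
    (u : EuclideanSpace ℝ (Fin m)) (i : Fin m) : EuclideanSpace ℝ (Fin (m + 1)) :=
  fderiv ℝ (fun u' => (ψ.symm u' : EuclideanSpace ℝ (Fin (m + 1)))) u (EuclideanSpace.single i 1)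

/-- The Euclidean density `α(θ)` of the round unit sphere in the chart `ψ`. -/
def sphDensity (ψ : OpenPartialHomeomorph (USphere m) (EuclideanSpace ℝ (Fin m)))
    (u : EuclideanSpace ℝ (Fin m)) : ℝ :=
  √(Matrix.of fun i j : Fin m => (inner ℝ (sphFrame ψ u i) (sphFrame ψ u j) : ℝ)).det

variable {M : Type*} [TopologicalSpace M] [ChartedSpace (EuclideanSpace ℝ (Fin (m + 1))) M]
  [RiemannianBundle (fun x : M => TangentSpace (𝓡 (m + 1)) x)]

/-- Geodesic polar coordinates centred at `x`: `(r, u) ↦ exp_x (r ψ⁻¹(u))`. -/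
def polarMap {x : M} (b : Fin (m + 1) → TangentSpace (𝓡 (m + 1)) x)
    (ψ : OpenPartialHomeomorph (USphere m) (EuclideanSpace ℝ (Fin m)))
    (q : ℝ × EuclideanSpace ℝ (Fin m)) : M :=
  expChart b (q.1 • (ψ.symm q.2 : EuclideanSpace ℝ (Fin (m + 1))))

/-- The coordinate field `∂_r` of geodesic polar coordinates. -/
def dR {x : M} (b : Fin (m + 1) → TangentSpace (𝓡 (m + 1)) x)
    (ψ : OpenPartialHomeomorph (USphere m) (EuclideanSpace ℝ (Fin m)))
    (r : ℝ) (u : EuclideanSpace ℝ (Fin m)) :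
    TangentSpace (𝓡 (m + 1)) (polarMap b ψ (r, u)) :=
  mfderiv 𝓘(ℝ, ℝ × EuclideanSpace ℝ (Fin m)) (𝓡 (m + 1)) (polarMap b ψ) (r, u)
    ((1, 0) : ℝ × EuclideanSpace ℝ (Fin m))

/-- The coordinate field `∂_{θᵢ}` of geodesic polar coordinates. -/
def dTheta {x : M} (b : Fin (m + 1) → TangentSpace (𝓡 (m + 1)) x)
    (ψ : OpenPartialHomeomorph (USphere m) (EuclideanSpace ℝ (Fin m)))
    (r : ℝ) (u : EuclideanSpace ℝ (Fin m)) (i : Fin m) :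
    TangentSpace (𝓡 (m + 1)) (polarMap b ψ (r, u)) :=
  mfderiv 𝓘(ℝ, ℝ × EuclideanSpace ℝ (Fin m)) (𝓡 (m + 1)) (polarMap b ψ) (r, u)
    ((0, EuclideanSpace.single i 1) : ℝ × EuclideanSpace ℝ (Fin m))

/-- The frame `(ν, ∂_{θ₁}, …, ∂_{θ_{n-1}})` at the point with polar coordinates `(r, u)`. -/
def polarFrame {x : M} (b : Fin (m + 1) → TangentSpace (𝓡 (m + 1)) x)
    (ψ : OpenPartialHomeomorph (USphere m) (EuclideanSpace ℝ (Fin m)))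
    (r : ℝ) (u : EuclideanSpace ℝ (Fin m))
    (ν : TangentSpace (𝓡 (m + 1)) (polarMap b ψ (r, u))) :
    Fin (m + 1) → TangentSpace (𝓡 (m + 1)) (polarMap b ψ (r, u)) :=
  Fin.cons (α := fun _ => TangentSpace (𝓡 (m + 1)) (polarMap b ψ (r, u))) ν (dTheta b ψ r u)

/-- The frame `(θ, ∂(ψ⁻¹)/∂θ₁, …, ∂(ψ⁻¹)/∂θ_{n-1})` of `ℝⁿ`, `θ = ψ⁻¹(u)`. -/
def euclPolarFrame (ψ : OpenPartialHomeomorph (USphere m) (EuclideanSpace ℝ (Fin m)))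
    (u : EuclideanSpace ℝ (Fin m)) : Fin (m + 1) → EuclideanSpace ℝ (Fin (m + 1)) :=
  Fin.cons (α := fun _ => EuclideanSpace ℝ (Fin (m + 1)))
    (ψ.symm u : EuclideanSpace ℝ (Fin (m + 1))) (sphFrame ψ u)

/-- The angular components `gᵢⱼ(r, θ) = g (∂_{θᵢ}, ∂_{θⱼ})`. -/
def polarGram {x : M} (b : Fin (m + 1) → TangentSpace (𝓡 (m + 1)) x)
    (ψ : OpenPartialHomeomorph (USphere m) (EuclideanSpace ℝ (Fin m)))
    (r : ℝ) (u : EuclideanSpace ℝ (Fin m)) : Matrix (Fin m) (Fin m) ℝ :=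
  Matrix.of fun i j => metric (polarMap b ψ (r, u)) (dTheta b ψ r u i) (dTheta b ψ r u j)

/-- The rescaled angular components `g̃ᵢⱼ(x, r, θ) = bᵢᵏ(θ) bⱼˡ(θ) g_{x,kl}(exp_x (r θ))`, which
make sense for `r = 0` too. -/
def tGram {x : M} (b : Fin (m + 1) → TangentSpace (𝓡 (m + 1)) x)
    (ψ : OpenPartialHomeomorph (USphere m) (EuclideanSpace ℝ (Fin m)))
    (r : ℝ) (u : EuclideanSpace ℝ (Fin m)) : Matrix (Fin m) (Fin m) ℝ :=
  Matrix.of fun i j => ∑ k, ∑ l, sphFrame ψ u i k * sphFrame ψ u j l *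
    expGram b (r • (ψ.symm u : EuclideanSpace ℝ (Fin (m + 1)))) k l

/-- The map `θ ↦ exp_x (r θ)` from the unit sphere to the geodesic sphere `S_r(x)`. -/
def sphMap {x : M} (b : Fin (m + 1) → TangentSpace (𝓡 (m + 1)) x) (r : ℝ) (θ : USphere m) : M :=
  expChart b (r • (θ : EuclideanSpace ℝ (Fin (m + 1))))

/-- The pull-back to the unit sphere, by `θ ↦ exp_x (r θ)`, of the metric induced by `g` on the
geodesic sphere `S_r(x)`. -/
def inducedForm {x : M} (b : Fin (m + 1) → TangentSpace (𝓡 (m + 1)) x) (r : ℝ)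
    (θ : USphere m) (v w : TangentSpace (𝓡 m) θ) : ℝ :=
  metric (sphMap b r θ) (mfderiv (𝓡 m) (𝓡 (m + 1)) (sphMap b r) θ v)
    (mfderiv (𝓡 m) (𝓡 (m + 1)) (sphMap b r) θ w)

/-- The metric `g_{x,r}` on the unit sphere: `r⁻²` times the induced metric. -/
def sphForm {x : M} (b : Fin (m + 1) → TangentSpace (𝓡 (m + 1)) x) (r : ℝ)
    (θ : USphere m) (v w : TangentSpace (𝓡 m) θ) : ℝ :=
  (r ^ 2)⁻¹ * inducedForm b r θ v w

/-- The operator `L_θ(x, r)` on functions on the unit sphere. -/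
def angularLaplacian {x : M} (b : Fin (m + 1) → TangentSpace (𝓡 (m + 1)) x) (r : ℝ)
    (f : USphere m → ℝ) (θ : USphere m) : ℝ :=
  r ^ 2 * laplaceBeltrami (inducedForm b r) f θ

end Polar

end

end PolarGeo

open PolarGeo

namespace PolarGeo

open scoped Matrix

/-! ### Smoothness of the composition operator on spaces of continuous maps -/

section Omega

variable {K : Type} [TopologicalSpace K] [CompactSpace K]
  {E F : Type} [NormedAddCommGroup E] [NormedSpace ℝ E] [NormedAddCommGroup F] [NormedSpace ℝ F]

/-! In a chart, geodesics solve a second order equation γ'' = Q(γ, γ') with Q quadratic in the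
velocity. On a fixed time interval [-1, 1], the velocity v of the solution with data (y, w) is
characterized by v - ∫ Q(y + ∫ v, v) = w. This is an equation between continuous curves, and its
left side is smooth because composition with a smooth map is a smooth operation on curves
(`contDiff_postcomp`). Since Q vanishes to second order at zero velocity, the linearization at the
constant curve is the identity. The inverse function theorem therefore gives solutions depending
smoothly on (y, w), and quadratic homogeneity identifies the time-one map restricted to a line with
the solution itself (`exists_spray_exp`).

Independence of the chart is proved on the Euler–Lagrange form of the geodesic equation, which
behaves well under pull-back (`EL.pullForm`, `EL_chart_change`). Uniqueness of geodesics
(`geodesic_unique`) then identifies the local solution with `expMap`.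

A radius common to all centres comes from inverting (y, w) ↦ (y, X(y, w)) once, near (φ x₀, 0), and
slicing the inverse at each y. Orthonormal frames at nearby points are uniformly bounded in the
chart, so a single ε serves every centre and every frame (`exists_uniform_chartExp`,
`ChartExp.exists_isNormalChart`).

In a normal chart the rays tw are geodesics, and Gauss's lemma (`gauss_lemma`, `bil_expGram_ray`)
says that g(tw)(w, ·) is the Euclidean pairing with w. The metric part of the theorem follows from
this identity: - Cauchy–Schwarz against the radial field shows that a curve starting at the centre
is at least as long as the radius it reaches, so geodesic balls are metric balls (`le_pathELength`,
`mem_of_pathELength_lt`, `edist_expChart`). - Differentiating it at the origin and permuting indices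
kills all first derivatives of the metric there (`fderiv_bil_expGram_zero`). Hence the rescaled
angular components have zero radial derivative at r = 0, and symmetry of second derivatives
transfers this to angular derivatives (`pd_of_hasDerivAt_zero`). - The metric splits as dr² + r² g̃,
which yields the unit normal, the determinant formula (`det_tGram`) and the volume form.

For the Laplacian, the coordinate formula is shown invariant under coordinate changes by the Piola
identity (`sum_pd_det_mul_inv`, `coordLaplacian_comp`). It is then evaluated on the block metric
(`coordLaplacian_polar`), and constant rescaling turns r² times the Laplacian of the geodesic sphere
into that of g_{x,r} (`coordLaplacian_smul`). -/

set_option synthInstance.maxHeartbeats 400000 in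
noncomputable instance : NormedAddCommGroup C(K, E →L[ℝ] F) := inferInstance

set_option synthInstance.maxHeartbeats 400000 in
noncomputable instance : NormedSpace ℝ C(K, E →L[ℝ] F) := inferInstance

/-- Composition on the left with a continuous map. -/
def postcomp (K : Type) [TopologicalSpace K] (f : C(E, F)) (γ : C(K, E)) : C(K, F) := f.comp γ

/-- Pointwise evaluation of a field of operators on a field of vectors. -/
noncomputable def pointwiseApply (K : Type) [TopologicalSpace K] [CompactSpace K]
    (E F : Type) [NormedAddCommGroup E] [NormedSpace ℝ E]
    [NormedAddCommGroup F] [NormedSpace ℝ F] : C(K, E →L[ℝ] F) →L[ℝ] C(K, E) →L[ℝ] C(K, F) :=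
  LinearMap.mkContinuous₂
    (LinearMap.mk₂ ℝ (fun A h => (⟨fun k => A k (h k), by fun_prop⟩ : C(K, F)))
      (by intros; ext; simp) (by intros; ext; simp) (by intros; ext; simp) (by intros; ext; simp)) 1
    (by
      intro A h
      refine (ContinuousMap.norm_le _ (by positivity)).2 fun k => ?_
      rw [one_mul]
      exact ((A k).le_opNorm (h k)).trans
        (mul_le_mul (A.norm_coe_le_norm k) (h.norm_coe_le_norm k) (by positivity) (by positivity)))

/-- The mean value inequality is applied on each segment [γ k, η k]. It is uniform in k because γ ↦
f' ∘ γ is continuous for the sup norm, which bounds the oscillation of f' on all these segments at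
once. -/
lemma hasFDerivAt_postcomp (f : C(E, F)) (f' : C(E, E →L[ℝ] F))
    (hf : ∀ x, HasFDerivAt f (f' x) x) (γ : C(K, E)) :
    HasFDerivAt (postcomp K f) (pointwiseApply K E F (postcomp K f' γ)) γ := by
  rw [hasFDerivAt_iff_isLittleO, Asymptotics.isLittleO_iff]
  intro c hc
  have hcont : Continuous (postcomp K f') := ContinuousMap.continuous_postcomp f'
  obtain ⟨δ, hδ, H⟩ := Metric.continuousAt_iff.1 (hcont.continuousAt (x := γ)) c hc
  filter_upwards [Metric.ball_mem_nhds γ hδ] with η hη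
  refine (ContinuousMap.norm_le _ (by positivity)).2 fun k => ?_
  have key := (convex_segment (𝕜 := ℝ) (γ k) (η k)).norm_image_sub_le_of_norm_hasFDerivWithin_le'
    (f := f) (f' := f') (φ := f' (γ k)) (C := c) (fun x _ => (hf x).hasFDerivWithinAt)
    (fun x hx => by
      rw [segment_eq_image'] at hx
      obtain ⟨s, hs, rfl⟩ := hx
      have h1 : dist (γ + s • (η - γ)) γ < δ := by
        rw [dist_eq_norm, add_sub_cancel_left, norm_smul, Real.norm_of_nonneg hs.1]
        rw [Metric.mem_ball, dist_eq_norm] at hη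
        nlinarith [norm_nonneg (η - γ), hs.2]
      have h2 := (ContinuousMap.dist_apply_le_dist (f := postcomp K f' (γ + s • (η - γ)))
        (g := postcomp K f' γ) k).trans (H h1).le
      rw [dist_eq_norm] at h2
      exact h2) (left_mem_segment _ _ _) (right_mem_segment _ _ _)
  refine key.trans (mul_le_mul_of_nonneg_left ?_ hc.le)
  exact (η - γ).norm_coe_le_norm k

/-- The derivative of composition with f is a fixed continuous linear map applied to composition
with Df, so the induction feeds on itself. The target F is quantified inside because it changes to E
→L F at each step. -/
theorem contDiff_postcomp_nat (n : ℕ) : ∀ {F : Type} [NormedAddCommGroup F] [NormedSpace ℝ F]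
    (f : C(E, F)), ContDiff ℝ n f → ContDiff ℝ n (postcomp K f) := by
  induction n with
  | zero =>
    intro F _ _ f _
    exact contDiff_zero.2 (ContinuousMap.continuous_postcomp f)
  | succ n ih =>
    intro F _ _ f hf
    have hd : Differentiable ℝ f := hf.differentiable (by simp)
    have hf' : ContDiff ℝ n (fderiv ℝ f) := hf.fderiv_right (by simp)
    let f' : C(E, E →L[ℝ] F) := ⟨fderiv ℝ f, hf'.continuous⟩
    have hD := hasFDerivAt_postcomp (K := K) f f' fun x => (hd x).hasFDerivAt
    have h1 : fderiv ℝ (postcomp K f) = fun γ => pointwiseApply K E F (postcomp K f' γ) :=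
      funext fun γ => (hD γ).fderiv
    rw [Nat.cast_add, Nat.cast_one, contDiff_succ_iff_fderiv]
    refine ⟨fun γ => (hD γ).differentiableAt, by simp, ?_⟩
    rw [h1]
    exact (pointwiseApply K E F).contDiff.comp (ih f' hf')

/-- The composition operator with a smooth map is smooth. -/
theorem contDiff_postcomp (f : C(E, F)) (hf : ContDiff ℝ ∞ f) : ContDiff ℝ ∞ (postcomp K f) :=
  contDiff_infty.2 fun n => contDiff_postcomp_nat n f (hf.of_le (by exact_mod_cast le_top))

end Omega

/-! ### A smooth local inverse on a neighbourhood -/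

/-- A smooth map with invertible derivative at a point restricts to an open partial homeomorphism
with smooth inverse. -/
theorem exists_openPartialHomeomorph_contDiffOn_symm {X Y : Type*} [NormedAddCommGroup X]
    [NormedSpace ℝ X] [CompleteSpace X] [NormedAddCommGroup Y] [NormedSpace ℝ Y] (f : X → Y)
    {s : Set X} (hs : IsOpen s) (hf : ContDiffOn ℝ ∞ f s) {a : X} (ha : a ∈ s) (f' : X ≃L[ℝ] Y)
    (hf' : HasFDerivAt f (f' : X →L[ℝ] Y) a) :
    ∃ Φ : OpenPartialHomeomorph X Y, (Φ : X → Y) = f ∧ a ∈ Φ.source ∧ Φ.source ⊆ s ∧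
      ContDiffOn ℝ ∞ Φ.symm Φ.target ∧
      ∀ x ∈ Φ.source, ∃ A : X ≃L[ℝ] Y, HasFDerivAt f (A : X →L[ℝ] Y) x := by
  have hfa : ContDiffAt ℝ ∞ f a := hf.contDiffAt (hs.mem_nhds ha)
  let Ψ := hfa.toOpenPartialHomeomorph f hf' (by simp)
  have hΨ : (Ψ : X → Y) = f := rfl
  have hc : ContinuousOn (fderiv ℝ f) s := hf.continuousOn_fderiv_of_isOpen hs (by simp)
  have hN : Set.range ((↑) : (X ≃L[ℝ] Y) → X →L[ℝ] Y) ∈ 𝓝 (fderiv ℝ f a) := by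
    rw [hf'.fderiv]; exact f'.nhds
  -- Invertible operators form an open set. Shrinking the source to points with invertible
  -- derivative makes the inverse smooth on the whole target, not only at the image of a.
  have hev : ∀ᶠ x in 𝓝 a, x ∈ s ∧ fderiv ℝ f x ∈ Set.range ((↑) : (X ≃L[ℝ] Y) → X →L[ℝ] Y) :=
    (hs.eventually_mem ha).and ((hc.continuousAt (hs.mem_nhds ha)).eventually hN)
  obtain ⟨t, htsub, hto, hat⟩ := eventually_nhds_iff.1 hev
  have hinv : ∀ x ∈ t, ∃ A : X ≃L[ℝ] Y, HasFDerivAt f (A : X →L[ℝ] Y) x := by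
    intro x hx
    obtain ⟨hxs, A, hA⟩ := htsub x hx
    refine ⟨A, hA ▸ ?_⟩
    exact ((hf.contDiffAt (hs.mem_nhds hxs)).differentiableAt (by simp)).hasFDerivAt
  have hsrc : (Ψ.restrOpen t hto).source = Ψ.source ∩ t := by simp
  refine ⟨Ψ.restrOpen t hto, rfl, ?_, ?_, ?_, ?_⟩
  · rw [hsrc]
    exact ⟨hfa.mem_toOpenPartialHomeomorph_source hf' (by simp), hat⟩
  · rw [hsrc]
    exact fun x hx => (htsub x hx.2).1
  · intro y hy
    have hx := (Ψ.restrOpen t hto).map_target hy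
    rw [hsrc] at hx
    obtain ⟨A, hA⟩ := hinv _ hx.2
    exact ((Ψ.restrOpen t hto).contDiffAt_symm hy hA
      (hf.contDiffAt (hs.mem_nhds (htsub _ hx.2).1))).contDiffWithinAt
  · intro x hx
    rw [hsrc] at hx
    exact hinv x hx.2

/-! ### The exponential map of a spray -/

section Spray

variable {E : Type} [NormedAddCommGroup E] [NormedSpace ℝ E] [CompleteSpace E]

/-- Continuous curves on `[-1, 1]`. -/
abbrev Curves (E : Type) [TopologicalSpace E] : Type := C(Icc (-1 : ℝ) 1, E)

/-- Extension of a curve on `[-1, 1]` by constants. -/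
noncomputable def Curves.ext {E : Type} [TopologicalSpace E] (v : Curves E) (t : ℝ) : E :=
  v (projIcc (-1) 1 (by norm_num) t)

omit [NormedSpace ℝ E] [CompleteSpace E] in
lemma Curves.continuous_ext (v : Curves E) : Continuous v.ext :=
  v.continuous.comp continuous_projIcc

omit [NormedSpace ℝ E] [CompleteSpace E] in
lemma Curves.ext_of_mem (v : Curves E) {t : ℝ} (ht : t ∈ Icc (-1 : ℝ) 1) : v.ext t = v ⟨t, ht⟩ := by
  rw [Curves.ext, projIcc_of_mem _ ht]

/-- The primitive vanishing at `0`, as an operator on curves. -/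
noncomputable def primitive (E : Type) [NormedAddCommGroup E] [NormedSpace ℝ E] :
    Curves E →L[ℝ] Curves E :=
  LinearMap.mkContinuous
    { toFun := fun v => ⟨fun t => ∫ s in (0 : ℝ)..t, v.ext s,
        (intervalIntegral.continuous_primitive
          (fun a b => v.continuous_ext.intervalIntegrable a b) 0).comp continuous_subtype_val⟩
      map_add' := fun v w => by
        ext t
        exact intervalIntegral.integral_add (v.continuous_ext.intervalIntegrable _ _)
          (w.continuous_ext.intervalIntegrable _ _)
      map_smul' := fun c v => by
        ext t
        exact intervalIntegral.integral_smul c _ } 1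
    (by
      intro v
      refine (ContinuousMap.norm_le _ (by positivity)).2 fun t => ?_
      rw [one_mul]
      have h := intervalIntegral.norm_integral_le_of_norm_le_const (a := 0) (b := (t : ℝ))
        (f := v.ext) (C := ‖v‖) fun s _ => v.norm_coe_le_norm _
      refine h.trans ?_
      have : |(t : ℝ) - 0| ≤ 1 := by rw [sub_zero]; exact abs_le.2 t.2
      nlinarith [norm_nonneg v])

omit [CompleteSpace E] in
lemma primitive_apply (v : Curves E) (t : Icc (-1 : ℝ) 1) :
    primitive E v t = ∫ s in (0 : ℝ)..t, v.ext s := rfl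

/-- Constant curves. -/
noncomputable def constCurve (E : Type) [NormedAddCommGroup E] [NormedSpace ℝ E] :
    E →L[ℝ] Curves E :=
  LinearMap.mkContinuous
    { toFun := fun y => ContinuousMap.const _ y
      map_add' := fun _ _ => rfl
      map_smul' := fun _ _ => rfl } 1
    (by
      intro v
      refine (ContinuousMap.norm_le _ (by positivity)).2 fun t => ?_
      rw [one_mul]
      exact le_rfl)

/-- The pair of two curves. -/
noncomputable def pairCurve (E : Type) [NormedAddCommGroup E] [NormedSpace ℝ E] :
    Curves E × Curves E →L[ℝ] Curves (E × E) :=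
  LinearMap.mkContinuous
    { toFun := fun p => p.1.prodMk p.2
      map_add' := fun _ _ => rfl
      map_smul' := fun _ _ => rfl } 1
    (by
      intro v
      refine (ContinuousMap.norm_le _ (by positivity)).2 fun t => ?_
      rw [one_mul]
      exact max_le_max (v.1.norm_coe_le_norm t) (v.2.norm_coe_le_norm t))

/-- The operator whose level sets are the velocities of the solutions of `γ'' = Q (γ, γ')`. -/
noncomputable def sprayOp (Q : C(E × E, E)) (p : (E × E) × Curves E) : (E × E) × Curves E :=
  (p.1, p.2 - primitive E (postcomp (Icc (-1 : ℝ) 1) Q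
    (pairCurve E (constCurve E p.1.1 + primitive E p.2, p.2))))

omit [CompleteSpace E] in
lemma contDiff_sprayOp (Q : C(E × E, E)) (hQ : ContDiff ℝ ∞ Q) : ContDiff ℝ ∞ (sprayOp Q) := by
  have h := contDiff_postcomp (K := Icc (-1 : ℝ) 1) Q hQ
  refine contDiff_fst.prodMk (contDiff_snd.sub ((primitive E).contDiff.comp (h.comp ?_)))
  refine (pairCurve E).contDiff.comp (ContDiff.prodMk (ContDiff.add ?_ ?_) contDiff_snd)
  · exact (constCurve E).contDiff.comp (contDiff_fst.comp contDiff_fst)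
  · exact (primitive E).contDiff.comp contDiff_snd

-- The nonlinear term is linearized through DQ(y₀, 0) = 0, so it contributes nothing and only the
-- identity remains. This is what makes the inverse function theorem applicable at rest.
omit [CompleteSpace E] in
lemma hasFDerivAt_sprayOp (Q : C(E × E, E)) (hQ : ContDiff ℝ ∞ Q) (y₀ : E)
    (hD : fderiv ℝ Q (y₀, 0) = 0) :
    HasFDerivAt (sprayOp Q) (ContinuousLinearMap.id ℝ ((E × E) × Curves E)) ((y₀, 0), 0) := by
  let Q' : C(E × E, E × E →L[ℝ] E) :=
    ⟨fderiv ℝ Q, hQ.continuous_fderiv (by simp)⟩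
  have hpt : pairCurve E (constCurve E y₀ + primitive E (0 : Curves E), 0)
      = (ContinuousMap.const _ (y₀, 0) : Curves (E × E)) := by
    rw [map_zero, add_zero]; rfl
  have h := hasFDerivAt_postcomp (K := Icc (-1 : ℝ) 1) Q Q'
    (fun x => (hQ.differentiable (by simp) x).hasFDerivAt) (ContinuousMap.const _ (y₀, 0))
  have h0 : pointwiseApply (Icc (-1 : ℝ) 1) (E × E) E
      (postcomp (Icc (-1 : ℝ) 1) Q' (ContinuousMap.const _ (y₀, 0))) = 0 := by
    ext η t
    change (fderiv ℝ Q (y₀, 0)) (η t) = 0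
    rw [hD]; rfl
  rw [h0, ← hpt] at h
  let Λ : (E × E) × Curves E →L[ℝ] Curves (E × E) :=
    (pairCurve E).comp (ContinuousLinearMap.prod
      ((constCurve E).comp ((ContinuousLinearMap.fst ℝ E E).comp
        (ContinuousLinearMap.fst ℝ (E × E) (Curves E))) +
        (primitive E).comp (ContinuousLinearMap.snd ℝ (E × E) (Curves E)))
      (ContinuousLinearMap.snd ℝ (E × E) (Curves E)))
  have h1 : HasFDerivAt (fun p : (E × E) × Curves E =>
      pairCurve E (constCurve E p.1.1 + primitive E p.2, p.2)) Λ ((y₀, 0), 0) := Λ.hasFDerivAt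
  have h2 := HasFDerivAt.comp (f := fun p : (E × E) × Curves E =>
      pairCurve E (constCurve E p.1.1 + primitive E p.2, p.2)) ((y₀, 0), 0) h h1
  have h3 := (primitive E).hasFDerivAt.comp _ h2
  have h4 := (hasFDerivAt_fst (𝕜 := ℝ) (p := ((y₀, (0 : E)), (0 : Curves E)))).prodMk
    ((hasFDerivAt_snd (𝕜 := ℝ) (p := ((y₀, (0 : E)), (0 : Curves E)))).sub h3)
  refine h4.congr_fderiv ?_
  ext <;> simp


omit [CompleteSpace E] in
lemma primitive_ext_of_mem (v : Curves E) {t : ℝ} (ht : t ∈ Icc (-1 : ℝ) 1) :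
    (primitive E v).ext t = ∫ s in (0 : ℝ)..t, v.ext s := by
  rw [Curves.ext_of_mem _ ht, primitive_apply]

lemma uIcc_zero_subset {t : ℝ} (ht : t ∈ Icc (-1 : ℝ) 1) : uIcc 0 t ⊆ Icc (-1 : ℝ) 1 :=
  uIcc_subset_Icc (by constructor <;> norm_num) ht

-- Taking the velocity as unknown lets the position be recovered as y plus a primitive, so a second
-- order problem becomes a single integral equation.
omit [CompleteSpace E] in
lemma sprayOp_eq_iff (Q : C(E × E, E)) (y w : E) (v : Curves E) :
    sprayOp Q ((y, w), v) = ((y, w), constCurve E w) ↔ ∀ t ∈ Icc (-1 : ℝ) 1, v.ext t =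
      w + ∫ τ in (0 : ℝ)..t, Q (y + ∫ σ in (0 : ℝ)..τ, v.ext σ, v.ext τ) := by
  have key : ∀ t ∈ Icc (-1 : ℝ) 1, (primitive E (postcomp (Icc (-1 : ℝ) 1) Q
      (pairCurve E (constCurve E y + primitive E v, v)))).ext t =
      ∫ τ in (0 : ℝ)..t, Q (y + ∫ σ in (0 : ℝ)..τ, v.ext σ, v.ext τ) := by
    intro t ht
    rw [primitive_ext_of_mem _ ht]
    refine intervalIntegral.integral_congr fun τ hτ => ?_
    have h := primitive_ext_of_mem v (uIcc_zero_subset ht hτ)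
    change Q (y + (primitive E v).ext τ, v.ext τ) = _
    rw [h]
  rw [sprayOp, Prod.mk.injEq, sub_eq_iff_eq_add]
  simp only [true_and]
  constructor
  · intro h t ht
    rw [← key t ht]
    exact congrArg (fun c : Curves E => c.ext t) h
  · intro h
    ext t
    have h1 := h t t.2
    rw [← key t t.2, Curves.ext_of_mem _ t.2, Curves.ext_of_mem _ t.2] at h1
    exact h1

/-- A spray (a smooth function, quadratic in the velocity) has a smooth exponential map. -/
theorem exists_spray_exp (Q : E × E → E) (hQ : ContDiff ℝ ∞ Q)
    (hom : ∀ y v (s : ℝ), Q (y, s • v) = s ^ 2 • Q (y, v)) (y₀ : E) {N : Set E} (hN : N ∈ 𝓝 y₀) :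
    ∃ ρ > 0, ∃ X : E × E → E, ContDiffOn ℝ ∞ X (Metric.ball y₀ ρ ×ˢ Metric.ball 0 ρ) ∧
      ∀ y ∈ Metric.ball y₀ ρ, X (y, 0) = y ∧ (∀ w ∈ Metric.ball 0 ρ, X (y, w) ∈ N) ∧
        (∀ w, deriv (fun τ : ℝ => X (y, τ • w)) 0 = w) ∧
        ∀ w (t : ℝ), ‖t • w‖ < ρ →
          HasDerivAt (deriv fun τ : ℝ => X (y, τ • w))
            (Q (X (y, t • w), deriv (fun τ : ℝ => X (y, τ • w)) t)) t := by
  have hQ0 : ∀ y, Q (y, 0) = 0 := fun y => by simpa using hom y 0 0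
  have hQd : Differentiable ℝ Q := hQ.differentiable (by simp)
  -- In position directions Q(·, 0) is identically zero; in velocity directions Q(y₀, sp) = s² Q(y₀,
  -- p) has zero derivative at s = 0.
  have hD : fderiv ℝ Q (y₀, 0) = 0 := by
    ext p
    · have h := (hQd (y₀, 0)).lineDeriv_eq_fderiv (v := (p, (0 : E)))
      simp [lineDeriv, hQ0] at h
      simpa using h.symm
    · have h := (hQd (y₀, 0)).lineDeriv_eq_fderiv (v := ((0 : E), p))
      simp only [lineDeriv, Prod.smul_mk, smul_zero, Prod.mk_add_mk, add_zero, zero_add, hom] at h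
      rw [deriv_smul_const (by fun_prop)] at h
      simpa using h.symm
  let Qc : C(E × E, E) := ⟨Q, hQ.continuous⟩
  obtain ⟨Φ, hΦ, hmem, -, hsymm, -⟩ := exists_openPartialHomeomorph_contDiffOn_symm (sprayOp Qc)
    isOpen_univ (contDiff_sprayOp Qc hQ).contDiffOn (mem_univ ((y₀, 0), 0))
    (ContinuousLinearEquiv.refl ℝ _) (hasFDerivAt_sprayOp Qc hQ y₀ hD)
  let j : E × E → (E × E) × Curves E := fun p => (p, constCurve E p.2)
  have hj : ContDiff ℝ ∞ j := contDiff_id.prodMk ((constCurve E).contDiff.comp contDiff_snd)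
  -- the velocity field
  let V : E × E → Curves E := fun p => (Φ.symm (j p)).2
  have hj0 : j (y₀, 0) = sprayOp Qc ((y₀, 0), 0) := by
    refine ((sprayOp_eq_iff Qc y₀ 0 0).2 fun t ht => ?_).symm
    have : ∀ t, (0 : Curves E).ext t = 0 := fun t => rfl
    simp [this, Qc, hQ0]
  have hj0t : j (y₀, 0) ∈ Φ.target := by
    rw [hj0, ← hΦ]; exact Φ.map_source hmem
  have hV0 : V (y₀, 0) = 0 := by
    change (Φ.symm (j (y₀, 0))).2 = 0
    rw [hj0, ← hΦ, Φ.left_inv hmem]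
  have hO : IsOpen (j ⁻¹' Φ.target) := Φ.open_target.preimage hj.continuous
  have hVs : ContDiffOn ℝ ∞ V (j ⁻¹' Φ.target) :=
    contDiff_snd.comp_contDiffOn (hsymm.comp hj.contDiffOn (mapsTo_preimage _ _))
  -- The exponential map: the position at time 1, that is, y plus the integral of the velocity over
  -- [0, 1].
  let X : E × E → E := fun p => p.1 + primitive E (V p) ⟨1, by norm_num⟩
  have hXs : ContDiffOn ℝ ∞ X (j ⁻¹' Φ.target) := by
    refine contDiff_fst.contDiffOn.add ?_
    exact (ContinuousMap.evalCLM ℝ (⟨1, by norm_num⟩ : Icc (-1 : ℝ) 1)).contDiff.comp_contDiffOn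
      ((primitive E).contDiff.comp_contDiffOn hVs)
  have hX0 : X (y₀, 0) = y₀ := by
    simp only [X, hV0, map_zero, ContinuousMap.zero_apply, add_zero]
  -- A ball in the source of Φ, where `sprayOp` is injective. Solutions and their time rescalings
  -- will both be kept inside it, so that they can be identified.
  obtain ⟨r, hr, hrs⟩ := Metric.isOpen_iff.1 Φ.open_source _ hmem
  have hn : (y₀, (0 : E)) ∈ j ⁻¹' Φ.target := hj0t
  have hev : ∀ᶠ p in 𝓝 (y₀, (0 : E)), p ∈ j ⁻¹' Φ.target ∧ ‖V p‖ < r ∧ X p ∈ N := by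
    refine (hO.eventually_mem hn).and (Filter.Eventually.and ?_ ?_)
    · have := (hVs.continuousOn.continuousAt (hO.mem_nhds hn)).norm
      rw [ContinuousAt, hV0, norm_zero] at this
      exact this.eventually (gt_mem_nhds hr)
    · refine (hXs.continuousOn.continuousAt (hO.mem_nhds hn)).eventually_mem ?_
      rwa [hX0]
  obtain ⟨ρ₀, hρ₀, hball⟩ := Metric.eventually_nhds_iff_ball.1 hev
  have hρ : 0 < min ρ₀ r := lt_min hρ₀ hr
  have hprod : ∀ y ∈ Metric.ball y₀ (min ρ₀ r), ∀ w ∈ Metric.ball (0 : E) (min ρ₀ r),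
      (y, w) ∈ j ⁻¹' Φ.target ∧ ‖V (y, w)‖ < r ∧ X (y, w) ∈ N := by
    intro y hy w hw
    refine hball _ ?_
    rw [← ball_prod_same]
    exact ⟨Metric.ball_subset_ball (min_le_left _ _) hy,
      Metric.ball_subset_ball (min_le_left _ _) hw⟩
  -- the integral equation
  have hsol : ∀ y ∈ Metric.ball y₀ (min ρ₀ r), ∀ w ∈ Metric.ball (0 : E) (min ρ₀ r),
      Φ.symm (j (y, w)) = ((y, w), V (y, w)) ∧
      sprayOp Qc ((y, w), V (y, w)) = ((y, w), constCurve E w) := by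
    intro y hy w hw
    have h1 : sprayOp Qc (Φ.symm (j (y, w))) = j (y, w) := by
      rw [← hΦ]; exact Φ.right_inv (hprod y hy w hw).1
    have h2 : Φ.symm (j (y, w)) = ((y, w), V (y, w)) :=
      have h3 : (Φ.symm (j (y, w))).1 = (y, w) := congrArg Prod.fst h1
      Prod.ext h3 rfl
    exact ⟨h2, h2 ▸ h1⟩
  -- Homogeneity: t ↦ s v(st) is a solution with initial velocity sw. It is no larger than v because
  -- |s| ≤ 1, so injectivity of Φ identifies it with the solution selected for (y, sw), and its
  -- position at time 1 is the original position at time s.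
  have hscale : ∀ y ∈ Metric.ball y₀ (min ρ₀ r), ∀ w ∈ Metric.ball (0 : E) (min ρ₀ r),
      ∀ s ∈ Icc (-1 : ℝ) 1, X (y, s • w) = y + ∫ σ in (0 : ℝ)..s, (V (y, w)).ext σ := by
    intro y hy w hw s hs
    have habs : |s| ≤ 1 := abs_le.2 hs
    have hsw : s • w ∈ Metric.ball (0 : E) (min ρ₀ r) := by
      rw [mem_ball_zero_iff] at hw ⊢
      rw [norm_smul, Real.norm_eq_abs]
      nlinarith [norm_nonneg w]
    set v := V (y, w) with hv
    have hst : ∀ t ∈ Icc (-1 : ℝ) 1, s * t ∈ Icc (-1 : ℝ) 1 := fun t ht => by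
      refine abs_le.1 ?_
      rw [abs_mul]
      exact mul_le_one₀ habs (abs_nonneg _) (abs_le.2 ht)
    let u : Curves E := ⟨fun t => s • v.ext (s * t),
      (v.continuous_ext.comp (continuous_const.mul continuous_subtype_val)).const_smul s⟩
    have hu : ∀ t ∈ Icc (-1 : ℝ) 1, u.ext t = s • v.ext (s * t) := fun t ht => by
      rw [Curves.ext_of_mem _ ht]; rfl
    have hprim : ∀ t ∈ Icc (-1 : ℝ) 1, ∫ σ in (0 : ℝ)..t, u.ext σ =
        ∫ σ in (0 : ℝ)..(s * t), v.ext σ := by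
      intro t ht
      rw [intervalIntegral.integral_congr (g := fun σ => s • v.ext (s * σ))
        (fun σ hσ => hu σ (uIcc_zero_subset ht hσ)), intervalIntegral.integral_smul,
        intervalIntegral.smul_integral_comp_mul_left, mul_zero]
    have hueq : sprayOp Qc ((y, s • w), u) = ((y, s • w), constCurve E (s • w)) := by
      rw [sprayOp_eq_iff]
      intro t ht
      have h1 := (sprayOp_eq_iff Qc y w v).1 (hsol y hy w hw).2 (s * t) (hst t ht)
      have hI : ∫ τ in (0 : ℝ)..t, Qc (y + ∫ σ in (0 : ℝ)..τ, u.ext σ, u.ext τ) =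
          ∫ τ in (0 : ℝ)..t, s • (s •
            Q (y + ∫ σ in (0 : ℝ)..(s * τ), v.ext σ, v.ext (s * τ))) := by
        refine intervalIntegral.integral_congr fun τ hτ => ?_
        have hτ' := uIcc_zero_subset ht hτ
        change Q (y + ∫ σ in (0 : ℝ)..τ, u.ext σ, u.ext τ) = _
        rw [hprim τ hτ', hu τ hτ', hom, smul_smul, sq]
      rw [hu t ht, h1, smul_add, hI, intervalIntegral.integral_smul,
        intervalIntegral.integral_smul, intervalIntegral.smul_integral_comp_mul_left
          (f := fun τ => Q (y + ∫ σ in (0 : ℝ)..τ, v.ext σ, v.ext τ)), mul_zero]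
      rfl
    have hnorm : ‖u‖ ≤ ‖v‖ := by
      refine (ContinuousMap.norm_le _ (norm_nonneg _)).2 fun t => ?_
      change ‖s • v.ext (s * t)‖ ≤ _
      rw [norm_smul, Real.norm_eq_abs]
      have := v.norm_coe_le_norm (projIcc (-1) 1 (by norm_num) (s * t))
      exact (mul_le_of_le_one_left (norm_nonneg _) habs).trans this
    have hbs : ∀ z ∈ Metric.ball (0 : E) (min ρ₀ r), ∀ q : Curves E, ‖q‖ < r →
        ((y, z), q) ∈ Φ.source := by
      intro z hz q hq
      refine hrs ?_
      rw [← ball_prod_same, ← ball_prod_same]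
      exact ⟨⟨Metric.ball_subset_ball (min_le_right _ _) hy,
        Metric.ball_subset_ball (min_le_right _ _) hz⟩, by simpa using hq⟩
    have huV : V (y, s • w) = u := by
      have hinj := Φ.injOn (hbs _ hsw _ (hprod y hy _ hsw).2.1)
        (hbs _ hsw u (hnorm.trans_lt (hprod y hy w hw).2.1))
        (by rw [hΦ, hueq, (hsol y hy _ hsw).2])
      exact congrArg Prod.snd hinj
    change y + primitive E (V (y, s • w)) ⟨1, by norm_num⟩ = _
    rw [huV, primitive_apply]
    congr 1
    rw [hprim 1 (by norm_num), mul_one]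
  have hV00 : ∀ y ∈ Metric.ball y₀ (min ρ₀ r), ∀ w ∈ Metric.ball (0 : E) (min ρ₀ r),
      (V (y, w)).ext 0 = w := by
    intro y hy w hw
    simpa using (sprayOp_eq_iff Qc y w _).1 (hsol y hy w hw).2 0 (by norm_num)
  have hder : ∀ y ∈ Metric.ball y₀ (min ρ₀ r), ∀ w ∈ Metric.ball (0 : E) (min ρ₀ r),
      ∀ t ∈ Ioo (-1 : ℝ) 1, deriv (fun τ : ℝ => X (y, τ • w)) t = (V (y, w)).ext t := by
    intro y hy w hw t ht
    have h1 : (fun τ : ℝ => X (y, τ • w)) =ᶠ[𝓝 t]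
        fun τ => y + ∫ σ in (0 : ℝ)..τ, (V (y, w)).ext σ := by
      filter_upwards [Ioo_mem_nhds ht.1 ht.2] with τ hτ
      exact hscale y hy w hw τ (Ioo_subset_Icc_self hτ)
    rw [h1.deriv_eq]
    exact ((intervalIntegral.integral_hasDerivAt_right
      ((V (y, w)).continuous_ext.intervalIntegrable _ _)
      ((V (y, w)).continuous_ext.stronglyMeasurableAtFilter _ _)
      (V (y, w)).continuous_ext.continuousAt).const_add y).deriv
  have hder2 : ∀ y ∈ Metric.ball y₀ (min ρ₀ r), ∀ w ∈ Metric.ball (0 : E) (min ρ₀ r),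
      ∀ t ∈ Ioo (-1 : ℝ) 1, HasDerivAt (deriv fun τ : ℝ => X (y, τ • w))
        (Q (X (y, t • w), deriv (fun τ : ℝ => X (y, τ • w)) t)) t := by
    intro y hy w hw t ht
    have hc : Continuous (V (y, w)).ext := (V (y, w)).continuous_ext
    have hcq : Continuous fun τ : ℝ =>
        Q (y + ∫ σ in (0 : ℝ)..τ, (V (y, w)).ext σ, (V (y, w)).ext τ) :=
      hQ.continuous.comp ((continuous_const.add (intervalIntegral.continuous_primitive
        (fun a b => hc.intervalIntegrable a b) 0)).prodMk hc)
    have h1 : (deriv fun τ : ℝ => X (y, τ • w)) =ᶠ[𝓝 t] fun t => w + ∫ τ in (0 : ℝ)..t,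
        Q (y + ∫ σ in (0 : ℝ)..τ, (V (y, w)).ext σ, (V (y, w)).ext τ) := by
      filter_upwards [Ioo_mem_nhds ht.1 ht.2] with τ hτ
      rw [hder y hy w hw τ hτ]
      exact (sprayOp_eq_iff Qc y w _).1 (hsol y hy w hw).2 τ (Ioo_subset_Icc_self hτ)
    rw [hder y hy w hw t ht, hscale y hy w hw t (Ioo_subset_Icc_self ht)]
    refine HasDerivAt.congr_of_eventuallyEq ?_ h1
    exact (intervalIntegral.integral_hasDerivAt_right (hcq.intervalIntegrable _ _)
      (hcq.stronglyMeasurableAtFilter _ _) hcq.continuousAt).const_add w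
  -- The conclusion allows w of any size as long as tw is small. Passing to sw with s slightly
  -- larger than |t| moves the time to t/s, strictly inside (-1, 1).
  have hrescale : ∀ w (t : ℝ), ‖t • w‖ < min ρ₀ r → ∃ s : ℝ, |t| < s ∧
      s • w ∈ Metric.ball (0 : E) (min ρ₀ r) := by
    intro w t ht
    have hc : ContinuousAt (fun s : ℝ => ‖s • w‖) |t| := by fun_prop
    have h0 : ‖|t| • w‖ < min ρ₀ r := by
      rw [norm_smul] at ht ⊢; simpa using ht
    have h1 : ∀ᶠ s in 𝓝[>] |t|, ‖s • w‖ < min ρ₀ r :=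
      (hc.eventually (gt_mem_nhds h0)).filter_mono nhdsWithin_le_nhds
    obtain ⟨s, hs, hs'⟩ := (h1.and self_mem_nhdsWithin).exists
    exact ⟨s, hs', by simpa using hs⟩
  have hderscale : ∀ y w (s : ℝ), 0 < s → (deriv fun τ : ℝ => X (y, τ • w)) =
      fun t => s⁻¹ • deriv (fun τ : ℝ => X (y, τ • (s • w))) (s⁻¹ * t) := by
    intro y w s hs
    have h1 : (fun τ : ℝ => X (y, τ • w)) =
        fun τ => (fun τ : ℝ => X (y, τ • (s • w))) (s⁻¹ * τ) := by
      funext τ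
      have : (s⁻¹ * τ) • s • w = τ • w := by
        rw [smul_smul]; congr 1; field_simp
      simp only [this]
    funext t
    rw [h1]
    exact deriv_comp_mul_left s⁻¹ (fun τ : ℝ => X (y, τ • (s • w))) t
  refine ⟨min ρ₀ r, hρ, X, hXs.mono fun p hp => (hprod p.1 hp.1 p.2 hp.2).1, fun y hy =>
    ⟨?_, fun w hw => (hprod y hy w hw).2.2, fun w => ?_, fun w t ht => ?_⟩⟩
  · have := hscale y hy 0 (Metric.mem_ball_self hρ) 0 (by norm_num)
    simpa using this
  · obtain ⟨s, hs, hsw⟩ := hrescale w 0 (by simpa using hρ)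
    rw [abs_zero] at hs
    rw [hderscale y w s hs]
    simp only [mul_zero]
    rw [hder y hy _ hsw 0 (by norm_num), hV00 y hy _ hsw, smul_smul, inv_mul_cancel₀ hs.ne',
      one_smul]
  · obtain ⟨s, hs, hsw⟩ := hrescale w t ht
    have hs0 : 0 < s := (abs_nonneg t).trans_lt hs
    have hts : s⁻¹ * t ∈ Ioo (-1 : ℝ) 1 := by
      refine abs_lt.1 ?_
      rw [abs_mul, abs_of_pos (inv_pos.2 hs0), inv_mul_lt_iff₀ hs0]
      simpa using hs
    have h1 := hder2 y hy _ hsw _ hts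
    have h2 : HasDerivAt (fun τ : ℝ => s⁻¹ * τ) s⁻¹ t := by
      simpa using (hasDerivAt_id t).const_mul s⁻¹
    have h3 := (h1.scomp t h2).const_smul s⁻¹
    have h4 : (s⁻¹ * t) • s • w = t • w := by
      rw [smul_smul]; congr 1; field_simp
    rw [hderscale y w s hs0]
    simp only [h4, hom] at h3 ⊢
    refine h3.congr_deriv ?_
    rw [smul_smul, sq]

end Spray

/-! ### The Euler–Lagrange form of the geodesic equation -/

section EulerLagrange

variable {E F : Type*} [NormedAddCommGroup E] [NormedSpace ℝ E]
  [NormedAddCommGroup F] [NormedSpace ℝ F]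

noncomputable instance : NormedAddCommGroup (E →L[ℝ] F) := ContinuousLinearMap.toNormedAddCommGroup

noncomputable instance : NormedAddCommGroup (E →L[ℝ] E →L[ℝ] ℝ) :=
  ContinuousLinearMap.toNormedAddCommGroup

noncomputable instance : NormedSpace ℝ (E →L[ℝ] E →L[ℝ] ℝ) :=
  ContinuousLinearMap.toNormedSpace

/-- The Euler–Lagrange equation of the energy of the field of forms `B`, at position `y`,
velocity `v` and acceleration `a`. -/
def EL (B : E → E → E → ℝ) (y v a : E) : Prop :=
  ∀ w, B y a w + fderiv ℝ (fun z => B z v w) y v - 1 / 2 * fderiv ℝ (fun z => B z v v) y w = 0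

/-- The pull-back of a field of bilinear forms. -/
noncomputable def pullForm (B : F → F →L[ℝ] F →L[ℝ] ℝ) (Φ : E → F) (z v w : E) : ℝ :=
  B (Φ z) (fderiv ℝ Φ z v) (fderiv ℝ Φ z w)

/-- Equality near y is required, since the equation involves derivatives of the form in its base
point. -/
lemma EL.congr {B B' : E → E → E → ℝ} {y v a : E} (h : EL B y v a) (hB : ∀ᶠ z in 𝓝 y, B z = B' z) :
    EL B' y v a := by
  intro w
  have h1 : (fun z => B' z v w) =ᶠ[𝓝 y] fun z => B z v w := hB.mono fun z hz => by simp only [hz]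
  have h2 : (fun z => B' z v v) =ᶠ[𝓝 y] fun z => B z v v := hB.mono fun z hz => by simp only [hz]
  rw [h1.fderiv_eq, h2.fderiv_eq, ← hB.self_of_nhds]
  exact h w

lemma fderiv_pullForm {B : F → F →L[ℝ] F →L[ℝ] ℝ} {Φ : E → F} {z : E}
    (hB : DifferentiableAt ℝ B (Φ z)) (hΦ : ContDiffAt ℝ 2 Φ z) (h v w : E) :
    fderiv ℝ (fun z => pullForm B Φ z v w) z h =
      fderiv ℝ B (Φ z) (fderiv ℝ Φ z h) (fderiv ℝ Φ z v) (fderiv ℝ Φ z w) +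
      B (Φ z) (fderiv ℝ (fderiv ℝ Φ) z h v) (fderiv ℝ Φ z w) +
      B (Φ z) (fderiv ℝ Φ z v) (fderiv ℝ (fderiv ℝ Φ) z h w) := by
  have h1 : HasFDerivAt Φ (fderiv ℝ Φ z) z := (hΦ.differentiableAt (by simp)).hasFDerivAt
  have h2 : HasFDerivAt (fderiv ℝ Φ) (fderiv ℝ (fderiv ℝ Φ) z) z :=
    ((hΦ.fderiv_right (m := 1) (by norm_num)).differentiableAt (by simp)).hasFDerivAt
  have h3 := hB.hasFDerivAt.comp z h1
  have h4 := (h3.clm_apply (h2.clm_apply (hasFDerivAt_const v z))).clm_apply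
    (h2.clm_apply (hasFDerivAt_const w z))
  have h5 := congrArg (fun L => L h) h4.fderiv
  simp only [Function.comp_apply] at h5
  unfold pullForm
  rw [h5]
  simp
  ring

/-- The Euler–Lagrange equation is inherited by pull-backs. -/
lemma EL.pullForm {B : F → F →L[ℝ] F →L[ℝ] ℝ} {Φ : E → F} {z v a : E}
    (hB : DifferentiableAt ℝ B (Φ z)) (hΦ : ContDiffAt ℝ 2 Φ z)
    (hsymm : ∀ v w, B (Φ z) v w = B (Φ z) w v)
    (h : EL (fun y v w => B y v w) (Φ z) (fderiv ℝ Φ z v)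
      (fderiv ℝ Φ z a + fderiv ℝ (fderiv ℝ Φ) z v v)) :
    EL (PolarGeo.pullForm B Φ) z v a := by
  intro w
  have h0 := h (fderiv ℝ Φ z w)
  have hBd : ∀ p q r : F, fderiv ℝ (fun y => B y p q) (Φ z) r = fderiv ℝ B (Φ z) r p q := by
    intro p q r
    have h4 := (hB.hasFDerivAt.clm_apply (hasFDerivAt_const p (Φ z))).clm_apply
      (hasFDerivAt_const q (Φ z))
    rw [h4.fderiv]; simp
  -- The terms pairing DΦ v with D²Φ(v, w) come once from the total derivative and once, halved and
  -- doubled, from the energy gradient. Symmetry of D²Φ makes them cancel, leaving the D²Φ(v, v)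
  -- correction to the acceleration.
  have hs : fderiv ℝ (fderiv ℝ Φ) z w v = fderiv ℝ (fderiv ℝ Φ) z v w :=
    (hΦ.isSymmSndFDerivAt (by simp)) w v
  simp only [hBd] at h0
  rw [fderiv_pullForm hB hΦ, fderiv_pullForm hB hΦ, hs]
  simp only [PolarGeo.pullForm, map_add, _root_.add_apply] at h0 ⊢
  rw [hsymm (fderiv ℝ (fderiv ℝ Φ) z v w) (fderiv ℝ Φ z v)]
  linarith

/-- **Gauss's lemma**: if the rays through the origin are geodesics, the radial vector is
orthogonal to the vectors which are orthogonal to it at the origin. -/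
theorem gauss_lemma {B : E → E →L[ℝ] E →L[ℝ] ℝ} {ρ : ℝ}
    (hB : DifferentiableOn ℝ B (Metric.ball 0 ρ))
    (hsymm : ∀ z ∈ Metric.ball 0 ρ, ∀ v w, B z v w = B z w v)
    (hEL : ∀ w (t : ℝ), ‖t • w‖ < ρ → EL (fun y v w => B y v w) (t • w) w 0)
    {w : E} (hw : ‖w‖ < ρ) (u : E) : B w w u = B 0 w u := by
  have hBat : ∀ z, ‖z‖ < ρ → DifferentiableAt ℝ B z := fun z hz =>
    hB.differentiableAt (Metric.isOpen_ball.mem_nhds (by simpa using hz))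
  have hlt : ∀ w : E, ‖w‖ < ρ → ∀ t ∈ Icc (0 : ℝ) 1, ‖t • w‖ < ρ := fun w hw t ht => by
    rw [norm_smul, Real.norm_of_nonneg ht.1]
    exact (mul_le_of_le_one_left (norm_nonneg _) ht.2).trans_lt hw
  have hBd : ∀ z, ‖z‖ < ρ → ∀ p q r : E,
      fderiv ℝ (fun y => B y p q) z r = fderiv ℝ B z r p q := by
    intro z hz p q r
    have h4 := ((hBat z hz).hasFDerivAt.clm_apply (hasFDerivAt_const p z)).clm_apply
      (hasFDerivAt_const q z)
    rw [h4.fderiv]; simp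
  have hray : ∀ w : E, ‖w‖ < ρ → ∀ u : E, ∀ t ∈ Icc (0 : ℝ) 1,
      HasDerivAt (fun s : ℝ => B (s • w) w u) (fderiv ℝ B (t • w) w w u) t := by
    intro w hw u t ht
    have h1 : HasDerivAt (fun s : ℝ => s • w) w t := by
      simpa using (hasDerivAt_id t).smul_const w
    have h2 := (hBat _ (hlt w hw t ht)).hasFDerivAt.comp_hasDerivAt t h1
    have h3 := (h2.clm_apply (hasDerivAt_const t w)).clm_apply (hasDerivAt_const t u)
    simpa using h3
  -- Rays have constant speed: test the Euler–Lagrange equation with the velocity itself.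
  have hconst : ∀ w : E, ‖w‖ < ρ → ∀ t ∈ Icc (0 : ℝ) 1, B (t • w) w w = B 0 w w := by
    intro w hw t ht
    have h0 : ∀ s ∈ Icc (0 : ℝ) 1, fderiv ℝ B (s • w) w w w = 0 := by
      intro s hs
      have := hEL w s (hlt w hw s hs) w
      simp only [hBd _ (hlt w hw s hs), map_zero, _root_.zero_apply] at this
      linarith
    have := constant_of_has_deriv_right_zero (f := fun s : ℝ => B (s • w) w w) (a := 0) (b := 1)
      (fun s hs => (hray w hw w s hs).continuousAt.continuousWithinAt)
      (fun s hs => by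
        have := (hray w hw w s (Ico_subset_Icc_self hs)).hasDerivWithinAt (s := Ici s)
        rwa [h0 s (Ico_subset_Icc_self hs)] at this) t ht
    simpa using this
  -- The variation through rays: the constant-speed identity is differentiated in w, in the
  -- direction u.
  have hvar : ∀ t ∈ Icc (0 : ℝ) 1,
      t * fderiv ℝ B (t • w) u w w + 2 * B (t • w) w u = 2 * B 0 w u := by
    intro t ht
    have h1 : HasDerivAt (fun s : ℝ => w + s • u) u 0 := by
      simpa using ((hasDerivAt_id (0 : ℝ)).smul_const u).const_add w
    have h1' : HasDerivAt (fun s : ℝ => t • (w + s • u)) (t • u) 0 := h1.const_smul t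
    have hbt : HasFDerivAt B (fderiv ℝ B (t • w)) (t • (w + (0 : ℝ) • u)) := by
      rw [zero_smul, add_zero]; exact (hBat _ (hlt w hw t ht)).hasFDerivAt
    have h2 := ((hbt.comp_hasDerivAt (0 : ℝ) h1').clm_apply h1).clm_apply h1
    have h3 := ((hasDerivAt_const (0 : ℝ) (B 0)).clm_apply h1).clm_apply h1
    have hev : (fun s : ℝ => B (t • (w + s • u)) (w + s • u) (w + s • u)) =ᶠ[𝓝 0]
        fun s => B 0 (w + s • u) (w + s • u) := by
      have hc : ContinuousAt (fun s : ℝ => ‖w + s • u‖) 0 := by fun_prop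
      have : ∀ᶠ s : ℝ in 𝓝 0, ‖w + s • u‖ < ρ :=
        hc.eventually (gt_mem_nhds (by simpa using hw))
      exact this.mono fun s hs => hconst _ hs t ht
    have h4 := h2.unique (h3.congr_of_eventuallyEq hev)
    simp only [Function.comp_apply, zero_smul, add_zero, map_smul, _root_.add_apply,
      _root_.smul_apply, smul_eq_mul, _root_.zero_apply, zero_add] at h4
    rw [hsymm _ (by simpa using hlt w hw t ht) u w,
      hsymm 0 (by simpa using (norm_nonneg w).trans_lt hw) u w] at h4
    linarith
  -- Combining the variation with the Euler–Lagrange equation tested on u, the function s (B(sw)(w,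
  -- u) - B(0)(w, u)) has zero derivative. It vanishes at s = 0, and s = 1 is the claim.
  have hder : ∀ t ∈ Icc (0 : ℝ) 1,
      HasDerivAt (fun s : ℝ => s * B (s • w) w u - s * B 0 w u) 0 t := by
    intro t ht
    have h1 := ((hasDerivAt_id t).mul (hray w hw u t ht)).sub
      ((hasDerivAt_id t).mul_const (B 0 w u))
    refine h1.congr_deriv ?_
    have h2 := hEL w t (hlt w hw t ht) u
    simp only [hBd _ (hlt w hw t ht), map_zero, _root_.zero_apply] at h2
    have h3 := hvar t ht
    simp only [id]
    linear_combination h3 / 2 + t * h2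
  have := constant_of_has_deriv_right_zero
    (f := fun s : ℝ => s * B (s • w) w u - s * B 0 w u) (a := 0) (b := 1)
    (fun s hs => (hder s hs).continuousAt.continuousWithinAt)
    (fun s hs => (hder s (Ico_subset_Icc_self hs)).hasDerivWithinAt) 1 (by norm_num)
  simp at this
  linarith

end EulerLagrange

/-! ### Bilinear forms of Gram matrices -/

section Bil

variable {d : ℕ}

/-- The bilinear form of a matrix. -/
noncomputable def bil (A : Matrix (Fin d) (Fin d) ℝ) :
    EuclideanSpace ℝ (Fin d) →L[ℝ] EuclideanSpace ℝ (Fin d) →L[ℝ] ℝ :=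
  ∑ i, ∑ j, A i j • (EuclideanSpace.proj i : EuclideanSpace ℝ (Fin d) →L[ℝ] ℝ).smulRight
    (EuclideanSpace.proj j : EuclideanSpace ℝ (Fin d) →L[ℝ] ℝ)

lemma bil_apply (A : Matrix (Fin d) (Fin d) ℝ) (v w : EuclideanSpace ℝ (Fin d)) :
    bil A v w = ∑ i, ∑ j, A i j * (v i * w j) := by
  simp [bil]

lemma bil_single (A : Matrix (Fin d) (Fin d) ℝ) (i j : Fin d) :
    bil A (EuclideanSpace.single i 1) (EuclideanSpace.single j 1) = A i j := by
  simp [bil_apply]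

lemma bil_symm {A : Matrix (Fin d) (Fin d) ℝ} (hA : A.IsSymm) (v w : EuclideanSpace ℝ (Fin d)) :
    bil A v w = bil A w v := by
  rw [bil_apply, bil_apply, Finset.sum_comm]
  refine Finset.sum_congr rfl fun i _ => Finset.sum_congr rfl fun j _ => ?_
  rw [← hA.apply i j]; ring

lemma contDiffOn_bil {E : Type*} [NormedAddCommGroup E] [NormedSpace ℝ E] {n : WithTop ℕ∞}
    {G : E → Matrix (Fin d) (Fin d) ℝ} {s : Set E}
    (hG : ∀ i j, ContDiffOn ℝ n (fun z => G z i j) s) : ContDiffOn ℝ n (fun z => bil (G z)) s := by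
  unfold bil
  exact ContDiffOn.sum fun i _ => ContDiffOn.sum fun j _ => (hG i j).smul contDiffOn_const

lemma fderiv_bil {G : EuclideanSpace ℝ (Fin d) → Matrix (Fin d) (Fin d) ℝ}
    {y : EuclideanSpace ℝ (Fin d)} (hG : ∀ i j, DifferentiableAt ℝ (fun z => G z i j) y)
    (v w h : EuclideanSpace ℝ (Fin d)) :
    fderiv ℝ (fun z => bil (G z) v w) y h =
      ∑ i, ∑ j, fderiv ℝ (fun z => G z i j) y h * (v i * w j) := by
  simp only [bil_apply]
  have h1 : HasFDerivAt (fun z => ∑ i, ∑ j, G z i j * (v i * w j))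
      (∑ i, ∑ j, (v i * w j) • fderiv ℝ (fun z => G z i j) y) y :=
    HasFDerivAt.fun_sum fun i _ => HasFDerivAt.fun_sum fun j _ =>
      (hG i j).hasFDerivAt.mul_const (v i * w j)
  rw [h1.fderiv]
  simp [mul_comm]

lemma fderiv_eq_sum_pd (f : EuclideanSpace ℝ (Fin d) → ℝ) (y h : EuclideanSpace ℝ (Fin d)) :
    fderiv ℝ f y h = ∑ k, h k * pd k f y := by
  have hh : h = ∑ k, h k • (EuclideanSpace.single k 1 : EuclideanSpace ℝ (Fin d)) := by
    ext j; simp [Pi.single_apply]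
  conv_lhs => rw [hh]
  simp [pd]

/-- The geodesic equation with Christoffel symbols is the Euler–Lagrange equation. -/
theorem el_iff_christoffel {G : EuclideanSpace ℝ (Fin d) → Matrix (Fin d) (Fin d) ℝ}
    {y : EuclideanSpace ℝ (Fin d)} (hG : ∀ i j, DifferentiableAt ℝ (fun z => G z i j) y)
    (hsymm : (G y).IsSymm) (hdet : IsUnit (G y).det) (v a : EuclideanSpace ℝ (Fin d)) :
    EL (fun z v w => bil (G z) v w) y v a ↔
      ∀ k, a k + ∑ i, ∑ j, christoffel G y k i j * v i * v j = 0 := by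
  let c : Fin d → ℝ := fun l => ∑ i, ∑ j,
    (pd i (fun z => G z j l) y + pd j (fun z => G z i l) y - pd l (fun z => G z i j) y) * (v i * v j)
  have hchr : ∀ k, ∑ i, ∑ j, christoffel G y k i j * v i * v j
      = ((1 / 2 : ℝ) • ((G y)⁻¹ *ᵥ c)) k := by
    intro k
    simp only [christoffel, Pi.smul_apply, smul_eq_mul, Matrix.mulVec, dotProduct, c,
      Finset.mul_sum, Finset.sum_mul]
    rw [Finset.sum_comm (s := Finset.univ (α := Fin d)) (f := fun l i => ∑ j, 1 / 2 * ((G y)⁻¹ k l *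
      ((pd i (fun z => G z j l) y + pd j (fun z => G z i l) y - pd l (fun z => G z i j) y) *
        (v i * v j))))]
    refine Finset.sum_congr rfl fun i _ => ?_
    rw [Finset.sum_comm]
    exact Finset.sum_congr rfl fun l _ => Finset.sum_congr rfl fun j _ => by ring
  -- The first two derivative terms of the Christoffel symbol coincide after contraction with vⁱvʲ
  -- by renaming indices; each gives the derivative along v of G(v, w).
  have hc : ∀ w : EuclideanSpace ℝ (Fin d), ∑ l, w l * c l =
      2 * fderiv ℝ (fun z => bil (G z) v w) y v - fderiv ℝ (fun z => bil (G z) v v) y w := by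
    intro w
    let g : Fin d → Fin d → Fin d → ℝ := fun p q k => v k * pd k (fun z => G z p q) y * (v p * w q)
    have hD : fderiv ℝ (fun z => bil (G z) v w) y v = ∑ p, ∑ q, ∑ k, g p q k := by
      rw [fderiv_bil hG]
      simp only [fderiv_eq_sum_pd _ _ v, Finset.sum_mul, g]
    have hC : fderiv ℝ (fun z => bil (G z) v v) y w =
        ∑ l, ∑ i, ∑ j, w l * pd l (fun z => G z i j) y * (v i * v j) := by
      rw [fderiv_bil hG, ← Finset.sum_comm_cycle]
      simp only [fderiv_eq_sum_pd _ _ w, Finset.sum_mul]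
    have hA : ∑ l, ∑ i, ∑ j, g j l i = ∑ p, ∑ q, ∑ k, g p q k := Finset.sum_comm_cycle
    have hB : ∑ l, ∑ i, ∑ j, g i l j = ∑ p, ∑ q, ∑ k, g p q k := Finset.sum_comm
    rw [hC, two_mul, hD]
    nth_rewrite 1 [← hA]
    rw [← hB]
    simp only [c, Finset.mul_sum, ← Finset.sum_add_distrib, ← Finset.sum_sub_distrib, g]
    exact Finset.sum_congr rfl fun l _ => Finset.sum_congr rfl fun i _ =>
      Finset.sum_congr rfl fun j _ => by ring
  have hEL : EL (fun z v w => bil (G z) v w) y v a ↔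
      G y *ᵥ (a : Fin d → ℝ) + (1 / 2 : ℝ) • c = 0 := by
    have h1 : ∀ w : EuclideanSpace ℝ (Fin d), bil (G y) a w = ∑ l, w l * (G y *ᵥ (a : Fin d → ℝ)) l := by
      intro w
      rw [bil_symm hsymm, bil_apply]
      simp only [Matrix.mulVec, dotProduct, Finset.mul_sum]
      exact Finset.sum_congr rfl fun i _ => Finset.sum_congr rfl fun j _ => by ring
    have h2 : ∀ w : EuclideanSpace ℝ (Fin d), bil (G y) a w +
        fderiv ℝ (fun z => bil (G z) v w) y v - 1 / 2 * fderiv ℝ (fun z => bil (G z) v v) y w =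
        ∑ l, w l * (G y *ᵥ (a : Fin d → ℝ) + (1 / 2 : ℝ) • c) l := by
      intro w
      have := hc w
      simp only [Pi.add_apply, Pi.smul_apply, smul_eq_mul, mul_add, Finset.sum_add_distrib, ← h1]
      have h3 : ∑ l, w l * (1 / 2 * c l) = 1 / 2 * ∑ l, w l * c l := by
        rw [Finset.mul_sum]
        exact Finset.sum_congr rfl fun l _ => by ring
      rw [h3, this]
      ring
    constructor
    · intro h
      ext l
      have := h (EuclideanSpace.single l 1)
      rw [h2] at this
      simpa [Pi.single_apply] using this
    · intro h w
      rw [h2, h]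
      simp
  rw [hEL]
  have h3 : (∀ k, a k + ∑ i, ∑ j, christoffel G y k i j * v i * v j = 0) ↔
      (a : Fin d → ℝ) + (1 / 2 : ℝ) • ((G y)⁻¹ *ᵥ c) = 0 := by
    rw [funext_iff]
    exact forall_congr' fun k => by rw [hchr]; rfl
  rw [h3]
  constructor
  · intro h
    have := congrArg (fun q => (G y)⁻¹ *ᵥ q) h
    simpa [Matrix.mulVec_add, Matrix.mulVec_smul, Matrix.mulVec_mulVec, Matrix.nonsing_inv_mul _ hdet]
      using this
  · intro h
    have := congrArg (fun q => G y *ᵥ q) h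
    simpa [Matrix.mulVec_add, Matrix.mulVec_smul, Matrix.mulVec_mulVec, Matrix.mul_nonsing_inv _ hdet]
      using this

lemma bil_eq_dotProduct (A : Matrix (Fin d) (Fin d) ℝ) (v w : EuclideanSpace ℝ (Fin d)) :
    bil A v w = (v : Fin d → ℝ) ⬝ᵥ (A *ᵥ (w : Fin d → ℝ)) := by
  rw [bil_apply]
  simp only [dotProduct, Matrix.mulVec, Finset.mul_sum]
  exact Finset.sum_congr rfl fun i _ => Finset.sum_congr rfl fun j _ => by ring

lemma posDef_of_bil {A : Matrix (Fin d) (Fin d) ℝ} (hA : A.IsSymm)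
    (h : ∀ v : EuclideanSpace ℝ (Fin d), v ≠ 0 → 0 < bil A v v) : A.PosDef := by
  refine Matrix.PosDef.of_dotProduct_mulVec_pos ?_ fun x hx => ?_
  · ext i j
    simpa using hA.apply i j
  · have := h (WithLp.toLp 2 x) (by simpa using hx)
    rw [bil_eq_dotProduct] at this
    simpa using this

lemma bil_pos {A : Matrix (Fin d) (Fin d) ℝ} (hA : A.PosDef) {v : EuclideanSpace ℝ (Fin d)}
    (hv : v ≠ 0) : 0 < bil A v v := by
  have := hA.dotProduct_mulVec_pos (x := (v : Fin d → ℝ)) (by simpa using hv)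
  rw [bil_eq_dotProduct]
  simpa using this

lemma isSymm_of_posDef {A : Matrix (Fin d) (Fin d) ℝ} (hA : A.PosDef) : A.IsSymm := by
  have := hA.isHermitian
  ext i j
  simpa using this.apply i j

lemma ContDiffAt.differentiableAt_deriv {X : Type*} [NormedAddCommGroup X] [NormedSpace ℝ X]
    {σ : ℝ → X} {t : ℝ} (hσ : ContDiffAt ℝ 2 σ t) : DifferentiableAt ℝ (deriv σ) t := by
  have h : DifferentiableAt ℝ (fun τ => fderiv ℝ σ τ 1) t :=
    ((hσ.fderiv_right (m := 1) (by norm_num)).differentiableAt (by simp)).clm_apply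
      (differentiableAt_const _)
  exact h

/-- The determinant depends smoothly on the entries. -/
lemma contDiffOn_det {X : Type*} [NormedAddCommGroup X] [NormedSpace ℝ X] {N : WithTop ℕ∞}
    {ι : Type*} [Fintype ι] [DecidableEq ι] {G : X → Matrix ι ι ℝ} {s : Set X}
    (hG : ∀ i j, ContDiffOn ℝ N (fun z => G z i j) s) : ContDiffOn ℝ N (fun z => (G z).det) s := by
  simp only [Matrix.det_apply']
  exact ContDiffOn.sum fun σ _ => contDiffOn_const.mul (contDiffOn_prod fun i _ => hG _ _)

/-- The inverse matrix depends smoothly on the entries. -/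
lemma contDiffOn_inv_apply {X : Type*} [NormedAddCommGroup X] [NormedSpace ℝ X] {N : WithTop ℕ∞}
    {ι : Type*} [Fintype ι] [DecidableEq ι] {G : X → Matrix ι ι ℝ} {s : Set X}
    (hG : ∀ i j, ContDiffOn ℝ N (fun z => G z i j) s) (hdet : ∀ z ∈ s, (G z).det ≠ 0) (i j : ι) :
    ContDiffOn ℝ N (fun z => (G z)⁻¹ i j) s := by
  simp only [Matrix.inv_def, Matrix.smul_apply, smul_eq_mul, Ring.inverse_eq_inv',
    Matrix.adjugate_apply]
  refine ((contDiffOn_det hG).inv hdet).mul (contDiffOn_det fun k l => ?_)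
  rcases eq_or_ne k j with rfl | h
  · simpa using contDiffOn_const
  · simpa [Matrix.updateRow_ne h] using hG k l

lemma contDiffOn_pd {f : EuclideanSpace ℝ (Fin d) → ℝ} {s : Set (EuclideanSpace ℝ (Fin d))}
    (hs : IsOpen s) (hf : ContDiffOn ℝ ∞ f s) (i : Fin d) : ContDiffOn ℝ ∞ (pd i f) s :=
  (hf.fderiv_of_isOpen hs (by simp)).clm_apply contDiffOn_const

lemma contDiffOn_christoffel {G : EuclideanSpace ℝ (Fin d) → Matrix (Fin d) (Fin d) ℝ}
    {s : Set (EuclideanSpace ℝ (Fin d))} (hs : IsOpen s)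
    (hG : ∀ i j, ContDiffOn ℝ ∞ (fun z => G z i j) s) (hdet : ∀ z ∈ s, (G z).det ≠ 0)
    (k i j : Fin d) : ContDiffOn ℝ ∞ (fun z => christoffel G z k i j) s := by
  unfold christoffel
  exact contDiffOn_const.mul (ContDiffOn.sum fun l _ => (contDiffOn_inv_apply hG hdet k l).mul
    (((contDiffOn_pd hs (hG j l) i).add (contDiffOn_pd hs (hG i l) j)).sub
      (contDiffOn_pd hs (hG i j) l)))

end Bil

/-! ### Tangent vectors and metrics in charts -/

section Charts

variable {n : ℕ} {M : Type*} [TopologicalSpace M] [ChartedSpace (EuclideanSpace ℝ (Fin n)) M]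

/-- The components of tangent vectors in a chart. -/
noncomputable def tcoord (e : OpenPartialHomeomorph M (EuclideanSpace ℝ (Fin n))) (p : M) :
    TangentSpace (𝓡 n) p →L[ℝ] EuclideanSpace ℝ (Fin n) :=
  mfderiv (𝓡 n) (𝓡 n) e p

variable [IsManifold (𝓡 n) ∞ M] {e : OpenPartialHomeomorph M (EuclideanSpace ℝ (Fin n))}
  (he : e ∈ IsManifold.maximalAtlas (𝓡 n) ∞ M)

include he

lemma mdiffAt_chart {p : M} (hp : p ∈ e.source) : MDifferentiableAt (𝓡 n) (𝓡 n) e p :=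
  (contMDiffAt_of_mem_maximalAtlas he hp).mdifferentiableAt (by simp)

lemma mdiffAt_chart_symm {y : EuclideanSpace ℝ (Fin n)} (hy : y ∈ e.target) :
    MDifferentiableAt (𝓡 n) (𝓡 n) e.symm y :=
  (contMDiffAt_symm_of_mem_maximalAtlas he hy).mdifferentiableAt (by simp)

/-- The chain rule in the form used throughout: manifold derivatives become ordinary derivatives
once tangent vectors are read in a chart. -/
lemma tcoord_mfderiv {V : Type*} [NormedAddCommGroup V] [NormedSpace ℝ V] {F : V → M} {y : V}
    (hF : MDifferentiableAt 𝓘(ℝ, V) (𝓡 n) F y) (hy : F y ∈ e.source) (v : V) :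
    tcoord e (F y) (mfderiv 𝓘(ℝ, V) (𝓡 n) F y v) = fderiv ℝ (e ∘ F) y v := by
  have h := mfderiv_comp y (mdiffAt_chart he hy) hF
  rw [← mfderiv_eq_fderiv, h]
  rfl

lemma tcoord_symm {y : EuclideanSpace ℝ (Fin n)} (hy : y ∈ e.target)
    (v : EuclideanSpace ℝ (Fin n)) :
    tcoord e (e.symm y) (mfderiv (𝓡 n) (𝓡 n) e.symm y v) = v := by
  rw [tcoord_mfderiv he (mdiffAt_chart_symm he hy) (e.map_target hy)]
  have : e ∘ e.symm =ᶠ[𝓝 y] id := e.eventually_right_inverse hy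
  rw [this.fderiv_eq]
  simp

lemma tcoord_injective {p : M} (hp : p ∈ e.source) : Function.Injective (tcoord e p) :=
  OpenPartialHomeomorph.MDifferentiable.mfderiv_injective
    ⟨(contMDiffOn_of_mem_maximalAtlas he).mdifferentiableOn (by simp),
      (contMDiffOn_symm_of_mem_maximalAtlas he).mdifferentiableOn (by simp)⟩ hp

lemma symm_tcoord {y : EuclideanSpace ℝ (Fin n)} (hy : y ∈ e.target)
    (v : TangentSpace (𝓡 n) (e.symm y)) :
    mfderiv (𝓡 n) (𝓡 n) e.symm y (tcoord e (e.symm y) v) = v :=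
  tcoord_injective he (e.map_target hy) (tcoord_symm he hy _)

omit he [IsManifold (𝓡 n) ∞ M] in
lemma bil_pullGram [RiemannianBundle (fun x : M => TangentSpace (𝓡 n) x)] {k : ℕ}
    (F : EuclideanSpace ℝ (Fin k) → M) (y a b : EuclideanSpace ℝ (Fin k)) :
    bil (pullGram (metric (n := n) (M := M)) F y) a b =
      metric (F y) (mfderiv (𝓡 k) (𝓡 n) F y a) (mfderiv (𝓡 k) (𝓡 n) F y b) := by
  have hh : ∀ h : EuclideanSpace ℝ (Fin k), mfderiv (𝓡 k) (𝓡 n) F y h =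
      ∑ i, h i • mfderiv (𝓡 k) (𝓡 n) F y (EuclideanSpace.single i 1 : EuclideanSpace ℝ (Fin k)) := by
    intro h
    have h1 : h = ∑ i, h i • (EuclideanSpace.single i 1 : EuclideanSpace ℝ (Fin k)) := by
      ext j; simp [Pi.single_apply]
    conv_lhs => rw [h1]
    exact (map_sum (mfderiv (𝓡 k) (𝓡 n) F y) _ _).trans
      (Finset.sum_congr rfl fun i _ => map_smul _ _ _)
  rw [hh a, hh b, bil_apply, metric, sum_inner]
  refine Finset.sum_congr rfl fun i _ => ?_
  rw [inner_sum]
  refine Finset.sum_congr rfl fun j _ => ?_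
  rw [real_inner_smul_left, real_inner_smul_right]
  simp only [pullGram, Matrix.of_apply, metric]
  ring

variable [RiemannianBundle (fun x : M => TangentSpace (𝓡 n) x)]

lemma metric_eq_bil {p : M} (hp : p ∈ e.source) (v w : TangentSpace (𝓡 n) p) :
    metric p v w =
      bil (pullGram (metric (n := n) (M := M)) e.symm (e p)) (tcoord e p v) (tcoord e p w) := by
  obtain ⟨y, hy, rfl⟩ : ∃ y ∈ e.target, e.symm y = p := ⟨e p, e.map_source hp, e.left_inv hp⟩
  rw [e.right_inv hy, bil_pullGram, symm_tcoord he hy, symm_tcoord he hy]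

lemma pullGram_eq_bil {k : ℕ} {F : EuclideanSpace ℝ (Fin k) → M} {y : EuclideanSpace ℝ (Fin k)}
    (hF : MDifferentiableAt (𝓡 k) (𝓡 n) F y) (hy : F y ∈ e.source)
    (a b : EuclideanSpace ℝ (Fin k)) :
    bil (pullGram (metric (n := n) (M := M)) F y) a b =
      bil (pullGram (metric (n := n) (M := M)) e.symm (e (F y)))
        (fderiv ℝ (e ∘ F) y a) (fderiv ℝ (e ∘ F) y b) := by
  rw [bil_pullGram, metric_eq_bil he hy, tcoord_mfderiv he hF hy, tcoord_mfderiv he hF hy]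

omit he [IsManifold (𝓡 n) ∞ M] in
lemma pullGram_isSymm {k : ℕ} (F : EuclideanSpace ℝ (Fin k) → M) (y : EuclideanSpace ℝ (Fin k)) :
    (pullGram (metric (n := n) (M := M)) F y).IsSymm := by
  ext i j
  exact real_inner_comm (F := TangentSpace (𝓡 n) (F y)) _ _

omit he [IsManifold (𝓡 n) ∞ M] in
/-- The Gram matrix of an immersion is positive definite. -/
lemma pullGram_posDef {k : ℕ} {F : EuclideanSpace ℝ (Fin k) → M} {y : EuclideanSpace ℝ (Fin k)}
    (hF : Function.Injective (mfderiv (𝓡 k) (𝓡 n) F y)) :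
    (pullGram (metric (n := n) (M := M)) F y).PosDef := by
  refine posDef_of_bil (pullGram_isSymm F y) fun v hv => ?_
  rw [bil_pullGram]
  refine real_inner_self_pos.2 fun h => hv (hF ?_)
  exact h.trans (map_zero (mfderiv (𝓡 k) (𝓡 n) F y)).symm

lemma pullGram_symm_posDef {y : EuclideanSpace ℝ (Fin n)} (hy : y ∈ e.target) :
    (pullGram (metric (n := n) (M := M)) e.symm y).PosDef := by
  refine pullGram_posDef fun v w h => ?_
  have := congrArg (tcoord e (e.symm y)) h
  exact (tcoord_symm he hy v).symm.trans (this.trans (tcoord_symm he hy w))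

variable [IsContMDiffRiemannianBundle (𝓡 n) ∞ (EuclideanSpace ℝ (Fin n))
  (fun x : M => TangentSpace (𝓡 n) x)]

/-- The coordinate fields are images of constant fields under the tangent map of the inverse chart,
hence smooth along it; smoothness of the bundle metric then applies to their inner products. -/
lemma contDiffOn_pullGram_symm (i j : Fin n) :
    ContDiffOn ℝ ∞ (fun y => pullGram (metric (n := n) (M := M)) e.symm y i j) e.target := by
  have hs : ∀ i : Fin n, ContMDiffOn (𝓡 n) (𝓡 n).tangent ∞
      (fun y => (⟨e.symm y, mfderiv (𝓡 n) (𝓡 n) e.symm y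
        (EuclideanSpace.single i 1 : EuclideanSpace ℝ (Fin n))⟩ : TangentBundle (𝓡 n) M)) e.target := by
    intro i
    have h1 := (contMDiffOn_symm_of_mem_maximalAtlas he).contMDiffOn_tangentMapWithin (m := ∞)
      (by simp) e.open_target.uniqueMDiffOn
    have h2 : ContMDiffOn (𝓡 n) (𝓡 n).tangent ∞ (fun y => (⟨y,
        (EuclideanSpace.single i 1 : EuclideanSpace ℝ (Fin n))⟩ :
          TangentBundle (𝓡 n) (EuclideanSpace ℝ (Fin n)))) e.target :=
      contMDiffOn_vectorSpace_iff_contDiffOn.2 contDiffOn_const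
    refine (h1.comp h2 fun y hy => hy).congr fun y hy => ?_
    simp only [Function.comp, tangentMapWithin]
    rw [mfderivWithin_of_isOpen e.open_target hy]
  have h := (hs i).inner_bundle (hs j)
  rw [contMDiffOn_iff_contDiffOn] at h
  exact h

omit he [IsContMDiffRiemannianBundle (𝓡 n) ∞ (EuclideanSpace ℝ (Fin n))
  (fun x : M => TangentSpace (𝓡 n) x)] [IsManifold (𝓡 n) ∞ M]
  [RiemannianBundle (fun x : M => TangentSpace (𝓡 n) x)] [TopologicalSpace M] [ChartedSpace (EuclideanSpace ℝ (Fin n)) M] in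
lemma deriv_apply_coord {σ : ℝ → EuclideanSpace ℝ (Fin n)} {t : ℝ} (hσ : DifferentiableAt ℝ σ t)
    (k : Fin n) : deriv (fun τ => σ τ k) t = deriv σ t k :=
  ((EuclideanSpace.proj k : EuclideanSpace ℝ (Fin n) →L[ℝ] ℝ).hasFDerivAt.comp_hasDerivAt t
    hσ.hasDerivAt).deriv

omit he [IsContMDiffRiemannianBundle (𝓡 n) ∞ (EuclideanSpace ℝ (Fin n))
  (fun x : M => TangentSpace (𝓡 n) x)] [IsManifold (𝓡 n) ∞ M]
  [RiemannianBundle (fun x : M => TangentSpace (𝓡 n) x)] [TopologicalSpace M] [ChartedSpace (EuclideanSpace ℝ (Fin n)) M] in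
lemma deriv_deriv_apply_coord {σ : ℝ → EuclideanSpace ℝ (Fin n)} {t : ℝ}
    (hσ : ContDiffAt ℝ 2 σ t) (k : Fin n) :
    deriv (deriv fun τ => σ τ k) t = deriv (deriv σ) t k := by
  have h1 : (deriv fun τ => σ τ k) =ᶠ[𝓝 t] fun τ => deriv σ τ k := by
    filter_upwards [hσ.eventually (by simp)] with τ hτ
    exact deriv_apply_coord (hτ.differentiableAt (by simp)) k
  rw [h1.deriv_eq, deriv_apply_coord]
  exact ContDiffAt.differentiableAt_deriv hσ

lemma contDiffAt_chart_comp {γ : ℝ → M} {t : ℝ} {N : WithTop ℕ∞} (hN : N ≤ (∞ : WithTop ℕ∞))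
    (hγ : ContMDiffAt 𝓘(ℝ, ℝ) (𝓡 n) N γ t) (ht : γ t ∈ e.source) :
    ContDiffAt ℝ N (e ∘ γ) t :=
  (((contMDiffAt_of_mem_maximalAtlas he ht).of_le hN).comp t hγ).contDiffAt

/-- The geodesic equation in a chart is the Euler–Lagrange equation. -/
lemma geodesicEq_iff_EL {γ : ℝ → M} {t : ℝ} (hγ : ContMDiffAt 𝓘(ℝ, ℝ) (𝓡 n) 2 γ t)
    (ht : γ t ∈ e.source) :
    (∀ k : Fin n, deriv (deriv fun τ => e (γ τ) k) t +
      ∑ i, ∑ j, christoffel (pullGram (metric (n := n) (M := M)) e.symm) (e (γ t)) k i j *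
        deriv (fun τ => e (γ τ) i) t * deriv (fun τ => e (γ τ) j) t = 0) ↔
    EL (fun z v w => bil (pullGram (metric (n := n) (M := M)) e.symm z) v w) (e (γ t))
      (deriv (e ∘ γ) t) (deriv (deriv (e ∘ γ)) t) := by
  have hσ : ContDiffAt ℝ 2 (e ∘ γ) t := contDiffAt_chart_comp he (by norm_cast) hγ ht
  have hpos := pullGram_symm_posDef he (e.map_source ht)
  rw [el_iff_christoffel (fun i j => ((contDiffOn_pullGram_symm he i j).contDiffAt
    (e.open_target.mem_nhds (e.map_source ht))).differentiableAt (by simp)) (pullGram_isSymm _ _)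
    hpos.det_pos.ne'.isUnit]
  refine forall_congr' fun k => ?_
  have h1 : ∀ i, deriv (fun τ => e (γ τ) i) t = deriv (e ∘ γ) t i := fun i =>
    deriv_apply_coord (hσ.differentiableAt (by simp)) i
  have h2 := deriv_deriv_apply_coord hσ k
  simp only [h1]
  rw [← h2]
  rfl

/-- The Euler–Lagrange equation does not depend on the chart. -/
lemma EL_chart_change {φ : OpenPartialHomeomorph M (EuclideanSpace ℝ (Fin n))}
    (hφ : φ ∈ IsManifold.maximalAtlas (𝓡 n) ∞ M) {γ : ℝ → M} {t : ℝ}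
    (hγ : ContMDiffAt 𝓘(ℝ, ℝ) (𝓡 n) 2 γ t) (ht : γ t ∈ e.source) (ht' : γ t ∈ φ.source)
    (h : EL (fun z v w => bil (pullGram (metric (n := n) (M := M)) φ.symm z) v w) (φ (γ t))
      (deriv (φ ∘ γ) t) (deriv (deriv (φ ∘ γ)) t)) :
    EL (fun z v w => bil (pullGram (metric (n := n) (M := M)) e.symm z) v w) (e (γ t))
      (deriv (e ∘ γ) t) (deriv (deriv (e ∘ γ)) t) := by
  have hσ : ContDiffAt ℝ 2 (e ∘ γ) t := contDiffAt_chart_comp he (by norm_cast) hγ ht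
  have hz : e (γ t) ∈ e.target := e.map_source ht
  have hΦ : ContDiffAt ℝ ∞ (φ ∘ e.symm) (e (γ t)) := by
    rw [← contMDiffAt_iff_contDiffAt]
    refine ContMDiffAt.comp (e (γ t)) ?_ (contMDiffAt_symm_of_mem_maximalAtlas he hz)
    rw [e.left_inv ht]
    exact contMDiffAt_of_mem_maximalAtlas hφ ht'
  have hΦz : (φ ∘ e.symm) (e (γ t)) = φ (γ t) := by simp [e.left_inv ht]
  have hev : ∀ᶠ τ in 𝓝 t, γ τ ∈ e.source :=
    hγ.continuousAt.eventually_mem (e.open_source.mem_nhds ht)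
  have hc : φ ∘ γ =ᶠ[𝓝 t] (φ ∘ e.symm) ∘ (e ∘ γ) := hev.mono fun τ hτ => by simp [e.left_inv hτ]
  have hΦ2 : ContDiffAt ℝ 2 (φ ∘ e.symm) (e (γ t)) := hΦ.of_le (by norm_cast)
  have hd : deriv (φ ∘ γ) =ᶠ[𝓝 t]
      fun τ => fderiv ℝ (φ ∘ e.symm) (e (γ τ)) (deriv (e ∘ γ) τ) := by
    have h1 : ∀ᶠ τ in 𝓝 t, ContDiffAt ℝ 2 (φ ∘ e.symm) ((e ∘ γ) τ) :=
      hσ.continuousAt.eventually (hΦ2.eventually (by simp))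
    filter_upwards [hc.eventuallyEq_nhds, h1, hσ.eventually (by simp)] with τ h1 h2 h3
    rw [h1.deriv_eq]
    exact ((h2.differentiableAt (by simp)).hasFDerivAt.comp_hasDerivAt τ
      (h3.differentiableAt (by simp)).hasDerivAt).deriv
  have hdσ : HasDerivAt (e ∘ γ) (deriv (e ∘ γ) t) t := (hσ.differentiableAt (by simp)).hasDerivAt
  have hddσ : HasDerivAt (deriv (e ∘ γ)) (deriv (deriv (e ∘ γ)) t) t :=
    (ContDiffAt.differentiableAt_deriv hσ).hasDerivAt
  have hdΦ : HasFDerivAt (fderiv ℝ (φ ∘ e.symm)) (fderiv ℝ (fderiv ℝ (φ ∘ e.symm)) (e (γ t)))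
      ((e ∘ γ) t) :=
    ((hΦ2.fderiv_right (m := 1) (by norm_num)).differentiableAt (by simp)).hasFDerivAt
  -- The acceleration in the new chart is DΦ(a) + D²Φ(v, v), precisely the quantity on which
  -- `EL.pullForm` is stated.
  have hdd := ((hdΦ.comp_hasDerivAt t hdσ).clm_apply hddσ).deriv
  have hdd' := hd.deriv_eq.trans hdd
  rw [hdd', hd.self_of_nhds, ← hΦz] at h
  have hG : DifferentiableAt ℝ (fun z => bil (pullGram (metric (n := n) (M := M)) φ.symm z))
      ((φ ∘ e.symm) (e (γ t))) := by
    rw [hΦz]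
    exact ((contDiffOn_bil fun i j => contDiffOn_pullGram_symm hφ i j).contDiffAt
      (φ.open_target.mem_nhds (φ.map_source ht'))).differentiableAt (by simp)
  have h3 := EL.pullForm (v := deriv (e ∘ γ) t) (a := deriv (deriv (e ∘ γ)) t) hG hΦ2
    (fun v w => bil_symm (pullGram_isSymm _ _) v w) (by
      rw [add_comm]; exact h)
  refine h3.congr ?_
  have hev2 : ∀ᶠ z in 𝓝 (e (γ t)), z ∈ e.target ∧ e.symm z ∈ φ.source := by
    refine (e.open_target.eventually_mem hz).and ?_
    refine (e.continuousAt_symm hz).eventually_mem (φ.open_source.mem_nhds ?_)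
    rwa [e.left_inv ht]
  filter_upwards [hev2] with z hz
  funext v w
  exact (pullGram_eq_bil hφ (mdiffAt_chart_symm he hz.1) hz.2 v w).symm

omit he in
/-- A curve which satisfies the geodesic equation in one chart is a geodesic. -/
lemma isGeodesicOn_of_EL {φ : OpenPartialHomeomorph M (EuclideanSpace ℝ (Fin n))}
    (hφ : φ ∈ IsManifold.maximalAtlas (𝓡 n) ∞ M) {γ : ℝ → M} {s : Set ℝ} (hs : IsOpen s)
    (hγ : ContMDiffOn 𝓘(ℝ, ℝ) (𝓡 n) 2 γ s) (hsrc : ∀ t ∈ s, γ t ∈ φ.source)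
    (h : ∀ t ∈ s, EL (fun z v w => bil (pullGram (metric (n := n) (M := M)) φ.symm z) v w)
      (φ (γ t)) (deriv (φ ∘ γ) t) (deriv (deriv (φ ∘ γ)) t)) :
    IsGeodesicOn (n := n) γ s := by
  refine ⟨hγ, fun e he t ht hte => ?_⟩
  have hγt := hγ.contMDiffAt (hs.mem_nhds ht)
  exact (geodesicEq_iff_EL he hγt hte).2 (EL_chart_change he hφ hγt hte (hsrc t ht) (h t ht))

lemma IsGeodesicOn.EL {γ : ℝ → M} {s : Set ℝ} (hs : IsOpen s) (hγ : IsGeodesicOn (n := n) γ s)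
    {t : ℝ} (ht : t ∈ s) (hte : γ t ∈ e.source) :
    EL (fun z v w => bil (pullGram (metric (n := n) (M := M)) e.symm z) v w) (e (γ t))
      (deriv (e ∘ γ) t) (deriv (deriv (e ∘ γ)) t) :=
  (geodesicEq_iff_EL he (hγ.1.contMDiffAt (hs.mem_nhds ht)) hte).1 (hγ.2 e he t ht hte)

end Charts
/-! ### The geodesic spray -/

section GeodesicSpray

variable {d : ℕ}

/-- The geodesic spray `(y, v) ↦ -Γ(y)(v, v)`. -/
noncomputable def spray (G : EuclideanSpace ℝ (Fin d) → Matrix (Fin d) (Fin d) ℝ)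
    (p : EuclideanSpace ℝ (Fin d) × EuclideanSpace ℝ (Fin d)) : EuclideanSpace ℝ (Fin d) :=
  WithLp.toLp 2 fun k => -∑ i, ∑ j, christoffel G p.1 k i j * p.2 i * p.2 j

lemma spray_smul (G : EuclideanSpace ℝ (Fin d) → Matrix (Fin d) (Fin d) ℝ)
    (y v : EuclideanSpace ℝ (Fin d)) (s : ℝ) : spray G (y, s • v) = s ^ 2 • spray G (y, v) := by
  ext k
  simp only [spray, PiLp.smul_apply, smul_eq_mul, mul_neg, Finset.mul_sum]
  congr 1
  exact Finset.sum_congr rfl fun i _ => Finset.sum_congr rfl fun j _ => by ring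

lemma contDiffOn_spray {G : EuclideanSpace ℝ (Fin d) → Matrix (Fin d) (Fin d) ℝ}
    {s : Set (EuclideanSpace ℝ (Fin d))} (hs : IsOpen s)
    (hG : ∀ i j, ContDiffOn ℝ ∞ (fun z => G z i j) s) (hdet : ∀ z ∈ s, (G z).det ≠ 0) :
    ContDiffOn ℝ ∞ (spray G) (s ×ˢ univ) := by
  rw [contDiffOn_euclidean]
  intro k
  have hc : ∀ i, ContDiffOn ℝ ∞ (fun p : EuclideanSpace ℝ (Fin d) × EuclideanSpace ℝ (Fin d) =>
      p.2 i) (s ×ˢ univ) := fun i =>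
    ((EuclideanSpace.proj i : EuclideanSpace ℝ (Fin d) →L[ℝ] ℝ).contDiff.comp contDiff_snd).contDiffOn
  refine (ContDiffOn.sum fun i _ => ContDiffOn.sum fun j _ => ?_).neg
  refine (ContDiffOn.mul ?_ (hc i)).mul (hc j)
  exact (contDiffOn_christoffel hs hG hdet k i j).comp contDiff_fst.contDiffOn fun p hp => hp.1

lemma el_iff_spray {G : EuclideanSpace ℝ (Fin d) → Matrix (Fin d) (Fin d) ℝ}
    {y : EuclideanSpace ℝ (Fin d)} (hG : ∀ i j, DifferentiableAt ℝ (fun z => G z i j) y)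
    (hsymm : (G y).IsSymm) (hdet : IsUnit (G y).det) (v a : EuclideanSpace ℝ (Fin d)) :
    EL (fun z v w => bil (G z) v w) y v a ↔ a = spray G (y, v) := by
  rw [el_iff_christoffel hG hsymm hdet]
  constructor
  · intro h
    ext k
    exact eq_neg_of_add_eq_zero_left (h k)
  · intro h k
    rw [h]
    simp [spray]

/-- A spray on an open set coincides near a point with a globally defined smooth spray. -/
lemma exists_spray_extension {G : EuclideanSpace ℝ (Fin d) → Matrix (Fin d) (Fin d) ℝ}
    {s : Set (EuclideanSpace ℝ (Fin d))} (hs : IsOpen s)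
    (hG : ∀ i j, ContDiffOn ℝ ∞ (fun z => G z i j) s) (hdet : ∀ z ∈ s, (G z).det ≠ 0)
    {y₀ : EuclideanSpace ℝ (Fin d)} (hy₀ : y₀ ∈ s) :
    ∃ Q : EuclideanSpace ℝ (Fin d) × EuclideanSpace ℝ (Fin d) → EuclideanSpace ℝ (Fin d),
      ContDiff ℝ ∞ Q ∧ (∀ y v (c : ℝ), Q (y, c • v) = c ^ 2 • Q (y, v)) ∧
      ∃ N ∈ 𝓝 y₀, N ⊆ s ∧ ∀ y ∈ N, ∀ v, Q (y, v) = spray G (y, v) := by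
  obtain ⟨r, hr, hrs⟩ := Metric.isOpen_iff.1 hs y₀ hy₀
  -- The cut-off depends on the position only, so multiplication by it preserves homogeneity in the
  -- velocity. Its support, of radius r / 2, stays inside s.
  let χ : ContDiffBump y₀ := ⟨r / 4, r / 2, by positivity, by linarith⟩
  refine ⟨fun p => χ p.1 • spray G p, ?_, ?_, Metric.ball y₀ (r / 4), Metric.ball_mem_nhds _
    (by positivity), (Metric.ball_subset_ball (by linarith)).trans hrs, ?_⟩
  · rw [contDiff_iff_contDiffAt]
    intro p
    by_cases hp : p.1 ∈ s
    · exact (χ.contDiff.comp contDiff_fst).contDiffAt.smul ((contDiffOn_spray hs hG hdet).contDiffAt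
        ((hs.prod isOpen_univ).mem_nhds ⟨hp, mem_univ _⟩))
    · have hp' : p.1 ∈ (Metric.closedBall y₀ (r / 2))ᶜ := fun h =>
        hp (hrs (Metric.closedBall_subset_ball (by linarith) h))
      have hev : (fun p => χ p.1 • spray G p) =ᶠ[𝓝 p] fun _ => 0 := by
        have h1 : ∀ᶠ q in 𝓝 p, q.1 ∈ (Metric.closedBall y₀ (r / 2))ᶜ :=
          continuousAt_fst.eventually_mem (Metric.isClosed_closedBall.isOpen_compl.mem_nhds hp')
        filter_upwards [h1] with q hq
        have : χ q.1 = 0 := χ.zero_of_le_dist (by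
          have : ¬ dist q.1 y₀ ≤ r / 2 := hq
          exact (not_le.1 this).le)
        rw [this, zero_smul]
      exact contDiffAt_const.congr_of_eventuallyEq hev
  · intro y v c
    simp only [spray_smul]
    rw [smul_comm]
  · intro y hy v
    have : χ y = 1 := χ.one_of_mem_closedBall (Metric.ball_subset_closedBall hy)
    simp only [this, one_smul]

/-- Local uniqueness for second order differential equations. -/
lemma second_order_ode_unique {E : Type*} [NormedAddCommGroup E] [NormedSpace ℝ E]
    {Q : E × E → E} {c₁ c₂ : ℝ → E} {t : ℝ} (hQ : ContDiffAt ℝ 1 Q (c₁ t, deriv c₁ t))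
    (h₁ : ContDiffAt ℝ 2 c₁ t) (h₂ : ContDiffAt ℝ 2 c₂ t)
    (he₁ : ∀ᶠ τ in 𝓝 t, deriv (deriv c₁) τ = Q (c₁ τ, deriv c₁ τ))
    (he₂ : ∀ᶠ τ in 𝓝 t, deriv (deriv c₂) τ = Q (c₂ τ, deriv c₂ τ))
    (h0 : c₁ t = c₂ t) (h0' : deriv c₁ t = deriv c₂ t) : c₁ =ᶠ[𝓝 t] c₂ := by
  obtain ⟨K, S, hS, hK⟩ := (contDiffAt_snd.prodMk hQ :
    ContDiffAt ℝ 1 (fun p : E × E => (p.2, Q p)) _).exists_lipschitzOnWith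
  have hd₁ := ContDiffAt.differentiableAt_deriv h₁
  have hd₂ := ContDiffAt.differentiableAt_deriv h₂
  have key : ∀ c : ℝ → E, ContDiffAt ℝ 2 c t → c t = c₁ t → deriv c t = deriv c₁ t →
      (∀ᶠ τ in 𝓝 t, deriv (deriv c) τ = Q (c τ, deriv c τ)) →
      ∀ᶠ τ in 𝓝 t, HasDerivAt (fun τ => (c τ, deriv c τ))
        ((fun p : E × E => (p.2, Q p)) (c τ, deriv c τ)) τ ∧ (c τ, deriv c τ) ∈ S := by
    intro c hc h1 h2 h3
    have hcont : ContinuousAt (fun τ => (c τ, deriv c τ)) t :=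
      hc.continuousAt.prodMk (ContDiffAt.differentiableAt_deriv hc).continuousAt
    have hmem : ∀ᶠ τ in 𝓝 t, (c τ, deriv c τ) ∈ S :=
      hcont.eventually_mem (by rw [h1, h2]; exact hS)
    filter_upwards [h3, hmem, hc.eventually (by simp)] with τ e1 e2 e3
    refine ⟨HasDerivAt.prodMk (e3.differentiableAt (by simp)).hasDerivAt ?_, e2⟩
    rw [← e1]
    exact (ContDiffAt.differentiableAt_deriv e3).hasDerivAt
  have := ODE_solution_unique_of_eventually (v := fun _ => fun p : E × E => (p.2, Q p))
    (s := fun _ => S) (Filter.Eventually.of_forall fun _ => hK) (key c₁ h₁ rfl rfl he₁)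
    (key c₂ h₂ h0.symm h0'.symm he₂) (Prod.ext h0 h0')
  exact this.mono fun τ hτ => congrArg Prod.fst hτ

end GeodesicSpray

/-! ### Uniqueness of geodesics -/

section Unique

variable {n : ℕ} {M : Type*} [TopologicalSpace M] [ChartedSpace (EuclideanSpace ℝ (Fin n)) M]
  [IsManifold (𝓡 n) ∞ M] {φ : OpenPartialHomeomorph M (EuclideanSpace ℝ (Fin n))}
  (hφ : φ ∈ IsManifold.maximalAtlas (𝓡 n) ∞ M)

include hφ

lemma deriv_eq_of_velocity_eq {γ₁ γ₂ : ℝ → M} {t : ℝ}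
    (h₁ : MDifferentiableAt 𝓘(ℝ, ℝ) (𝓡 n) γ₁ t) (h₂ : MDifferentiableAt 𝓘(ℝ, ℝ) (𝓡 n) γ₂ t)
    (ht : γ₁ t ∈ φ.source) (h : velocity (n := n) γ₁ t = velocity γ₂ t) :
    γ₁ t = γ₂ t ∧ deriv (φ ∘ γ₁) t = deriv (φ ∘ γ₂) t := by
  have h0 : γ₁ t = γ₂ t := congrArg Bundle.TotalSpace.proj h
  have h3 := congrArg (fun q : TangentBundle (𝓡 n) M => tcoord φ q.1 q.2) h
  have e1 := tcoord_mfderiv hφ h₁ ht (1 : ℝ)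
  have e2 := tcoord_mfderiv hφ h₂ (h0 ▸ ht) (1 : ℝ)
  exact ⟨h0, e1.symm.trans (h3.trans e2)⟩

variable [RiemannianBundle (fun x : M => TangentSpace (𝓡 n) x)]
  [IsContMDiffRiemannianBundle (𝓡 n) ∞ (EuclideanSpace ℝ (Fin n))
    (fun x : M => TangentSpace (𝓡 n) x)]

lemma el_iff_spray_chart {y : EuclideanSpace ℝ (Fin n)} (hy : y ∈ φ.target)
    (v a : EuclideanSpace ℝ (Fin n)) :
    EL (fun z v w => bil (pullGram (metric (n := n) (M := M)) φ.symm z) v w) y v a ↔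
      a = spray (pullGram (metric (n := n) (M := M)) φ.symm) (y, v) :=
  el_iff_spray (fun i j => ((contDiffOn_pullGram_symm hφ i j).contDiffAt
    (φ.open_target.mem_nhds hy)).differentiableAt (by simp)) (pullGram_isSymm _ _)
    (pullGram_symm_posDef hφ hy).det_pos.ne'.isUnit v a

lemma contDiffOn_spray_chart :
    ContDiffOn ℝ ∞ (spray (pullGram (metric (n := n) (M := M)) φ.symm)) (φ.target ×ˢ univ) :=
  contDiffOn_spray φ.open_target (contDiffOn_pullGram_symm hφ)
    fun _ hz => (pullGram_symm_posDef hφ hz).det_pos.ne'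

/-- A connectedness argument on [0, 1]: the coincidence set is closed because M is Hausdorff, and
local uniqueness for the spray equation in φ extends coincidence to the right. Assuming that γ₁
stays in φ suffices, as γ₂ is there wherever they agree. -/
lemma geodesic_unique [T2Space M] {γ₁ γ₂ : ℝ → M} {s : Set ℝ} (hs : IsOpen s)
    (hs1 : Icc (0 : ℝ) 1 ⊆ s) (h₁ : IsGeodesicOn (n := n) γ₁ s) (h₂ : IsGeodesicOn (n := n) γ₂ s)
    (hsrc : ∀ t ∈ Icc (0 : ℝ) 1, γ₁ t ∈ φ.source)
    (hv : velocity (n := n) γ₁ 0 = velocity γ₂ 0) : EqOn γ₁ γ₂ (Icc 0 1) := by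
  have hmd : ∀ γ : ℝ → M, IsGeodesicOn (n := n) γ s → ∀ t ∈ s,
      ContMDiffAt 𝓘(ℝ, ℝ) (𝓡 n) 2 γ t := fun γ h t ht => h.1.contMDiffAt (hs.mem_nhds ht)
  have h00 := deriv_eq_of_velocity_eq hφ
    ((hmd γ₁ h₁ 0 (hs1 (by norm_num))).mdifferentiableAt (by simp))
    ((hmd γ₂ h₂ 0 (hs1 (by norm_num))).mdifferentiableAt (by simp)) (hsrc 0 (by norm_num)) hv
  have hclosed : IsClosed ({t | γ₁ t = γ₂ t} ∩ Icc (0 : ℝ) 1) := by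
    have hc : ContinuousOn (fun t => (γ₁ t, γ₂ t)) (Icc (0 : ℝ) 1) :=
      (h₁.1.continuousOn.mono hs1).prodMk (h₂.1.continuousOn.mono hs1)
    have := hc.preimage_isClosed_of_isClosed isClosed_Icc isClosed_diagonal
    rwa [inter_comm] at this
  refine IsClosed.Icc_subset_of_forall_mem_nhdsGT_of_Icc_subset hclosed h00.1 fun t ht hsub => ?_
  have htI : t ∈ Icc (0 : ℝ) 1 := Ico_subset_Icc_self ht
  have hts : t ∈ s := hs1 htI
  have heq : γ₁ t = γ₂ t := hsub ⟨ht.1, le_rfl⟩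
  have ht₁ : γ₁ t ∈ φ.source := hsrc t htI
  have ht₂ : γ₂ t ∈ φ.source := heq ▸ ht₁
  have hc₁ : ContDiffAt ℝ 2 (φ ∘ γ₁) t :=
    contDiffAt_chart_comp hφ (by norm_cast) (hmd γ₁ h₁ t hts) ht₁
  have hc₂ : ContDiffAt ℝ 2 (φ ∘ γ₂) t :=
    contDiffAt_chart_comp hφ (by norm_cast) (hmd γ₂ h₂ t hts) ht₂
  -- At t = 0 this is the hypothesis on velocities. For t > 0 the curves agree on [0, t], and their
  -- derivatives at t are determined from the left.
  have hd : deriv (φ ∘ γ₁) t = deriv (φ ∘ γ₂) t := by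
    rcases ht.1.eq_or_lt with rfl | h0
    · exact h00.2
    · have u : UniqueDiffWithinAt ℝ (Icc 0 t) t := uniqueDiffOn_Icc h0 t ⟨h0.le, le_rfl⟩
      have e1 := (hc₁.differentiableAt (by simp)).hasDerivAt.hasDerivWithinAt (s := Icc 0 t)
      have e2 := (hc₂.differentiableAt (by simp)).hasDerivAt.hasDerivWithinAt (s := Icc 0 t)
      refine u.eq_deriv _ e1 (e2.congr (fun τ hτ => ?_) ?_)
      · exact congrArg φ (hsub hτ)
      · exact congrArg φ heq
  have hev : ∀ γ : ℝ → M, IsGeodesicOn (n := n) γ s → γ t ∈ φ.source →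
      ∀ᶠ τ in 𝓝 t, γ τ ∈ φ.source ∧ deriv (deriv (φ ∘ γ)) τ =
        spray (pullGram (metric (n := n) (M := M)) φ.symm) ((φ ∘ γ) τ, deriv (φ ∘ γ) τ) := by
    intro γ hγ hγt
    filter_upwards [hs.eventually_mem hts, (hmd γ hγ t hts).continuousAt.eventually_mem
      (φ.open_source.mem_nhds hγt)] with τ h1 h2
    exact ⟨h2, (el_iff_spray_chart hφ (φ.map_source h2) _ _).1 (hγ.EL hφ hs h1 h2)⟩
  have hQ : ContDiffAt ℝ 1 (spray (pullGram (metric (n := n) (M := M)) φ.symm))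
      ((φ ∘ γ₁) t, deriv (φ ∘ γ₁) t) :=
    ((contDiffOn_spray_chart hφ).contDiffAt ((φ.open_target.prod isOpen_univ).mem_nhds
      ⟨φ.map_source ht₁, mem_univ _⟩)).of_le (by norm_cast)
  have := second_order_ode_unique hQ hc₁ hc₂ ((hev γ₁ h₁ ht₁).mono fun _ h => h.2)
    ((hev γ₂ h₂ ht₂).mono fun _ h => h.2) (congrArg φ heq) hd
  refine mem_nhdsWithin_of_mem_nhds ?_
  filter_upwards [this, hev γ₁ h₁ ht₁, hev γ₂ h₂ ht₂] with τ e1 e2 e3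
  exact φ.injOn e2.1 e3.1 e1

end Unique
/-! ### The exponential map in a chart -/

section ChartExp

/-- Sections of a fibred local diffeomorphism `(y, w) ↦ (y, X (y, w))`. -/
lemma exists_fiber_openPartialHomeomorph {E : Type*} [NormedAddCommGroup E] [NormedSpace ℝ E]
    {X : E × E → E} (Φ : OpenPartialHomeomorph (E × E) (E × E)) (hΦ : ∀ p, Φ p = (p.1, X p))
    (hsymm : ContDiffOn ℝ ∞ Φ.symm Φ.target) {S : Set (E × E)} (hX : ContDiffOn ℝ ∞ X S)
    (y : E) (A : E ≃L[ℝ] E) {O : Set E} (hO : IsOpen O)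
    (hOS : ∀ u ∈ O, (y, A u) ∈ Φ.source ∧ (y, A u) ∈ S) :
    ∃ H : OpenPartialHomeomorph E E, H.target = O ∧ (∀ u, H.symm u = X (y, A u)) ∧
      ContDiffOn ℝ ∞ H H.source ∧ ContDiffOn ℝ ∞ H.symm H.target := by
  have hpr : Continuous fun q : E => (y, q) := by fun_prop
  have hcd : ContDiff ℝ ∞ fun q : E => (y, q) := contDiff_const.prodMk contDiff_id
  have hO' : IsOpen ((fun q : E => (y, q)) ⁻¹' Φ.target) := Φ.open_target.preimage hpr
  have hsm : ContDiffOn ℝ ∞ (fun q => A.symm (Φ.symm (y, q)).2)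
      ((fun q : E => (y, q)) ⁻¹' Φ.target) :=
    A.symm.contDiff.comp_contDiffOn (contDiff_snd.comp_contDiffOn
      (hsymm.comp hcd.contDiffOn (mapsTo_preimage _ _)))
  have hXA : ContDiffOn ℝ ∞ (fun u => X (y, A u)) O :=
    hX.comp (hcd.comp A.contDiff).contDiffOn fun u hu => (hOS u hu).2
  have hmem : ∀ u ∈ O, (y, X (y, A u)) ∈ Φ.target ∧ Φ.symm (y, X (y, A u)) = (y, A u) := by
    intro u hu
    have h1 := Φ.map_source (hOS u hu).1
    have h2 := Φ.left_inv (hOS u hu).1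
    rw [hΦ] at h1 h2
    exact ⟨h1, h2⟩
  let H : OpenPartialHomeomorph E E :=
    { toFun := fun q => A.symm (Φ.symm (y, q)).2
      invFun := fun u => X (y, A u)
      source := ((fun q : E => (y, q)) ⁻¹' Φ.target) ∩ (fun q => A.symm (Φ.symm (y, q)).2) ⁻¹' O
      target := O
      map_source' := fun q hq => hq.2
      map_target' := fun u hu => ⟨(hmem u hu).1, by
        simp only [mem_preimage, (hmem u hu).2, A.symm_apply_apply]; exact hu⟩
      left_inv' := fun q hq => by
        have h1 := Φ.right_inv hq.1
        rw [hΦ] at h1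
        have h2 : (Φ.symm (y, q)).1 = y := congrArg Prod.fst h1
        have h3 : X (Φ.symm (y, q)) = q := congrArg Prod.snd h1
        rw [A.apply_symm_apply, ← h2]
        nth_rewrite 2 [h2]
        exact h3
      right_inv' := fun u hu => by
        simp only [(hmem u hu).2, A.symm_apply_apply]
      open_source := hsm.continuousOn.isOpen_inter_preimage hO' hO
      open_target := hO
      continuousOn_toFun := hsm.continuousOn.mono inter_subset_left
      continuousOn_invFun := hXA.continuousOn }
  exact ⟨H, rfl, fun _ => rfl, hsm.mono inter_subset_left, hXA⟩

variable {n : ℕ} {M : Type*} [TopologicalSpace M] [ChartedSpace (EuclideanSpace ℝ (Fin n)) M]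
  [RiemannianBundle (fun x : M => TangentSpace (𝓡 n) x)]

/-- `X` is the exponential map, read in the chart `φ`, for base points in the ball of radius `ρ`
about `y₀` and vectors of norm less than `ρ`. -/
structure ChartExp (φ : OpenPartialHomeomorph M (EuclideanSpace ℝ (Fin n)))
    (y₀ : EuclideanSpace ℝ (Fin n)) (ρ : ℝ)
    (X : EuclideanSpace ℝ (Fin n) × EuclideanSpace ℝ (Fin n) → EuclideanSpace ℝ (Fin n)) : Prop where
  pos : 0 < ρ
  smooth : ContDiffOn ℝ ∞ X (Metric.ball y₀ ρ ×ˢ Metric.ball 0 ρ)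
  zero : ∀ y ∈ Metric.ball y₀ ρ, X (y, 0) = y
  mem : ∀ y ∈ Metric.ball y₀ ρ, ∀ w ∈ Metric.ball 0 ρ, X (y, w) ∈ φ.target
  deriv_zero : ∀ y ∈ Metric.ball y₀ ρ, ∀ w, deriv (fun τ : ℝ => X (y, τ • w)) 0 = w
  el : ∀ y ∈ Metric.ball y₀ ρ, ∀ w (t : ℝ), ‖t • w‖ < ρ →
    EL (fun z v w => bil (pullGram (metric (n := n) (M := M)) φ.symm z) v w) (X (y, t • w))
      (deriv (fun τ : ℝ => X (y, τ • w)) t) (deriv (deriv fun τ : ℝ => X (y, τ • w)) t)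

variable {φ : OpenPartialHomeomorph M (EuclideanSpace ℝ (Fin n))} {y₀ : EuclideanSpace ℝ (Fin n)}
  {ρ : ℝ} {X : EuclideanSpace ℝ (Fin n) × EuclideanSpace ℝ (Fin n) → EuclideanSpace ℝ (Fin n)}

lemma ChartExp.mono (h : ChartExp φ y₀ ρ X) {ρ' : ℝ} (hpos : 0 < ρ') (hle : ρ' ≤ ρ) :
    ChartExp φ y₀ ρ' X where
  pos := hpos
  smooth := h.smooth.mono (prod_mono (Metric.ball_subset_ball hle) (Metric.ball_subset_ball hle))
  zero y hy := h.zero y (Metric.ball_subset_ball hle hy)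
  mem y hy w hw := h.mem y (Metric.ball_subset_ball hle hy) w (Metric.ball_subset_ball hle hw)
  deriv_zero y hy := h.deriv_zero y (Metric.ball_subset_ball hle hy)
  el y hy w t ht := h.el y (Metric.ball_subset_ball hle hy) w t (ht.trans_le hle)

variable [IsManifold (𝓡 n) ∞ M] (hφ : φ ∈ IsManifold.maximalAtlas (𝓡 n) ∞ M)

include hφ

/-- The geodesic spray is cut off to a globally defined one. The solutions stay in the neighbourhood
N where nothing was changed, so they solve the true geodesic equation. -/
theorem exists_chartExp [IsContMDiffRiemannianBundle (𝓡 n) ∞ (EuclideanSpace ℝ (Fin n))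
    (fun x : M => TangentSpace (𝓡 n) x)] (hy₀ : y₀ ∈ φ.target) : ∃ ρ X, ChartExp φ y₀ ρ X := by
  obtain ⟨Q, hQ, hom, N, hN, hNs, hQN⟩ := exists_spray_extension φ.open_target
    (contDiffOn_pullGram_symm hφ) (fun _ hz => (pullGram_symm_posDef hφ hz).det_pos.ne') hy₀
  obtain ⟨ρ, hρ, X, hX, h⟩ := exists_spray_exp Q hQ hom y₀ hN
  refine ⟨ρ, X, hρ, hX, fun y hy => (h y hy).1, fun y hy w hw => hNs ((h y hy).2.1 w hw),
    fun y hy => (h y hy).2.2.1, fun y hy w t ht => ?_⟩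
  have hmem : X (y, t • w) ∈ N := (h y hy).2.1 _ (by simpa using ht)
  rw [el_iff_spray_chart hφ (hNs hmem), ← hQN _ hmem]
  exact ((h y hy).2.2.2 w t ht).deriv

omit [RiemannianBundle (fun x : M => TangentSpace (𝓡 n) x)] in
lemma tangentBundle_ext {q₁ q₂ : TangentBundle (𝓡 n) M} (h : q₁.1 = q₂.1) (hs : q₁.1 ∈ φ.source)
    (ht : tcoord φ q₁.1 q₁.2 = tcoord φ q₂.1 q₂.2) : q₁ = q₂ := by
  obtain ⟨p, v⟩ := q₁
  obtain ⟨p', v'⟩ := q₂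
  obtain rfl : p = p' := h
  exact congrArg (fun u => (⟨p, u⟩ : TangentBundle (𝓡 n) M)) (tcoord_injective hφ hs ht)

omit [IsManifold (𝓡 n) ∞ M] hφ in
lemma isOpen_ray (w : EuclideanSpace ℝ (Fin n)) (ρ : ℝ) : IsOpen {t : ℝ | ‖t • w‖ < ρ} :=
  isOpen_lt (by fun_prop) continuous_const

omit [IsManifold (𝓡 n) ∞ M] hφ in
lemma ChartExp.contDiffOn_ray (h : ChartExp φ y₀ ρ X) {y : EuclideanSpace ℝ (Fin n)}
    (hy : y ∈ Metric.ball y₀ ρ) (w : EuclideanSpace ℝ (Fin n)) :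
    ContDiffOn ℝ ∞ (fun τ : ℝ => X (y, τ • w)) {t : ℝ | ‖t • w‖ < ρ} :=
  h.smooth.comp (contDiff_const.prodMk (contDiff_id.smul contDiff_const)).contDiffOn
    fun t ht => ⟨hy, by simpa using ht⟩

lemma ChartExp.contMDiffOn_ray (h : ChartExp φ y₀ ρ X) {y : EuclideanSpace ℝ (Fin n)}
    (hy : y ∈ Metric.ball y₀ ρ) (w : EuclideanSpace ℝ (Fin n)) :
    ContMDiffOn 𝓘(ℝ, ℝ) (𝓡 n) ∞ (fun τ : ℝ => φ.symm (X (y, τ • w))) {t : ℝ | ‖t • w‖ < ρ} :=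
  (contMDiffOn_symm_of_mem_maximalAtlas hφ).comp (h.contDiffOn_ray hy w).contMDiffOn
    fun t ht => h.mem y hy _ (by simpa using ht)

lemma ChartExp.isGeodesicOn_ray [IsContMDiffRiemannianBundle (𝓡 n) ∞ (EuclideanSpace ℝ (Fin n))
    (fun x : M => TangentSpace (𝓡 n) x)] (h : ChartExp φ y₀ ρ X) {y : EuclideanSpace ℝ (Fin n)}
    (hy : y ∈ Metric.ball y₀ ρ) (w : EuclideanSpace ℝ (Fin n)) {s : Set ℝ} (hs : IsOpen s)
    (hsub : ∀ t ∈ s, ‖t • w‖ < ρ) :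
    IsGeodesicOn (n := n) (fun τ : ℝ => φ.symm (X (y, τ • w))) s := by
  have hm : ∀ t ∈ s, X (y, t • w) ∈ φ.target := fun t ht => h.mem y hy _ (by simpa using hsub t ht)
  refine isGeodesicOn_of_EL hφ hs (((h.contMDiffOn_ray hφ hy w).mono hsub).of_le (by norm_cast))
    (fun t ht => φ.map_target (hm t ht)) fun t ht => ?_
  have hev : (φ ∘ fun τ : ℝ => φ.symm (X (y, τ • w))) =ᶠ[𝓝 t] fun τ => X (y, τ • w) := by
    filter_upwards [hs.mem_nhds ht] with τ hτ
    exact φ.right_inv (hm τ hτ)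
  rw [hev.deriv.deriv_eq, hev.deriv_eq, φ.right_inv (hm t ht)]
  exact h.el y hy w t (hsub t ht)

lemma ChartExp.velocity_ray (h : ChartExp φ y₀ ρ X) {x : M} (hx : x ∈ φ.source)
    (hy : φ x ∈ Metric.ball y₀ ρ) (v : TangentSpace (𝓡 n) x) :
    velocity (fun τ : ℝ => φ.symm (X (φ x, τ • tcoord φ x v))) 0 = ⟨x, v⟩ := by
  set w := tcoord φ x v with hw
  have h0 : ‖(0 : ℝ) • w‖ < ρ := by simpa using h.pos
  have hp : φ.symm (X (φ x, (0 : ℝ) • w)) = x := by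
    rw [zero_smul, h.zero _ hy, φ.left_inv hx]
  have hps : φ.symm (X (φ x, (0 : ℝ) • w)) ∈ φ.source := by rw [hp]; exact hx
  have hmd := ((h.contMDiffOn_ray hφ hy w).contMDiffAt ((isOpen_ray w ρ).mem_nhds h0))
    |>.mdifferentiableAt (by simp)
  refine tangentBundle_ext hφ hp hps ?_
  have h1 := tcoord_mfderiv hφ hmd hps (1 : ℝ)
  refine h1.trans ?_
  have hev : (φ ∘ fun τ : ℝ => φ.symm (X (φ x, τ • w))) =ᶠ[𝓝 0] fun τ => X (φ x, τ • w) := by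
    filter_upwards [(isOpen_ray w ρ).mem_nhds h0] with τ hτ
    exact φ.right_inv (h.mem _ hy _ (by simpa using hτ))
  change deriv (φ ∘ fun τ : ℝ => φ.symm (X (φ x, τ • w))) 0 = _
  rw [hev.deriv_eq, h.deriv_zero _ hy]

/-- The ray is one geodesic with the given initial velocity, defined slightly beyond [0, 1];
uniqueness shows that the geodesic chosen in the definition of `expMap` has the same endpoint. -/
lemma ChartExp.expMap_eq [T2Space M]
    [IsContMDiffRiemannianBundle (𝓡 n) ∞ (EuclideanSpace ℝ (Fin n))
    (fun x : M => TangentSpace (𝓡 n) x)] (h : ChartExp φ y₀ ρ X) {x : M} (hx : x ∈ φ.source)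
    (hy : φ x ∈ Metric.ball y₀ ρ) {v : TangentSpace (𝓡 n) x} (hv : ‖tcoord φ x v‖ < ρ) :
    expMap x v = φ.symm (X (φ x, tcoord φ x v)) := by
  set w := tcoord φ x v with hw
  -- Chosen so that (1 + δ)‖w‖ ≤ ρ; the added 1 in the denominator covers w = 0.
  let δ : ℝ := (ρ - ‖w‖) / (‖w‖ + 1)
  have hδ : 0 < δ := div_pos (by linarith) (by positivity)
  have hδw : δ * ‖w‖ ≤ ρ - ‖w‖ := by
    rw [div_mul_eq_mul_div, div_le_iff₀ (by positivity)]
    nlinarith [norm_nonneg w]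
  have hray : ∀ t ∈ Ioo (-δ) (1 + δ), ‖t • w‖ < ρ := by
    intro t ht
    rw [norm_smul, Real.norm_eq_abs]
    rcases eq_or_ne w 0 with h0 | h0
    · simpa [h0] using h.pos
    · have : |t| < 1 + δ := abs_lt.2 ⟨by linarith [ht.1], ht.2⟩
      have := mul_lt_mul_of_pos_right this (norm_pos_iff.2 h0)
      linarith
  have hex : ∃ γ : ℝ → M, (∃ δ > 0, IsGeodesicOn (n := n) γ (Ioo (-δ) (1 + δ))) ∧
      velocity γ 0 = ⟨x, v⟩ :=
    ⟨_, ⟨δ, hδ, h.isGeodesicOn_ray hφ hy w isOpen_Ioo hray⟩, h.velocity_ray hφ hx hy v⟩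
  rw [expMap, dif_pos hex]
  obtain ⟨⟨δ', hδ', hg⟩, hvel⟩ := hex.choose_spec
  have hmin : 0 < min δ δ' := lt_min hδ hδ'
  have hIoo : ∀ η, min δ δ' ≤ η → Ioo (-(min δ δ')) (1 + min δ δ') ⊆ Ioo (-η) (1 + η) :=
    fun η hη => Ioo_subset_Ioo (by linarith) (by linarith)
  have hg1 : IsGeodesicOn (n := n) (fun τ : ℝ => φ.symm (X (φ x, τ • w)))
      (Ioo (-(min δ δ')) (1 + min δ δ')) :=
    h.isGeodesicOn_ray hφ hy w isOpen_Ioo fun t ht => hray t (hIoo δ (min_le_left _ _) ht)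
  have hg2 : IsGeodesicOn (n := n) hex.choose (Ioo (-(min δ δ')) (1 + min δ δ')) :=
    ⟨hg.1.mono (hIoo δ' (min_le_right _ _)),
      fun e he t ht => hg.2 e he t (hIoo δ' (min_le_right _ _) ht)⟩
  have hIcc : Icc (0 : ℝ) 1 ⊆ Ioo (-(min δ δ')) (1 + min δ δ') := fun t ht =>
    ⟨by linarith [ht.1], by linarith [ht.2]⟩
  have := geodesic_unique hφ isOpen_Ioo hIcc hg1 hg2 (fun t ht => φ.map_target
    (h.mem _ hy _ (by
      simpa using hray t (hIoo δ (min_le_left _ _) (hIcc ht)))))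
    ((h.velocity_ray hφ hx hy v).trans hvel.symm) (right_mem_Icc.2 zero_le_one)
  rw [← this]
  simp only [one_smul]

end ChartExp
/-! ### Normal charts -/

section Uniform

lemma exists_bil_lower_bound {d : ℕ} {A : Matrix (Fin d) (Fin d) ℝ} (hA : A.PosDef) :
    ∃ c > 0, ∀ v, c * ‖v‖ ^ 2 ≤ bil A v v := by
  obtain ⟨c, hc, h⟩ := (isCompact_sphere (0 : EuclideanSpace ℝ (Fin d)) 1).exists_forall_le'
    (f := fun v => bil A v v) (by fun_prop) (a := 0)
    (fun v hv => bil_pos hA (ne_zero_of_mem_unit_sphere ⟨v, hv⟩))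
  refine ⟨c, hc, fun v => ?_⟩
  rcases eq_or_ne v 0 with rfl | hv
  · simp
  have hv' : ‖v‖ ≠ 0 := norm_ne_zero_iff.2 hv
  have h1 := h (‖v‖⁻¹ • v) (by simp [norm_smul, hv'])
  simp only [map_smul, _root_.smul_apply, smul_eq_mul] at h1
  have h2 : ‖v‖ ^ 2 * (‖v‖⁻¹ * (‖v‖⁻¹ * bil A v v)) = bil A v v := by field_simp
  nlinarith [sq_nonneg ‖v‖, mul_le_mul_of_nonneg_left h1 (sq_nonneg ‖v‖)]

/-- Half of the ellipticity constant at y₀ survives nearby, the rest absorbing the variation in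
operator norm. The bound is uniform in y, which later bounds all orthonormal frames near x₀ at once.
-/
lemma eventually_bil_lower_bound {d : ℕ}
    {G : EuclideanSpace ℝ (Fin d) → Matrix (Fin d) (Fin d) ℝ} {y₀ : EuclideanSpace ℝ (Fin d)}
    (hG : ContinuousAt (fun y => bil (G y)) y₀) (hpos : (G y₀).PosDef) :
    ∃ c > 0, ∀ᶠ y in 𝓝 y₀, ∀ v, c * ‖v‖ ^ 2 ≤ bil (G y) v v := by
  obtain ⟨c, hc, h⟩ := exists_bil_lower_bound hpos
  refine ⟨c / 2, by positivity, ?_⟩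
  filter_upwards [Metric.continuousAt_iff'.1 hG (c / 2) (by positivity)] with y hy v
  rw [dist_eq_norm] at hy
  have h1 : |(bil (G y) - bil (G y₀)) v v| ≤ ‖bil (G y) - bil (G y₀)‖ * ‖v‖ * ‖v‖ :=
    (bil (G y) - bil (G y₀)).le_opNorm₂ v v
  have h2 : (bil (G y) - bil (G y₀)) v v = bil (G y) v v - bil (G y₀) v v := rfl
  rw [h2] at h1
  have h3 := h v
  have h4 := (abs_le.1 h1).1
  nlinarith [mul_le_mul_of_nonneg_right hy.le (sq_nonneg ‖v‖)]

/-- The fibred map `(y, w) ↦ (y, X (y, w))` of a spray exponential is a local diffeomorphism. -/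
lemma exists_fibered_openPartialHomeomorph {E : Type*} [NormedAddCommGroup E] [NormedSpace ℝ E]
    [CompleteSpace E] {y₀ : E} {ρ : ℝ} (hρ : 0 < ρ) {X : E × E → E}
    (hX : ContDiffOn ℝ ∞ X (Metric.ball y₀ ρ ×ˢ Metric.ball 0 ρ))
    (hzero : ∀ y ∈ Metric.ball y₀ ρ, X (y, 0) = y)
    (hderiv : ∀ y ∈ Metric.ball y₀ ρ, ∀ w, deriv (fun τ : ℝ => X (y, τ • w)) 0 = w) :
    ∃ Φ : OpenPartialHomeomorph (E × E) (E × E),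
      (∀ p, Φ p = (p.1, X p)) ∧ (y₀, 0) ∈ Φ.source ∧ ContDiffOn ℝ ∞ Φ.symm Φ.target := by
  have hopen : IsOpen (Metric.ball y₀ ρ ×ˢ Metric.ball (0 : E) ρ) :=
    Metric.isOpen_ball.prod Metric.isOpen_ball
  have hy₀ : y₀ ∈ Metric.ball y₀ ρ := Metric.mem_ball_self hρ
  have hmem : (y₀, (0 : E)) ∈ Metric.ball y₀ ρ ×ˢ Metric.ball (0 : E) ρ :=
    ⟨hy₀, Metric.mem_ball_self hρ⟩
  have hX' : HasFDerivAt X (fderiv ℝ X (y₀, 0)) (y₀, 0) :=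
    ((hX.contDiffAt (hopen.mem_nhds hmem)).differentiableAt (by simp)).hasFDerivAt
  have h1 : ∀ a : E, fderiv ℝ X (y₀, 0) (a, 0) = a := by
    intro a
    have hc : HasFDerivAt (fun y : E => X (y, (0 : E)))
        ((fderiv ℝ X (y₀, 0)).comp (ContinuousLinearMap.inl ℝ E E)) y₀ :=
      hX'.comp y₀ (ContinuousLinearMap.inl ℝ E E).hasFDerivAt
    have hid : (fun y : E => X (y, (0 : E))) =ᶠ[𝓝 y₀] id := by
      filter_upwards [Metric.isOpen_ball.mem_nhds hy₀] with y hy using hzero y hy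
    have := (hasFDerivAt_id y₀).congr_of_eventuallyEq hid |>.unique hc
    exact (congrArg (fun L : E →L[ℝ] E => L a) this).symm
  have h2 : ∀ w : E, fderiv ℝ X (y₀, 0) (0, w) = w := by
    intro w
    have hc : HasDerivAt (fun τ : ℝ => X (y₀, τ • w)) (fderiv ℝ X (y₀, 0) (0, w)) 0 := by
      have hl : HasDerivAt (fun τ : ℝ => ((y₀, τ • w) : E × E)) (0, w) 0 := by
        have := (hasDerivAt_id (0 : ℝ)).smul_const w
        rw [one_smul] at this
        exact (hasDerivAt_const (0 : ℝ) y₀).prodMk this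
      have hX0 : HasFDerivAt X (fderiv ℝ X (y₀, 0)) (y₀, (0 : ℝ) • w) := by rwa [zero_smul]
      exact hX0.comp_hasDerivAt 0 hl
    rw [← hc.deriv, hderiv y₀ hy₀]
  -- The derivative at (y₀, 0) is (a, w) ↦ (a, a + w): X(y, 0) = y gives the dependence on a, and
  -- unit initial speed of the rays that on w.
  let A : (E × E) ≃L[ℝ] (E × E) := ContinuousLinearEquiv.equivOfInverse
    ((ContinuousLinearMap.fst ℝ E E).prod
      (ContinuousLinearMap.fst ℝ E E + ContinuousLinearMap.snd ℝ E E))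
    ((ContinuousLinearMap.fst ℝ E E).prod
      (ContinuousLinearMap.snd ℝ E E - ContinuousLinearMap.fst ℝ E E))
    (fun p => by simp) (fun p => by simp)
  have hA : HasFDerivAt (fun p : E × E => (p.1, X p)) (A : (E × E) →L[ℝ] E × E) (y₀, 0) := by
    have : HasFDerivAt (fun p : E × E => (p.1, X p))
        ((ContinuousLinearMap.fst ℝ E E).prod (fderiv ℝ X (y₀, 0))) (y₀, 0) :=
      hasFDerivAt_fst.prodMk hX'
    convert this using 1
    refine ContinuousLinearMap.ext fun p => ?_
    have hp : p = (p.1, 0) + (0, p.2) := by simp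
    change (p.1, p.1 + p.2) = (p.1, fderiv ℝ X (y₀, 0) p)
    rw [hp, map_add, h1, h2]
    simp
  obtain ⟨Φ, hΦ, hs, -, hsm, -⟩ := exists_openPartialHomeomorph_contDiffOn_symm
    (fun p : E × E => (p.1, X p)) hopen (contDiff_fst.contDiffOn.prodMk hX) hmem A hA
  exact ⟨Φ, fun p => by rw [hΦ], hs, hsm⟩

variable {n : ℕ} {M : Type*} [TopologicalSpace M] [ChartedSpace (EuclideanSpace ℝ (Fin n)) M]
  [RiemannianBundle (fun x : M => TangentSpace (𝓡 n) x)]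

lemma metric_sum_orthonormal {x : M} {b : Fin n → TangentSpace (𝓡 n) x} (hb : Orthonormal ℝ b)
    (u v : EuclideanSpace ℝ (Fin n)) :
    metric x (∑ i, u i • b i) (∑ i, v i • b i) = inner ℝ u v := by
  rw [metric, hb.inner_sum, PiLp.inner_apply]
  simp [mul_comm]

/-- The coordinates in the chart `φ` of the vector with coordinates `u` in the frame `b`. -/
noncomputable def frameCoord (φ : OpenPartialHomeomorph M (EuclideanSpace ℝ (Fin n))) {x : M}
    (b : Fin n → TangentSpace (𝓡 n) x) :
    EuclideanSpace ℝ (Fin n) →L[ℝ] EuclideanSpace ℝ (Fin n) :=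
  ∑ i, (EuclideanSpace.proj i : EuclideanSpace ℝ (Fin n) →L[ℝ] ℝ).smulRight (tcoord φ x (b i))

lemma frameCoord_apply (φ : OpenPartialHomeomorph M (EuclideanSpace ℝ (Fin n))) {x : M}
    (b : Fin n → TangentSpace (𝓡 n) x) (u : EuclideanSpace ℝ (Fin n)) :
    frameCoord φ b u = tcoord φ x (∑ i, u i • b i) := by
  simp [frameCoord, map_sum]

variable [IsManifold (𝓡 n) ∞ M] {φ : OpenPartialHomeomorph M (EuclideanSpace ℝ (Fin n))}
  (hφ : φ ∈ IsManifold.maximalAtlas (𝓡 n) ∞ M)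

include hφ

lemma bil_frameCoord {x : M} (hx : x ∈ φ.source) {b : Fin n → TangentSpace (𝓡 n) x}
    (hb : Orthonormal ℝ b) (u v : EuclideanSpace ℝ (Fin n)) :
    bil (pullGram (metric (n := n) (M := M)) φ.symm (φ x)) (frameCoord φ b u) (frameCoord φ b v) =
      inner ℝ u v := by
  rw [frameCoord_apply, frameCoord_apply, ← metric_eq_bil hφ hx, metric_sum_orthonormal hb]

lemma exists_frameCoord_equiv {x : M} (hx : x ∈ φ.source) {b : Fin n → TangentSpace (𝓡 n) x}
    (hb : Orthonormal ℝ b) :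
    ∃ A : EuclideanSpace ℝ (Fin n) ≃L[ℝ] EuclideanSpace ℝ (Fin n),
      ∀ u, A u = frameCoord φ b u := by
  have hinj : Function.Injective (frameCoord φ b).toLinearMap := by
    refine (injective_iff_map_eq_zero _).2 fun u hu => ?_
    have hu' : frameCoord φ b u = 0 := hu
    have := bil_frameCoord hφ hx hb u u
    rw [hu', map_zero] at this
    exact inner_self_eq_zero.1 this.symm
  exact ⟨(LinearEquiv.ofInjectiveEndo _ hinj).toContinuousLinearEquiv, fun u => rfl⟩

/-- An orthonormal frame is an isometry from Euclidean space to the metric at x, so an ellipticity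
constant alone controls its size in the chart, whatever the frame. -/
lemma frame_norm_le {x : M} (hx : x ∈ φ.source) {c : ℝ} (hc : 0 < c)
    (h : ∀ v, c * ‖v‖ ^ 2 ≤ bil (pullGram (metric (n := n) (M := M)) φ.symm (φ x)) v v)
    {b : Fin n → TangentSpace (𝓡 n) x} (hb : Orthonormal ℝ b) (u : EuclideanSpace ℝ (Fin n)) :
    ‖frameCoord φ b u‖ ≤ (√c)⁻¹ * ‖u‖ := by
  have h1 := h (frameCoord φ b u)
  rw [bil_frameCoord hφ hx hb, real_inner_self_eq_norm_sq] at h1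
  have h2 : √c * ‖frameCoord φ b u‖ ≤ ‖u‖ := by
    refine abs_le_of_sq_le_sq' ?_ (norm_nonneg _) |>.2
    rwa [mul_pow, Real.sq_sqrt hc.le]
  rwa [inv_mul_eq_div, le_div_iff₀ (by positivity), mul_comm]

variable [IsContMDiffRiemannianBundle (𝓡 n) ∞ (EuclideanSpace ℝ (Fin n))
  (fun x : M => TangentSpace (𝓡 n) x)]

/-- The source of the uniform radius: ρ makes X an exponential map inside one invertible fibred map
Φ, and ε = √c ρ makes every orthonormal frame at a nearby point send the ε-ball into the ρ-ball. -/
lemma exists_uniform_chartExp {x₀ : M} (hx₀ : x₀ ∈ φ.source) :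
    ∃ ρ X, ChartExp φ (φ x₀) ρ X ∧
      (∃ Φ : OpenPartialHomeomorph (EuclideanSpace ℝ (Fin n) × EuclideanSpace ℝ (Fin n))
        (EuclideanSpace ℝ (Fin n) × EuclideanSpace ℝ (Fin n)),
        (∀ p, Φ p = (p.1, X p)) ∧ Metric.ball (φ x₀) ρ ×ˢ Metric.ball 0 ρ ⊆ Φ.source ∧
          ContDiffOn ℝ ∞ Φ.symm Φ.target) ∧
      ∃ ε > 0, ∀ᶠ x in 𝓝 x₀, x ∈ φ.source ∧ φ x ∈ Metric.ball (φ x₀) ρ ∧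
        ∀ b : Fin n → TangentSpace (𝓡 n) x, Orthonormal ℝ b →
          ∀ u ∈ Metric.ball 0 ε, ‖frameCoord φ b u‖ < ρ := by
  obtain ⟨ρ₀, X, hX₀⟩ := exists_chartExp hφ (φ.map_source hx₀)
  obtain ⟨Φ, hΦ, hs, hsm⟩ := exists_fibered_openPartialHomeomorph hX₀.pos hX₀.smooth hX₀.zero
    hX₀.deriv_zero
  obtain ⟨ρ₁, hρ₁, hball⟩ := Metric.isOpen_iff.1 Φ.open_source _ hs
  rw [← ball_prod_same] at hball
  have hpos : 0 < min ρ₀ ρ₁ := lt_min hX₀.pos hρ₁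
  have hX := hX₀.mono hpos (min_le_left _ _)
  refine ⟨_, X, hX, ⟨Φ, hΦ, (prod_mono (Metric.ball_subset_ball (min_le_right _ _))
    (Metric.ball_subset_ball (min_le_right _ _))).trans hball, hsm⟩, ?_⟩
  obtain ⟨c, hc, hlow⟩ := eventually_bil_lower_bound
    (((contDiffOn_bil (contDiffOn_pullGram_symm hφ)).contDiffAt
      (φ.open_target.mem_nhds (φ.map_source hx₀))).continuousAt)
    (pullGram_symm_posDef hφ (φ.map_source hx₀))
  refine ⟨√c * min ρ₀ ρ₁, by positivity, ?_⟩
  have hcont := φ.continuousAt hx₀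
  filter_upwards [φ.open_source.eventually_mem hx₀, hcont.eventually hlow,
    hcont.eventually_mem (Metric.ball_mem_nhds _ hpos)] with x hx hxl hxb
  refine ⟨hx, hxb, fun b hb u hu => (frame_norm_le hφ hx hc hxl hb u).trans_lt ?_⟩
  rw [inv_mul_lt_iff₀ (by positivity)]
  simpa using hu

end Uniform

lemma velocity_congr {n : ℕ} {M : Type*} [TopologicalSpace M]
    [ChartedSpace (EuclideanSpace ℝ (Fin n)) M] {γ γ' : ℝ → M} {t : ℝ} (h : γ =ᶠ[𝓝 t] γ') :
    velocity (n := n) γ t = velocity γ' t := by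
  have h1 : mfderiv 𝓘(ℝ, ℝ) (𝓡 n) γ t = mfderiv 𝓘(ℝ, ℝ) (𝓡 n) γ' t := h.mfderiv_eq
  have key : ∀ p q : M, p = q → ∀ v w : EuclideanSpace ℝ (Fin n), v = w →
      (⟨p, v⟩ : TangentBundle (𝓡 n) M) = ⟨q, w⟩ := by
    rintro p _ rfl v _ rfl; rfl
  exact key _ _ h.self_of_nhds _ _
    (congrArg (fun L : ℝ →L[ℝ] EuclideanSpace ℝ (Fin n) => L 1) h1)

lemma IsGeodesicOn.congr {n : ℕ} {M : Type*} [TopologicalSpace M]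
    [ChartedSpace (EuclideanSpace ℝ (Fin n)) M]
    [RiemannianBundle (fun x : M => TangentSpace (𝓡 n) x)] {γ γ' : ℝ → M} {s : Set ℝ}
    (h : IsGeodesicOn (n := n) γ' s) (hs : IsOpen s) (heq : EqOn γ γ' s) :
    IsGeodesicOn (n := n) γ s := by
  refine ⟨h.1.congr heq, fun e he t ht hte k => ?_⟩
  have hev : γ =ᶠ[𝓝 t] γ' := heq.eventuallyEq_of_mem (hs.mem_nhds ht)
  have hc : ∀ i : Fin n, (fun τ => e (γ τ) i) =ᶠ[𝓝 t] fun τ => e (γ' τ) i := fun i => by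
    filter_upwards [hev] with τ hτ
    rw [hτ]
  rw [heq ht] at hte
  have := h.2 e he t ht hte k
  rw [(hc k).deriv.deriv_eq, heq ht]
  simpa only [(hc _).deriv_eq] using this

section NormalChart

variable {n : ℕ} {M : Type*} [TopologicalSpace M] [ChartedSpace (EuclideanSpace ℝ (Fin n)) M]
  [RiemannianBundle (fun x : M => TangentSpace (𝓡 n) x)]

/-- `e` is the chart given by the exponential map at `x` on the ball of radius `ε`, read in the
orthonormal frame `b`. -/
structure IsNormalChart {x : M} (b : Fin n → TangentSpace (𝓡 n) x) (ε : ℝ)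
    (e : OpenPartialHomeomorph M (EuclideanSpace ℝ (Fin n))) : Prop where
  pos : 0 < ε
  orthonormal : Orthonormal ℝ b
  mem_maximalAtlas : e ∈ IsManifold.maximalAtlas (𝓡 n) ∞ M
  target : e.target = Metric.ball 0 ε
  symm : EqOn e.symm (expChart b) (Metric.ball 0 ε)
  zero : expChart b 0 = x
  geodesic : ∀ w : EuclideanSpace ℝ (Fin n),
    IsGeodesicOn (n := n) (fun t : ℝ => expChart b (t • w)) {t : ℝ | ‖t • w‖ < ε}
  velocity : ∀ w : EuclideanSpace ℝ (Fin n),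
    velocity (fun t : ℝ => expChart b (t • w)) 0 = ⟨x, ∑ i, w i • b i⟩

variable [IsManifold (𝓡 n) ∞ M] {φ : OpenPartialHomeomorph M (EuclideanSpace ℝ (Fin n))}
  (hφ : φ ∈ IsManifold.maximalAtlas (𝓡 n) ∞ M)
  [IsContMDiffRiemannianBundle (𝓡 n) ∞ (EuclideanSpace ℝ (Fin n))
  (fun x : M => TangentSpace (𝓡 n) x)]

include hφ

lemma ChartExp.expChart_eq [T2Space M] {y₀ : EuclideanSpace ℝ (Fin n)} {ρ : ℝ}
    {X : EuclideanSpace ℝ (Fin n) × EuclideanSpace ℝ (Fin n) → EuclideanSpace ℝ (Fin n)}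
    (h : ChartExp φ y₀ ρ X) {x : M} (hx : x ∈ φ.source) (hy : φ x ∈ Metric.ball y₀ ρ)
    {b : Fin n → TangentSpace (𝓡 n) x} {u : EuclideanSpace ℝ (Fin n)}
    (hu : ‖frameCoord φ b u‖ < ρ) : expChart b u = φ.symm (X (φ x, frameCoord φ b u)) := by
  rw [frameCoord_apply] at hu ⊢
  exact h.expMap_eq hφ hx hy hu

/-- The chart is φ followed by the inverse of u ↦ X(φ x, A u), with A the frame read in φ. This
inverse is the slice of Φ⁻¹ over φ x, so no new inverse function theorem, hence no new radius, is
needed for each x. -/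
theorem ChartExp.exists_isNormalChart [T2Space M] {y₀ : EuclideanSpace ℝ (Fin n)} {ρ : ℝ}
    {X : EuclideanSpace ℝ (Fin n) × EuclideanSpace ℝ (Fin n) → EuclideanSpace ℝ (Fin n)}
    (h : ChartExp φ y₀ ρ X)
    {Φ : OpenPartialHomeomorph (EuclideanSpace ℝ (Fin n) × EuclideanSpace ℝ (Fin n))
        (EuclideanSpace ℝ (Fin n) × EuclideanSpace ℝ (Fin n))}
    (hΦ : ∀ p, Φ p = (p.1, X p)) (hsub : Metric.ball y₀ ρ ×ˢ Metric.ball 0 ρ ⊆ Φ.source)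
    (hsm : ContDiffOn ℝ ∞ Φ.symm Φ.target) {x : M} (hx : x ∈ φ.source)
    (hy : φ x ∈ Metric.ball y₀ ρ) {b : Fin n → TangentSpace (𝓡 n) x} (hb : Orthonormal ℝ b)
    {ε : ℝ} (hε : 0 < ε) (hbound : ∀ u ∈ Metric.ball 0 ε, ‖frameCoord φ b u‖ < ρ) :
    ∃ e, IsNormalChart b ε e ∧ e.source ⊆ φ.source := by
  obtain ⟨A, hA⟩ := exists_frameCoord_equiv hφ hx hb
  obtain ⟨H, hHt, hHs, hH1, hH2⟩ := exists_fiber_openPartialHomeomorph Φ hΦ hsm h.smooth (φ x) A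
    (Metric.isOpen_ball (x := (0 : EuclideanSpace ℝ (Fin n))) (ε := ε)) (fun u hu => by
      have : (φ x, A u) ∈ Metric.ball y₀ ρ ×ˢ Metric.ball 0 ρ :=
        ⟨hy, by rw [hA]; simpa using hbound u hu⟩
      exact ⟨hsub this, this⟩)
  have hmem : ∀ u ∈ Metric.ball 0 ε, H.symm u ∈ φ.target := fun u hu => by
    rw [hHs, hA]
    exact h.mem _ hy _ (by simpa using hbound u hu)
  have htarget : (φ ≫ₕ H).target = Metric.ball 0 ε := by
    rw [OpenPartialHomeomorph.trans_target, hHt]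
    exact inter_eq_left.2 hmem
  have hsymm : EqOn (φ ≫ₕ H).symm (expChart b) (Metric.ball 0 ε) := fun u hu => by
    rw [h.expChart_eq hφ hx hy (hbound u hu)]
    simp [hHs, hA]
  have hsrc : (φ ≫ₕ H).source ⊆ φ.source := by
    rw [OpenPartialHomeomorph.trans_source]
    exact inter_subset_left
  have hray : ∀ w (t : ℝ), ‖t • w‖ < ε → ‖t • frameCoord φ b w‖ < ρ := fun w t ht => by
    rw [← map_smul]; exact hbound _ (by simpa using ht)
  have hcurve : ∀ w, EqOn (fun t : ℝ => expChart b (t • w))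
      (fun t : ℝ => φ.symm (X (φ x, t • frameCoord φ b w))) {t : ℝ | ‖t • w‖ < ε} := fun w t ht => by
    have := h.expChart_eq hφ hx hy (hbound (t • w) (by simpa using ht))
    rwa [map_smul] at this
  refine ⟨φ ≫ₕ H, ⟨hε, hb, ?_, htarget, hsymm, ?_, ?_, ?_⟩, hsrc⟩
  · refine OpenPartialHomeomorph.mem_maximalAtlas_of_contMDiffOn _ ?_ ?_
    · exact hH1.contMDiffOn.comp ((contMDiffOn_of_mem_maximalAtlas hφ).mono hsrc)
        (fun p hp => hp.2)
    · refine (contMDiffOn_symm_of_mem_maximalAtlas hφ).comp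
        (hH2.contMDiffOn.mono ?_) ?_
      · rw [htarget, hHt]
      · rw [htarget]; exact hmem
  · rw [h.expChart_eq hφ hx hy (hbound 0 (Metric.mem_ball_self hε)), map_zero, h.zero _ hy,
      φ.left_inv hx]
  · intro w
    have hg := h.isGeodesicOn_ray hφ hy (frameCoord φ b w) (isOpen_ray w ε) (hray w)
    exact hg.congr (isOpen_ray w ε) (hcurve w)
  · intro w
    have hv := h.velocity_ray hφ hx hy (∑ i, w i • b i)
    rw [← frameCoord_apply] at hv
    rw [← hv]
    exact velocity_congr ((hcurve w).eventuallyEq_of_mem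
      ((isOpen_ray w ε).mem_nhds (by simpa using hε)))

end NormalChart
/-! ### The metric in a normal chart -/

lemma pullGram_congr {d k : ℕ} {N : Type*} [TopologicalSpace N]
    [ChartedSpace (EuclideanSpace ℝ (Fin d)) N]
    (h : ∀ p : N, TangentSpace (𝓡 d) p → TangentSpace (𝓡 d) p → ℝ)
    {F F' : EuclideanSpace ℝ (Fin k) → N} {y : EuclideanSpace ℝ (Fin k)} (hF : F =ᶠ[𝓝 y] F') :
    pullGram h F y = pullGram h F' y := by
  have h1 : mfderiv (𝓡 k) (𝓡 d) F y = mfderiv (𝓡 k) (𝓡 d) F' y := hF.mfderiv_eq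
  -- The two sides live in tangent spaces at points that are only propositionally equal; all fibres
  -- are the same model space, so base point and vectors are substituted together.
  have key : ∀ p q : N, p = q → ∀ v v' w w' : EuclideanSpace ℝ (Fin d), v = v' → w = w' →
      h p v w = h q v' w' := by
    rintro p _ rfl v _ w _ rfl rfl; rfl
  ext i j
  exact key _ _ hF.self_of_nhds _ _ _ _
    (congrArg (fun L : EuclideanSpace ℝ (Fin k) →L[ℝ] EuclideanSpace ℝ (Fin d) =>
      L (EuclideanSpace.single i 1)) h1)
    (congrArg (fun L : EuclideanSpace ℝ (Fin k) →L[ℝ] EuclideanSpace ℝ (Fin d) =>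
      L (EuclideanSpace.single j 1)) h1)

section NormalChart

variable {n : ℕ} {M : Type*} [TopologicalSpace M] [ChartedSpace (EuclideanSpace ℝ (Fin n)) M]
  [RiemannianBundle (fun x : M => TangentSpace (𝓡 n) x)]
  {x : M} {b : Fin n → TangentSpace (𝓡 n) x} {ε : ℝ}
  {e : OpenPartialHomeomorph M (EuclideanSpace ℝ (Fin n))}

namespace IsNormalChart

section Basic

variable (hN : IsNormalChart b ε e)

include hN

lemma expChart_mem {y : EuclideanSpace ℝ (Fin n)} (hy : y ∈ Metric.ball 0 ε) :
    expChart b y ∈ e.source := by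
  rw [← hN.symm hy]
  exact e.map_target (hN.target ▸ hy)

lemma apply_expChart {y : EuclideanSpace ℝ (Fin n)} (hy : y ∈ Metric.ball 0 ε) :
    e (expChart b y) = y := by
  rw [← hN.symm hy]
  exact e.right_inv (hN.target ▸ hy)

lemma mem_ball {p : M} (hp : p ∈ e.source) : e p ∈ Metric.ball 0 ε :=
  hN.target ▸ e.map_source hp

lemma expChart_apply {p : M} (hp : p ∈ e.source) : expChart b (e p) = p := by
  rw [← hN.symm (hN.mem_ball hp), e.left_inv hp]

lemma center_mem : x ∈ e.source := by
  have := hN.expChart_mem (Metric.mem_ball_self hN.pos)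
  rwa [hN.zero] at this

lemma apply_center : e x = 0 := by
  have := hN.apply_expChart (Metric.mem_ball_self hN.pos)
  rwa [hN.zero] at this

lemma eventuallyEq {y : EuclideanSpace ℝ (Fin n)} (hy : y ∈ Metric.ball 0 ε) :
    e.symm =ᶠ[𝓝 y] expChart b :=
  hN.symm.eventuallyEq_of_mem (Metric.isOpen_ball.mem_nhds hy)

lemma expGram_eq {y : EuclideanSpace ℝ (Fin n)} (hy : y ∈ Metric.ball 0 ε) :
    expGram b y = pullGram (metric (n := n) (M := M)) e.symm y :=
  (pullGram_congr _ (hN.eventuallyEq hy)).symm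

end Basic

variable [IsManifold (𝓡 n) ∞ M]

section Manifold

variable (hN : IsNormalChart b ε e)

include hN

lemma contMDiffAt_expChart {y : EuclideanSpace ℝ (Fin n)} (hy : y ∈ Metric.ball 0 ε) :
    ContMDiffAt (𝓡 n) (𝓡 n) ∞ (expChart b) y :=
  (contMDiffAt_symm_of_mem_maximalAtlas hN.mem_maximalAtlas
    (hN.target ▸ hy)).congr_of_eventuallyEq (hN.eventuallyEq hy).symm

lemma mdifferentiableAt_expChart {y : EuclideanSpace ℝ (Fin n)} (hy : y ∈ Metric.ball 0 ε) :
    MDifferentiableAt (𝓡 n) (𝓡 n) (expChart b) y :=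
  (hN.contMDiffAt_expChart hy).mdifferentiableAt (by simp)

lemma tcoord_expChart {y : EuclideanSpace ℝ (Fin n)} (hy : y ∈ Metric.ball 0 ε)
    (v : EuclideanSpace ℝ (Fin n)) :
    tcoord e (expChart b y) (mfderiv (𝓡 n) (𝓡 n) (expChart b) y v) = v := by
  rw [tcoord_mfderiv hN.mem_maximalAtlas (hN.mdifferentiableAt_expChart hy) (hN.expChart_mem hy)]
  have : (e ∘ expChart b) =ᶠ[𝓝 y] id := by
    filter_upwards [Metric.isOpen_ball.mem_nhds hy] with z hz using hN.apply_expChart hz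
  rw [this.fderiv_eq]
  simp

lemma mfderiv_tcoord {y : EuclideanSpace ℝ (Fin n)} (hy : y ∈ Metric.ball 0 ε)
    (v : TangentSpace (𝓡 n) (expChart b y)) :
    mfderiv (𝓡 n) (𝓡 n) (expChart b) y (tcoord e (expChart b y) v) = v :=
  tcoord_injective hN.mem_maximalAtlas (hN.expChart_mem hy) (hN.tcoord_expChart hy _)

lemma expGram_posDef {y : EuclideanSpace ℝ (Fin n)} (hy : y ∈ Metric.ball 0 ε) :
    (expGram b y).PosDef := by
  rw [hN.expGram_eq hy]
  exact pullGram_symm_posDef hN.mem_maximalAtlas (hN.target ▸ hy)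

lemma tcoord_ray (w : EuclideanSpace ℝ (Fin n)) {s : ℝ} (hs : ‖s • w‖ < ε) :
    tcoord e (expChart b (s • w))
      (mfderiv 𝓘(ℝ, ℝ) (𝓡 n) (fun t : ℝ => expChart b (t • w)) s (1 : ℝ)) = w := by
  have hγ : (fun t : ℝ => expChart b (t • w)) s ∈ e.source :=
    hN.expChart_mem (by simpa using hs)
  have hd : MDifferentiableAt 𝓘(ℝ, ℝ) (𝓡 n) (fun t : ℝ => expChart b (t • w)) s :=
    ((hN.geodesic w).1.contMDiffAt ((isOpen_ray w ε).mem_nhds hs)).mdifferentiableAt (by simp)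
  refine (tcoord_mfderiv hN.mem_maximalAtlas hd hγ (1 : ℝ)).trans ?_
  have hev : (e ∘ fun t : ℝ => expChart b (t • w)) =ᶠ[𝓝 s] fun t => t • w := by
    filter_upwards [(isOpen_ray w ε).mem_nhds hs] with t ht
    exact hN.apply_expChart (by simpa using ht)
  rw [hev.fderiv_eq]
  have : HasDerivAt (fun t : ℝ => t • w) ((1 : ℝ) • w) s := (hasDerivAt_id s).smul_const w
  simpa using congrArg (fun L : ℝ →L[ℝ] EuclideanSpace ℝ (Fin n) => L 1) this.hasFDerivAt.fderiv

/-- The initial velocity of the ray tw is computed twice: it is ∑ wᵢbᵢ by construction, and w in the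
normal chart, where the ray is a straight line. -/
lemma tcoord_frame (w : EuclideanSpace ℝ (Fin n)) : tcoord e x (∑ i, w i • b i) = w := by
  have h1 := congrArg (fun q : TangentBundle (𝓡 n) M => tcoord e q.1 q.2) (hN.velocity w)
  exact h1.symm.trans (hN.tcoord_ray w (by simpa using hN.pos))

lemma bil_expGram_zero (w u : EuclideanSpace ℝ (Fin n)) :
    bil (expGram b 0) w u = inner ℝ w u := by
  rw [hN.expGram_eq (Metric.mem_ball_self hN.pos), ← metric_sum_orthonormal hN.orthonormal,
    metric_eq_bil hN.mem_maximalAtlas hN.center_mem, hN.tcoord_frame, hN.tcoord_frame,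
    hN.apply_center]

lemma expGram_zero : expGram b 0 = 1 := by
  ext i j
  rw [← bil_single (expGram b 0), hN.bil_expGram_zero]
  simp [EuclideanSpace.inner_single_left, Matrix.one_apply, Pi.single_apply, eq_comm]

variable [IsContMDiffRiemannianBundle (𝓡 n) ∞ (EuclideanSpace ℝ (Fin n))
  (fun x : M => TangentSpace (𝓡 n) x)]

lemma contDiffOn_expGram (i j : Fin n) :
    ContDiffOn ℝ ∞ (fun y => expGram b y i j) (Metric.ball 0 ε) := by
  have := contDiffOn_pullGram_symm hN.mem_maximalAtlas i j
  rw [hN.target] at this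
  exact this.congr fun y hy => by rw [hN.expGram_eq hy]

/-- Gauss's lemma. -/
theorem bil_expGram_self {w : EuclideanSpace ℝ (Fin n)} (hw : w ∈ Metric.ball 0 ε)
    (u : EuclideanSpace ℝ (Fin n)) : bil (expGram b w) w u = inner ℝ w u := by
  rw [← hN.bil_expGram_zero]
  refine gauss_lemma (B := fun y => bil (expGram b y))
    ((contDiffOn_bil hN.contDiffOn_expGram).differentiableOn (by simp))
    (fun z hz v w => bil_symm (isSymm_of_posDef (hN.expGram_posDef hz)) v w)
    (fun w t ht => ?_) (by simpa using hw) u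
  have htb : t • w ∈ Metric.ball (0 : EuclideanSpace ℝ (Fin n)) ε := by simpa using ht
  have h1 := (hN.geodesic w).EL hN.mem_maximalAtlas (isOpen_ray w ε) ht (hN.expChart_mem htb)
  -- In the normal chart the geodesic is the straight line tw, so its velocity is w and its
  -- acceleration 0, which is the hypothesis of `gauss_lemma`.
  have hev : (e ∘ fun t : ℝ => expChart b (t • w)) =ᶠ[𝓝 t] fun t => t • w := by
    filter_upwards [(isOpen_ray w ε).mem_nhds ht] with t ht
    exact hN.apply_expChart (by simpa using ht)
  have hd : (deriv fun t : ℝ => t • w) = fun _ => w := by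
    funext s
    have : HasDerivAt (fun t : ℝ => t • w) ((1 : ℝ) • w) s := (hasDerivAt_id s).smul_const w
    rw [this.deriv, one_smul]
  rw [hev.deriv.deriv_eq, hev.deriv_eq, hd, hN.apply_expChart htb, deriv_const] at h1
  refine h1.congr ?_
  filter_upwards [Metric.isOpen_ball.mem_nhds htb] with z hz
  rw [hN.expGram_eq hz]

/-- Gauss's lemma with the factor t divided out. In this form it also holds for t = 0 and t < 0, as
needed for polar coordinates through the origin. -/
lemma bil_expGram_ray (w u : EuclideanSpace ℝ (Fin n)) {t : ℝ} (ht : ‖t • w‖ < ε) :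
    bil (expGram b (t • w)) w u = inner ℝ w u := by
  rcases eq_or_ne t 0 with rfl | h
  · rw [zero_smul, hN.bil_expGram_zero]
  · have := hN.bil_expGram_self (w := t • w) (by simpa using ht) u
    rw [map_smul, _root_.smul_apply, real_inner_smul_left, smul_eq_mul] at this
    exact mul_left_cancel₀ h this

/-- Let T(a, v, u) be the derivative at 0. Differentiating Gauss's lemma along rays gives T(w, w, u)
= 0, so T is antisymmetric in its first two arguments; it is symmetric in the last two. A trilinear
form with both symmetries vanishes. -/
lemma fderiv_bil_expGram_zero (a v u : EuclideanSpace ℝ (Fin n)) :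
    fderiv ℝ (fun y => bil (expGram b y)) 0 a v u = 0 := by
  have h0 : (0 : EuclideanSpace ℝ (Fin n)) ∈ Metric.ball 0 ε := Metric.mem_ball_self hN.pos
  have hB : HasFDerivAt (fun y => bil (expGram b y)) (fderiv ℝ (fun y => bil (expGram b y)) 0) 0 :=
    (((contDiffOn_bil hN.contDiffOn_expGram).contDiffAt
      (Metric.isOpen_ball.mem_nhds h0)).differentiableAt (by simp)).hasFDerivAt
  set T := fderiv ℝ (fun y => bil (expGram b y)) 0
  have hline : ∀ w v u, HasDerivAt (fun t : ℝ => bil (expGram b (t • w)) v u) (T w v u) 0 := by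
    intro w v u
    have h1 : HasDerivAt (fun t : ℝ => t • w) ((1 : ℝ) • w) 0 := (hasDerivAt_id 0).smul_const w
    rw [one_smul] at h1
    have hB' : HasFDerivAt (fun y => bil (expGram b y)) T ((0 : ℝ) • w) := by rwa [zero_smul]
    have h2 := hB'.comp_hasDerivAt 0 h1
    have h3 := (h2.clm_apply (hasDerivAt_const 0 v)).clm_apply (hasDerivAt_const 0 u)
    simpa using h3
  have hdiag : ∀ w u, T w w u = 0 := by
    intro w u
    have hev : (fun t : ℝ => bil (expGram b (t • w)) w u) =ᶠ[𝓝 0] fun _ => inner ℝ w u := by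
      have hopen := isOpen_ray w ε
      filter_upwards [hopen.mem_nhds (show (0 : ℝ) ∈ {t : ℝ | ‖t • w‖ < ε} by
        simpa using hN.pos)] with t ht
      exact hN.bil_expGram_ray w u ht
    rw [← (hline w w u).deriv, hev.deriv_eq, deriv_const]
  have hanti : ∀ w v u, T w v u = -T v w u := by
    intro w v u
    have := hdiag (w + v) u
    simp only [map_add, _root_.add_apply, hdiag, zero_add, add_zero] at this
    linarith
  have hsym : ∀ w v u, T w v u = T w u v := by
    intro w v u
    rw [← (hline w v u).deriv, ← (hline w u v).deriv]
    refine Filter.EventuallyEq.deriv_eq (Filter.Eventually.of_forall fun t => ?_)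
    exact bil_symm (pullGram_isSymm _ _) _ _
  have e1 := hanti a v u
  have e2 := hsym v a u
  have e3 := hanti v u a
  have e4 := hsym u v a
  have e5 := hanti u a v
  have e6 := hsym a u v
  linarith

lemma pd_expGram_zero (k i j : Fin n) : pd k (fun y => expGram b y i j) 0 = 0 := by
  have h0 : (0 : EuclideanSpace ℝ (Fin n)) ∈ Metric.ball 0 ε := Metric.mem_ball_self hN.pos
  have hB : DifferentiableAt ℝ (fun y => bil (expGram b y)) 0 :=
    ((contDiffOn_bil hN.contDiffOn_expGram).contDiffAt
      (Metric.isOpen_ball.mem_nhds h0)).differentiableAt (by simp)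
  have h1 := (hB.hasFDerivAt.clm_apply
    (hasFDerivAt_const (EuclideanSpace.single i (1 : ℝ)) _)).clm_apply
    (hasFDerivAt_const (EuclideanSpace.single j (1 : ℝ)) _)
  simp only [bil_single] at h1
  rw [pd, h1.fderiv]
  simpa using hN.fderiv_bil_expGram_zero _ _ _

/-- By Gauss's lemma the Euclidean radial covector at y is the metric pairing with Y = D exp(y), and
Y has metric length ‖y‖. Cauchy–Schwarz then says that the radius grows at most at unit rate. -/
lemma inner_tcoord_le {p : M} (hp : p ∈ e.source) (v : TangentSpace (𝓡 n) p) :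
    |(inner ℝ (e p) (tcoord e p v) : ℝ)| ≤ ‖e p‖ * ‖v‖ := by
  obtain ⟨y, hy, rfl⟩ : ∃ y ∈ Metric.ball 0 ε, expChart b y = p :=
    ⟨e p, hN.mem_ball hp, hN.expChart_apply hp⟩
  rw [hN.apply_expChart hy]
  set Y := mfderiv (𝓡 n) (𝓡 n) (expChart b) y y with hY
  have h1 : ∀ u : EuclideanSpace ℝ (Fin n),
      metric (expChart b y) Y (mfderiv (𝓡 n) (𝓡 n) (expChart b) y u) = inner ℝ y u := fun u => by
    rw [← hN.bil_expGram_self hy, expGram, bil_pullGram]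
  have h2 : (inner ℝ Y v : ℝ) = inner ℝ y (tcoord e (expChart b y) v) := by
    rw [← h1, hN.mfderiv_tcoord hy, metric]
  have h3 : ‖Y‖ = ‖y‖ := by
    have h4 : (inner ℝ Y Y : ℝ) = inner ℝ y y := h1 y
    rw [real_inner_self_eq_norm_sq (F := TangentSpace (𝓡 n) (expChart b y)),
      real_inner_self_eq_norm_sq] at h4
    exact (sq_eq_sq₀ (norm_nonneg _) (norm_nonneg _)).1 h4
  rw [← h2, ← h3]
  exact abs_real_inner_le_norm _ _

end Manifold

end IsNormalChart

end NormalChart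
/-! ### Geodesic balls -/

namespace IsNormalChart

open MeasureTheory

/-! ### Lengths of curves issuing from the centre. -/

section Length

variable {n : ℕ} {M : Type*} [TopologicalSpace M] [ChartedSpace (EuclideanSpace ℝ (Fin n)) M]
  [RiemannianBundle (fun x : M => TangentSpace (𝓡 n) x)]
  {x : M} {b : Fin n → TangentSpace (𝓡 n) x} {ε : ℝ}
  {e : OpenPartialHomeomorph M (EuclideanSpace ℝ (Fin n))} [IsManifold (𝓡 n) ∞ M]
  [IsContMDiffRiemannianBundle (𝓡 n) ∞ (EuclideanSpace ℝ (Fin n))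
    (fun x : M => TangentSpace (𝓡 n) x)]
  (hN : IsNormalChart b ε e)

include hN

lemma norm_mfderiv_ray (w : EuclideanSpace ℝ (Fin n)) {s : ℝ} (hs : ‖s • w‖ < ε) :
    ‖mfderiv 𝓘(ℝ, ℝ) (𝓡 n) (fun t : ℝ => expChart b (t • w)) s (1 : ℝ)‖ = ‖w‖ := by
  have hsb : s • w ∈ Metric.ball (0 : EuclideanSpace ℝ (Fin n)) ε := by simpa using hs
  have h1 := metric_eq_bil hN.mem_maximalAtlas (hN.expChart_mem hsb)
    (mfderiv 𝓘(ℝ, ℝ) (𝓡 n) (fun t : ℝ => expChart b (t • w)) s (1 : ℝ))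
    (mfderiv 𝓘(ℝ, ℝ) (𝓡 n) (fun t : ℝ => expChart b (t • w)) s (1 : ℝ))
  rw [hN.apply_expChart hsb, ← hN.expGram_eq hsb, hN.tcoord_ray w hs, hN.bil_expGram_ray w w hs,
    metric, real_inner_self_eq_norm_sq, real_inner_self_eq_norm_sq] at h1
  exact (sq_eq_sq₀ (norm_nonneg _) (norm_nonneg _)).1 h1

lemma pathELength_ray (w : EuclideanSpace ℝ (Fin n)) {r : ℝ} (hr : 0 ≤ r) (hw : r * ‖w‖ < ε) :
    Manifold.pathELength (𝓡 n) (fun t : ℝ => expChart b (t • w)) 0 r =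
      ENNReal.ofReal (r * ‖w‖) := by
  rw [Manifold.pathELength_eq_lintegral_mfderiv_Ioo]
  have : EqOn (fun s => ‖mfderiv 𝓘(ℝ, ℝ) (𝓡 n) (fun t : ℝ => expChart b (t • w)) s (1 : ℝ)‖ₑ)
      (fun _ => ENNReal.ofReal ‖w‖) (Ioo 0 r) := fun s hs => by
    have hlt : ‖s • w‖ < ε := by
      rw [norm_smul, Real.norm_eq_abs, abs_of_pos hs.1]
      exact (mul_le_mul_of_nonneg_right hs.2.le (norm_nonneg w)).trans_lt hw
    simp only
    rw [← hN.norm_mfderiv_ray w hlt, ofReal_norm]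
  refine (setLIntegral_congr_fun measurableSet_Ioo this).trans ?_
  rw [setLIntegral_const, Real.volume_Ioo, sub_zero,
    ← ENNReal.ofReal_mul (norm_nonneg w), mul_comm]

/-- The derivative of the radius along γ is bounded by the speed (`inner_tcoord_le`), then
integrated. The radius is not differentiable at the centre, where γ starts, so it is replaced by
√(‖·‖² + δ²) with δ arbitrarily small. -/
lemma le_pathELength {γ : ℝ → M} {t : ℝ} (ht : 0 ≤ t)
    (hγ : ContMDiffOn 𝓘(ℝ, ℝ) (𝓡 n) 1 γ (Icc 0 t)) (h0 : γ 0 = x)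
    (hsrc : ∀ s ∈ Icc 0 t, γ s ∈ e.source) :
    ENNReal.ofReal ‖e (γ t)‖ ≤ Manifold.pathELength (𝓡 n) γ 0 t := by
  refine ENNReal.le_of_forall_pos_le_add fun δ hδ _ => ?_
  have hσ : ContDiffOn ℝ 1 (fun s => e (γ s)) (Icc 0 t) :=
    (((contMDiffOn_of_mem_maximalAtlas hN.mem_maximalAtlas).of_le (by norm_cast)).comp hγ
      hsrc).contDiffOn
  have hδ2 : (0 : ℝ) < (δ : ℝ) ^ 2 := by positivity
  have hpos : ∀ s, 0 < ‖e (γ s)‖ ^ 2 + (δ : ℝ) ^ 2 := fun s => by positivity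
  have hh : ContDiffOn ℝ 1 (fun s => √(‖e (γ s)‖ ^ 2 + (δ : ℝ) ^ 2)) (Icc 0 t) :=
    ((hσ.norm_sq ℝ).add contDiffOn_const).sqrt fun s _ => (hpos s).ne'
  have hle := enorm_sub_le_lintegral_deriv_of_contDiffOn_Icc hh ht
  rw [h0, hN.apply_center] at hle
  have hint : ∫⁻ s in Icc 0 t, ‖deriv (fun s => √(‖e (γ s)‖ ^ 2 + (δ : ℝ) ^ 2)) s‖ₑ ≤
      Manifold.pathELength (𝓡 n) γ 0 t := by
    rw [Manifold.pathELength_eq_lintegral_mfderiv_Ioo, ← restrict_Ioo_eq_restrict_Icc]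
    refine setLIntegral_mono' measurableSet_Ioo fun s hs => ?_
    have hnhds : Icc 0 t ∈ 𝓝 s := Icc_mem_nhds hs.1 hs.2
    have hsI := Ioo_subset_Icc_self hs
    have hσs : HasDerivAt (fun s => e (γ s)) (deriv (fun s => e (γ s)) s) s :=
      ((hσ.contDiffAt hnhds).differentiableAt (by simp)).hasDerivAt
    have htc : tcoord e (γ s) (mfderiv 𝓘(ℝ, ℝ) (𝓡 n) γ s (1 : ℝ)) = deriv (fun s => e (γ s)) s :=
      tcoord_mfderiv hN.mem_maximalAtlas
        ((hγ.contMDiffAt hnhds).mdifferentiableAt (by simp)) (hsrc s hsI) (1 : ℝ)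
    have hder := ((hσs.norm_sq).add_const ((δ : ℝ) ^ 2)).sqrt (hpos s).ne'
    have hin := hN.inner_tcoord_le (hsrc s hsI) (mfderiv 𝓘(ℝ, ℝ) (𝓡 n) γ s (1 : ℝ))
    rw [htc] at hin
    have hsq : ‖e (γ s)‖ ≤ √(‖e (γ s)‖ ^ 2 + (δ : ℝ) ^ 2) := Real.le_sqrt_of_sq_le (by linarith)
    have hsqpos := Real.sqrt_pos.2 (hpos s)
    rw [hder.deriv, enorm_le_iff_norm_le, Real.norm_eq_abs, mul_div_mul_left _ _ two_ne_zero,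
      abs_div, abs_of_pos hsqpos, div_le_iff₀ hsqpos, mul_comm]
    exact hin.trans (mul_le_mul_of_nonneg_right hsq (norm_nonneg _))
  have h2 : ENNReal.ofReal (√(‖e (γ t)‖ ^ 2 + (δ : ℝ) ^ 2)) ≤
      Manifold.pathELength (𝓡 n) γ 0 t + δ := by
    have h3 : √(‖(0 : EuclideanSpace ℝ (Fin n))‖ ^ 2 + (δ : ℝ) ^ 2) = δ := by simp
    rw [h3, Real.enorm_eq_ofReal_abs] at hle
    have h4 := (hle.trans hint)
    refine le_trans ?_ (add_le_add_left h4 _)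
    rw [← ENNReal.ofReal_coe_nnreal, ← ENNReal.ofReal_add (abs_nonneg _) δ.coe_nonneg]
    refine ENNReal.ofReal_le_ofReal ?_
    linarith [le_abs_self (√(‖e (γ t)‖ ^ 2 + (δ : ℝ) ^ 2) - δ)]
  refine (ENNReal.ofReal_le_ofReal ?_).trans h2
  exact Real.le_sqrt_of_sq_le (by linarith)

/-- A curve leaving the geodesic ball of radius q has a first exit time; up to then it stays in the
chart and has already spent length q. This excludes shortcuts outside the chart and needs no
completeness. -/
lemma mem_of_pathELength_lt [T2Space M] {r : ℝ} (hr : r ≤ ε) {γ : ℝ → M}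
    (hγ : ContMDiffOn 𝓘(ℝ, ℝ) (𝓡 n) 1 γ (Icc 0 1)) (h0 : γ 0 = x)
    (hL : Manifold.pathELength (𝓡 n) γ 0 1 < ENNReal.ofReal r) :
    γ 1 ∈ expChart b '' Metric.ball 0 r := by
  -- An intermediate radius, strictly below r: the closed q-ball is compact in the domain of the
  -- chart even when r = ε.
  obtain ⟨q, hq1, hq2⟩ := ENNReal.lt_iff_exists_nnreal_btwn.1 hL
  have hqr : (q : ℝ) < r := by
    rw [← ENNReal.ofReal_coe_nnreal] at hq2
    exact (ENNReal.ofReal_lt_ofReal_iff_of_nonneg q.2).1 hq2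
  have hq0 : 0 < (q : ℝ) := by
    have : (0 : ℝ≥0∞) < q := bot_le.trans_lt hq1
    exact_mod_cast this
  have hqε : Metric.closedBall (0 : EuclideanSpace ℝ (Fin n)) q ⊆ Metric.ball 0 ε :=
    Metric.closedBall_subset_ball (hqr.trans_le hr)
  have hclosed : IsClosed (expChart b '' Metric.closedBall 0 q) := by
    refine ((isCompact_closedBall _ _).image_of_continuousOn fun y hy => ?_).isClosed
    exact (hN.contMDiffAt_expChart (hqε hy)).continuousAt.continuousWithinAt
  have hopen : IsOpen (expChart b '' Metric.ball 0 q) := by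
    have h1 : expChart b '' Metric.ball 0 q = e.symm '' Metric.ball 0 q :=
      (image_congr (fun y hy => (hN.symm (hqε (Metric.ball_subset_closedBall hy))).symm))
    rw [h1]
    exact e.symm.isOpen_image_of_subset_source Metric.isOpen_ball
      ((Metric.ball_subset_closedBall.trans hqε).trans_eq hN.target.symm)
  suffices h : ∀ s ∈ Icc (0 : ℝ) 1, γ s ∈ expChart b '' Metric.ball 0 q from
    image_mono (Metric.ball_subset_ball hqr.le) (h 1 (by simp))
  by_contra! hcon
  obtain ⟨s₁, hs₁, hs₁'⟩ := hcon
  have hT : IsCompact (Icc (0 : ℝ) 1 ∩ γ ⁻¹' (expChart b '' Metric.ball 0 q)ᶜ) :=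
    isCompact_Icc.of_isClosed_subset
      (hγ.continuousOn.preimage_isClosed_of_isClosed isClosed_Icc hopen.isClosed_compl)
      inter_subset_left
  obtain ⟨s₀, hs₀, hmin⟩ := hT.exists_isLeast ⟨s₁, hs₁, hs₁'⟩
  have hx0 : x ∈ expChart b '' Metric.ball 0 q := ⟨0, by simpa using hq0, hN.zero⟩
  have hpos : 0 < s₀ := by
    refine hs₀.1.1.lt_of_ne fun h => hs₀.2 ?_
    rw [← h, h0]
    exact hx0
  have hlt : ∀ s ∈ Ico 0 s₀, γ s ∈ expChart b '' Metric.ball 0 q := fun s hs => by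
    by_contra h
    exact (hmin ⟨⟨hs.1, hs.2.le.trans hs₀.1.2⟩, h⟩).not_gt hs.2
  have hγ' : ContMDiffOn 𝓘(ℝ, ℝ) (𝓡 n) 1 γ (Icc 0 s₀) :=
    hγ.mono (Icc_subset_Icc_right hs₀.1.2)
  -- The image of the closed ball is compact, hence closed, so the exit point itself still lies in
  -- the chart and its radius can be measured.
  have hK : ∀ s ∈ Icc 0 s₀, γ s ∈ expChart b '' Metric.closedBall 0 q := by
    have h1 : Icc 0 s₀ ⊆ closure (Ico 0 s₀) := by rw [closure_Ico hpos.ne]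
    have h2 : MapsTo γ (closure (Ico 0 s₀)) (closure (expChart b '' Metric.closedBall 0 q)) := by
      refine MapsTo.closure_of_continuousOn (fun s hs =>
        image_mono Metric.ball_subset_closedBall (hlt s hs)) ?_
      rw [closure_Ico hpos.ne]
      exact hγ'.continuousOn
    intro s hs
    exact hclosed.closure_eq ▸ h2 (h1 hs)
  have hlow := hN.le_pathELength hpos.le hγ' h0 fun s hs => by
    obtain ⟨y, hy, hys⟩ := hK s hs
    exact hys ▸ hN.expChart_mem (hqε hy)
  obtain ⟨y, hy, hys⟩ := hK s₀ (right_mem_Icc.2 hpos.le)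
  rw [← hys, hN.apply_expChart (hqε hy)] at hlow
  have hqy : (q : ℝ) ≤ ‖y‖ := by
    by_contra! h
    exact hs₀.2 ⟨y, by simpa using h, hys⟩
  refine hq1.not_ge (le_trans ?_ (hlow.trans (Manifold.pathELength_mono le_rfl hs₀.1.2)))
  rw [← ENNReal.ofReal_coe_nnreal]
  exact ENNReal.ofReal_le_ofReal hqy

end Length

/-! ### Distances from the centre and images of balls and spheres. -/

section Distance

variable {n : ℕ} {M : Type*} [EMetricSpace M] [ChartedSpace (EuclideanSpace ℝ (Fin n)) M]
  [RiemannianBundle (fun x : M => TangentSpace (𝓡 n) x)]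
  {x : M} {b : Fin n → TangentSpace (𝓡 n) x} {ε : ℝ}
  {e : OpenPartialHomeomorph M (EuclideanSpace ℝ (Fin n))} [IsManifold (𝓡 n) ∞ M]
  [IsContMDiffRiemannianBundle (𝓡 n) ∞ (EuclideanSpace ℝ (Fin n))
    (fun x : M => TangentSpace (𝓡 n) x)] [IsRiemannianManifold (𝓡 n) M]
  (hN : IsNormalChart b ε e)

include hN

lemma mem_of_edist_lt {r : ℝ} (hr : r ≤ ε) {p : M} (hp : edist x p < ENNReal.ofReal r) :
    p ∈ expChart b '' Metric.ball 0 r := by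
  rw [IsRiemannianManifold.out (I := 𝓡 n)] at hp
  obtain ⟨γ, h0, h1, hγ, hL⟩ := Manifold.exists_lt_of_riemannianEDist_lt hp
  exact h1 ▸ hN.mem_of_pathELength_lt hr hγ h0 hL

/-- The ray gives the upper bound. If the distance were smaller, the point would also be the image
of a vector of norm less than ‖y‖, against injectivity of the chart. -/
theorem edist_expChart {y : EuclideanSpace ℝ (Fin n)} (hy : y ∈ Metric.ball 0 ε) :
    edist x (expChart b y) = ENNReal.ofReal ‖y‖ := by
  have hy' : ‖y‖ < ε := by simpa using hy
  refine le_antisymm ?_ ?_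
  · rw [IsRiemannianManifold.out (I := 𝓡 n)]
    have hray : ContMDiffOn 𝓘(ℝ, ℝ) (𝓡 n) 1 (fun t : ℝ => expChart b (t • y)) (Icc 0 1) :=
      ((hN.geodesic y).1.of_le (by norm_num)).mono fun t ht => by
        have : ‖t • y‖ ≤ ‖y‖ := by
          rw [norm_smul, Real.norm_eq_abs, abs_of_nonneg ht.1]
          exact mul_le_of_le_one_left (norm_nonneg _) ht.2
        exact this.trans_lt hy'
    refine (Manifold.riemannianEDist_le_pathELength hray (by simpa using hN.zero)
      (by simp) zero_le_one).trans_eq ?_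
    rw [hN.pathELength_ray y zero_le_one (by simpa using hy'), one_mul]
  · by_contra! h
    obtain ⟨z, hz, hzy⟩ := hN.mem_of_edist_lt hy'.le h
    have hz' : z ∈ Metric.ball 0 ε := Metric.ball_subset_ball hy'.le hz
    have : z = y := by rw [← hN.apply_expChart hz', hzy, hN.apply_expChart hy]
    rw [this] at hz
    simp at hz

theorem image_ball {r : ℝ} (hr : 0 < r) (hrε : r ≤ ε) :
    expChart b '' Metric.ball 0 r = Metric.eball x (ENNReal.ofReal r) := by
  ext p
  refine ⟨?_, fun hp => hN.mem_of_edist_lt hrε (by rwa [edist_comm])⟩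
  rintro ⟨y, hy, rfl⟩
  rw [Metric.mem_eball', hN.edist_expChart (Metric.ball_subset_ball hrε hy)]
  exact (ENNReal.ofReal_lt_ofReal_iff hr).2 (by simpa using hy)

theorem source_eq : e.source = Metric.eball x (ENNReal.ofReal ε) := by
  rw [← hN.image_ball hN.pos le_rfl]
  refine Subset.antisymm (fun p hp => ⟨e p, hN.mem_ball hp, hN.expChart_apply hp⟩) ?_
  rintro _ ⟨y, hy, rfl⟩
  exact hN.expChart_mem hy

/-- Closed balls and spheres at once: S is any condition on the distance which keeps points within
radius r < ε, hence in the chart. -/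
lemma image_setOf_norm {r : ℝ} (hr : 0 ≤ r) (hrε : r < ε) (S : ℝ≥0∞ → Prop)
    (hS : ∀ d, S d → d ≤ ENNReal.ofReal r) :
    expChart b '' {y | S (ENNReal.ofReal ‖y‖)} = {p | S (edist p x)} := by
  have hb : ∀ y : EuclideanSpace ℝ (Fin n), S (ENNReal.ofReal ‖y‖) → y ∈ Metric.ball 0 ε := by
    intro y hy
    have := (ENNReal.ofReal_le_ofReal_iff hr).1 (hS _ hy)
    simpa using this.trans_lt hrε
  ext p
  constructor
  · rintro ⟨y, hy, rfl⟩
    rw [mem_ofPred_eq, edist_comm, hN.edist_expChart (hb y hy)]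
    exact hy
  · intro hp
    rw [mem_ofPred_eq, edist_comm] at hp
    obtain ⟨y, hy, rfl⟩ := hN.mem_of_edist_lt (p := p) le_rfl
      ((hS _ hp).trans_lt ((ENNReal.ofReal_lt_ofReal_iff hN.pos).2 hrε))
    rw [hN.edist_expChart hy] at hp
    exact ⟨y, hp, rfl⟩

theorem image_closedBall {r : ℝ} (hr : 0 ≤ r) (hrε : r < ε) :
    expChart b '' Metric.closedBall 0 r = Metric.closedEBall x (ENNReal.ofReal r) := by
  have := hN.image_setOf_norm hr hrε (fun d => d ≤ ENNReal.ofReal r) fun _ h => h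
  simp only [ENNReal.ofReal_le_ofReal_iff hr] at this
  refine Eq.trans ?_ this
  congr 1
  ext y; simp

theorem image_sphere {r : ℝ} (hr : 0 ≤ r) (hrε : r < ε) :
    expChart b '' Metric.sphere 0 r = {p | edist p x = ENNReal.ofReal r} := by
  have := hN.image_setOf_norm hr hrε (fun d => d = ENNReal.ofReal r) fun _ h => h.le
  simp only [ENNReal.ofReal_eq_ofReal_iff (norm_nonneg _) hr] at this
  convert this using 2
  ext y; simp

end Distance

end IsNormalChart
/-! ### Smooth dependence on the centre -/

section SmoothDependence

variable {n : ℕ} {M : Type*} [TopologicalSpace M] [ChartedSpace (EuclideanSpace ℝ (Fin n)) M]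
  [IsManifold (𝓡 n) ∞ M] {φ : OpenPartialHomeomorph M (EuclideanSpace ℝ (Fin n))}
  (hφ : φ ∈ IsManifold.maximalAtlas (𝓡 n) ∞ M) {U : Set M}

include hφ

/-- The components are the fibre part of the tangent map of φ applied to the section; over the model
space the tangent bundle is a product, so this part is smooth. -/
lemma contMDiffOn_tcoord {s : ∀ x : M, TangentSpace (𝓡 n) x} (hU : U ⊆ φ.source)
    (hs : ContMDiffOn (𝓡 n) (𝓡 n).tangent ∞ (fun x => (⟨x, s x⟩ : TangentBundle (𝓡 n) M)) U) :
    ContMDiffOn (𝓡 n) (𝓡 n) ∞ (fun x => tcoord φ x (s x)) U := by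
  have h1 := (contMDiffOn_of_mem_maximalAtlas hφ).contMDiffOn_tangentMapWithin (m := ∞)
    (by simp) φ.open_source.uniqueMDiffOn
  have h2 : ContMDiffOn (𝓡 n) (𝓡 n).tangent ∞ (fun x => tangentMapWithin (𝓡 n) (𝓡 n) φ φ.source
      (⟨x, s x⟩ : TangentBundle (𝓡 n) M)) U := h1.comp hs fun x hx => hU hx
  have h3 := (contMDiff_snd_tangentBundle_modelSpace (n := ∞) (EuclideanSpace ℝ (Fin n))
    𝓘(ℝ, EuclideanSpace ℝ (Fin n))).comp_contMDiffOn h2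
  refine h3.congr fun x hx => ?_
  have : mfderivWithin (𝓡 n) (𝓡 n) φ φ.source x = mfderiv (𝓡 n) (𝓡 n) φ x :=
    mfderivWithin_of_isOpen φ.open_source (hU hx)
  change tcoord φ x (s x) = mfderivWithin (𝓡 n) (𝓡 n) φ φ.source x (s x)
  rw [this]
  rfl

lemma contMDiffOn_frameCoord {s : Fin n → ∀ x : M, TangentSpace (𝓡 n) x} (hU : U ⊆ φ.source)
    (hs : ∀ i, ContMDiffOn (𝓡 n) (𝓡 n).tangent ∞
      (fun x => (⟨x, s i x⟩ : TangentBundle (𝓡 n) M)) U)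
    {S : Set (M × EuclideanSpace ℝ (Fin n))} (hS : ∀ q ∈ S, q.1 ∈ U)
    {g : M × EuclideanSpace ℝ (Fin n) → EuclideanSpace ℝ (Fin n)}
    (hg : ContMDiffOn ((𝓡 n).prod (𝓡 n)) (𝓡 n) ∞ g S) :
    ContMDiffOn ((𝓡 n).prod (𝓡 n)) (𝓡 n) ∞
      (fun q => frameCoord φ (x := q.1) (fun i => s i q.1) (g q)) S := by
  have h1 : ∀ i, ContMDiffOn ((𝓡 n).prod (𝓡 n)) 𝓘(ℝ, ℝ) ∞ (fun q => g q i) S := fun i =>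
    (EuclideanSpace.proj i : EuclideanSpace ℝ (Fin n) →L[ℝ] ℝ).contMDiff.comp_contMDiffOn hg
  have h2 : ∀ i, ContMDiffOn ((𝓡 n).prod (𝓡 n)) (𝓡 n) ∞
      (fun q : M × EuclideanSpace ℝ (Fin n) => tcoord φ q.1 (s i q.1)) S := fun i =>
    (contMDiffOn_tcoord hφ hU (hs i)).comp contMDiffOn_fst hS
  refine (contMDiffOn_finsetSum (t := Finset.univ) fun i _ => (h1 i).smul (h2 i)).congr
    fun q _ => ?_
  simp [frameCoord]

variable [RiemannianBundle (fun x : M => TangentSpace (𝓡 n) x)] [T2Space M]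
  [IsContMDiffRiemannianBundle (𝓡 n) ∞ (EuclideanSpace ℝ (Fin n))
    (fun x : M => TangentSpace (𝓡 n) x)]
  {y₀ : EuclideanSpace ℝ (Fin n)} {ρ : ℝ}
  {X : EuclideanSpace ℝ (Fin n) × EuclideanSpace ℝ (Fin n) → EuclideanSpace ℝ (Fin n)}
  (h : ChartExp φ y₀ ρ X)

include h

/-- The normal components expressed entirely in the fixed chart φ: the centre and the frame enter
only through φ x and `frameCoord`, so joint smoothness in centre and vector can be read off. -/
lemma ChartExp.expGram_eq {x : M} (hx : x ∈ φ.source) (hy : φ x ∈ Metric.ball y₀ ρ)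
    {b : Fin n → TangentSpace (𝓡 n) x} {u : EuclideanSpace ℝ (Fin n)}
    (hu : ‖frameCoord φ b u‖ < ρ) (k l : Fin n) :
    expGram b u k l =
      bil (pullGram (metric (n := n) (M := M)) φ.symm (X (φ x, frameCoord φ b u)))
        (fderiv ℝ X (φ x, frameCoord φ b u) (0, frameCoord φ b (EuclideanSpace.single k 1)))
        (fderiv ℝ X (φ x, frameCoord φ b u) (0, frameCoord φ b (EuclideanSpace.single l 1))) := by
  have hopen : IsOpen {u | ‖frameCoord φ b u‖ < ρ} :=
    isOpen_lt (by fun_prop) continuous_const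
  have hu' : {u | ‖frameCoord φ b u‖ < ρ} ∈ 𝓝 u := hopen.mem_nhds hu
  have hmem : ∀ v ∈ {u | ‖frameCoord φ b u‖ < ρ}, X (φ x, frameCoord φ b v) ∈ φ.target :=
    fun v hv => h.mem _ hy _ (by simpa using hv)
  have heq : expChart b =ᶠ[𝓝 u] fun v => φ.symm (X (φ x, frameCoord φ b v)) := by
    filter_upwards [hu'] with v hv using h.expChart_eq hφ hx hy hv
  have hev : (φ ∘ expChart b) =ᶠ[𝓝 u] fun v => X (φ x, frameCoord φ b v) := by
    filter_upwards [heq, hu'] with v hv hv'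
    rw [Function.comp_apply, hv, φ.right_inv (hmem v hv')]
  have hopen₂ : IsOpen (Metric.ball y₀ ρ ×ˢ Metric.ball (0 : EuclideanSpace ℝ (Fin n)) ρ) :=
    Metric.isOpen_ball.prod Metric.isOpen_ball
  have hmem₂ : (φ x, frameCoord φ b u) ∈
      Metric.ball y₀ ρ ×ˢ Metric.ball (0 : EuclideanSpace ℝ (Fin n)) ρ :=
    ⟨hy, by simpa using hu⟩
  have hXd : HasFDerivAt X (fderiv ℝ X (φ x, frameCoord φ b u)) (φ x, frameCoord φ b u) :=
    ((h.smooth.contDiffAt (hopen₂.mem_nhds hmem₂)).differentiableAt (by simp)).hasFDerivAt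
  have hd : HasFDerivAt (fun v => X (φ x, frameCoord φ b v))
      ((fderiv ℝ X (φ x, frameCoord φ b u)).comp
        ((0 : EuclideanSpace ℝ (Fin n) →L[ℝ] EuclideanSpace ℝ (Fin n)).prod (frameCoord φ b))) u :=
    hXd.comp u ((hasFDerivAt_const (φ x) u).prodMk (frameCoord φ b).hasFDerivAt)
  have hmd : MDifferentiableAt (𝓡 n) (𝓡 n) (expChart b) u := by
    refine MDifferentiableAt.congr_of_eventuallyEq ?_ heq
    exact (mdiffAt_chart_symm hφ (hmem u hu)).comp u hd.differentiableAt.mdifferentiableAt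
  have hsrc : expChart b u ∈ φ.source := by
    rw [heq.self_of_nhds]; exact φ.map_target (hmem u hu)
  rw [← bil_single (expGram b u), expGram, pullGram_eq_bil hφ hmd hsrc, hev.fderiv_eq, hd.fderiv]
  have : φ (expChart b u) = X (φ x, frameCoord φ b u) := hev.self_of_nhds
  rw [this]
  simp only [ContinuousLinearMap.comp_apply, ContinuousLinearMap.prod_apply, _root_.zero_apply]

variable {ε : ℝ} (hU : ∀ x ∈ U, x ∈ φ.source ∧ φ x ∈ Metric.ball y₀ ρ)
  {s : Fin n → ∀ x : M, TangentSpace (𝓡 n) x}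
  (hs : ∀ i, ContMDiffOn (𝓡 n) (𝓡 n).tangent ∞
    (fun x => (⟨x, s i x⟩ : TangentBundle (𝓡 n) M)) U)
  (hbound : ∀ x ∈ U, ∀ u ∈ Metric.ball 0 ε, ‖frameCoord φ (fun i => s i x) u‖ < ρ)

include hU hs hbound

omit [T2Space M] [IsContMDiffRiemannianBundle (𝓡 n) ∞ (EuclideanSpace ℝ (Fin n))
    (fun x : M => TangentSpace (𝓡 n) x)] [RiemannianBundle (fun x : M => TangentSpace (𝓡 n) x)] h in
lemma contMDiffOn_chart_frameCoord :
    ContMDiffOn ((𝓡 n).prod (𝓡 n)) 𝓘(ℝ, EuclideanSpace ℝ (Fin n) × EuclideanSpace ℝ (Fin n)) ∞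
      (fun q : M × EuclideanSpace ℝ (Fin n) => (φ q.1, frameCoord φ (x := q.1) (fun i => s i q.1) q.2))
      (U ×ˢ Metric.ball 0 ε) ∧
    MapsTo (fun q : M × EuclideanSpace ℝ (Fin n) => (φ q.1, frameCoord φ (x := q.1) (fun i => s i q.1) q.2))
      (U ×ˢ Metric.ball 0 ε) (Metric.ball y₀ ρ ×ˢ Metric.ball 0 ρ) := by
  refine ⟨ContMDiffOn.prodMk_space ?_ ?_, fun q hq => ⟨(hU _ hq.1).2, ?_⟩⟩
  · exact ((contMDiffOn_of_mem_maximalAtlas hφ).mono fun x hx => (hU x hx).1).comp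
      contMDiffOn_fst fun q hq => hq.1
  · exact contMDiffOn_frameCoord hφ (fun x hx => (hU x hx).1) hs (fun q hq => hq.1)
      contMDiffOn_snd
  · simpa using hbound _ hq.1 _ hq.2

theorem ChartExp.contMDiffOn_expChart :
    ContMDiffOn ((𝓡 n).prod (𝓡 n)) (𝓡 n) ∞
      (fun q : M × EuclideanSpace ℝ (Fin n) => expChart (fun i => s i q.1) q.2)
      (U ×ˢ Metric.ball 0 ε) := by
  obtain ⟨h1, h2⟩ := contMDiffOn_chart_frameCoord hφ hU hs hbound
  have h3 := (contMDiffOn_symm_of_mem_maximalAtlas hφ).comp (h.smooth.contMDiffOn.comp h1 h2)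
    fun q hq => h.mem _ (h2 hq).1 _ (h2 hq).2
  exact h3.congr fun q hq =>
    h.expChart_eq hφ (hU _ hq.1).1 (hU _ hq.1).2 (hbound _ hq.1 _ hq.2)

theorem ChartExp.contMDiffOn_expGram (k l : Fin n) :
    ContMDiffOn ((𝓡 n).prod (𝓡 n)) 𝓘(ℝ, ℝ) ∞
      (fun q : M × EuclideanSpace ℝ (Fin n) => expGram (fun i => s i q.1) q.2 k l)
      (U ×ˢ Metric.ball 0 ε) := by
  obtain ⟨h1, h2⟩ := contMDiffOn_chart_frameCoord hφ hU hs hbound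
  have hopen : IsOpen (Metric.ball y₀ ρ ×ˢ Metric.ball (0 : EuclideanSpace ℝ (Fin n)) ρ) :=
    Metric.isOpen_ball.prod Metric.isOpen_ball
  have hX' := (h.smooth.fderiv_of_isOpen (m := ∞) hopen (by simp)).contMDiffOn.comp h1 h2
  have hG : ContDiffOn ℝ ∞ (fun z => bil (pullGram (metric (n := n) (M := M)) φ.symm (X z)))
      (Metric.ball y₀ ρ ×ˢ Metric.ball 0 ρ) :=
    (contDiffOn_bil (contDiffOn_pullGram_symm hφ)).comp h.smooth
      fun z hz => h.mem _ hz.1 _ hz.2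
  have hG' := hG.contMDiffOn.comp h1 h2
  have hcol : ∀ k : Fin n, ContMDiffOn ((𝓡 n).prod (𝓡 n)) (𝓡 n) ∞
      (fun q : M × EuclideanSpace ℝ (Fin n) =>
        fderiv ℝ X (φ q.1, frameCoord φ (x := q.1) (fun i => s i q.1) q.2)
          (0, frameCoord φ (x := q.1) (fun i => s i q.1) (EuclideanSpace.single k 1)))
      (U ×ˢ Metric.ball 0 ε) := fun k =>
    hX'.clm_apply (contMDiffOn_const.prodMk_space
      (contMDiffOn_frameCoord hφ (fun x hx => (hU x hx).1) hs (fun q hq => hq.1)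
        contMDiffOn_const))
  exact ((hG'.clm_apply (hcol k)).clm_apply (hcol l)).congr fun q hq =>
    h.expGram_eq hφ (hU _ hq.1).1 (hU _ hq.1).2 (hbound _ hq.1 _ hq.2) k l

end SmoothDependence

/-! ### Charts of the sphere -/

section Sphere

lemma contMDiff_coe_usphere {m : ℕ} {N : WithTop ℕ∞} :
    ContMDiff (𝓡 m) (𝓡 (m + 1)) N ((↑) : USphere m → EuclideanSpace ℝ (Fin (m + 1))) := by
  have := Fact.mk (@finrank_euclideanSpace_fin ℝ _ (m + 1))
  exact contMDiff_coe_sphere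

lemma mfderiv_coe_usphere_injective {m : ℕ} (θ : USphere m) : Function.Injective
    (mfderiv (𝓡 m) (𝓡 (m + 1)) ((↑) : USphere m → EuclideanSpace ℝ (Fin (m + 1))) θ) := by
  have := Fact.mk (@finrank_euclideanSpace_fin ℝ _ (m + 1))
  exact injective_mvfderiv_subtypeVal_sphere θ

variable {m : ℕ} {ψ : OpenPartialHomeomorph (USphere m) (EuclideanSpace ℝ (Fin m))}
  (hψ : ψ ∈ IsManifold.maximalAtlas (𝓡 m) ∞ (USphere m))

include hψ

lemma contDiffOn_coe_symm :
    ContDiffOn ℝ ∞ (fun u => (ψ.symm u : EuclideanSpace ℝ (Fin (m + 1)))) ψ.target :=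
  (contMDiff_coe_usphere.comp_contMDiffOn (contMDiffOn_symm_of_mem_maximalAtlas hψ)).contDiffOn

lemma contDiffOn_sphFrame (i : Fin m) : ContDiffOn ℝ ∞ (fun u => sphFrame ψ u i) ψ.target :=
  ((contDiffOn_coe_symm hψ).fderiv_of_isOpen ψ.open_target (by simp)).clm_apply contDiffOn_const

omit hψ in
lemma norm_coe_symm (u : EuclideanSpace ℝ (Fin m)) :
    ‖(ψ.symm u : EuclideanSpace ℝ (Fin (m + 1)))‖ = 1 := by simp

/-- Differentiate ‖θ(u)‖² = 1. -/
lemma inner_sphFrame {u : EuclideanSpace ℝ (Fin m)} (hu : u ∈ ψ.target) (i : Fin m) :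
    inner ℝ (ψ.symm u : EuclideanSpace ℝ (Fin (m + 1))) (sphFrame ψ u i) = 0 := by
  have h1 := (((contDiffOn_coe_symm hψ).contDiffAt (ψ.open_target.mem_nhds hu)).differentiableAt
    (by simp)).hasFDerivAt
  have h2 := h1.norm_sq
  have h3 : (fun u => ‖(ψ.symm u : EuclideanSpace ℝ (Fin (m + 1)))‖ ^ 2) = fun _ => 1 := by
    funext u; simp
  rw [h3] at h2
  have h4 := congrArg (fun L : EuclideanSpace ℝ (Fin m) →L[ℝ] ℝ => L (EuclideanSpace.single i 1))
    (h2.unique (hasFDerivAt_const (1 : ℝ) u))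
  simpa [sphFrame] using h4

lemma fderiv_coe_symm_injective {u : EuclideanSpace ℝ (Fin m)} (hu : u ∈ ψ.target) :
    Function.Injective
      (fderiv ℝ (fun u => (ψ.symm u : EuclideanSpace ℝ (Fin (m + 1)))) u) := by
  have hd : MDifferentiableAt (𝓡 m) (𝓡 m) ψ.symm u := mdiffAt_chart_symm hψ hu
  have hc : MDifferentiableAt (𝓡 m) (𝓡 (m + 1))
      ((↑) : USphere m → EuclideanSpace ℝ (Fin (m + 1))) (ψ.symm u) :=
    (contMDiff_coe_usphere (N := 1)).mdifferentiableAt (by simp)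
  have h1 := mfderiv_comp u hc hd
  rw [mfderiv_eq_fderiv] at h1
  intro v w hvw
  have h2 : mfderiv (𝓡 m) (𝓡 (m + 1)) ((↑) : USphere m → EuclideanSpace ℝ (Fin (m + 1)))
      (ψ.symm u) (mfderiv (𝓡 m) (𝓡 m) ψ.symm u v) =
      mfderiv (𝓡 m) (𝓡 (m + 1)) ((↑) : USphere m → EuclideanSpace ℝ (Fin (m + 1)))
      (ψ.symm u) (mfderiv (𝓡 m) (𝓡 m) ψ.symm u w) := by
    have e1 := congrArg (fun L : EuclideanSpace ℝ (Fin m) →L[ℝ] EuclideanSpace ℝ (Fin (m + 1)) =>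
      L v) h1
    have e2 := congrArg (fun L : EuclideanSpace ℝ (Fin m) →L[ℝ] EuclideanSpace ℝ (Fin (m + 1)) =>
      L w) h1
    exact e1.symm.trans (Eq.trans hvw e2)
  have h3 := mfderiv_coe_usphere_injective (ψ.symm u) h2
  have h4 := congrArg (tcoord ψ (ψ.symm u)) h3
  exact (tcoord_symm hψ hu v).symm.trans (h4.trans (tcoord_symm hψ hu w))

end Sphere

/-! ### Smoothness of the rescaled angular components jointly with the centre. -/

section Polar

variable {m : ℕ} {M : Type*} [TopologicalSpace M] [ChartedSpace (EuclideanSpace ℝ (Fin (m + 1))) M]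
  [IsManifold (𝓡 (m + 1)) ∞ M] [RiemannianBundle (fun x : M => TangentSpace (𝓡 (m + 1)) x)]
  {ψ : OpenPartialHomeomorph (USphere m) (EuclideanSpace ℝ (Fin m))}
  (hψ : ψ ∈ IsManifold.maximalAtlas (𝓡 m) ∞ (USphere m)) {ε : ℝ}

include hψ

omit [IsManifold (𝓡 (m + 1)) ∞ M] in
theorem contMDiffOn_tGram {U : Set M} {s : Fin (m + 1) → ∀ x : M, TangentSpace (𝓡 (m + 1)) x}
    (hG : ∀ k l, ContMDiffOn ((𝓡 (m + 1)).prod (𝓡 (m + 1))) 𝓘(ℝ, ℝ) ∞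
      (fun q : M × EuclideanSpace ℝ (Fin (m + 1)) => expGram (fun i => s i q.1) q.2 k l)
      (U ×ˢ Metric.ball 0 ε)) (i j : Fin m) :
    ContMDiffOn ((𝓡 (m + 1)).prod 𝓘(ℝ, ℝ × EuclideanSpace ℝ (Fin m))) 𝓘(ℝ, ℝ) ∞
      (fun q : M × (ℝ × EuclideanSpace ℝ (Fin m)) => tGram (fun i => s i q.1) ψ q.2.1 q.2.2 i j)
      (U ×ˢ (Ioo (-ε) ε ×ˢ ψ.target)) := by
  have h2 : ContMDiffOn ((𝓡 (m + 1)).prod 𝓘(ℝ, ℝ × EuclideanSpace ℝ (Fin m)))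
      𝓘(ℝ, ℝ × EuclideanSpace ℝ (Fin m)) ∞
      (fun q : M × (ℝ × EuclideanSpace ℝ (Fin m)) => q.2) (U ×ˢ (Ioo (-ε) ε ×ˢ ψ.target)) :=
    contMDiffOn_snd
  have hfr : ∀ (i : Fin m) (k : Fin (m + 1)),
      ContMDiffOn ((𝓡 (m + 1)).prod 𝓘(ℝ, ℝ × EuclideanSpace ℝ (Fin m))) 𝓘(ℝ, ℝ) ∞
      (fun q : M × (ℝ × EuclideanSpace ℝ (Fin m)) => sphFrame ψ q.2.2 i k)
      (U ×ˢ (Ioo (-ε) ε ×ˢ ψ.target)) := fun i k => by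
    have h1 : ContDiffOn ℝ ∞ (fun z : ℝ × EuclideanSpace ℝ (Fin m) => sphFrame ψ z.2 i k)
        (Ioo (-ε) ε ×ˢ ψ.target) :=
      (EuclideanSpace.proj k : EuclideanSpace ℝ (Fin (m + 1)) →L[ℝ] ℝ).contDiff.comp_contDiffOn
        ((contDiffOn_sphFrame hψ i).comp contDiffOn_snd fun z hz => hz.2)
    exact h1.contMDiffOn.comp h2 fun q hq => hq.2
  have hθ : ContDiffOn ℝ ∞ (fun z : ℝ × EuclideanSpace ℝ (Fin m) =>
      z.1 • (ψ.symm z.2 : EuclideanSpace ℝ (Fin (m + 1)))) (Ioo (-ε) ε ×ˢ ψ.target) :=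
    contDiffOn_fst.smul ((contDiffOn_coe_symm hψ).comp contDiffOn_snd fun z hz => hz.2)
  have hpt : ContMDiffOn ((𝓡 (m + 1)).prod 𝓘(ℝ, ℝ × EuclideanSpace ℝ (Fin m)))
      ((𝓡 (m + 1)).prod (𝓡 (m + 1))) ∞
      (fun q : M × (ℝ × EuclideanSpace ℝ (Fin m)) =>
        (q.1, q.2.1 • (ψ.symm q.2.2 : EuclideanSpace ℝ (Fin (m + 1)))))
      (U ×ˢ (Ioo (-ε) ε ×ˢ ψ.target)) :=
    contMDiffOn_fst.prodMk (hθ.contMDiffOn.comp h2 fun q hq => hq.2)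
  have hmaps : MapsTo (fun q : M × (ℝ × EuclideanSpace ℝ (Fin m)) =>
        (q.1, q.2.1 • (ψ.symm q.2.2 : EuclideanSpace ℝ (Fin (m + 1)))))
      (U ×ˢ (Ioo (-ε) ε ×ˢ ψ.target)) (U ×ˢ Metric.ball 0 ε) := fun q hq => by
    refine ⟨hq.1, ?_⟩
    simpa [norm_smul] using abs_lt.2 hq.2.1
  refine (contMDiffOn_finsetSum (t := Finset.univ) fun k _ =>
    contMDiffOn_finsetSum (t := Finset.univ) fun l _ =>
      ((hfr i k).mul (hfr j l)).mul ((hG k l).comp hpt hmaps)).congr fun q _ => ?_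
  simp [tGram]

end Polar
/-! ### Invariance of the Laplacian under changes of coordinates -/

section Jacobian

variable {d : ℕ}

lemma contDiffAt_det {N : WithTop ℕ∞} {X : Type*} [NormedAddCommGroup X]
    [NormedSpace ℝ X] {G : X → Matrix (Fin d) (Fin d) ℝ} {y : X}
    (hG : ∀ i j, ContDiffAt ℝ N (fun z => G z i j) y) : ContDiffAt ℝ N (fun z => (G z).det) y := by
  simp only [Matrix.det_apply']
  exact ContDiffAt.sum fun σ _ => contDiffAt_const.mul (contDiffAt_prod fun i _ => hG _ _)

lemma contDiffAt_inv_apply {N : WithTop ℕ∞} {X : Type*} [NormedAddCommGroup X]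
    [NormedSpace ℝ X] {G : X → Matrix (Fin d) (Fin d) ℝ} {y : X}
    (hG : ∀ i j, ContDiffAt ℝ N (fun z => G z i j) y) (hdet : (G y).det ≠ 0) (i j : Fin d) :
    ContDiffAt ℝ N (fun z => (G z)⁻¹ i j) y := by
  simp only [Matrix.inv_def, Matrix.smul_apply, smul_eq_mul, Ring.inverse_eq_inv',
    Matrix.adjugate_apply]
  refine ((contDiffAt_det hG).inv hdet).mul (contDiffAt_det fun k l => ?_)
  rcases eq_or_ne k j with rfl | h
  · simpa using contDiffAt_const
  · simpa [Matrix.updateRow_ne h] using hG k l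

/-- The derivative of the determinant at an invertible matrix. -/
lemma hasFDerivAt_det {X : Type*} [NormedAddCommGroup X] [NormedSpace ℝ X]
    {A : X → Matrix (Fin d) (Fin d) ℝ} {y : X}
    {A' : Fin d → Fin d → X →L[ℝ] ℝ} (hA : ∀ i j, HasFDerivAt (fun z => A z i j) (A' i j) y)
    (hdet : IsUnit (A y).det) :
    HasFDerivAt (fun z => (A z).det) ((A y).det • ∑ p, ∑ q, (A y)⁻¹ p q • A' q p) y := by
  let F : (Fin d → Fin d → ℝ) → ℝ := fun N => (Matrix.of N).det
  have hF : ContDiff ℝ 1 F := by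
    rw [← contDiffOn_univ]
    refine contDiffOn_det (G := fun N : Fin d → Fin d → ℝ => Matrix.of N) fun i j => ?_
    have : ContDiff ℝ 1 fun N : Fin d → Fin d → ℝ => N i j := by fun_prop
    exact this.contDiffOn
  have hFd : ∀ N, HasFDerivAt F (fderiv ℝ F N) N := fun N =>
    (hF.differentiable (by simp) N).hasFDerivAt
  have hline : ∀ N H : Fin d → Fin d → ℝ, IsUnit (Matrix.of N).det →
      fderiv ℝ F N H = (Matrix.of N).det * ((Matrix.of N)⁻¹ * Matrix.of H).trace := by
    intro N H hN
    have h1 : HasDerivAt (fun t : ℝ => F (N + t • H)) (fderiv ℝ F N H) 0 := by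
      have h2 : HasDerivAt (fun t : ℝ => N + t • H) H 0 := by
        have := ((hasDerivAt_id (0 : ℝ)).smul_const H).const_add N
        rwa [one_smul] at this
      have h3 : HasFDerivAt F (fderiv ℝ F N) (N + (0 : ℝ) • H) := by
        rw [zero_smul, add_zero]; exact hFd N
      exact h3.comp_hasDerivAt 0 h2
    have h4 : (fun t : ℝ => F (N + t • H)) = fun t : ℝ =>
        (Matrix.of N).det * (1 + t • ((Matrix.of N)⁻¹ * Matrix.of H)).det := by
      funext t
      rw [← Matrix.det_mul, Matrix.mul_add, Matrix.mul_one, Matrix.mul_smul, ← Matrix.mul_assoc,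
        Matrix.mul_nonsing_inv _ hN, Matrix.one_mul]
      rfl
    rw [h4] at h1
    have h5 : HasDerivAt (fun t : ℝ => (1 + t • ((Matrix.of N)⁻¹ * Matrix.of H)).det)
        ((Matrix.of N)⁻¹ * Matrix.of H).trace 0 := by
      -- The expansion det(1 + tC) = 1 + t tr C + t² p(t) with p a polynomial; only the trace
      -- survives at t = 0. It applies after writing N + tH = N(1 + tN⁻¹H).
      have h6 : HasDerivAt (fun t : ℝ => (1 : ℝ) +
          ((Matrix.of N)⁻¹ * Matrix.of H).trace * t + (Polynomial.divX (Polynomial.divX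
            (1 + (Polynomial.X : Polynomial ℝ) •
              ((Matrix.of N)⁻¹ * Matrix.of H).map Polynomial.C).det)).eval t * t ^ 2) _ 0 :=
        (((hasDerivAt_id (0 : ℝ)).const_mul _).const_add 1).add
          ((Polynomial.hasDerivAt _ 0).mul (hasDerivAt_pow 2 (0 : ℝ)))
      simp only [← Matrix.det_one_add_smul] at h6
      simpa using h6
    exact h1.unique (h5.const_mul _)
  have hcomp : HasFDerivAt (fun z => F (fun i j => A z i j))
      ((fderiv ℝ F (fun i j => A y i j)).comp
        (ContinuousLinearMap.pi fun i => ContinuousLinearMap.pi fun j => A' i j)) y :=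
    (hFd _).comp y (hasFDerivAt_pi.2 fun i => hasFDerivAt_pi.2 fun j => hA i j)
  refine hcomp.congr_fderiv ?_
  ext v
  have h6 : (Matrix.of fun i j => A y i j) = A y := rfl
  rw [ContinuousLinearMap.comp_apply, hline _ _ (by rwa [h6]), h6]
  simp [Matrix.trace, Matrix.mul_apply]

/-- The Jacobian matrix. -/
noncomputable def jac (Φ : EuclideanSpace ℝ (Fin d) → EuclideanSpace ℝ (Fin d))
    (z : EuclideanSpace ℝ (Fin d)) : Matrix (Fin d) (Fin d) ℝ :=
  Matrix.of fun i j => fderiv ℝ Φ z (EuclideanSpace.single j 1) i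

lemma pd_comp {f : EuclideanSpace ℝ (Fin d) → ℝ}
    {Φ : EuclideanSpace ℝ (Fin d) → EuclideanSpace ℝ (Fin d)} {z : EuclideanSpace ℝ (Fin d)}
    (hf : DifferentiableAt ℝ f (Φ z)) (hΦ : DifferentiableAt ℝ Φ z) (j : Fin d) :
    pd j (f ∘ Φ) z = ∑ k, pd k f (Φ z) * jac Φ z k j := by
  rw [pd, fderiv_comp z hf hΦ, ContinuousLinearMap.comp_apply, fderiv_eq_sum_pd]
  exact Finset.sum_congr rfl fun k _ => mul_comm _ _

lemma pd_congr {f g : EuclideanSpace ℝ (Fin d) → ℝ} {y : EuclideanSpace ℝ (Fin d)}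
    (h : f =ᶠ[𝓝 y] g) (i : Fin d) : pd i f y = pd i g y := by
  rw [pd, pd, h.fderiv_eq]

lemma pd_sum {ι : Type*} {s : Finset ι} {f : ι → EuclideanSpace ℝ (Fin d) → ℝ}
    {y : EuclideanSpace ℝ (Fin d)} (hf : ∀ k ∈ s, DifferentiableAt ℝ (f k) y) (i : Fin d) :
    pd i (fun z => ∑ k ∈ s, f k z) y = ∑ k ∈ s, pd i (f k) y := by
  rw [pd, fderiv_fun_sum hf, _root_.sum_apply]
  rfl

lemma pd_mul {f g : EuclideanSpace ℝ (Fin d) → ℝ} {y : EuclideanSpace ℝ (Fin d)}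
    (hf : DifferentiableAt ℝ f y) (hg : DifferentiableAt ℝ g y) (i : Fin d) :
    pd i (fun z => f z * g z) y = f y * pd i g y + pd i f y * g y := by
  rw [pd, fderiv_fun_mul hf hg]
  simp [pd, mul_comm]

lemma pd_const (c : ℝ) (y : EuclideanSpace ℝ (Fin d)) (i : Fin d) : pd i (fun _ => c) y = 0 := by
  simp [pd]

/-- The divergence of the rows of the cofactor matrix of a Jacobian matrix vanishes. -/
lemma sum_pd_det_mul_inv {A : EuclideanSpace ℝ (Fin d) → Matrix (Fin d) (Fin d) ℝ}
    {y : EuclideanSpace ℝ (Fin d)} (hA : ∀ i j, ContDiffAt ℝ 1 (fun z => A z i j) y)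
    (hdet : (A y).det ≠ 0)
    (hsymm : ∀ i p q, pd i (fun z => A z p q) y = pd q (fun z => A z p i) y) (l : Fin d) :
    ∑ i, pd i (fun z => (A z).det * (A z)⁻¹ i l) y = 0 := by
  have hunit : IsUnit (A y).det := isUnit_iff_ne_zero.2 hdet
  have hAd : ∀ i j, DifferentiableAt ℝ (fun z => A z i j) y := fun i j =>
    (hA i j).differentiableAt (by simp)
  have hdd := hasFDerivAt_det (fun i j => (hAd i j).hasFDerivAt) hunit
  have hne : ∀ᶠ z in 𝓝 y, (A z).det ≠ 0 := hdd.continuousAt.eventually_ne hdet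
  have hinv : ∀ i j, DifferentiableAt ℝ (fun z => (A z)⁻¹ i j) y := fun i j =>
    (contDiffAt_inv_apply hA hdet i j).differentiableAt (by simp)
  let dA : Fin d → Matrix (Fin d) (Fin d) ℝ := fun i => Matrix.of fun p q => pd i (fun z => A z p q) y
  let dI : Fin d → Matrix (Fin d) (Fin d) ℝ := fun i =>
    Matrix.of fun p q => pd i (fun z => (A z)⁻¹ p q) y
  -- Obtained by differentiating A⁻¹A = 1, which holds in a neighbourhood of y.
  have hI : ∀ i, dI i = -((A y)⁻¹ * dA i * (A y)⁻¹) := by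
    intro i
    have h0 : dI i * A y + (A y)⁻¹ * dA i = 0 := by
      ext p r
      have h1 : (fun z => ∑ q, (A z)⁻¹ p q * A z q r) =ᶠ[𝓝 y]
          fun _ => (1 : Matrix (Fin d) (Fin d) ℝ) p r := by
        filter_upwards [hne] with z hz
        rw [← Matrix.mul_apply, Matrix.nonsing_inv_mul _ (isUnit_iff_ne_zero.2 hz)]
      have h2 := pd_congr h1 i
      rw [pd_const, pd_sum (fun q _ => (hinv p q).fun_mul (hAd q r))] at h2
      simp only [pd_mul (hinv _ _) (hAd _ _), Finset.sum_add_distrib] at h2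
      rw [Matrix.add_apply, Matrix.mul_apply, Matrix.mul_apply, add_comm]
      exact h2
    have h3 : dI i * A y * (A y)⁻¹ = -((A y)⁻¹ * dA i) * (A y)⁻¹ := by
      rw [eq_neg_of_add_eq_zero_left h0]
    rwa [Matrix.mul_assoc, Matrix.mul_nonsing_inv _ hunit, Matrix.mul_one, Matrix.neg_mul] at h3
  have hD : ∀ i, pd i (fun z => (A z).det) y = (A y).det * ∑ p, ∑ q, (A y)⁻¹ p q * dA i q p := by
    intro i
    rw [pd, hdd.fderiv]
    simp [dA, pd]
  have hP : ∀ i, pd i (fun z => (A z).det * (A z)⁻¹ i l) y = (A y).det *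
      (∑ p, ∑ q, (A y)⁻¹ p q * dA i q p * (A y)⁻¹ i l -
        ∑ p, ∑ q, (A y)⁻¹ i q * dA i q p * (A y)⁻¹ p l) := by
    intro i
    have h1 : pd i (fun z => (A z)⁻¹ i l) y = dI i i l := rfl
    rw [pd_mul hdd.differentiableAt (hinv i l), hD, h1, hI]
    simp only [Matrix.neg_apply, Matrix.mul_apply, Finset.sum_mul, mul_assoc (A y).det]
    rw [mul_sub, mul_neg, neg_add_eq_sub]
  simp only [hP, ← Finset.mul_sum, Finset.sum_sub_distrib]
  rw [mul_eq_zero]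
  right
  -- After this exchange the two triple sums agree term by term: the curl condition ∂ᵢA_{qp} =
  -- ∂ₚA_{qi} swaps the differentiation index with the column index.
  rw [sub_eq_zero, Finset.sum_comm]
  refine Finset.sum_congr rfl fun p _ => Finset.sum_congr rfl fun i _ =>
    Finset.sum_congr rfl fun q _ => ?_
  have : dA i q p = dA p q i := hsymm i q p
  rw [this]

end Jacobian
-- The coordinate Laplacian under a change of variables.
section CoordLaplacian

variable {d : ℕ}

lemma coordLaplacian_congr {G G' : EuclideanSpace ℝ (Fin d) → Matrix (Fin d) (Fin d) ℝ}
    {f f' : EuclideanSpace ℝ (Fin d) → ℝ} {y : EuclideanSpace ℝ (Fin d)}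
    (hG : G =ᶠ[𝓝 y] G') (hf : f =ᶠ[𝓝 y] f') :
    coordLaplacian G f y = coordLaplacian G' f' y := by
  unfold coordLaplacian
  rw [hG.self_of_nhds]
  congr 2
  refine Finset.sum_congr rfl fun i _ => pd_congr ?_ i
  filter_upwards [hG, hf.eventuallyEq_nhds] with z hz hz'
  rw [hz]
  exact Finset.sum_congr rfl fun j _ => by rw [pd_congr hz' j]

lemma contDiffAt_jac {N : WithTop ℕ∞} {Φ : EuclideanSpace ℝ (Fin d) → EuclideanSpace ℝ (Fin d)}
    {y : EuclideanSpace ℝ (Fin d)} (hΦ : ContDiffAt ℝ (N + 1) Φ y) (i j : Fin d) :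
    ContDiffAt ℝ N (fun z => jac Φ z i j) y :=
  (EuclideanSpace.proj i : EuclideanSpace ℝ (Fin d) →L[ℝ] ℝ).contDiff.contDiffAt.comp y
    ((hΦ.fderiv_right le_rfl).clm_apply contDiffAt_const)

lemma pd_jac_symm {Φ : EuclideanSpace ℝ (Fin d) → EuclideanSpace ℝ (Fin d)}
    {y : EuclideanSpace ℝ (Fin d)} (hΦ : ContDiffAt ℝ 2 Φ y) (i p q : Fin d) :
    pd i (fun z => jac Φ z p q) y = pd q (fun z => jac Φ z p i) y := by
  have hd : HasFDerivAt (fderiv ℝ Φ) (fderiv ℝ (fderiv ℝ Φ) y) y :=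
    ((hΦ.fderiv_right (m := 1) (by norm_num)).differentiableAt (by simp)).hasFDerivAt
  have h1 : ∀ i q, pd i (fun z => jac Φ z p q) y =
      fderiv ℝ (fderiv ℝ Φ) y (EuclideanSpace.single i 1) (EuclideanSpace.single q 1) p := by
    intro i q
    have h2 : HasFDerivAt (fun z => jac Φ z p q) _ y :=
      (EuclideanSpace.proj p : EuclideanSpace ℝ (Fin d) →L[ℝ] ℝ).hasFDerivAt.comp y
        (hd.clm_apply (hasFDerivAt_const (EuclideanSpace.single q (1 : ℝ)) y))
    rw [pd, h2.fderiv]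
    simp
  rw [h1, h1, (hΦ.isSymmSndFDerivAt (by simp)) (EuclideanSpace.single i 1)]

/-- The Laplacian in coordinates is invariant under changes of coordinates. -/
theorem coordLaplacian_comp {Φ : EuclideanSpace ℝ (Fin d) → EuclideanSpace ℝ (Fin d)}
    {y : EuclideanSpace ℝ (Fin d)} {G G' : EuclideanSpace ℝ (Fin d) → Matrix (Fin d) (Fin d) ℝ}
    {f : EuclideanSpace ℝ (Fin d) → ℝ} (hΦ : ContDiffAt ℝ 2 Φ y) (hdet : (jac Φ y).det ≠ 0)
    (hG' : ∀ i j, ContDiffAt ℝ 1 (fun z => G' z i j) (Φ y)) (hpos : 0 < (G' (Φ y)).det)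
    (hG : ∀ᶠ z in 𝓝 y, G z = (jac Φ z)ᵀ * G' (Φ z) * jac Φ z) (hf : ContDiffAt ℝ 2 f (Φ y)) :
    coordLaplacian G (f ∘ Φ) y = coordLaplacian G' f (Φ y) := by
  -- W is the gradient of f weighted by the volume density, so the Laplacian is minus its divergence
  -- divided by that density.
  let W : Fin d → EuclideanSpace ℝ (Fin d) → ℝ := fun l z =>
    ∑ k, (G' z)⁻¹ l k * √(G' z).det * pd k f z
  have hΦd : DifferentiableAt ℝ Φ y := hΦ.differentiableAt (by simp)
  have hjac : ∀ i j, ContDiffAt ℝ 1 (fun z => jac Φ z i j) y := fun i j =>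
    contDiffAt_jac (N := 1) (by rwa [one_add_one_eq_two]) i j
  have hdetd := contDiffAt_det hjac
  have hdet'd := contDiffAt_det hG'
  have hW : ∀ l, DifferentiableAt ℝ (W l) (Φ y) := fun l => by
    have hpd : ∀ k, ContDiffAt ℝ 1 (pd k f) (Φ y) := fun k =>
      (hf.fderiv_right (m := 1) (by norm_num)).clm_apply contDiffAt_const
    exact (ContDiffAt.sum fun k _ => ((contDiffAt_inv_apply hG' hpos.ne' l k).mul
      (hdet'd.sqrt hpos.ne')).mul (hpd k)).differentiableAt (by simp)
  -- the sign of the Jacobian determinant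
  obtain ⟨σ, hσ⟩ : ∃ σ : ℝ, ∀ᶠ z in 𝓝 y, |(jac Φ z).det| = σ * (jac Φ z).det := by
    rcases hdet.lt_or_gt with h | h
    · refine ⟨-1, ?_⟩
      filter_upwards [hdetd.continuousAt.eventually_lt continuousAt_const h] with z hz
      rw [abs_of_neg hz]; ring
    · refine ⟨1, ?_⟩
      filter_upwards [continuousAt_const.eventually_lt hdetd.continuousAt h] with z hz
      rw [abs_of_pos hz]; ring
  have hevf : ∀ᶠ z in 𝓝 y, DifferentiableAt ℝ f (Φ z) :=
    hΦd.continuousAt.eventually ((hf.eventually (by simp)).mono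
      fun z hz => hz.differentiableAt (by simp))
  have hevΦ : ∀ᶠ z in 𝓝 y, DifferentiableAt ℝ Φ z :=
    (hΦ.eventually (by simp)).mono fun z hz => hz.differentiableAt (by simp)
  have hev0 : ∀ᶠ z in 𝓝 y, (jac Φ z).det ≠ 0 := hdetd.continuousAt.eventually_ne hdet
  have hevp : ∀ᶠ z in 𝓝 y, 0 < (G' (Φ z)).det :=
    hΦd.continuousAt.eventually (continuousAt_const.eventually_lt hdet'd.continuousAt hpos)
  have hsqrt : ∀ z, G z = (jac Φ z)ᵀ * G' (Φ z) * jac Φ z →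
      √(G z).det = |(jac Φ z).det| * √(G' (Φ z)).det := by
    intro z hz
    rw [hz, Matrix.det_mul, Matrix.det_mul, Matrix.det_transpose, mul_right_comm,
      Real.sqrt_mul (mul_self_nonneg _), Real.sqrt_mul_self_eq_abs]
  -- The weighted gradient upstairs is the Piola transform |det J| J⁻¹ W of the one downstairs. The
  -- sign σ of det J is locally constant, so it passes through derivatives.
  have hV : ∀ i, (fun z => ∑ j, (G z)⁻¹ i j * √(G z).det * pd j (f ∘ Φ) z) =ᶠ[𝓝 y]
      fun z => ∑ l, σ * (((jac Φ z).det * (jac Φ z)⁻¹ i l) * W l (Φ z)) := by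
    intro i
    filter_upwards [hG, hσ, hevf, hevΦ, hev0, hevp] with z hz hzσ hzf hzΦ hz0 hzp
    have hu : IsUnit (jac Φ z).det := isUnit_iff_ne_zero.2 hz0
    have hinv : (G z)⁻¹ * (jac Φ z)ᵀ = (jac Φ z)⁻¹ * (G' (Φ z))⁻¹ := by
      rw [hz, Matrix.mul_inv_rev, Matrix.mul_inv_rev, Matrix.mul_assoc, Matrix.mul_assoc,
        Matrix.nonsing_inv_mul _ (by rwa [Matrix.det_transpose]), Matrix.mul_one]
    have hinv' : ∀ k, ∑ j, (G z)⁻¹ i j * jac Φ z k j = ∑ l, (jac Φ z)⁻¹ i l * (G' (Φ z))⁻¹ l k := by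
      intro k
      have := congrFun (congrFun hinv i) k
      simpa only [Matrix.mul_apply, Matrix.transpose_apply] using this
    calc ∑ j, (G z)⁻¹ i j * √(G z).det * pd j (f ∘ Φ) z
        = √(G z).det * ∑ k, (∑ j, (G z)⁻¹ i j * jac Φ z k j) * pd k f (Φ z) := by
          simp only [pd_comp hzf hzΦ, Finset.mul_sum, Finset.sum_mul]
          rw [Finset.sum_comm]
          exact Finset.sum_congr rfl fun _ _ => Finset.sum_congr rfl fun _ _ => by ring
      _ = _ := by
          simp only [hinv', hsqrt z hz, hzσ, W, Finset.mul_sum, Finset.sum_mul]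
          rw [Finset.sum_comm]
          exact Finset.sum_congr rfl fun _ _ => Finset.sum_congr rfl fun _ _ => by ring
  have hinvd : ∀ i l, DifferentiableAt ℝ (fun z => (jac Φ z)⁻¹ i l) y := fun i l =>
    (contDiffAt_inv_apply hjac hdet i l).differentiableAt (by simp)
  have hP : ∀ i l, DifferentiableAt ℝ (fun z => (jac Φ z).det * (jac Φ z)⁻¹ i l) y := fun i l =>
    (hdetd.differentiableAt (by simp)).fun_mul (hinvd i l)
  have hWΦ : ∀ l, DifferentiableAt ℝ (fun z => W l (Φ z)) y := fun l => (hW l).comp y hΦd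
  have hpdV : ∀ i, pd i (fun z => ∑ l, σ * (((jac Φ z).det * (jac Φ z)⁻¹ i l) * W l (Φ z))) y =
      ∑ l, σ * ((jac Φ y).det * (jac Φ y)⁻¹ i l * ∑ k, pd k (W l) (Φ y) * jac Φ y k i) +
      ∑ l, σ * (pd i (fun z => (jac Φ z).det * (jac Φ z)⁻¹ i l) y * W l (Φ y)) := by
    intro i
    rw [pd_sum fun l _ => ((hP i l).fun_mul (hWΦ l)).const_mul σ, ← Finset.sum_add_distrib]
    refine Finset.sum_congr rfl fun l _ => ?_
    rw [pd_mul (differentiableAt_const σ) ((hP i l).fun_mul (hWΦ l)), pd_const,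
      pd_mul (hP i l) (hWΦ l)]
    have := pd_comp (hW l) hΦd i
    change pd i (fun z => W l (Φ z)) y = _ at this
    rw [this]
    ring
  -- The Piola identity removes the terms where a derivative falls on det J · J⁻¹; in the others J
  -- J⁻¹ = 1 collapses the double sum to the divergence of W.
  have hpiola := sum_pd_det_mul_inv hjac hdet (pd_jac_symm hΦ)
  have hu : IsUnit (jac Φ y).det := isUnit_iff_ne_zero.2 hdet
  have hJJ : ∀ k l, ∑ i, jac Φ y k i * (jac Φ y)⁻¹ i l = (1 : Matrix (Fin d) (Fin d) ℝ) k l := by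
    intro k l
    rw [← Matrix.mul_apply, Matrix.mul_nonsing_inv _ hu]
  have hsum : ∑ i, pd i (fun z => ∑ j, (G z)⁻¹ i j * √(G z).det * pd j (f ∘ Φ) z) y =
      σ * (jac Φ y).det * ∑ l, pd l (W l) (Φ y) := by
    simp only [fun i => pd_congr (hV i) i, hpdV, Finset.sum_add_distrib]
    have h2 : ∑ i, ∑ l, σ * (pd i (fun z => (jac Φ z).det * (jac Φ z)⁻¹ i l) y * W l (Φ y)) = 0 := by
      rw [Finset.sum_comm]
      refine Finset.sum_eq_zero fun l _ => ?_
      rw [← Finset.mul_sum, ← Finset.sum_mul, hpiola, zero_mul, mul_zero]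
    rw [h2, add_zero]
    have h3 : ∀ l, ∑ i, ∑ k, pd k (W l) (Φ y) * (jac Φ y k i * (jac Φ y)⁻¹ i l) =
        pd l (W l) (Φ y) := by
      intro l
      rw [Finset.sum_comm]
      simp only [← Finset.mul_sum, hJJ, Matrix.one_apply]
      simp
    rw [Finset.sum_comm, Finset.mul_sum]
    refine Finset.sum_congr rfl fun l _ => ?_
    rw [← h3 l, Finset.mul_sum]
    refine Finset.sum_congr rfl fun i _ => ?_
    rw [Finset.mul_sum, Finset.mul_sum, Finset.mul_sum]
    exact Finset.sum_congr rfl fun k _ => by ring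
  have habs : |(jac Φ y).det| = σ * (jac Φ y).det := hσ.self_of_nhds
  unfold coordLaplacian
  rw [hsum, hsqrt y hG.self_of_nhds, ← habs]
  have hne : |(jac Φ y).det| ≠ 0 := abs_ne_zero.2 hdet
  have hne' : √(G' (Φ y)).det ≠ 0 := (Real.sqrt_pos.2 hpos).ne'
  simp only [W]
  field_simp

end CoordLaplacian
/-! ### The Laplace–Beltrami operator in an arbitrary chart -/

/-- A field of bilinear forms which is a smooth Riemannian metric in all charts. -/
structure IsRiemannianForm {d : ℕ} {N : Type*} [TopologicalSpace N]
    [ChartedSpace (EuclideanSpace ℝ (Fin d)) N]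
    (h : ∀ p : N, TangentSpace (𝓡 d) p → TangentSpace (𝓡 d) p → ℝ) : Prop where
  add_left : ∀ p u v w, h p (u + v) w = h p u w + h p v w
  smul_left : ∀ p (c : ℝ) v w, h p (c • v) w = c * h p v w
  add_right : ∀ p u v w, h p u (v + w) = h p u v + h p u w
  smul_right : ∀ p (c : ℝ) v w, h p v (c • w) = c * h p v w
  smooth : ∀ e ∈ IsManifold.maximalAtlas (𝓡 d) ∞ N, ∀ i j,
    ContDiffOn ℝ ∞ (fun y => pullGram h e.symm y i j) e.target
  posDef : ∀ e ∈ IsManifold.maximalAtlas (𝓡 d) ∞ N, ∀ y ∈ e.target, (pullGram h e.symm y).PosDef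

namespace IsRiemannianForm

variable {d : ℕ} {N : Type*} [TopologicalSpace N] [ChartedSpace (EuclideanSpace ℝ (Fin d)) N]
  {h : ∀ p : N, TangentSpace (𝓡 d) p → TangentSpace (𝓡 d) p → ℝ}

lemma bil_pullGram (hh : IsRiemannianForm h) {k : ℕ} (F : EuclideanSpace ℝ (Fin k) → N)
    (y a b : EuclideanSpace ℝ (Fin k)) :
    bil (pullGram h F y) a b =
      h (F y) (mfderiv (𝓡 k) (𝓡 d) F y a) (mfderiv (𝓡 k) (𝓡 d) F y b) := by
  let B : EuclideanSpace ℝ (Fin d) →ₗ[ℝ] EuclideanSpace ℝ (Fin d) →ₗ[ℝ] ℝ :=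
    LinearMap.mk₂ ℝ (fun v w => h (F y) v w) (hh.add_left (F y)) (hh.smul_left (F y))
      (hh.add_right (F y)) (hh.smul_right (F y))
  let L : EuclideanSpace ℝ (Fin k) →ₗ[ℝ] EuclideanSpace ℝ (Fin d) :=
    (show EuclideanSpace ℝ (Fin k) →L[ℝ] EuclideanSpace ℝ (Fin d) from
      mfderiv (𝓡 k) (𝓡 d) F y).toLinearMap
  have hh : ∀ a : EuclideanSpace ℝ (Fin k), L a = ∑ i, a i • L (EuclideanSpace.single i 1) := by
    intro a
    have h1 : a = ∑ i, a i • (EuclideanSpace.single i 1 : EuclideanSpace ℝ (Fin k)) := by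
      ext j; simp [Pi.single_apply]
    conv_lhs => rw [h1]
    simp [map_sum]
  change _ = B (L a) (L b)
  rw [hh a, hh b, bil_apply]
  simp only [map_sum, map_smul, LinearMap.sum_apply, LinearMap.smul_apply, smul_eq_mul]
  rw [Finset.sum_comm]
  refine Finset.sum_congr rfl fun i _ => ?_
  rw [Finset.mul_sum]
  refine Finset.sum_congr rfl fun j _ => ?_
  change B (L (EuclideanSpace.single j 1)) (L (EuclideanSpace.single i 1)) * _ = _
  ring

variable [IsManifold (𝓡 d) ∞ N] {e : OpenPartialHomeomorph N (EuclideanSpace ℝ (Fin d))}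

lemma eq_bil (hh : IsRiemannianForm h) (he : e ∈ IsManifold.maximalAtlas (𝓡 d) ∞ N) {p : N}
    (hp : p ∈ e.source) (v w : TangentSpace (𝓡 d) p) :
    h p v w = bil (pullGram h e.symm (e p)) (tcoord e p v) (tcoord e p w) := by
  obtain ⟨y, hy, rfl⟩ : ∃ y ∈ e.target, e.symm y = p := ⟨e p, e.map_source hp, e.left_inv hp⟩
  rw [e.right_inv hy, hh.bil_pullGram, symm_tcoord he hy, symm_tcoord he hy]

lemma pullGram_eq (hh : IsRiemannianForm h) (he : e ∈ IsManifold.maximalAtlas (𝓡 d) ∞ N)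
    {F : EuclideanSpace ℝ (Fin d) → N} {y : EuclideanSpace ℝ (Fin d)}
    (hF : MDifferentiableAt (𝓡 d) (𝓡 d) F y) (hy : F y ∈ e.source) :
    pullGram h F y = (jac (e ∘ F) y)ᵀ * pullGram h e.symm (e (F y)) * jac (e ∘ F) y := by
  ext i j
  rw [← bil_single (pullGram h F y), hh.bil_pullGram, hh.eq_bil he hy, tcoord_mfderiv he hF hy,
    tcoord_mfderiv he hF hy, bil_apply, Matrix.mul_apply, Finset.sum_comm]
  simp only [Matrix.mul_apply, Finset.sum_mul, Matrix.transpose_apply]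
  refine Finset.sum_congr rfl fun k _ => Finset.sum_congr rfl fun l _ => ?_
  simp only [jac, Matrix.of_apply]
  ring

/-- The Laplace–Beltrami operator can be computed in any chart. -/
theorem laplaceBeltrami_eq (hh : IsRiemannianForm h)
    (he : e ∈ IsManifold.maximalAtlas (𝓡 d) ∞ N) {p : N} (hp : p ∈ e.source) {f : N → ℝ}
    (hf : ContMDiffAt (𝓡 d) 𝓘(ℝ, ℝ) 2 f p) :
    laplaceBeltrami h f p = coordLaplacian (pullGram h e.symm) (f ∘ e.symm) (e p) := by
  set c := chartAt (EuclideanSpace ℝ (Fin d)) p with hc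
  have hcm : c ∈ IsManifold.maximalAtlas (𝓡 d) ∞ N := IsManifold.chart_mem_maximalAtlas p
  have hpc : p ∈ c.source := mem_chart_source _ p
  have hy : c p ∈ c.target := c.map_source hpc
  have hleft : c.symm (c p) = p := c.left_inv hpc
  have hcs : ContMDiffAt (𝓡 d) (𝓡 d) ∞ c.symm (c p) := contMDiffAt_symm_of_mem_maximalAtlas hcm hy
  have hsrc : ∀ᶠ z in 𝓝 (c p), c.symm z ∈ e.source := by
    refine hcs.continuousAt.eventually_mem (e.open_source.mem_nhds ?_)
    rwa [hleft]
  have hΦy : (e ∘ c.symm) (c p) = e p := by rw [Function.comp_apply, hleft]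
  have hΦ : ContDiffAt ℝ ∞ (e ∘ c.symm) (c p) := by
    refine ContMDiffAt.contDiffAt (ContMDiffAt.comp (c p) ?_ hcs)
    exact contMDiffAt_of_mem_maximalAtlas he (by rwa [hleft])
  have hG : ∀ᶠ z in 𝓝 (c p), pullGram h c.symm z = (jac (e ∘ c.symm) z)ᵀ *
      pullGram h e.symm ((e ∘ c.symm) z) * jac (e ∘ c.symm) z := by
    filter_upwards [hsrc, c.open_target.eventually_mem hy] with z hz hz'
    exact hh.pullGram_eq he (mdiffAt_chart_symm hcm hz') hz
  have hpos := (hh.posDef e he (e p) (e.map_source hp)).det_pos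
  -- The Gram determinant in the chart c is positive and contains this determinant as a factor.
  have hdet : (jac (e ∘ c.symm) (c p)).det ≠ 0 := by
    intro h0
    have h1 := (hh.posDef c hcm (c p) hy).det_pos
    rw [hG.self_of_nhds, Matrix.det_mul, h0, mul_zero] at h1
    exact h1.false
  have hf' : ContDiffAt ℝ 2 (f ∘ e.symm) (e p) := by
    have h1 : ContMDiffAt (𝓡 d) (𝓡 d) 2 e.symm (e p) :=
      (contMDiffAt_symm_of_mem_maximalAtlas he (e.map_source hp)).of_le (by norm_cast)
    refine ContMDiffAt.contDiffAt (ContMDiffAt.comp (e p) ?_ h1)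
    rwa [e.left_inv hp]
  have key := coordLaplacian_comp (G := pullGram h c.symm) (G' := pullGram h e.symm)
    (f := f ∘ e.symm) (hΦ.of_le (by norm_cast)) hdet
    (fun i j => by
      rw [hΦy]
      exact ((hh.smooth e he i j).contDiffAt
        (e.open_target.mem_nhds (e.map_source hp))).of_le (by norm_cast))
    (by rwa [hΦy]) hG (by rwa [hΦy])
  rw [hΦy] at key
  rw [← key, laplaceBeltrami]
  refine coordLaplacian_congr Filter.EventuallyEq.rfl ?_
  filter_upwards [hsrc] with z hz
  change f (c.symm z) = f (e.symm (e (c.symm z)))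
  rw [e.left_inv hz]

end IsRiemannianForm

lemma isRiemannianForm_metric {n : ℕ} {M : Type*} [TopologicalSpace M]
    [ChartedSpace (EuclideanSpace ℝ (Fin n)) M] [IsManifold (𝓡 n) ∞ M]
    [RiemannianBundle (fun x : M => TangentSpace (𝓡 n) x)]
    [IsContMDiffRiemannianBundle (𝓡 n) ∞ (EuclideanSpace ℝ (Fin n))
      (fun x : M => TangentSpace (𝓡 n) x)] :
    IsRiemannianForm (metric (n := n) (M := M)) where
  add_left p u v w := inner_add_left (E := TangentSpace (𝓡 n) p) u v w
  smul_left p c v w := real_inner_smul_left (F := TangentSpace (𝓡 n) p) v w c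
  add_right p u v w := inner_add_right (E := TangentSpace (𝓡 n) p) u v w
  smul_right p c v w := real_inner_smul_right (F := TangentSpace (𝓡 n) p) v w c
  smooth _ he i j := contDiffOn_pullGram_symm he i j
  posDef _ he _ hy := pullGram_symm_posDef he hy

/-! ### Scaling of the Laplacian under a constant factor. -/

section Scaling

variable {d : ℕ}

/-- Singular matrices are included, both inverses being 0 by convention; this keeps the scaling of
the Laplacian free of any nondegeneracy condition. -/
lemma inv_smul_matrix {c : ℝ} (hc : c ≠ 0) (A : Matrix (Fin d) (Fin d) ℝ) :
    (c • A)⁻¹ = c⁻¹ • A⁻¹ := by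
  by_cases h : IsUnit A.det
  · exact Matrix.inv_smul' A (Units.mk0 c hc) h
  · have h' : ¬IsUnit (c • A).det := by
      rw [Matrix.det_smul, isUnit_iff_ne_zero]
      rw [isUnit_iff_ne_zero, not_not] at h
      simp [h]
    rw [Matrix.nonsing_inv_apply_not_isUnit _ h, Matrix.nonsing_inv_apply_not_isUnit _ h', smul_zero]

lemma pd_const_mul (c : ℝ) (f : EuclideanSpace ℝ (Fin d) → ℝ) (y : EuclideanSpace ℝ (Fin d))
    (i : Fin d) : pd i (fun z => c * f z) y = c * pd i f y := by
  have : (fun z => c * f z) = c • f := rfl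
  rw [this, pd, fderiv_const_smul_field]
  rfl

/-- The constant factors of the volume densities cancel and the inverse metric contributes c⁻¹. With
c = r² this accounts for the factor r² in L_θ. -/
lemma coordLaplacian_smul {c : ℝ} (hc : 0 < c)
    (G : EuclideanSpace ℝ (Fin d) → Matrix (Fin d) (Fin d) ℝ) (f : EuclideanSpace ℝ (Fin d) → ℝ)
    (y : EuclideanSpace ℝ (Fin d)) :
    coordLaplacian (fun z => c • G z) f y = c⁻¹ * coordLaplacian G f y := by
  have hs : ∀ z, √(c • G z).det = √(c ^ d) * √(G z).det := fun z => by
    rw [Matrix.det_smul, Fintype.card_fin, Real.sqrt_mul (by positivity)]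
  have hV : ∀ i, pd i (fun z => ∑ j, (c • G z)⁻¹ i j * √(c • G z).det * pd j f z) y =
      (c⁻¹ * √(c ^ d)) * pd i (fun z => ∑ j, (G z)⁻¹ i j * √(G z).det * pd j f z) y := by
    intro i
    rw [← pd_const_mul]
    refine congrArg (fun F => pd i F y) (funext fun z => ?_)
    rw [Finset.mul_sum]
    refine Finset.sum_congr rfl fun j _ => ?_
    rw [hs, inv_smul_matrix hc.ne', Matrix.smul_apply, smul_eq_mul]
    ring
  have h0 : √(c ^ d) ≠ 0 := (Real.sqrt_pos.2 (by positivity)).ne'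
  unfold coordLaplacian
  simp only [hV, ← Finset.mul_sum]
  rw [hs]
  field_simp

end Scaling
/-! ### The metric in geodesic polar coordinates -/

section Algebra

lemma det_eq_of_cons {m : ℕ} {A : Matrix (Fin (m + 1)) (Fin (m + 1)) ℝ} (h0 : A 0 0 = 1)
    (h1 : ∀ j : Fin m, A 0 j.succ = 0) : A.det = (A.submatrix Fin.succ Fin.succ).det := by
  rw [Matrix.det_succ_row_zero, Fin.sum_univ_succ]
  simp [h0, h1]

lemma transpose_mul_mul_apply {d : ℕ} (P G : Matrix (Fin d) (Fin d) ℝ) (i j : Fin d) :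
    (Pᵀ * G * P) i j = bil G (WithLp.toLp 2 fun k => P k i) (WithLp.toLp 2 fun k => P k j) := by
  rw [bil_apply, Matrix.mul_apply, Finset.sum_comm]
  simp only [Matrix.mul_apply, Matrix.transpose_apply, Finset.sum_mul]
  exact Finset.sum_congr rfl fun k _ => Finset.sum_congr rfl fun l _ => by ring

end Algebra

/-! ### Mixed derivatives at radius zero. -/

section MixedDerivative

variable {m : ℕ}

/-- A function whose radial derivative vanishes at radius `0` has vanishing mixed derivatives. -/
lemma pd_of_hasDerivAt_zero {F : ℝ × EuclideanSpace ℝ (Fin m) → ℝ} {I : Set ℝ} (hI : IsOpen I)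
    (h0 : (0 : ℝ) ∈ I) {O : Set (EuclideanSpace ℝ (Fin m))} (hO : IsOpen O)
    (hF : ContDiffOn ℝ ∞ F (I ×ˢ O)) (h : ∀ u ∈ O, HasDerivAt (fun r => F (r, u)) 0 0)
    (k : Fin m) :
    ContDiffOn ℝ ∞ (fun q : ℝ × EuclideanSpace ℝ (Fin m) => pd k (fun u' => F (q.1, u')) q.2)
      (I ×ˢ O) ∧
    ∀ u ∈ O, HasDerivAt (fun r => pd k (fun u' => F (r, u')) u) 0 0 := by
  have hopen : IsOpen (I ×ˢ O) := hI.prod hO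
  have hF' := hF.fderiv_of_isOpen (m := ∞) hopen (by simp)
  have hd : ∀ q ∈ I ×ˢ O, HasFDerivAt F (fderiv ℝ F q) q := fun q hq =>
    ((hF.contDiffAt (hopen.mem_nhds hq)).differentiableAt (by simp)).hasFDerivAt
  have hpd : ∀ q ∈ I ×ˢ O, pd k (fun u' => F (q.1, u')) q.2 =
      fderiv ℝ F q (0, EuclideanSpace.single k 1) := by
    intro q hq
    have h1 : HasFDerivAt (fun u' => F (q.1, u'))
        ((fderiv ℝ F q).comp (ContinuousLinearMap.inr ℝ ℝ (EuclideanSpace ℝ (Fin m)))) q.2 :=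
      (hd q hq).comp q.2 (hasFDerivAt_prodMk_right q.1 q.2)
    rw [pd, h1.fderiv]
    simp
  refine ⟨(hF'.clm_apply contDiffOn_const).congr hpd, fun u hu => ?_⟩
  have hq : ((0 : ℝ), u) ∈ I ×ˢ O := ⟨h0, hu⟩
  have h2 : ContDiffAt ℝ ∞ F (0, u) := hF.contDiffAt (hopen.mem_nhds hq)
  have hDD : HasFDerivAt (fderiv ℝ F) (fderiv ℝ (fderiv ℝ F) (0, u)) (0, u) :=
    ((h2.fderiv_right (m := 1) (by norm_cast)).differentiableAt (by simp)).hasFDerivAt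
  -- Schwarz's theorem: ∂_r∂_kF at (0, u) is the k-th derivative of u' ↦ ∂_rF(0, u'), which vanishes
  -- on O. The smoothness of ∂_kF proved above allows the lemma to be iterated.
  have hsymm := (h2.isSymmSndFDerivAt (by simp; norm_cast)) ((1 : ℝ), (0 : EuclideanSpace ℝ (Fin m)))
    ((0 : ℝ), EuclideanSpace.single k 1)
  have hr : ∀ u' ∈ O, fderiv ℝ F (0, u') (1, 0) = 0 := by
    intro u' hu'
    have h3 : HasDerivAt (fun r : ℝ => F (r, u')) (fderiv ℝ F (0, u') (1, 0)) 0 :=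
      (hd (0, u') ⟨h0, hu'⟩).comp_hasDerivAt 0
        ((hasDerivAt_id (0 : ℝ)).prodMk (hasDerivAt_const (0 : ℝ) u'))
    exact h3.unique (h u' hu')
  have h4 : fderiv ℝ (fderiv ℝ F) (0, u) (0, EuclideanSpace.single k 1) (1, 0) = 0 := by
    have h5 : HasFDerivAt (fun u' => fderiv ℝ F (0, u') (1, 0)) _ u :=
      (hDD.comp u (hasFDerivAt_prodMk_right (0 : ℝ) u)).clm_apply
        (hasFDerivAt_const ((1 : ℝ), (0 : EuclideanSpace ℝ (Fin m))) u)
    have h6 : (fun u' => fderiv ℝ F (0, u') (1, 0)) =ᶠ[𝓝 u] fun _ => (0 : ℝ) := by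
      filter_upwards [hO.mem_nhds hu] with u' hu' using hr u' hu'
    have h7 := h5.unique ((hasFDerivAt_const (0 : ℝ) u).congr_of_eventuallyEq h6)
    simpa using congrArg (fun L : EuclideanSpace ℝ (Fin m) →L[ℝ] ℝ =>
      L (EuclideanSpace.single k 1)) h7
  have h8 : HasDerivAt (fun r : ℝ => fderiv ℝ F (r, u) (0, EuclideanSpace.single k 1))
      (fderiv ℝ (fderiv ℝ F) (0, u) (1, 0) (0, EuclideanSpace.single k 1)) 0 := by
    have h9 := (hDD.comp_hasDerivAt 0
      ((hasDerivAt_id (0 : ℝ)).prodMk (hasDerivAt_const (0 : ℝ) u))).clm_apply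
      (hasDerivAt_const (0 : ℝ) ((0 : ℝ), EuclideanSpace.single k (1 : ℝ)))
    simpa using h9
  rw [hsymm, h4] at h8
  refine h8.congr_of_eventuallyEq ?_
  filter_upwards [hI.mem_nhds h0] with r hr using hpd (r, u) ⟨hr, hu⟩

end MixedDerivative

/-- The matrix whose columns are the Euclidean polar frame. -/
noncomputable def polarMatrix {m : ℕ}
    (ψ : OpenPartialHomeomorph (USphere m) (EuclideanSpace ℝ (Fin m)))
    (u : EuclideanSpace ℝ (Fin m)) : Matrix (Fin (m + 1)) (Fin (m + 1)) ℝ :=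
  Matrix.of fun k j => euclPolarFrame ψ u j k

namespace IsNormalChart

variable {m : ℕ} {M : Type*} [TopologicalSpace M] [ChartedSpace (EuclideanSpace ℝ (Fin (m + 1))) M]
  [RiemannianBundle (fun x : M => TangentSpace (𝓡 (m + 1)) x)]
  {x : M} {b : Fin (m + 1) → TangentSpace (𝓡 (m + 1)) x} {ε : ℝ}
  {e : OpenPartialHomeomorph M (EuclideanSpace ℝ (Fin (m + 1)))}
  {ψ : OpenPartialHomeomorph (USphere m) (EuclideanSpace ℝ (Fin m))}
  (hψ : ψ ∈ IsManifold.maximalAtlas (𝓡 m) ∞ (USphere m))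
  {u : EuclideanSpace ℝ (Fin m)} (hu : u ∈ ψ.target) {r : ℝ}

lemma smul_mem_ball (hr : |r| < ε) (θ : USphere m) :
    r • (θ : EuclideanSpace ℝ (Fin (m + 1))) ∈ Metric.ball 0 ε := by
  simpa [norm_smul] using hr

lemma tGram_apply (r : ℝ) (u : EuclideanSpace ℝ (Fin m)) (i j : Fin m) :
    tGram b ψ r u i j =
      bil (expGram b (r • (ψ.symm u : EuclideanSpace ℝ (Fin (m + 1))))) (sphFrame ψ u i)
        (sphFrame ψ u j) := by
  rw [bil_apply, tGram, Matrix.of_apply]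
  exact Finset.sum_congr rfl fun k _ => Finset.sum_congr rfl fun l _ => mul_comm _ _

lemma bil_tGram (r : ℝ) (u v w : EuclideanSpace ℝ (Fin m)) :
    bil (tGram b ψ r u) v w =
      bil (expGram b (r • (ψ.symm u : EuclideanSpace ℝ (Fin (m + 1)))))
        (fderiv ℝ (fun u' => (ψ.symm u' : EuclideanSpace ℝ (Fin (m + 1)))) u v)
        (fderiv ℝ (fun u' => (ψ.symm u' : EuclideanSpace ℝ (Fin (m + 1)))) u w) := by
  have hh : ∀ v : EuclideanSpace ℝ (Fin m),
      fderiv ℝ (fun u' => (ψ.symm u' : EuclideanSpace ℝ (Fin (m + 1)))) u v =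
        ∑ i, v i • sphFrame ψ u i := by
    intro v
    have h1 : v = ∑ i, v i • (EuclideanSpace.single i 1 : EuclideanSpace ℝ (Fin m)) := by
      ext j; simp [Pi.single_apply]
    conv_lhs => rw [h1]
    simp [map_sum, sphFrame]
  rw [hh v, hh w, bil_apply]
  simp only [map_sum, map_smul, _root_.sum_apply, _root_.smul_apply, smul_eq_mul,
    tGram_apply]
  rw [Finset.sum_comm]
  refine Finset.sum_congr rfl fun i _ => ?_
  rw [Finset.mul_sum]
  exact Finset.sum_congr rfl fun j _ => by ring

lemma tGram_isSymm (r : ℝ) (u : EuclideanSpace ℝ (Fin m)) : (tGram b ψ r u).IsSymm := by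
  ext i j
  rw [Matrix.transpose_apply, tGram_apply, tGram_apply]
  exact bil_symm (pullGram_isSymm _ _) _ _

include hψ

lemma hasFDerivAt_coe_symm (hu : u ∈ ψ.target) :
    HasFDerivAt (fun u' => (ψ.symm u' : EuclideanSpace ℝ (Fin (m + 1))))
      (fderiv ℝ (fun u' => (ψ.symm u' : EuclideanSpace ℝ (Fin (m + 1)))) u) u :=
  (((contDiffOn_coe_symm hψ).contDiffAt (ψ.open_target.mem_nhds hu)).differentiableAt
    (by simp)).hasFDerivAt

lemma hasFDerivAt_smul_coe_symm (hu : u ∈ ψ.target) (r : ℝ) :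
    HasFDerivAt (fun q : ℝ × EuclideanSpace ℝ (Fin m) =>
        q.1 • (ψ.symm q.2 : EuclideanSpace ℝ (Fin (m + 1))))
      (r • ((fderiv ℝ (fun u' => (ψ.symm u' : EuclideanSpace ℝ (Fin (m + 1)))) u).comp
          (ContinuousLinearMap.snd ℝ ℝ (EuclideanSpace ℝ (Fin m)))) +
        (ContinuousLinearMap.fst ℝ ℝ (EuclideanSpace ℝ (Fin m))).smulRight
          (ψ.symm u : EuclideanSpace ℝ (Fin (m + 1)))) (r, u) :=
  HasFDerivAt.smul (x := (r, u)) hasFDerivAt_fst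
    (HasFDerivAt.comp (r, u) (hasFDerivAt_coe_symm hψ hu) hasFDerivAt_snd)

variable [IsManifold (𝓡 (m + 1)) ∞ M] (hN : IsNormalChart b ε e)

include hN

lemma mdifferentiableAt_polarMap (hu : u ∈ ψ.target) (hr : |r| < ε) :
    MDifferentiableAt 𝓘(ℝ, ℝ × EuclideanSpace ℝ (Fin m)) (𝓡 (m + 1)) (polarMap b ψ) (r, u) :=
  MDifferentiableAt.comp (r, u) (g := expChart b)
    (hN.mdifferentiableAt_expChart (smul_mem_ball hr (ψ.symm u)))
    (hasFDerivAt_smul_coe_symm hψ hu r).differentiableAt.mdifferentiableAt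

/-- In the normal chart, polar coordinates are the Euclidean map (ρ, v) ↦ ρ θ(v), so this is the
product rule. Hence ∂_r reads as θ and ∂_{θᵢ} as r ∂ᵢθ. -/
lemma tcoord_polar (hu : u ∈ ψ.target) (hr : |r| < ε) (v : ℝ × EuclideanSpace ℝ (Fin m)) :
    tcoord e (polarMap b ψ (r, u)) (mfderiv 𝓘(ℝ, ℝ × EuclideanSpace ℝ (Fin m)) (𝓡 (m + 1))
      (polarMap b ψ) (r, u) v) =
    v.1 • (ψ.symm u : EuclideanSpace ℝ (Fin (m + 1))) +
      r • fderiv ℝ (fun u' => (ψ.symm u' : EuclideanSpace ℝ (Fin (m + 1)))) u v.2 := by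
  have hT := hasFDerivAt_smul_coe_symm hψ hu r
  have hsrc : polarMap b ψ (r, u) ∈ e.source := hN.expChart_mem (smul_mem_ball hr (ψ.symm u))
  rw [tcoord_mfderiv hN.mem_maximalAtlas (hN.mdifferentiableAt_polarMap hψ hu hr) hsrc]
  have hev : e ∘ polarMap b ψ =ᶠ[𝓝 (r, u)] fun q : ℝ × EuclideanSpace ℝ (Fin m) =>
      q.1 • (ψ.symm q.2 : EuclideanSpace ℝ (Fin (m + 1))) := by
    filter_upwards [hT.continuousAt.eventually_mem
      (Metric.isOpen_ball.mem_nhds (smul_mem_ball hr (ψ.symm u)))] with q hq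
    exact hN.apply_expChart hq
  rw [hev.fderiv_eq, hT.fderiv]
  simp [add_comm]

lemma tcoord_dR (hu : u ∈ ψ.target) (hr : |r| < ε) :
    tcoord e (polarMap b ψ (r, u)) (dR b ψ r u) = (ψ.symm u : EuclideanSpace ℝ (Fin (m + 1))) := by
  rw [dR, hN.tcoord_polar hψ hu hr]
  simp

lemma tcoord_dTheta (hu : u ∈ ψ.target) (hr : |r| < ε) (i : Fin m) :
    tcoord e (polarMap b ψ (r, u)) (dTheta b ψ r u i) = r • sphFrame ψ u i := by
  rw [dTheta, hN.tcoord_polar hψ hu hr]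
  simp [sphFrame]

omit hψ in
lemma metric_polarMap (hr : |r| < ε)
    (ξ η : TangentSpace (𝓡 (m + 1)) (polarMap b ψ (r, u))) :
    metric (polarMap b ψ (r, u)) ξ η =
      bil (expGram b (r • (ψ.symm u : EuclideanSpace ℝ (Fin (m + 1)))))
        (tcoord e (polarMap b ψ (r, u)) ξ) (tcoord e (polarMap b ψ (r, u)) η) := by
  have hb := smul_mem_ball hr (ψ.symm u)
  have hsrc : polarMap b ψ (r, u) ∈ e.source := hN.expChart_mem hb
  have happ : e (polarMap b ψ (r, u)) = r • (ψ.symm u : EuclideanSpace ℝ (Fin (m + 1))) :=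
    hN.apply_expChart hb
  rw [metric_eq_bil hN.mem_maximalAtlas hsrc, happ, hN.expGram_eq hb]

lemma polarGram_eq (hu : u ∈ ψ.target) (hr : |r| < ε) :
    polarGram b ψ r u = r ^ 2 • tGram b ψ r u := by
  ext i j
  rw [Matrix.smul_apply, tGram_apply, polarGram, Matrix.of_apply, hN.metric_polarMap hr,
    hN.tcoord_dTheta hψ hu hr, hN.tcoord_dTheta hψ hu hr]
  simp only [map_smul, _root_.smul_apply, smul_eq_mul]
  ring

lemma pullGram_inducedForm (hu : u ∈ ψ.target) (hr : |r| < ε) :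
    pullGram (inducedForm b r) ψ.symm u = r ^ 2 • tGram b ψ r u := by
  have hb := smul_mem_ball hr (ψ.symm u)
  have hsrc : sphMap b r (ψ.symm u) ∈ e.source := hN.expChart_mem hb
  have happ : e (sphMap b r (ψ.symm u)) = r • (ψ.symm u : EuclideanSpace ℝ (Fin (m + 1))) :=
    hN.apply_expChart hb
  have hmd : MDifferentiableAt (𝓡 m) (𝓡 (m + 1)) (sphMap b r) (ψ.symm u) := by
    refine MDifferentiableAt.comp (ψ.symm u) (g := expChart b)
      (hN.mdifferentiableAt_expChart hb) ?_
    exact (((contDiff_const_smul (𝕜 := ℝ) (n := 1) r).contMDiff).comp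
      (contMDiff_coe_usphere (N := 1))).mdifferentiableAt (by simp)
  have hd := (hasFDerivAt_coe_symm hψ hu).const_smul r
  have hmdψ : MDifferentiableAt (𝓡 m) (𝓡 m) ψ.symm u := mdiffAt_chart_symm hψ hu
  have hcomp := hmd.comp u hmdψ
  have hev : e ∘ (sphMap b r ∘ ψ.symm) =ᶠ[𝓝 u]
      fun u' => r • (ψ.symm u' : EuclideanSpace ℝ (Fin (m + 1))) := by
    filter_upwards [hd.continuousAt.eventually_mem (Metric.isOpen_ball.mem_nhds hb)] with u' hu'
    exact hN.apply_expChart hu'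
  have htc : ∀ i : Fin m, tcoord e (sphMap b r (ψ.symm u))
      (mfderiv (𝓡 m) (𝓡 (m + 1)) (sphMap b r) (ψ.symm u) (mfderiv (𝓡 m) (𝓡 m) ψ.symm u
        (EuclideanSpace.single i 1 : EuclideanSpace ℝ (Fin m)))) = r • sphFrame ψ u i := by
    intro i
    have h1 := tcoord_mfderiv hN.mem_maximalAtlas hcomp hsrc
      (EuclideanSpace.single i 1 : EuclideanSpace ℝ (Fin m))
    rw [mfderiv_comp u hmd hmdψ, hev.fderiv_eq] at h1
    refine h1.trans ?_
    have h2 := hd.fderiv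
    have : (fun u' => r • (ψ.symm u' : EuclideanSpace ℝ (Fin (m + 1)))) =
      r • (fun u' => (ψ.symm u' : EuclideanSpace ℝ (Fin (m + 1)))) := rfl
    rw [this, h2]
    rfl
  ext i j
  rw [Matrix.smul_apply, tGram_apply, pullGram, Matrix.of_apply, inducedForm,
    metric_eq_bil hN.mem_maximalAtlas hsrc, htc, htc, happ, ← hN.expGram_eq hb]
  simp only [map_smul, _root_.smul_apply, smul_eq_mul]
  ring

lemma pullGram_sphForm (hu : u ∈ ψ.target) (hr : |r| < ε) (h0 : r ≠ 0) :
    pullGram (sphForm b r) ψ.symm u = tGram b ψ r u := by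
  have h1 := hN.pullGram_inducedForm hψ hu hr
  ext i j
  have h2 := congrFun (congrFun h1 i) j
  rw [Matrix.smul_apply, smul_eq_mul] at h2
  have h3 : pullGram (sphForm b r) ψ.symm u i j =
      (r ^ 2)⁻¹ * pullGram (inducedForm b r) ψ.symm u i j := rfl
  rw [h3, h2]
  field_simp

lemma tGram_posDef (hu : u ∈ ψ.target) (hr : |r| < ε) : (tGram b ψ r u).PosDef := by
  refine posDef_of_bil (tGram_isSymm r u) fun v hv => ?_
  rw [bil_tGram]
  refine bil_pos (hN.expGram_posDef (smul_mem_ball hr (ψ.symm u))) fun h => hv ?_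
  exact fderiv_coe_symm_injective hψ hu (h.trans (map_zero _).symm)

-- The metric is Euclidean at the origin, so α is the value of √|g̃| at r = 0. Positivity and
-- smoothness of α are inherited from those of g̃.
omit hψ in
lemma sphDensity_eq (u : EuclideanSpace ℝ (Fin m)) : sphDensity ψ u = √(tGram b ψ 0 u).det := by
  rw [sphDensity]
  congr 2
  ext i j
  rw [tGram_apply, zero_smul, hN.bil_expGram_zero, Matrix.of_apply]

lemma sphDensity_pos (hu : u ∈ ψ.target) : 0 < sphDensity ψ u := by
  rw [hN.sphDensity_eq u]
  exact Real.sqrt_pos.2 (hN.tGram_posDef hψ hu (by simpa using hN.pos)).det_pos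

variable [IsContMDiffRiemannianBundle (𝓡 (m + 1)) ∞ (EuclideanSpace ℝ (Fin (m + 1)))
  (fun x : M => TangentSpace (𝓡 (m + 1)) x)]

/-- Let P have columns θ, ∂₁θ, …. By Gauss's lemma the first row of PᵀGP is (1, 0, …, 0), so its
determinant is that of the angular block; it is also det P² · det G. At r = 0 this gives α = |det
P|. -/
lemma det_tGram (hu : u ∈ ψ.target) (hr : |r| < ε) :
    (tGram b ψ r u).det = (polarMatrix ψ u).det ^ 2 *
      (expGram b (r • (ψ.symm u : EuclideanSpace ℝ (Fin (m + 1))))).det := by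
  set G := expGram b (r • (ψ.symm u : EuclideanSpace ℝ (Fin (m + 1))))
  have hlt : ‖r • (ψ.symm u : EuclideanSpace ℝ (Fin (m + 1)))‖ < ε := by
    simpa using smul_mem_ball hr (ψ.symm u)
  have hcol : ∀ i j, ((polarMatrix ψ u)ᵀ * G * polarMatrix ψ u) i j =
      bil G (euclPolarFrame ψ u i) (euclPolarFrame ψ u j) :=
    fun i j => transpose_mul_mul_apply _ _ _ _
  have h1 : ((polarMatrix ψ u)ᵀ * G * polarMatrix ψ u).det = (tGram b ψ r u).det := by
    rw [det_eq_of_cons]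
    · congr 1
      ext i j
      rw [Matrix.submatrix_apply, hcol, tGram_apply]
      rfl
    · rw [hcol]
      exact (hN.bil_expGram_ray _ _ hlt).trans (by simp [euclPolarFrame])
    · intro j
      rw [hcol]
      exact (hN.bil_expGram_ray _ _ hlt).trans (inner_sphFrame hψ hu j)
  rw [← h1, Matrix.det_mul, Matrix.det_mul, Matrix.det_transpose]
  ring

lemma sphDensity_eq_abs_det (hu : u ∈ ψ.target) : sphDensity ψ u = |(polarMatrix ψ u).det| := by
  rw [hN.sphDensity_eq u, hN.det_tGram hψ hu (by simpa using hN.pos), zero_smul,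
    hN.expGram_zero, Matrix.det_one, mul_one, Real.sqrt_sq_eq_abs]

lemma sqrt_det_tGram (hu : u ∈ ψ.target) (hr : |r| < ε) :
    √(tGram b ψ r u).det =
      sphDensity ψ u * expJ b (r • (ψ.symm u : EuclideanSpace ℝ (Fin (m + 1)))) := by
  rw [hN.det_tGram hψ hu hr, Real.sqrt_mul (sq_nonneg _), Real.sqrt_sq_eq_abs,
    hN.sphDensity_eq_abs_det hψ hu, expJ]

omit hψ in
lemma expJ_pos {y : EuclideanSpace ℝ (Fin (m + 1))} (hy : y ∈ Metric.ball 0 ε) : 0 < expJ b y :=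
  Real.sqrt_pos.2 (hN.expGram_posDef hy).det_pos

lemma deriv_log_sqrt_det_tGram (hu : u ∈ ψ.target) (hr : |r| < ε) :
    deriv (fun ρ : ℝ => Real.log √(tGram b ψ ρ u).det) r =
      deriv (fun ρ : ℝ =>
        Real.log (expJ b (ρ • (ψ.symm u : EuclideanSpace ℝ (Fin (m + 1)))))) r := by
  have hev : (fun ρ : ℝ => Real.log √(tGram b ψ ρ u).det) =ᶠ[𝓝 r] fun ρ =>
      Real.log (sphDensity ψ u) +
        Real.log (expJ b (ρ • (ψ.symm u : EuclideanSpace ℝ (Fin (m + 1))))) := by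
    have hopen : IsOpen {ρ : ℝ | |ρ| < ε} := isOpen_lt continuous_abs continuous_const
    filter_upwards [hopen.mem_nhds hr] with ρ hρ
    rw [hN.sqrt_det_tGram hψ hu hρ, Real.log_mul (hN.sphDensity_pos hψ hu).ne'
      (hN.expJ_pos (smul_mem_ball hρ (ψ.symm u))).ne']
  rw [hev.deriv_eq, deriv_const_add]

lemma contDiffOn_tGram (i j : Fin m) :
    ContDiffOn ℝ ∞ (fun q : ℝ × EuclideanSpace ℝ (Fin m) => tGram b ψ q.1 q.2 i j)
      (Ioo (-ε) ε ×ˢ ψ.target) := by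
  have hsph : ∀ i, ContDiffOn ℝ ∞ (fun q : ℝ × EuclideanSpace ℝ (Fin m) => sphFrame ψ q.2 i)
      (Ioo (-ε) ε ×ˢ ψ.target) := fun i =>
    (contDiffOn_sphFrame hψ i).comp contDiffOn_snd fun q hq => hq.2
  have hT : ContDiffOn ℝ ∞ (fun q : ℝ × EuclideanSpace ℝ (Fin m) =>
      q.1 • (ψ.symm q.2 : EuclideanSpace ℝ (Fin (m + 1)))) (Ioo (-ε) ε ×ˢ ψ.target) :=
    contDiffOn_fst.smul ((contDiffOn_coe_symm hψ).comp contDiffOn_snd fun q hq => hq.2)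
  have hG := (contDiffOn_bil hN.contDiffOn_expGram).comp hT
    fun q hq => smul_mem_ball (abs_lt.2 hq.1) (ψ.symm q.2)
  exact ((hG.clm_apply (hsph i)).clm_apply (hsph j)).congr fun q _ => tGram_apply q.1 q.2 i j

-- The radius enters only through the point rθ, and the first derivatives of the metric vanish at
-- the origin.
omit hψ in
lemma hasDerivAt_tGram (u : EuclideanSpace ℝ (Fin m)) (i j : Fin m) :
    HasDerivAt (fun r : ℝ => tGram b ψ r u i j) 0 0 := by
  have h0 : (0 : EuclideanSpace ℝ (Fin (m + 1))) ∈ Metric.ball 0 ε := Metric.mem_ball_self hN.pos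
  have hB : HasFDerivAt (fun y => bil (expGram b y)) (fderiv ℝ (fun y => bil (expGram b y)) 0)
      ((0 : ℝ) • (ψ.symm u : EuclideanSpace ℝ (Fin (m + 1)))) := by
    rw [zero_smul]
    exact (((contDiffOn_bil hN.contDiffOn_expGram).contDiffAt
      (Metric.isOpen_ball.mem_nhds h0)).differentiableAt (by simp)).hasFDerivAt
  have h1 := ((hB.comp_hasDerivAt 0 ((hasDerivAt_id (0 : ℝ)).smul_const
    (ψ.symm u : EuclideanSpace ℝ (Fin (m + 1))))).clm_apply
    (hasDerivAt_const (0 : ℝ) (sphFrame ψ u i))).clm_apply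
    (hasDerivAt_const (0 : ℝ) (sphFrame ψ u j))
  simp only [map_smul, _root_.smul_apply, hN.fderiv_bil_expGram_zero, smul_zero, map_zero,
    add_zero] at h1
  exact h1.congr_of_eventuallyEq (Filter.Eventually.of_forall fun r => tGram_apply r u i j)

lemma hasDerivAt_pd_tGram (hu : u ∈ ψ.target) (i j k : Fin m) :
    HasDerivAt (fun r : ℝ => pd k (fun u' => tGram b ψ r u' i j) u) 0 0 :=
  (pd_of_hasDerivAt_zero isOpen_Ioo (by simpa using hN.pos) ψ.open_target
    (hN.contDiffOn_tGram hψ i j) (fun u _ => hN.hasDerivAt_tGram u i j) k).2 u hu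

lemma hasDerivAt_det_tGram (hu : u ∈ ψ.target) :
    HasDerivAt (fun r : ℝ => (tGram b ψ r u).det) 0 0 := by
  have h1 := (hasFDerivAt_det (fun i j => (hN.hasDerivAt_tGram (ψ := ψ) u i j).hasFDerivAt)
    (isUnit_iff_ne_zero.2 (hN.tGram_posDef hψ hu (by simpa using hN.pos)).det_pos.ne')).hasDerivAt
  simpa using h1

lemma contDiffOn_det_tGram :
    ContDiffOn ℝ ∞ (fun q : ℝ × EuclideanSpace ℝ (Fin m) => (tGram b ψ q.1 q.2).det)
      (Ioo (-ε) ε ×ˢ ψ.target) :=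
  contDiffOn_det (hN.contDiffOn_tGram hψ)

lemma hasDerivAt_pd_det_tGram (hu : u ∈ ψ.target) (k : Fin m) :
    HasDerivAt (fun r : ℝ => pd k (fun u' => (tGram b ψ r u').det) u) 0 0 :=
  (pd_of_hasDerivAt_zero isOpen_Ioo (by simpa using hN.pos) ψ.open_target
    (hN.contDiffOn_det_tGram hψ) (fun _ hu => hN.hasDerivAt_det_tGram hψ hu) k).2 u hu

lemma contDiffOn_sqrt_det_tGram :
    ContDiffOn ℝ ∞ (fun q : ℝ × EuclideanSpace ℝ (Fin m) => √(tGram b ψ q.1 q.2).det)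
      (Ioo (-ε) ε ×ˢ ψ.target) :=
  (hN.contDiffOn_det_tGram hψ).sqrt fun _ hq => (hN.tGram_posDef hψ hq.2 (abs_lt.2 hq.1)).det_pos.ne'

lemma contDiffOn_density :
    ContDiffOn ℝ ∞ (fun q : ℝ × EuclideanSpace ℝ (Fin m) =>
      √(tGram b ψ q.1 q.2).det / sphDensity ψ q.2) (Ioo (-ε) ε ×ˢ ψ.target) := by
  have h0 : (0 : ℝ) ∈ Ioo (-ε) ε := by simpa using hN.pos
  have h1 : ContDiffOn ℝ ∞ (fun q : ℝ × EuclideanSpace ℝ (Fin m) => sphDensity ψ q.2)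
      (Ioo (-ε) ε ×ˢ ψ.target) := by
    refine ((hN.contDiffOn_sqrt_det_tGram hψ).comp
      (contDiff_const.prodMk contDiff_snd).contDiffOn
      (fun q hq => (⟨h0, hq.2⟩ : ((0 : ℝ), q.2) ∈ Ioo (-ε) ε ×ˢ ψ.target))).congr fun q hq => ?_
    exact hN.sphDensity_eq q.2
  exact (hN.contDiffOn_sqrt_det_tGram hψ).div h1 fun q hq => (hN.sphDensity_pos hψ hq.2).ne'

lemma hasDerivAt_density (hu : u ∈ ψ.target) :
    HasDerivAt (fun r : ℝ => √(tGram b ψ r u).det / sphDensity ψ u) 0 0 := by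
  have h1 := ((hN.hasDerivAt_det_tGram hψ hu).sqrt
    (hN.tGram_posDef hψ hu (by simpa using hN.pos)).det_pos.ne').div_const (sphDensity ψ u)
  simpa using h1

lemma hasDerivAt_pd_density (hu : u ∈ ψ.target) (k : Fin m) :
    HasDerivAt (fun r : ℝ => pd k (fun u' => √(tGram b ψ r u').det / sphDensity ψ u') u) 0 0 :=
  (pd_of_hasDerivAt_zero isOpen_Ioo (by simpa using hN.pos) ψ.open_target
    (hN.contDiffOn_density hψ) (fun _ hu => hN.hasDerivAt_density hψ hu) k).2 u hu

lemma hasDerivAt_pd_pd_density (hu : u ∈ ψ.target) (k k' : Fin m) :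
    HasDerivAt (fun r : ℝ => pd k (fun u' => pd k' (fun u'' =>
      √(tGram b ψ r u'').det / sphDensity ψ u'') u') u) 0 0 := by
  have h1 := pd_of_hasDerivAt_zero isOpen_Ioo (by simpa using hN.pos) ψ.open_target
    (hN.contDiffOn_density hψ) (fun _ hu => hN.hasDerivAt_density hψ hu) k'
  exact (pd_of_hasDerivAt_zero isOpen_Ioo (by simpa using hN.pos) ψ.open_target
    h1.1 h1.2 k).2 u hu

end IsNormalChart
/-! ### Orientation of frames and the normal of geodesic spheres -/

section Determinant

variable {k : ℕ} {V : Type*} [AddCommGroup V] [Module ℝ V] {B v : Fin k → V}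
  (L : V →ₗ[ℝ] EuclideanSpace ℝ (Fin k)) (hL : Function.Injective L)
  (hB : ∀ i, L (B i) = EuclideanSpace.single i 1)

include hL hB

/-- L carries B to the standard basis, so the matrix of v in B is forced to have the coordinates of
L(v j) as its columns. -/
lemma hasDet_iff {d : ℝ} : HasDet B v d ↔ (Matrix.of fun i j => L (v j) i).det = d := by
  constructor
  · rintro ⟨A, hA, rfl⟩
    congr 1
    ext i j
    rw [Matrix.of_apply, hA j]
    simp [hB, Pi.single_apply]
  · intro h
    refine ⟨_, fun j => hL ?_, h⟩
    ext i
    simp [hB, Pi.single_apply]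

lemma isDirect_iff : IsDirect B v ↔ 0 < (Matrix.of fun i j => L (v j) i).det := by
  simp [IsDirect, hasDet_iff L hL hB]

end Determinant

/-- A functional which is nonnegative on an open half-space must vanish on the bounding hyperplane:
otherwise adding to θ a suitable multiple of a tangent vector would bring its value down to -1. -/
lemma eq_inner_mul_of_nonneg {E : Type*} [NormedAddCommGroup E] [InnerProductSpace ℝ E]
    {l : E →L[ℝ] ℝ} {θ : E} (hθ : ‖θ‖ = 1) (h : ∀ u, 0 < inner ℝ θ u → 0 ≤ l u) (u : E) :
    l u = inner ℝ θ u * l θ := by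
  have hself : inner ℝ θ θ = (1 : ℝ) := by rw [real_inner_self_eq_norm_sq, hθ, one_pow]
  have key : ∀ v, inner ℝ θ v = (0 : ℝ) → l v = 0 := by
    intro v hv
    by_contra hne
    have h1 := h (θ + (-(l θ + 1) / l v) • v) (by
      rw [inner_add_right, real_inner_smul_right, hself, hv]; norm_num)
    rw [map_add, map_smul, smul_eq_mul, div_mul_cancel₀ _ hne] at h1
    linarith
  have h2 := key (u - (inner ℝ θ u : ℝ) • θ) (by
    rw [inner_sub_right, real_inner_smul_right, hself]; ring)
  rw [map_sub, map_smul, smul_eq_mul] at h2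
  linarith

/-! ### Orientation of the exponential chart. -/

section ChartOrientation

variable {n : ℕ} {M : Type*} [TopologicalSpace M] [ChartedSpace (EuclideanSpace ℝ (Fin n)) M]
  [IsManifold (𝓡 n) ∞ M] {φ : OpenPartialHomeomorph M (EuclideanSpace ℝ (Fin n))}
  (hφ : φ ∈ IsManifold.maximalAtlas (𝓡 n) ∞ M)

include hφ

/-- Orientation becomes the sign of a matrix of chart components. The statement types vectors at p
as vectors at φ.symm (φ p), so the components must be transported along the equality of these
points. -/
lemma isDirect_coordFrame_symm_iff {p : M} (hp : p ∈ φ.source)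
    (v : Fin n → TangentSpace (𝓡 n) p) :
    IsDirect (V := TangentSpace (𝓡 n) (φ.symm (φ p))) (coordFrame (d := n) φ.symm (φ p)) v ↔
      0 < (Matrix.of fun i j => tcoord φ p (v j) i).det := by
  have hq : φ.symm (φ p) = p := φ.left_inv hp
  have hqs : φ.symm (φ p) ∈ φ.source := hq.symm ▸ hp
  have key : ∀ q, q = p → ∀ w : EuclideanSpace ℝ (Fin n),
      (tcoord φ q w : EuclideanSpace ℝ (Fin n)) = tcoord φ p w := by
    rintro _ rfl w; rfl
  have h1 := isDirect_iff (V := TangentSpace (𝓡 n) (φ.symm (φ p)))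
    (B := coordFrame (d := n) φ.symm (φ p)) (v := v)
    (tcoord φ (φ.symm (φ p))).toLinearMap (tcoord_injective hφ hqs)
    (fun i => tcoord_symm hφ (φ.map_source hp) _)
  rw [h1]
  refine iff_of_eq (congrArg (fun A : Matrix (Fin n) (Fin n) ℝ => 0 < A.det) ?_)
  ext i j
  exact congrArg (fun z : EuclideanSpace ℝ (Fin n) => z i) (key _ hq (v j))

variable [RiemannianBundle (fun x : M => TangentSpace (𝓡 n) x)]
  {x : M} {b : Fin n → TangentSpace (𝓡 n) x} {ε : ℝ}
  {e : OpenPartialHomeomorph M (EuclideanSpace ℝ (Fin n))} (hN : IsNormalChart b ε e)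

include hN

omit hφ in
lemma IsNormalChart.mfderiv_zero (w : EuclideanSpace ℝ (Fin n)) :
    (mfderiv (𝓡 n) (𝓡 n) (expChart b) 0 w : EuclideanSpace ℝ (Fin n)) =
      (show EuclideanSpace ℝ (Fin n) from ∑ i, w i • b i) := by
  have key : ∀ q, q = x → ∀ w w' : EuclideanSpace ℝ (Fin n),
      (tcoord e q w : EuclideanSpace ℝ (Fin n)) = tcoord e x w' → w = w' := by
    rintro _ rfl w w' h
    exact tcoord_injective hN.mem_maximalAtlas hN.center_mem h
  exact key _ hN.zero _ _ ((hN.tcoord_expChart (Metric.mem_ball_self hN.pos) w).trans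
    (hN.tcoord_frame w).symm)

/-- The exponential chart has the orientation of its initial frame. -/
theorem IsNormalChart.isDirect_coordFrame (hsub : e.source ⊆ φ.source)
    (hb : IsDirect (V := TangentSpace (𝓡 n) (φ.symm (φ x))) (coordFrame (d := n) φ.symm (φ x)) b)
    {y : EuclideanSpace ℝ (Fin n)} (hy : y ∈ Metric.ball 0 ε) :
    IsDirect (V := TangentSpace (𝓡 n) (φ.symm (φ (expChart b y))))
      (coordFrame (d := n) φ.symm (φ (expChart b y))) (coordFrame (expChart b) y) := by
  have hsrc : ∀ z ∈ Metric.ball (0 : EuclideanSpace ℝ (Fin n)) ε, expChart b z ∈ φ.source :=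
    fun z hz => hsub (hN.expChart_mem hz)
  have hsm : ContDiffOn ℝ ∞ (φ ∘ expChart b) (Metric.ball 0 ε) := fun z hz =>
    (ContMDiffAt.contDiffAt ((contMDiffAt_of_mem_maximalAtlas hφ (hsrc z hz)).comp z
      (hN.contMDiffAt_expChart hz))).contDiffWithinAt
  let D : EuclideanSpace ℝ (Fin n) → Matrix (Fin n) (Fin n) ℝ := fun z =>
    Matrix.of fun i j => fderiv ℝ (φ ∘ expChart b) z (EuclideanSpace.single j 1) i
  have hfd : ∀ z ∈ Metric.ball (0 : EuclideanSpace ℝ (Fin n)) ε, ∀ w,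
      tcoord φ (expChart b z) (mfderiv (𝓡 n) (𝓡 n) (expChart b) z w) =
        fderiv ℝ (φ ∘ expChart b) z w := fun z hz w =>
    tcoord_mfderiv hφ (hN.mdifferentiableAt_expChart hz) (hsrc z hz) w
  have hD : ∀ z ∈ Metric.ball (0 : EuclideanSpace ℝ (Fin n)) ε,
      (Matrix.of fun i j => tcoord φ (expChart b z) (coordFrame (d := n) (expChart b) z j) i) =
        D z := fun z hz => by
    ext i j
    exact congrArg (fun z : EuclideanSpace ℝ (Fin n) => z i) (hfd z hz _)
  -- A kernel vector would be killed by the differential of the exponential map, which is injective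
  -- throughout the ball.
  have hne : ∀ z ∈ Metric.ball (0 : EuclideanSpace ℝ (Fin n)) ε, (D z).det ≠ 0 := by
    intro z hz h0
    obtain ⟨v, hv0, hv⟩ := Matrix.exists_mulVec_eq_zero_iff.2 h0
    refine hv0 ?_
    have h1 : fderiv ℝ (φ ∘ expChart b) z (WithLp.toLp 2 v) = 0 := by
      have h2 : WithLp.toLp 2 v = ∑ j, v j • (EuclideanSpace.single j 1 : EuclideanSpace ℝ (Fin n)) := by
        ext j; simp [Pi.single_apply]
      rw [h2, map_sum]
      ext i
      have h3 := congrFun hv i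
      simp only [Matrix.mulVec, dotProduct, D, Matrix.of_apply, Pi.zero_apply] at h3
      simpa [mul_comm] using h3
    have h4 := tcoord_injective hφ (hsrc z hz)
      (((hfd z hz (WithLp.toLp 2 v)).trans h1).trans (map_zero _).symm)
    have h5 := hN.tcoord_expChart hz (WithLp.toLp 2 v)
    rw [h4, map_zero] at h5
    simpa using (congrArg (WithLp.ofLp) h5).symm
  have hcont : ContinuousOn (fun z => (D z).det) (Metric.ball 0 ε) := by
    have h1 : ContinuousOn D (Metric.ball 0 ε) := by
      refine continuousOn_pi.2 fun i => continuousOn_pi.2 fun j => ?_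
      have h2 := (hsm.continuousOn_fderiv_of_isOpen Metric.isOpen_ball (by simp)).clm_apply
        (continuousOn_const (c := (EuclideanSpace.single j 1 : EuclideanSpace ℝ (Fin n))))
      exact (EuclideanSpace.proj (𝕜 := ℝ) i).continuous.comp_continuousOn h2
    exact Continuous.comp_continuousOn (continuous_id.matrix_det) h1
  have h0 : 0 < (D 0).det := by
    rw [isDirect_coordFrame_symm_iff hφ (hsub hN.center_mem)] at hb
    refine lt_of_lt_of_eq hb (congrArg Matrix.det ?_)
    rw [← hD 0 (Metric.mem_ball_self hN.pos)]
    have key : ∀ q, q = x → ∀ w w' : EuclideanSpace ℝ (Fin n), w = w' →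
        (tcoord φ q w : EuclideanSpace ℝ (Fin n)) = tcoord φ x w' := by
      rintro _ rfl w _ rfl; rfl
    ext i j
    refine congrArg (fun z : EuclideanSpace ℝ (Fin n) => z i) (key _ hN.zero _ _ ?_).symm
    refine (hN.mfderiv_zero _).trans ?_
    change (∑ k, (EuclideanSpace.single j (1 : ℝ) : EuclideanSpace ℝ (Fin n)) k • b k) = b j
    simp [Pi.single_apply]
  rw [isDirect_coordFrame_symm_iff hφ (hsrc y hy), hD y hy]
  by_contra hle
  -- The determinant is continuous and never zero on the connected ball, so it keeps the sign it has
  -- at 0, where its columns are the components of b.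
  obtain ⟨z, hz, hz0⟩ := (convex_ball (0 : EuclideanSpace ℝ (Fin n)) ε).isPreconnected.intermediate_value
    hy (Metric.mem_ball_self hN.pos) hcont ⟨not_lt.1 hle, h0.le⟩
  exact hne z hz hz0

end ChartOrientation

namespace IsNormalChart

variable {m : ℕ} {M : Type*} [TopologicalSpace M] [ChartedSpace (EuclideanSpace ℝ (Fin (m + 1))) M]
  [RiemannianBundle (fun x : M => TangentSpace (𝓡 (m + 1)) x)]
  {x : M} {b : Fin (m + 1) → TangentSpace (𝓡 (m + 1)) x} {ε : ℝ}
  {e : OpenPartialHomeomorph M (EuclideanSpace ℝ (Fin (m + 1)))}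
  {ψ : OpenPartialHomeomorph (USphere m) (EuclideanSpace ℝ (Fin m))}
  (hψ : ψ ∈ IsManifold.maximalAtlas (𝓡 m) ∞ (USphere m))
  {u : EuclideanSpace ℝ (Fin m)} (hu : u ∈ ψ.target) {r : ℝ}
  [IsManifold (𝓡 (m + 1)) ∞ M] (hN : IsNormalChart b ε e)
  [IsContMDiffRiemannianBundle (𝓡 (m + 1)) ∞ (EuclideanSpace ℝ (Fin (m + 1)))
    (fun x : M => TangentSpace (𝓡 (m + 1)) x)]

include hψ hN hu

/-- Gauss's lemma for ∂_r against an arbitrary vector: pairing with ∂_r is Euclidean pairing with θ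
in the normal chart. The orthonormality relations and the gradient of the radius are special cases.
-/
lemma metric_dR (hr : |r| < ε) (ξ : TangentSpace (𝓡 (m + 1)) (polarMap b ψ (r, u))) :
    metric (polarMap b ψ (r, u)) (dR b ψ r u) ξ =
      inner ℝ (ψ.symm u : EuclideanSpace ℝ (Fin (m + 1))) (tcoord e (polarMap b ψ (r, u)) ξ) := by
  rw [hN.metric_polarMap hr, hN.tcoord_dR hψ hu hr]
  exact hN.bil_expGram_ray _ _ (by simpa using smul_mem_ball hr (ψ.symm u))

lemma metric_dR_dR (hr : |r| < ε) :
    metric (polarMap b ψ (r, u)) (dR b ψ r u) (dR b ψ r u) = 1 := by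
  rw [hN.metric_dR hψ hu hr, hN.tcoord_dR hψ hu hr]
  simp

lemma metric_dR_dTheta (hr : |r| < ε) (i : Fin m) :
    metric (polarMap b ψ (r, u)) (dR b ψ r u) (dTheta b ψ r u i) = 0 := by
  rw [hN.metric_dR hψ hu hr, hN.tcoord_dTheta hψ hu hr, real_inner_smul_right,
    inner_sphFrame hψ hu, mul_zero]

lemma norm_dR (hr : |r| < ε) : ‖dR b ψ r u‖ = 1 := by
  have h1 := hN.metric_dR_dR hψ hu hr
  have h2 : metric (polarMap b ψ (r, u)) (dR b ψ r u) (dR b ψ r u) = ‖dR b ψ r u‖ ^ 2 :=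
    real_inner_self_eq_norm_sq (F := TangentSpace (𝓡 (m + 1)) (polarMap b ψ (r, u))) _
  rw [h2] at h1
  exact (pow_eq_one_iff_of_nonneg (norm_nonneg _) two_ne_zero).1 h1

lemma det_polarMatrix_ne_zero : (polarMatrix ψ u).det ≠ 0 := by
  have h1 := hN.sphDensity_pos hψ hu
  rw [hN.sphDensity_eq_abs_det hψ hu] at h1
  exact abs_pos.1 h1

/-- A tangent vector read as `a θ` in the normal chart is a multiple of `∂_r`. -/
lemma eq_dR_of_tcoord_eq (hr : |r| < ε) {ν : TangentSpace (𝓡 (m + 1)) (polarMap b ψ (r, u))}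
    (hν : ‖ν‖ = 1) {a : ℝ} (ha : 0 ≤ a)
    (h : tcoord e (polarMap b ψ (r, u)) ν =
      a • (ψ.symm u : EuclideanSpace ℝ (Fin (m + 1)))) : ν = dR b ψ r u := by
  have hsrc : polarMap b ψ (r, u) ∈ e.source := hN.expChart_mem (smul_mem_ball hr (ψ.symm u))
  have h1 : ν = a • dR b ψ r u := by
    refine tcoord_injective hN.mem_maximalAtlas hsrc ?_
    rw [h, map_smul, hN.tcoord_dR hψ hu hr]
  have h2 := hN.norm_dR hψ hu hr
  have h3 : a = 1 := by
    have h4 := congrArg norm h1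
    rw [hν, norm_smul, h2, mul_one, Real.norm_of_nonneg ha] at h4
    exact h4.symm
  rw [h1, h3, one_smul]

/-- The determinant of the frame `(ν, ∂_θ)` when `ν` is read as `a θ` in the normal chart. -/
lemma hasDet_polarFrame (hr : |r| < ε) {ν : TangentSpace (𝓡 (m + 1)) (polarMap b ψ (r, u))}
    {a : ℝ} (h : tcoord e (polarMap b ψ (r, u)) ν =
      a • (ψ.symm u : EuclideanSpace ℝ (Fin (m + 1)))) (d : ℝ) :
    HasDet (coordFrame (expChart b) (r • (ψ.symm u : EuclideanSpace ℝ (Fin (m + 1)))))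
      (polarFrame b ψ r u ν) d ↔ a * r ^ m * (polarMatrix ψ u).det = d := by
  have hb := smul_mem_ball hr (ψ.symm u)
  have hsrc : polarMap b ψ (r, u) ∈ e.source := hN.expChart_mem hb
  have h1 := hasDet_iff (V := TangentSpace (𝓡 (m + 1)) (polarMap b ψ (r, u)))
    (B := coordFrame (expChart b) (r • (ψ.symm u : EuclideanSpace ℝ (Fin (m + 1)))))
    (v := polarFrame b ψ r u ν) (d := d)
    (tcoord e (polarMap b ψ (r, u))).toLinearMap (tcoord_injective hN.mem_maximalAtlas hsrc)
    (fun i => hN.tcoord_expChart hb _)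
  refine h1.trans (iff_of_eq (congrArg (fun t : ℝ => t = d) ?_))
  -- The components form `polarMatrix` with its first column scaled by a and the m others by r,
  -- whence the factor a rᵐ.
  have h2 : (Matrix.of fun i j => tcoord e (polarMap b ψ (r, u)) (polarFrame b ψ r u ν j) i) =
      Matrix.of fun i j => (Fin.cons a fun _ => r : Fin (m + 1) → ℝ) j * polarMatrix ψ u i j := by
    ext i j
    refine Fin.cases ?_ (fun j => ?_) j
    · exact congrArg (fun z : EuclideanSpace ℝ (Fin (m + 1)) => z i) h
    · exact congrArg (fun z : EuclideanSpace ℝ (Fin (m + 1)) => z i)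
        (hN.tcoord_dTheta hψ hu hr j)
  refine (congrArg Matrix.det h2).trans ?_
  rw [Matrix.det_mul_row, Fin.prod_univ_succ]
  simp

omit hψ hN hu [IsManifold (𝓡 (m + 1)) ∞ M] in
lemma isDirect_euclPolarFrame_iff :
    IsDirect (fun i => (EuclideanSpace.single i 1 : EuclideanSpace ℝ (Fin (m + 1))))
      (euclPolarFrame ψ u) ↔ 0 < (polarMatrix ψ u).det :=
  isDirect_iff LinearMap.id Function.injective_id fun _ => rfl

lemma isDirect_polarFrame_iff (h0 : 0 < r) (hr : |r| < ε) :
    IsDirect (coordFrame (expChart b) (r • (ψ.symm u : EuclideanSpace ℝ (Fin (m + 1)))))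
        (polarFrame b ψ r u (dR b ψ r u)) ↔
      IsDirect (fun i => (EuclideanSpace.single i 1 : EuclideanSpace ℝ (Fin (m + 1))))
        (euclPolarFrame ψ u) := by
  rw [isDirect_euclPolarFrame_iff]
  have h1 := hN.hasDet_polarFrame hψ hu hr (ν := dR b ψ r u) (a := 1)
    (by rw [one_smul, hN.tcoord_dR hψ hu hr])
  constructor
  · rintro ⟨d, hd, h⟩
    rw [← (h1 d).1 h, one_mul] at hd
    exact (mul_pos_iff_of_pos_left (pow_pos h0 m)).1 hd
  · intro h
    exact ⟨_, by positivity, (h1 _).2 rfl⟩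

/-- `∂_r` is the unit normal which completes the angular frame to a direct frame. -/
lemma normal_direct_iff (h0 : 0 < r) (hr : |r| < ε)
    (hdir : IsDirect (fun i => (EuclideanSpace.single i 1 : EuclideanSpace ℝ (Fin (m + 1))))
      (euclPolarFrame ψ u)) (ν : TangentSpace (𝓡 (m + 1)) (polarMap b ψ (r, u))) :
    (‖ν‖ = 1 ∧ (∀ i, metric (polarMap b ψ (r, u)) ν (dTheta b ψ r u i) = 0) ∧
      IsDirect (coordFrame (expChart b) (r • (ψ.symm u : EuclideanSpace ℝ (Fin (m + 1)))))
        (polarFrame b ψ r u ν)) ↔ ν = dR b ψ r u := by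
  constructor
  · rintro ⟨hν, horth, d, hd, hdet⟩
    have hb := smul_mem_ball hr (ψ.symm u)
    have hlt : ‖r • (ψ.symm u : EuclideanSpace ℝ (Fin (m + 1)))‖ < ε := by simpa using hb
    have hpos := hN.expGram_posDef hb
    have hsymm := isSymm_of_posDef hpos
    -- Decompose ν in the basis θ, ∂₁θ, …; the coefficient c 0 of θ is its radial part.
    obtain ⟨c, hc⟩ := (Matrix.mulVec_surjective_iff_isUnit.2 ((Matrix.isUnit_iff_isUnit_det _).2
      (isUnit_iff_ne_zero.2 (hN.det_polarMatrix_ne_zero hψ hu))))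
      (WithLp.ofLp (tcoord e (polarMap b ψ (r, u)) ν))
    have hdec : tcoord e (polarMap b ψ (r, u)) ν -
        c 0 • (ψ.symm u : EuclideanSpace ℝ (Fin (m + 1))) =
        ∑ i : Fin m, c i.succ • sphFrame ψ u i := by
      rw [sub_eq_iff_eq_add']
      ext k
      rw [← hc, Matrix.mulVec, dotProduct, Fin.sum_univ_succ]
      simp [polarMatrix, euclPolarFrame, mul_comm]
    have hz : ∀ i, bil (expGram b (r • (ψ.symm u : EuclideanSpace ℝ (Fin (m + 1)))))
        (tcoord e (polarMap b ψ (r, u)) ν -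
          c 0 • (ψ.symm u : EuclideanSpace ℝ (Fin (m + 1)))) (sphFrame ψ u i) = 0 := by
      intro i
      have h1 := horth i
      rw [hN.metric_polarMap hr, hN.tcoord_dTheta hψ hu hr, map_smul, smul_eq_mul] at h1
      rw [map_sub, map_smul, _root_.sub_apply, _root_.smul_apply,
        (mul_eq_zero.1 h1).resolve_left h0.ne', hN.bil_expGram_ray _ _ hlt,
        inner_sphFrame hψ hu, smul_zero, sub_zero]
    -- The angular part lies in the span of the ∂ᵢθ and is orthogonal to each of them, so it
    -- vanishes by positivity. The orientation then forces c 0 > 0, and the unit norm forces c 0 =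
    -- 1.
    have hzero : tcoord e (polarMap b ψ (r, u)) ν -
          c 0 • (ψ.symm u : EuclideanSpace ℝ (Fin (m + 1))) = 0 := by
      by_contra hne
      have h1 : 0 < bil (expGram b (r • (ψ.symm u : EuclideanSpace ℝ (Fin (m + 1)))))
          (tcoord e (polarMap b ψ (r, u)) ν -
            c 0 • (ψ.symm u : EuclideanSpace ℝ (Fin (m + 1))))
          (∑ i : Fin m, c i.succ • sphFrame ψ u i) := hdec ▸ bil_pos hpos hne
      rw [map_sum] at h1
      simp only [map_smul, hz, smul_zero, Finset.sum_const_zero, lt_self_iff_false] at h1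
    have htc := sub_eq_zero.1 hzero
    rw [hN.hasDet_polarFrame hψ hu hr htc] at hdet
    rw [isDirect_euclPolarFrame_iff] at hdir
    have hc0 : 0 < c 0 := by
      rw [← hdet, mul_assoc] at hd
      exact (mul_pos_iff_of_pos_right (by positivity)).1 hd
    exact hN.eq_dR_of_tcoord_eq hψ hu hr hν hc0.le htc
  · rintro rfl
    exact ⟨hN.norm_dR hψ hu hr, hN.metric_dR_dTheta hψ hu hr,
      (hN.isDirect_polarFrame_iff hψ hu h0 hr).2 hdir⟩

/-- The volume form of the ball on the polar frame. -/
lemma exists_hasDet_polarFrame (h0 : 0 < r) (hr : |r| < ε)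
    (hdir : IsDirect (fun i => (EuclideanSpace.single i 1 : EuclideanSpace ℝ (Fin (m + 1))))
      (euclPolarFrame ψ u)) :
    ∃ d : ℝ, HasDet (coordFrame (expChart b) (r • (ψ.symm u : EuclideanSpace ℝ (Fin (m + 1)))))
        (polarFrame b ψ r u (dR b ψ r u)) d ∧
      expJ b (r • (ψ.symm u : EuclideanSpace ℝ (Fin (m + 1)))) * d = √(polarGram b ψ r u).det := by
  rw [isDirect_euclPolarFrame_iff] at hdir
  refine ⟨_, (hN.hasDet_polarFrame hψ hu hr (a := 1)
    (by rw [one_smul, hN.tcoord_dR hψ hu hr]) _).2 rfl, ?_⟩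
  rw [hN.polarGram_eq hψ hu hr, Matrix.det_smul, Fintype.card_fin,
    Real.sqrt_mul (by positivity), hN.sqrt_det_tGram hψ hu hr, hN.sphDensity_eq_abs_det hψ hu,
    abs_of_pos hdir, ← pow_mul, mul_comm 2 m, pow_mul, Real.sqrt_sq (by positivity)]
  ring

end IsNormalChart

namespace IsNormalChart

variable {m : ℕ} {M : Type*} [EMetricSpace M] [ChartedSpace (EuclideanSpace ℝ (Fin (m + 1))) M]
  [RiemannianBundle (fun x : M => TangentSpace (𝓡 (m + 1)) x)]
  {x : M} {b : Fin (m + 1) → TangentSpace (𝓡 (m + 1)) x} {ε : ℝ}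
  {e : OpenPartialHomeomorph M (EuclideanSpace ℝ (Fin (m + 1)))}
  {ψ : OpenPartialHomeomorph (USphere m) (EuclideanSpace ℝ (Fin m))}
  (hψ : ψ ∈ IsManifold.maximalAtlas (𝓡 m) ∞ (USphere m))
  {u : EuclideanSpace ℝ (Fin m)} (hu : u ∈ ψ.target) {r : ℝ}
  [IsManifold (𝓡 (m + 1)) ∞ M] (hN : IsNormalChart b ε e)
  [IsContMDiffRiemannianBundle (𝓡 (m + 1)) ∞ (EuclideanSpace ℝ (Fin (m + 1)))
    (fun x : M => TangentSpace (𝓡 (m + 1)) x)] [IsRiemannianManifold (𝓡 (m + 1)) M]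

include hN

lemma mem_eball_iff (h0 : 0 < r) (hr : r < ε) {q : M} (hq : q ∈ e.source) :
    q ∈ Metric.eball x (ENNReal.ofReal r) ↔ ‖e q‖ < r := by
  rw [← hN.image_ball h0 hr.le]
  constructor
  · rintro ⟨y, hy, rfl⟩
    rw [hN.apply_expChart (Metric.ball_subset_ball hr.le hy)]
    simpa using hy
  · intro h
    exact ⟨e q, by simpa using h, hN.expChart_apply hq⟩

include hψ hu

/-- The defining function is ‖e q‖² - r². By Gauss's lemma its differential at the point is 2r times
the pairing with ∂_r. -/
lemma isOutwardUnitNormal_dR (h0 : 0 < r) (hr : r < ε) :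
    IsOutwardUnitNormal (Metric.eball x (ENNReal.ofReal r)) (polarMap b ψ (r, u))
      (dR b ψ r u) := by
  have hr' : |r| < ε := by rwa [abs_of_pos h0]
  have hb := smul_mem_ball hr' (ψ.symm u)
  have hsrc : polarMap b ψ (r, u) ∈ e.source := hN.expChart_mem hb
  have happ : e (polarMap b ψ (r, u)) = r • (ψ.symm u : EuclideanSpace ℝ (Fin (m + 1))) :=
    hN.apply_expChart hb
  have he : ContMDiffAt (𝓡 (m + 1)) (𝓡 (m + 1)) ∞ e (polarMap b ψ (r, u)) :=
    contMDiffAt_of_mem_maximalAtlas hN.mem_maximalAtlas hsrc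
  have hsq : ContDiff ℝ ∞ fun z : EuclideanSpace ℝ (Fin (m + 1)) => ‖z‖ ^ 2 - r ^ 2 :=
    (contDiff_norm_sq ℝ).sub contDiff_const
  refine ⟨hN.norm_dR hψ hu hr', fun q => ‖e q‖ ^ 2 - r ^ 2,
    ContMDiffAt.comp (g := fun z : EuclideanSpace ℝ (Fin (m + 1)) => ‖z‖ ^ 2 - r ^ 2) _
      hsq.contMDiff.contMDiffAt he, ?_, ?_, 2 * r, by positivity, fun w => ?_⟩
  · simp [happ, norm_smul]
  · filter_upwards [e.open_source.mem_nhds hsrc] with q hq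
    rw [hN.mem_eball_iff h0 hr hq, sub_neg, sq_lt_sq₀ (norm_nonneg _) h0.le]
  · have h1 : MDifferentiableAt (𝓡 (m + 1)) 𝓘(ℝ, ℝ)
        (fun z : EuclideanSpace ℝ (Fin (m + 1)) => ‖z‖ ^ 2 - r ^ 2) (e (polarMap b ψ (r, u))) :=
      (hsq.differentiable (by simp)).differentiableAt.mdifferentiableAt
    have h2 := mfderiv_comp_apply (polarMap b ψ (r, u)) h1
      (mdiffAt_chart hN.mem_maximalAtlas hsrc) w
    refine h2.trans ?_
    have h3 : HasFDerivAt (fun z : EuclideanSpace ℝ (Fin (m + 1)) => ‖z‖ ^ 2 - r ^ 2)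
        ((2 : ℝ) • innerSL ℝ (e (polarMap b ψ (r, u)))) (e (polarMap b ψ (r, u))) := by
      have h4 := (hasStrictFDerivAt_norm_sq (e (polarMap b ψ (r, u)))).hasFDerivAt
      rw [ofNat_smul_eq_nsmul]
      exact h4.sub_const (r ^ 2)
    rw [mfderiv_eq_fderiv, h3.fderiv]
    have h5 := hN.metric_dR hψ hu hr' w
    refine Eq.trans ?_ (congrArg (fun t : ℝ => 2 * r * t) h5).symm
    rw [happ]
    change (2 : ℝ) * inner ℝ (r • (ψ.symm u : EuclideanSpace ℝ (Fin (m + 1))))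
      (tcoord e (polarMap b ψ (r, u)) w) = _
    rw [real_inner_smul_left, mul_assoc]

/-- Any other defining function f is nonnegative outside the ball, so its derivative in normal
coordinates is nonnegative on the half-space pointing outwards from θ and is a nonnegative multiple
of the pairing with θ. Gauss's lemma and nondegeneracy of the metric then make ν a nonnegative
multiple of ∂_r. -/
lemma eq_dR_of_isOutwardUnitNormal (h0 : 0 < r) (hr : r < ε)
    {ν : TangentSpace (𝓡 (m + 1)) (polarMap b ψ (r, u))}
    (h : IsOutwardUnitNormal (Metric.eball x (ENNReal.ofReal r)) (polarMap b ψ (r, u)) ν) :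
    ν = dR b ψ r u := by
  obtain ⟨hν, f, hf, hf0, hD, c, hc, hgrad⟩ := h
  have hr' : |r| < ε := by rwa [abs_of_pos h0]
  have hb := smul_mem_ball hr' (ψ.symm u)
  have hlt : ‖r • (ψ.symm u : EuclideanSpace ℝ (Fin (m + 1)))‖ < ε := by simpa using hb
  have hexp := hN.mdifferentiableAt_expChart hb
  have hfd : MDifferentiableAt (𝓡 (m + 1)) 𝓘(ℝ, ℝ) f
      (expChart b (r • (ψ.symm u : EuclideanSpace ℝ (Fin (m + 1))))) :=
    hf.mdifferentiableAt (by simp)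
  have hgd : DifferentiableAt ℝ (f ∘ expChart b)
      (r • (ψ.symm u : EuclideanSpace ℝ (Fin (m + 1)))) :=
    mdifferentiableAt_iff_differentiableAt.1 (hfd.comp _ hexp)
  have hl : ∀ v, fderiv ℝ (f ∘ expChart b) (r • (ψ.symm u : EuclideanSpace ℝ (Fin (m + 1)))) v =
      c * bil (expGram b (r • (ψ.symm u : EuclideanSpace ℝ (Fin (m + 1)))))
        (tcoord e (polarMap b ψ (r, u)) ν) v := by
    intro v
    have h1 := mfderiv_comp_apply (r • (ψ.symm u : EuclideanSpace ℝ (Fin (m + 1)))) hfd hexp v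
    rw [mfderiv_eq_fderiv] at h1
    refine h1.trans ((hgrad _).trans ?_)
    have h2 := hN.metric_polarMap hr' ν (mfderiv (𝓡 (m + 1)) (𝓡 (m + 1)) (expChart b)
      (r • (ψ.symm u : EuclideanSpace ℝ (Fin (m + 1)))) v)
    refine (congrArg (fun t : ℝ => c * t) h2).trans ?_
    exact congrArg (fun z => c * bil (expGram b (r • (ψ.symm u : EuclideanSpace ℝ (Fin (m + 1)))))
      (tcoord e (polarMap b ψ (r, u)) ν) z) (hN.tcoord_expChart hb v)
  have hev : ∀ᶠ z in 𝓝 (r • (ψ.symm u : EuclideanSpace ℝ (Fin (m + 1)))),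
      ‖z‖ < r ↔ f (expChart b z) < 0 := by
    filter_upwards [Metric.isOpen_ball.mem_nhds hb, hexp.continuousAt.eventually hD] with z hz hz'
    rw [← hz', hN.mem_eball_iff h0 hr (hN.expChart_mem hz), hN.apply_expChart hz]
  have hnonneg : ∀ v, 0 < inner ℝ (ψ.symm u : EuclideanSpace ℝ (Fin (m + 1))) v →
      0 ≤ fderiv ℝ (f ∘ expChart b) (r • (ψ.symm u : EuclideanSpace ℝ (Fin (m + 1)))) v := by
    intro v hv
    have hline : HasDerivAt (fun t : ℝ =>
        r • (ψ.symm u : EuclideanSpace ℝ (Fin (m + 1))) + t • v) v 0 := by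
      have h1 := ((hasDerivAt_id (0 : ℝ)).smul_const v).const_add
        (r • (ψ.symm u : EuclideanSpace ℝ (Fin (m + 1))))
      rwa [one_smul] at h1
    have hcomp : HasDerivAt (fun t : ℝ => (f ∘ expChart b)
        (r • (ψ.symm u : EuclideanSpace ℝ (Fin (m + 1))) + t • v))
        (fderiv ℝ (f ∘ expChart b) (r • (ψ.symm u : EuclideanSpace ℝ (Fin (m + 1)))) v) 0 := by
      have h1 : HasFDerivAt (f ∘ expChart b)
          (fderiv ℝ (f ∘ expChart b) (r • (ψ.symm u : EuclideanSpace ℝ (Fin (m + 1)))))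
          (r • (ψ.symm u : EuclideanSpace ℝ (Fin (m + 1))) + (0 : ℝ) • v) := by
        rw [zero_smul, add_zero]
        exact hgd.hasFDerivAt
      exact h1.comp_hasDerivAt (0 : ℝ) hline
    refine ge_of_tendsto hcomp.tendsto_slope_zero_right ?_
    have hev' : ∀ᶠ t in 𝓝 (0 : ℝ), ‖r • (ψ.symm u : EuclideanSpace ℝ (Fin (m + 1))) + t • v‖ < r ↔
        f (expChart b (r • (ψ.symm u : EuclideanSpace ℝ (Fin (m + 1))) + t • v)) < 0 := by
      have h1 := hline.continuousAt.tendsto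
      rw [zero_smul, add_zero] at h1
      exact h1.eventually hev
    filter_upwards [mem_nhdsWithin_of_mem_nhds hev', self_mem_nhdsWithin] with t ht htpos
    have htpos' : 0 < t := htpos
    have hz : (f ∘ expChart b) (r • (ψ.symm u : EuclideanSpace ℝ (Fin (m + 1))) + (0 : ℝ) • v) = 0 := by
      rw [zero_smul, add_zero]; exact hf0
    rw [zero_add, hz, sub_zero, smul_eq_mul]
    refine mul_nonneg (inv_nonneg.2 htpos'.le) (not_lt.1 fun hneg => ?_)
    have h1 := ht.2 hneg
    rw [← sq_lt_sq₀ (norm_nonneg _) h0.le, norm_add_sq_real, real_inner_smul_left,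
      real_inner_smul_right, norm_smul, norm_coe_symm, mul_one, Real.norm_of_nonneg h0.le] at h1
    have h2 : 0 < 2 * (r * (t * inner ℝ (ψ.symm u : EuclideanSpace ℝ (Fin (m + 1))) v)) := by
      positivity
    have h3 : 0 ≤ ‖t • v‖ ^ 2 := sq_nonneg _
    linarith
  have hmul := eq_inner_mul_of_nonneg (norm_coe_symm u) hnonneg
  set a := fderiv ℝ (f ∘ expChart b) (r • (ψ.symm u : EuclideanSpace ℝ (Fin (m + 1))))
    (ψ.symm u : EuclideanSpace ℝ (Fin (m + 1))) with ha_def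
  have ha : 0 ≤ a := hnonneg _ (by simp)
  have htc : tcoord e (polarMap b ψ (r, u)) ν =
      (a / c) • (ψ.symm u : EuclideanSpace ℝ (Fin (m + 1))) := by
    have hz : ∀ v, bil (expGram b (r • (ψ.symm u : EuclideanSpace ℝ (Fin (m + 1)))))
        (tcoord e (polarMap b ψ (r, u)) ν -
          (a / c) • (ψ.symm u : EuclideanSpace ℝ (Fin (m + 1)))) v = 0 := fun v => by
      have h1 := hl v
      rw [hmul v] at h1
      rw [map_sub, map_smul, _root_.sub_apply, _root_.smul_apply, hN.bil_expGram_ray _ _ hlt,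
        smul_eq_mul, sub_eq_zero, div_mul_eq_mul_div, eq_div_iff hc.ne', mul_comm, ← h1, mul_comm]
    rw [← sub_eq_zero]
    by_contra hne
    exact (bil_pos (hN.expGram_posDef hb) hne).ne' (hz _)
  exact hN.eq_dR_of_tcoord_eq hψ hu hr' hν (div_nonneg ha hc.le) htc

end IsNormalChart
/-! ### The Laplacian of a metric `dr² + r² g(r)` -/

section PolarCoordinates

variable {m : ℕ}

/-- The identification `ℝ × ℝᵐ → ℝᵐ⁺¹`, `(r, u) ↦ (r, u₁, …, uₘ)`. -/
noncomputable def consL (m : ℕ) :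
    ℝ × EuclideanSpace ℝ (Fin m) →L[ℝ] EuclideanSpace ℝ (Fin (m + 1)) :=
  LinearMap.toContinuousLinearMap
    { toFun := fun q => WithLp.toLp 2 (Fin.cons (α := fun _ => ℝ) q.1 (WithLp.ofLp q.2))
      map_add' := fun p q => by
        ext i
        refine Fin.cases ?_ (fun j => ?_) i <;> simp
      map_smul' := fun c q => by
        ext i
        refine Fin.cases ?_ (fun j => ?_) i <;> simp }

/-- The inverse of `consL`, that is, `z ↦ (z₀, (z₁, …, zₘ))`. -/
noncomputable def unconsL (m : ℕ) :
    EuclideanSpace ℝ (Fin (m + 1)) →L[ℝ] ℝ × EuclideanSpace ℝ (Fin m) :=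
  LinearMap.toContinuousLinearMap
    { toFun := fun z => (z 0, WithLp.toLp 2 fun i => z i.succ)
      map_add' := fun _ _ => rfl
      map_smul' := fun _ _ => rfl }

lemma consL_apply (q : ℝ × EuclideanSpace ℝ (Fin m)) :
    consL m q = WithLp.toLp 2 (Fin.cons (α := fun _ => ℝ) q.1 (WithLp.ofLp q.2)) := rfl

lemma unconsL_consL (q : ℝ × EuclideanSpace ℝ (Fin m)) : unconsL m (consL m q) = q := rfl

lemma consL_apply_zero (q : ℝ × EuclideanSpace ℝ (Fin m)) : consL m q 0 = q.1 := rfl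

lemma consL_one_zero : consL m (1, 0) = EuclideanSpace.single 0 1 := by
  ext i
  refine Fin.cases ?_ (fun j => ?_) i <;> simp [consL_apply]

lemma consL_zero_single (k : Fin m) :
    consL m (0, EuclideanSpace.single k 1) = EuclideanSpace.single k.succ 1 := by
  ext i
  refine Fin.cases ?_ (fun j => ?_) i
  · simp [consL_apply, Pi.single_apply, (Fin.succ_ne_zero k).symm]
  · simp [consL_apply, Pi.single_apply]

lemma unconsL_single_zero : unconsL m (EuclideanSpace.single 0 1) = (1, 0) := by
  rw [← consL_one_zero, unconsL_consL]

lemma unconsL_single_succ (k : Fin m) :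
    unconsL m (EuclideanSpace.single k.succ 1) = (0, EuclideanSpace.single k 1) := by
  rw [← consL_zero_single, unconsL_consL]

lemma hasDerivAt_comp_consL {g : EuclideanSpace ℝ (Fin (m + 1)) → ℝ}
    {q : ℝ × EuclideanSpace ℝ (Fin m)} (hg : DifferentiableAt ℝ g (consL m q)) :
    HasDerivAt (fun ρ => g (consL m (ρ, q.2))) (pd 0 g (consL m q)) q.1 := by
  have h1 : HasDerivAt (fun ρ => consL m (ρ, q.2)) (consL m (1, 0)) q.1 :=
    (consL m).hasFDerivAt.comp_hasDerivAt q.1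
      ((hasDerivAt_id q.1).prodMk (hasDerivAt_const q.1 q.2))
  rw [consL_one_zero] at h1
  exact hg.hasFDerivAt.comp_hasDerivAt q.1 h1

lemma pd_comp_consL {g : EuclideanSpace ℝ (Fin (m + 1)) → ℝ}
    {q : ℝ × EuclideanSpace ℝ (Fin m)} (hg : DifferentiableAt ℝ g (consL m q)) (k : Fin m) :
    pd k (fun u => g (consL m (q.1, u))) q.2 = pd k.succ g (consL m q) := by
  have h1 : HasFDerivAt (fun u => consL m (q.1, u))
      ((consL m).comp (ContinuousLinearMap.inr ℝ ℝ (EuclideanSpace ℝ (Fin m)))) q.2 :=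
    (consL m).hasFDerivAt.comp q.2 (hasFDerivAt_prodMk_right q.1 q.2)
  have h2 := hg.hasFDerivAt.comp q.2 h1
  rw [pd]
  refine (congrArg (fun L : EuclideanSpace ℝ (Fin m) →L[ℝ] ℝ => L (EuclideanSpace.single k 1))
    h2.fderiv).trans ?_
  rw [pd, ← consL_zero_single]
  rfl

/-- The matrix of `dr² + c A`. -/
def block (c : ℝ) (A : Matrix (Fin m) (Fin m) ℝ) : Matrix (Fin (m + 1)) (Fin (m + 1)) ℝ :=
  Matrix.of (Fin.cons (α := fun _ => Fin (m + 1) → ℝ) (Fin.cons (α := fun _ => ℝ) 1 0)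
    fun i => Fin.cons (α := fun _ => ℝ) 0 fun j => c * A i j)

variable (c : ℝ) (A : Matrix (Fin m) (Fin m) ℝ)

@[simp] lemma block_zero_zero : block c A 0 0 = 1 := rfl
@[simp] lemma block_zero_succ (j : Fin m) : block c A 0 j.succ = 0 := rfl
@[simp] lemma block_succ_zero (i : Fin m) : block c A i.succ 0 = 0 := rfl
@[simp] lemma block_succ_succ (i j : Fin m) : block c A i.succ j.succ = c * A i j := rfl

lemma block_det : (block c A).det = c ^ m * A.det := by
  rw [det_eq_of_cons rfl fun _ => rfl]
  have : (block c A).submatrix Fin.succ Fin.succ = c • A := by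
    ext i j; simp
  rw [this, Matrix.det_smul, Fintype.card_fin]

lemma block_inv {c : ℝ} (hc : c ≠ 0) {A : Matrix (Fin m) (Fin m) ℝ} (hA : A.det ≠ 0) :
    (block c A)⁻¹ = block c⁻¹ A⁻¹ := by
  refine Matrix.inv_eq_right_inv ?_
  ext i j
  rw [Matrix.mul_apply, Fin.sum_univ_succ]
  refine Fin.cases ?_ (fun i => ?_) i
  · refine Fin.cases ?_ (fun j => ?_) j
    · simp
    · simp [(Fin.succ_ne_zero j).symm]
  · refine Fin.cases ?_ (fun j => ?_) j
    · simp
    · have h1 := congrFun (congrFun (Matrix.mul_nonsing_inv A (isUnit_iff_ne_zero.2 hA)) i) j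
      rw [Matrix.mul_apply] at h1
      have h2 : ∀ k, c * A i k * (c⁻¹ * A⁻¹ k j) = A i k * A⁻¹ k j := fun k => by field_simp
      simp only [block_succ_zero, block_succ_succ, zero_mul, zero_add, h2, h1]
      simp [Matrix.one_apply]

lemma continuousAt_consL_left (q : ℝ × EuclideanSpace ℝ (Fin m)) :
    Filter.Tendsto (fun ρ => consL m (ρ, q.2)) (𝓝 q.1) (𝓝 (consL m q)) :=
  ((consL m).continuous.comp (by fun_prop : Continuous fun ρ : ℝ => (ρ, q.2))).tendsto q.1

lemma continuousAt_consL_right (q : ℝ × EuclideanSpace ℝ (Fin m)) :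
    Filter.Tendsto (fun u => consL m (q.1, u)) (𝓝 q.2) (𝓝 (consL m q)) :=
  ((consL m).continuous.comp
    (by fun_prop : Continuous fun u : EuclideanSpace ℝ (Fin m) => (q.1, u))).tendsto q.2

lemma contDiffAt_pd {d : ℕ} {f : EuclideanSpace ℝ (Fin d) → ℝ} {y : EuclideanSpace ℝ (Fin d)}
    (hf : ContDiffAt ℝ 2 f y) (i : Fin d) : ContDiffAt ℝ 1 (pd i f) y :=
  (hf.fderiv_right (m := 1) (by norm_num)).clm_apply contDiffAt_const

/-- The Laplacian of the metric `dr² + r² g(r, u)` on functions on `(0, ∞) × ℝᵐ`. -/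
theorem coordLaplacian_polar {g : ℝ × EuclideanSpace ℝ (Fin m) → Matrix (Fin m) (Fin m) ℝ}
    {r : ℝ} {u : EuclideanSpace ℝ (Fin m)} (hr : 0 < r)
    (hg : ∀ i j, ContDiffAt ℝ 1 (fun q => g q i j) (r, u)) (hpos : 0 < (g (r, u)).det)
    {F : EuclideanSpace ℝ (Fin (m + 1)) → ℝ} (hF : ContDiffAt ℝ 2 F (consL m (r, u))) :
    -coordLaplacian (fun z => block (z 0 ^ 2) (g (unconsL m z))) F (consL m (r, u)) =
      deriv (deriv fun ρ => F (consL m (ρ, u))) r +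
        m / r * deriv (fun ρ => F (consL m (ρ, u))) r +
        deriv (fun ρ => Real.log √(g (ρ, u)).det) r * deriv (fun ρ => F (consL m (ρ, u))) r -
        (r ^ 2)⁻¹ * coordLaplacian (fun u' => g (r, u')) (fun u' => F (consL m (r, u'))) u := by
  have hgz : ∀ i j, ContDiffAt ℝ 1 (fun z => g (unconsL m z) i j) (consL m (r, u)) := fun i j =>
    ContDiffAt.comp (consL m (r, u)) (g := fun q => g q i j) (hg i j) (unconsL m).contDiff.contDiffAt
  have hz0 : ContDiffAt ℝ 1 (fun z : EuclideanSpace ℝ (Fin (m + 1)) => z 0) (consL m (r, u)) :=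
    (EuclideanSpace.proj (0 : Fin (m + 1)) : _ →L[ℝ] ℝ).contDiff.contDiffAt
  have hdetz : ContDiffAt ℝ 1 (fun z => (g (unconsL m z)).det) (consL m (r, u)) :=
    contDiffAt_det hgz
  have hsqz : ContDiffAt ℝ 1 (fun z => √(g (unconsL m z)).det) (consL m (r, u)) :=
    hdetz.sqrt hpos.ne'
  have hev : ∀ᶠ z in 𝓝 (consL m (r, u)), 0 < z 0 ∧ 0 < (g (unconsL m z)).det ∧
      DifferentiableAt ℝ F z :=
    (hz0.continuousAt.eventually (lt_mem_nhds hr)).and ((hdetz.continuousAt.eventually (lt_mem_nhds hpos)).and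
      ((hF.eventually (by simp)).mono fun z hz => hz.differentiableAt (by simp)))
  have hsq : ∀ z : EuclideanSpace ℝ (Fin (m + 1)), 0 < z 0 →
      √(block (z 0 ^ 2) (g (unconsL m z))).det = z 0 ^ m * √(g (unconsL m z)).det := by
    intro z hz
    rw [block_det, Real.sqrt_mul (by positivity), ← pow_mul, mul_comm 2 m, pow_mul,
      Real.sqrt_sq (by positivity)]
  have hpdF : ∀ i, ContDiffAt ℝ 1 (pd i F) (consL m (r, u)) := contDiffAt_pd hF
  -- the radial component of the field `√det G grad F`
  have hrad : (fun z => ∑ j, (block (z 0 ^ 2) (g (unconsL m z)))⁻¹ 0 j *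
      √(block (z 0 ^ 2) (g (unconsL m z))).det * pd j F z) =ᶠ[𝓝 (consL m (r, u))]
      fun z => z 0 ^ m * √(g (unconsL m z)).det * pd 0 F z := by
    filter_upwards [hev] with z hz
    rw [block_inv (pow_pos hz.1 2).ne' hz.2.1.ne', Fin.sum_univ_succ, hsq z hz.1]
    simp
  have hang : ∀ k : Fin m, (fun z => ∑ j, (block (z 0 ^ 2) (g (unconsL m z)))⁻¹ k.succ j *
      √(block (z 0 ^ 2) (g (unconsL m z))).det * pd j F z) =ᶠ[𝓝 (consL m (r, u))]
      fun z => z 0 ^ m * (z 0 ^ 2)⁻¹ * ∑ j : Fin m, (g (unconsL m z))⁻¹ k j *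
        √(g (unconsL m z)).det * pd j.succ F z := by
    intro k
    filter_upwards [hev] with z hz
    rw [block_inv (pow_pos hz.1 2).ne' hz.2.1.ne', Fin.sum_univ_succ, hsq z hz.1, Finset.mul_sum]
    simp only [block_succ_zero, block_succ_succ, zero_mul, zero_add]
    exact Finset.sum_congr rfl fun j _ => by ring
  have hS0 : √(g (r, u)).det ≠ 0 := (Real.sqrt_pos.2 hpos).ne'
  -- radial part
  have hφ : ∀ᶠ ρ in 𝓝 r, deriv (fun ρ => F (consL m (ρ, u))) ρ = pd 0 F (consL m (ρ, u)) :=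
    ((continuousAt_consL_left (r, u)).eventually hev).mono fun ρ hρ =>
      (hasDerivAt_comp_consL (q := (ρ, u)) hρ.2.2).deriv
  have hφ' : HasDerivAt (fun ρ => pd 0 F (consL m (ρ, u)))
      (deriv (deriv fun ρ => F (consL m (ρ, u))) r) r := by
    have h1 := hasDerivAt_comp_consL (q := (r, u)) ((hpdF 0).differentiableAt (by simp))
    rw [Filter.EventuallyEq.deriv_eq hφ]
    exact h1.differentiableAt.hasDerivAt
  have hS : HasDerivAt (fun ρ => √(g (ρ, u)).det) (deriv (fun ρ => √(g (ρ, u)).det) r) r :=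
    (hasDerivAt_comp_consL (q := (r, u))
      (hsqz.differentiableAt (by simp))).differentiableAt.hasDerivAt
  have hlog : deriv (fun ρ => Real.log √(g (ρ, u)).det) r =
      deriv (fun ρ => √(g (ρ, u)).det) r / √(g (r, u)).det := (hS.log hS0).deriv
  have hpd0 : pd 0 (fun z => z 0 ^ m * √(g (unconsL m z)).det * pd 0 F z) (consL m (r, u)) =
      (m * r ^ (m - 1) * √(g (r, u)).det + r ^ m * deriv (fun ρ => √(g (ρ, u)).det) r) *
        pd 0 F (consL m (r, u)) +
      r ^ m * √(g (r, u)).det * deriv (deriv fun ρ => F (consL m (ρ, u))) r := by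
    have h1 := hasDerivAt_comp_consL (q := (r, u))
      ((((hz0.pow m).mul hsqz).mul (hpdF 0)).differentiableAt (by simp))
    have h2 := ((hasDerivAt_pow m r).mul hS).mul hφ'
    exact h1.unique h2
  -- angular part
  have hpdk : ∀ k : Fin m, pd k.succ (fun z => z 0 ^ m * (z 0 ^ 2)⁻¹ *
      ∑ j : Fin m, (g (unconsL m z))⁻¹ k j * √(g (unconsL m z)).det * pd j.succ F z)
        (consL m (r, u)) =
      r ^ m * (r ^ 2)⁻¹ * pd k (fun u' => ∑ j : Fin m, (g (r, u'))⁻¹ k j * √(g (r, u')).det *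
        pd j (fun u' => F (consL m (r, u'))) u') u := by
    intro k
    have hd : DifferentiableAt ℝ (fun z => z 0 ^ m * (z 0 ^ 2)⁻¹ *
        ∑ j : Fin m, (g (unconsL m z))⁻¹ k j * √(g (unconsL m z)).det * pd j.succ F z)
        (consL m (r, u)) := by
      refine ContDiffAt.differentiableAt (n := 1) (((hz0.pow m).mul ((hz0.pow 2).inv
        (pow_pos hr 2).ne')).mul (ContDiffAt.sum fun j _ => ?_)) (by simp)
      exact ((contDiffAt_inv_apply hgz hpos.ne' k j).mul hsqz).mul (hpdF j.succ)
    rw [← pd_comp_consL (q := (r, u)) hd, ← pd_const_mul]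
    refine pd_congr ?_ k
    filter_upwards [(continuousAt_consL_right (r, u)).eventually hev] with u' hu'
    have h1 : ∀ j : Fin m, pd j (fun u' => F (consL m (r, u'))) u' =
        pd j.succ F (consL m (r, u')) := fun j => pd_comp_consL (q := (r, u')) hu'.2.2 j
    simp only [h1, unconsL_consL, consL_apply_zero]
  rw [coordLaplacian, Fin.sum_univ_succ, pd_congr hrad, hpd0]
  simp only [pd_congr (hang _), hpdk]
  rw [hsq _ hr, ← Finset.mul_sum, coordLaplacian, hlog, hφ.self_of_nhds]
  simp only [unconsL_consL, consL_apply_zero]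
  -- For m = 0 the truncated exponent is harmless, since both sides vanish.
  have hm : (m : ℝ) * r ^ (m - 1) = m / r * r ^ m := by
    rcases m with _ | k
    · simp
    · simp [pow_succ]; field_simp
  rw [hm]
  have hrm : r ^ m ≠ 0 := (pow_pos hr m).ne'
  generalize (∑ k : Fin m, pd k (fun u' => ∑ j : Fin m, (g (r, u'))⁻¹ k j * √(g (r, u')).det *
        pd j (fun u' => F (consL m (r, u'))) u') u) = Q
  generalize √(g (r, u)).det = S at hS0 ⊢
  field_simp
  ring

end PolarCoordinates
/-! ### The metrics of geodesic spheres -/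

namespace IsRiemannianForm

variable {d : ℕ} {N : Type*} [TopologicalSpace N] [ChartedSpace (EuclideanSpace ℝ (Fin d)) N]
  [IsManifold (𝓡 d) ∞ N] {h : ∀ p : N, TangentSpace (𝓡 d) p → TangentSpace (𝓡 d) p → ℝ}

/-- The value at `p` of a Riemannian form, as a bilinear form on the model space. -/
noncomputable def innerAt
    (h : ∀ p : N, TangentSpace (𝓡 d) p → TangentSpace (𝓡 d) p → ℝ) (p : N) :
    EuclideanSpace ℝ (Fin d) →L[ℝ] EuclideanSpace ℝ (Fin d) →L[ℝ] ℝ :=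
  (bil (pullGram h (chartAt (EuclideanSpace ℝ (Fin d)) p).symm
    (chartAt (EuclideanSpace ℝ (Fin d)) p p))).bilinearComp
    (show EuclideanSpace ℝ (Fin d) →L[ℝ] EuclideanSpace ℝ (Fin d) from
      tcoord (chartAt (EuclideanSpace ℝ (Fin d)) p) p)
    (show EuclideanSpace ℝ (Fin d) →L[ℝ] EuclideanSpace ℝ (Fin d) from
      tcoord (chartAt (EuclideanSpace ℝ (Fin d)) p) p)

lemma innerAt_apply (hh : IsRiemannianForm h) (p : N) (v w : TangentSpace (𝓡 d) p) :
    innerAt h p v w = h p v w :=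
  (hh.eq_bil (IsManifold.chart_mem_maximalAtlas p) (mem_chart_source _ p) v w).symm

/-- A positive minimum c on the compact unit sphere gives c‖v‖² ≤ B(v, v). This is the compatibility
with the topology of the fibre that a bundle metric must satisfy. -/
lemma isBounded_bil_lt_one {B : EuclideanSpace ℝ (Fin d) →L[ℝ] EuclideanSpace ℝ (Fin d) →L[ℝ] ℝ}
    (hB : ∀ v, v ≠ 0 → 0 < B v v) : Bornology.IsBounded {v | B v v < 1} := by
  obtain ⟨c, hc, hcb⟩ := (isCompact_sphere (0 : EuclideanSpace ℝ (Fin d)) 1).exists_forall_le'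
    (f := fun v => B v v) (a := 0)
    (B.continuous.clm_apply continuous_id).continuousOn fun v hv =>
      hB v (by rintro rfl; simp at hv)
  refine (Metric.isBounded_closedBall (x := (0 : EuclideanSpace ℝ (Fin d)))
    (r := √(c⁻¹))).subset fun v hv => ?_
  rw [mem_closedBall_zero_iff]
  refine Real.le_sqrt_of_sq_le ?_
  rcases eq_or_ne v 0 with rfl | h0
  · simp [hc.le]
  · have hn : 0 < ‖v‖ := norm_pos_iff.2 h0
    have h1 := hcb (‖v‖⁻¹ • v) (by simp [norm_smul, hn.ne'])
    simp only [map_smul, _root_.smul_apply, smul_eq_mul] at h1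
    have h2 : B v v < 1 := hv
    rw [← mul_assoc, ← mul_inv, ← sq, inv_mul_eq_div, le_div_iff₀ (by positivity)] at h1
    rw [le_inv_comm₀ (by positivity) hc]
    rw [← one_div, le_div_iff₀ (by positivity)]
    exact h1.trans h2.le

/-- A Riemannian form is a smooth Riemannian metric on the tangent bundle. -/
noncomputable def toMetric (hh : IsRiemannianForm h) :
    ContMDiffRiemannianMetric (𝓡 d) ∞ (EuclideanSpace ℝ (Fin d))
      (fun p : N => TangentSpace (𝓡 d) p) where
  inner p := innerAt h p
  symm p v w := by
    refine (hh.innerAt_apply p v w).trans (Eq.trans ?_ (hh.innerAt_apply p w v).symm)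
    have hc := IsManifold.chart_mem_maximalAtlas (I := 𝓡 d) (n := ∞) p
    rw [hh.eq_bil hc (mem_chart_source _ p), hh.eq_bil hc (mem_chart_source _ p)]
    exact bil_symm (isSymm_of_posDef (hh.posDef _ hc _ (mem_chart_target _ p))) _ _
  pos p v hv := by
    refine lt_of_lt_of_eq ?_ (hh.innerAt_apply p v v).symm
    have hc := IsManifold.chart_mem_maximalAtlas (I := 𝓡 d) (n := ∞) p
    rw [hh.eq_bil hc (mem_chart_source _ p)]
    refine bil_pos (hh.posDef _ hc _ (mem_chart_target _ p)) fun h0 => hv ?_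
    exact tcoord_injective hc (mem_chart_source _ p) (h0.trans (map_zero _).symm)
  isVonNBounded p := by
    have hc := IsManifold.chart_mem_maximalAtlas (I := 𝓡 d) (n := ∞) p
    refine (NormedSpace.isVonNBounded_iff ℝ (E := EuclideanSpace ℝ (Fin d))).2
      (isBounded_bil_lt_one (B := innerAt h p) fun v hv => ?_)
    refine bil_pos (hh.posDef _ hc _ (mem_chart_target _ p)) fun h0 => hv ?_
    exact tcoord_injective hc (mem_chart_source _ p) (h0.trans (map_zero _).symm)
  contMDiff p := by
    set c := chartAt (EuclideanSpace ℝ (Fin d)) p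
    have hc : c ∈ IsManifold.maximalAtlas (𝓡 d) ∞ N := IsManifold.chart_mem_maximalAtlas p
    rw [contMDiffAt_hom_bundle]
    refine ⟨contMDiffAt_id, ?_⟩
    have hsm : ContMDiffAt (𝓡 d) 𝓘(ℝ, EuclideanSpace ℝ (Fin d) →L[ℝ]
        EuclideanSpace ℝ (Fin d) →L[ℝ] ℝ) ∞ (fun q => bil (pullGram h c.symm (c q))) p := by
      refine ContMDiffAt.comp p (g := fun y => bil (pullGram h c.symm y)) ?_
        (contMDiffAt_of_mem_maximalAtlas hc (mem_chart_source _ p))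
      exact ((contDiffOn_bil (hh.smooth c hc)).contDiffAt
        (c.open_target.mem_nhds (mem_chart_target _ p))).contMDiffAt
    refine hsm.congr_of_eventuallyEq ?_
    filter_upwards [c.open_source.mem_nhds (mem_chart_source _ p)] with q hq
    ext v w
    -- The tangent bundle is trivialized around p by the derivative of the preferred chart, so in
    -- this trivialization the form is given by the Gram matrix of the chart, already known to be
    -- smooth.
    have hsymm : ∀ v : EuclideanSpace ℝ (Fin d), tcoord c q ((trivializationAt
        (EuclideanSpace ℝ (Fin d)) (TangentSpace (𝓡 d)) p).symm q v) = v := by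
      intro v
      have hb : q ∈ (trivializationAt (EuclideanSpace ℝ (Fin d)) (TangentSpace (𝓡 d)) p).baseSet :=
        hq
      have h1 := (trivializationAt (EuclideanSpace ℝ (Fin d))
        (TangentSpace (𝓡 d)) p).continuousLinearMapAt_symmL (R := ℝ) hb v
      rw [TangentBundle.continuousLinearMapAt_trivializationAt hq, Trivialization.symmL_apply (hb := hb)] at h1
      have hext : (extChartAt (𝓡 d) p : N → EuclideanSpace ℝ (Fin d)) = c := by
        ext z; simp [c]
      rw [hext] at h1
      exact h1
    have h1 := inCoordinates_apply_eq₂ (𝕜 := ℝ) (F₁ := EuclideanSpace ℝ (Fin d))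
      (F₂ := EuclideanSpace ℝ (Fin d)) (F₃ := ℝ) (E₁ := fun q : N => TangentSpace (𝓡 d) q)
      (E₂ := fun q : N => TangentSpace (𝓡 d) q) (E₃ := Bundle.Trivial N ℝ) (x₀ := p) (x := q)
      (ϕ := innerAt h q) (v := v) (w := w) hq hq (by simp)
    have h2 := (hh.innerAt_apply q ((trivializationAt
        (EuclideanSpace ℝ (Fin d)) (TangentSpace (𝓡 d)) p).symm q v) ((trivializationAt
        (EuclideanSpace ℝ (Fin d)) (TangentSpace (𝓡 d)) p).symm q w)).trans (hh.eq_bil hc hq _ _)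
    rw [hsymm, hsymm] at h2
    refine h1.trans (Eq.trans ?_ h2)
    simp
    rfl

end IsRiemannianForm

/-! ### The angular operator and the Laplacian in geodesic polar coordinates. -/

section AngularLaplacian

variable {m : ℕ} {M : Type*} [TopologicalSpace M] [ChartedSpace (EuclideanSpace ℝ (Fin (m + 1))) M]
  [RiemannianBundle (fun x : M => TangentSpace (𝓡 (m + 1)) x)]
  {x : M} {b : Fin (m + 1) → TangentSpace (𝓡 (m + 1)) x} {r : ℝ}

lemma angularLaplacian_eq (b : Fin (m + 1) → TangentSpace (𝓡 (m + 1)) x) (hr : r ≠ 0)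
    (f : USphere m → ℝ) (θ : USphere m) :
    angularLaplacian b r f θ = laplaceBeltrami (sphForm b r) f θ := by
  have h2 : 0 < r ^ 2 := by positivity
  have h1 : pullGram (inducedForm b r) (chartAt (EuclideanSpace ℝ (Fin m)) θ).symm =
      fun u => r ^ 2 • pullGram (sphForm b r) (chartAt (EuclideanSpace ℝ (Fin m)) θ).symm u := by
    funext u
    ext i j
    rw [Matrix.smul_apply, smul_eq_mul]
    simp only [pullGram, Matrix.of_apply, sphForm]
    rw [mul_inv_cancel_left₀ h2.ne']
  rw [angularLaplacian, laplaceBeltrami, h1, coordLaplacian_smul h2, mul_inv_cancel_left₀ h2.ne']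
  rfl

namespace IsNormalChart

variable {ε : ℝ} {e : OpenPartialHomeomorph M (EuclideanSpace ℝ (Fin (m + 1)))}
  [IsManifold (𝓡 (m + 1)) ∞ M] (hN : IsNormalChart b ε e)
  [IsContMDiffRiemannianBundle (𝓡 (m + 1)) ∞ (EuclideanSpace ℝ (Fin (m + 1)))
    (fun x : M => TangentSpace (𝓡 (m + 1)) x)]

include hN

lemma isRiemannianForm_sphForm (h0 : r ≠ 0) (hr : |r| < ε) : IsRiemannianForm (sphForm b r) where
  add_left θ u v w := by
    have h1 := inner_add_left (𝕜 := ℝ) (E := TangentSpace (𝓡 (m + 1)) (sphMap b r θ))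
      (mfderiv (𝓡 m) (𝓡 (m + 1)) (sphMap b r) θ u) (mfderiv (𝓡 m) (𝓡 (m + 1)) (sphMap b r) θ v)
      (mfderiv (𝓡 m) (𝓡 (m + 1)) (sphMap b r) θ w)
    rw [sphForm, sphForm, sphForm, inducedForm, map_add, metric, h1, mul_add]
    rfl
  smul_left θ c v w := by
    have h1 := real_inner_smul_left (F := TangentSpace (𝓡 (m + 1)) (sphMap b r θ))
      (mfderiv (𝓡 m) (𝓡 (m + 1)) (sphMap b r) θ v) (mfderiv (𝓡 m) (𝓡 (m + 1)) (sphMap b r) θ w) c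
    rw [sphForm, sphForm, inducedForm, map_smul, metric, h1, mul_left_comm]
    rfl
  add_right θ u v w := by
    have h1 := inner_add_right (𝕜 := ℝ) (E := TangentSpace (𝓡 (m + 1)) (sphMap b r θ))
      (mfderiv (𝓡 m) (𝓡 (m + 1)) (sphMap b r) θ u) (mfderiv (𝓡 m) (𝓡 (m + 1)) (sphMap b r) θ v)
      (mfderiv (𝓡 m) (𝓡 (m + 1)) (sphMap b r) θ w)
    rw [sphForm, sphForm, sphForm, inducedForm, map_add, metric, h1, mul_add]
    rfl
  smul_right θ c v w := by
    have h1 := real_inner_smul_right (F := TangentSpace (𝓡 (m + 1)) (sphMap b r θ))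
      (mfderiv (𝓡 m) (𝓡 (m + 1)) (sphMap b r) θ v) (mfderiv (𝓡 m) (𝓡 (m + 1)) (sphMap b r) θ w) c
    rw [sphForm, sphForm, inducedForm, map_smul, metric, h1, mul_left_comm]
    rfl
  smooth ψ hψ i j := by
    have h1 := (hN.contDiffOn_tGram hψ i j).comp (contDiff_prodMk_right r).contDiffOn
      (fun u hu => (⟨abs_lt.1 hr, hu⟩ : (r, u) ∈ Ioo (-ε) ε ×ˢ ψ.target))
    exact h1.congr fun u hu => by rw [hN.pullGram_sphForm hψ hu hr h0]; rfl
  posDef ψ hψ u hu := by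
    rw [hN.pullGram_sphForm hψ hu hr h0]
    exact hN.tGram_posDef hψ hu hr

variable {ψ : OpenPartialHomeomorph (USphere m) (EuclideanSpace ℝ (Fin m))}
  (hψ : ψ ∈ IsManifold.maximalAtlas (𝓡 m) ∞ (USphere m))
  {u : EuclideanSpace ℝ (Fin m)}

/-- The operator `L_θ(x, r)` in a chart of the sphere. -/
lemma angularLaplacian_chart (hψ : ψ ∈ IsManifold.maximalAtlas (𝓡 m) ∞ (USphere m))
    (hu : u ∈ ψ.target) (h0 : r ≠ 0) (hr : |r| < ε) {f : USphere m → ℝ}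
    (hf : ContMDiffAt (𝓡 m) 𝓘(ℝ, ℝ) 2 f (ψ.symm u)) :
    angularLaplacian b r f (ψ.symm u) = coordLaplacian (tGram b ψ r) (f ∘ ψ.symm) u := by
  rw [angularLaplacian_eq b h0,
    (hN.isRiemannianForm_sphForm h0 hr).laplaceBeltrami_eq hψ (ψ.map_target hu) hf,
    ψ.right_inv hu]
  refine coordLaplacian_congr ?_ Filter.EventuallyEq.rfl
  filter_upwards [ψ.open_target.mem_nhds hu] with z hz using hN.pullGram_sphForm hψ hz hr h0

/-- The Laplacian in geodesic polar coordinates. -/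
theorem laplaceBeltrami_polar (h0 : 0 < r) (hr : r < ε) (θ : USphere m) {w : M → ℝ}
    (hw : ContMDiffAt (𝓡 (m + 1)) 𝓘(ℝ, ℝ) 2 w
      (expChart b (r • (θ : EuclideanSpace ℝ (Fin (m + 1)))))) :
    -laplaceBeltrami (metric (n := m + 1) (M := M)) w
        (expChart b (r • (θ : EuclideanSpace ℝ (Fin (m + 1))))) =
      deriv (deriv fun ρ : ℝ =>
          w (expChart b (ρ • (θ : EuclideanSpace ℝ (Fin (m + 1)))))) r +
        (m : ℝ) / r * deriv (fun ρ : ℝ =>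
          w (expChart b (ρ • (θ : EuclideanSpace ℝ (Fin (m + 1)))))) r +
        deriv (fun ρ : ℝ => Real.log (expJ b (ρ • (θ : EuclideanSpace ℝ (Fin (m + 1)))))) r *
          deriv (fun ρ : ℝ => w (expChart b (ρ • (θ : EuclideanSpace ℝ (Fin (m + 1)))))) r -
        (r ^ 2)⁻¹ * angularLaplacian b r
          (fun θ' => w (expChart b (r • (θ' : EuclideanSpace ℝ (Fin (m + 1)))))) θ := by
  obtain ⟨ψ, hψ, u, hu, rfl⟩ : ∃ ψ ∈ IsManifold.maximalAtlas (𝓡 m) ∞ (USphere m),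
      ∃ u ∈ ψ.target, ψ.symm u = θ :=
    ⟨chartAt (EuclideanSpace ℝ (Fin m)) θ, IsManifold.chart_mem_maximalAtlas θ, _,
      mem_chart_target _ θ, (chartAt (EuclideanSpace ℝ (Fin m)) θ).left_inv (mem_chart_source _ θ)⟩
  have hr' : |r| < ε := by rwa [abs_of_pos h0]
  have hb := smul_mem_ball hr' (ψ.symm u)
  have hsrc := hN.expChart_mem hb
  -- the map `T : (ρ, v) ↦ ρ θ(v)`
  let T : EuclideanSpace ℝ (Fin (m + 1)) → EuclideanSpace ℝ (Fin (m + 1)) := fun z =>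
    (unconsL m z).1 • (ψ.symm (unconsL m z).2 : EuclideanSpace ℝ (Fin (m + 1)))
  have hTc : ∀ q : ℝ × EuclideanSpace ℝ (Fin m),
      T (consL m q) = q.1 • (ψ.symm q.2 : EuclideanSpace ℝ (Fin (m + 1))) := fun q => rfl
  have hTd : ∀ z, (unconsL m z).2 ∈ ψ.target → HasFDerivAt T
      (((unconsL m z).1 • ((fderiv ℝ (fun u' => (ψ.symm u' : EuclideanSpace ℝ (Fin (m + 1))))
          (unconsL m z).2).comp (ContinuousLinearMap.snd ℝ ℝ (EuclideanSpace ℝ (Fin m)))) +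
        (ContinuousLinearMap.fst ℝ ℝ (EuclideanSpace ℝ (Fin m))).smulRight
          (ψ.symm (unconsL m z).2 : EuclideanSpace ℝ (Fin (m + 1)))).comp (unconsL m)) z :=
    fun z hz => HasFDerivAt.comp (g := fun q : ℝ × EuclideanSpace ℝ (Fin m) =>
      q.1 • (ψ.symm q.2 : EuclideanSpace ℝ (Fin (m + 1)))) z
      (hasFDerivAt_smul_coe_symm hψ hz (unconsL m z).1) (unconsL m).hasFDerivAt
  have hTsm : ContDiffAt ℝ ∞ T (consL m (r, u)) := by
    refine ContDiffAt.smul (contDiff_fst.comp (unconsL m).contDiff).contDiffAt ?_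
    exact ContDiffAt.comp (consL m (r, u))
      (g := fun v => (ψ.symm v : EuclideanSpace ℝ (Fin (m + 1))))
      ((contDiffOn_coe_symm hψ).contDiffAt (ψ.open_target.mem_nhds hu))
      (contDiff_snd.comp (unconsL m).contDiff).contDiffAt
  have hcol0 : ∀ z, (unconsL m z).2 ∈ ψ.target →
      (WithLp.toLp 2 fun k => jac T z k 0) =
        (ψ.symm (unconsL m z).2 : EuclideanSpace ℝ (Fin (m + 1))) := by
    intro z hz
    ext k
    simp [jac, (hTd z hz).fderiv, unconsL_single_zero]
  have hcolS : ∀ z, (unconsL m z).2 ∈ ψ.target → ∀ j : Fin m,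
      (WithLp.toLp 2 fun k => jac T z k j.succ) =
        (unconsL m z).1 • sphFrame ψ (unconsL m z).2 j := by
    intro z hz j
    ext k
    simp [jac, (hTd z hz).fderiv, unconsL_single_succ, sphFrame]
  have hmem : ∀ᶠ z in 𝓝 (consL m (r, u)), (unconsL m z).2 ∈ ψ.target ∧ |(unconsL m z).1| < ε := by
    have hc : Filter.Tendsto (unconsL m) (𝓝 (consL m (r, u))) (𝓝 (r, u)) :=
      (unconsL m).continuous.tendsto _
    have h1 : ∀ᶠ q in 𝓝 (r, u), q.2 ∈ ψ.target ∧ |q.1| < ε :=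
      ((continuous_snd.tendsto (r, u)).eventually (ψ.open_target.mem_nhds hu)).and
        ((continuous_abs.comp continuous_fst).tendsto (r, u) |>.eventually (gt_mem_nhds hr'))
    exact hc.eventually h1
  -- Gauss's lemma: the first column θ of the Jacobian has unit length and is orthogonal to the
  -- columns ρ ∂ⱼθ, so the metric has block form.
  have hblock : ∀ᶠ z in 𝓝 (consL m (r, u)),
      block (z 0 ^ 2) (tGram b ψ (unconsL m z).1 (unconsL m z).2) =
        (jac T z)ᵀ * expGram b (T z) * jac T z := by
    filter_upwards [hmem] with z hz
    have hlt : ‖(unconsL m z).1 • (ψ.symm (unconsL m z).2 : EuclideanSpace ℝ (Fin (m + 1)))‖ < ε :=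
      by simpa using smul_mem_ball hz.2 (ψ.symm (unconsL m z).2)
    have hsymm := isSymm_of_posDef (hN.expGram_posDef (smul_mem_ball hz.2 (ψ.symm (unconsL m z).2)))
    ext i j
    rw [transpose_mul_mul_apply]
    refine Fin.cases ?_ (fun i => ?_) i
    · rw [hcol0 z hz.1]
      refine Fin.cases ?_ (fun j => ?_) j
      · rw [hcol0 z hz.1]
        exact ((hN.bil_expGram_ray _ _ hlt).trans (by simp)).symm
      · rw [hcolS z hz.1]
        refine ((hN.bil_expGram_ray _ _ hlt).trans ?_).symm
        rw [real_inner_smul_right, inner_sphFrame hψ hz.1, mul_zero]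
        rfl
    · rw [hcolS z hz.1]
      refine Fin.cases ?_ (fun j => ?_) j
      · rw [hcol0 z hz.1, bil_symm hsymm]
        refine ((hN.bil_expGram_ray _ _ hlt).trans ?_).symm
        rw [real_inner_smul_right, inner_sphFrame hψ hz.1, mul_zero]
        rfl
      · rw [hcolS z hz.1, block_succ_succ, tGram_apply]
        simp only [map_smul, _root_.smul_apply, smul_eq_mul]
        rw [← mul_assoc, ← sq]
        rfl
  -- The block determinant r²ᵐ |g̃| is nonzero because r > 0, and it contains this Jacobian as a
  -- factor.
  have hdetT : (jac T (consL m (r, u))).det ≠ 0 := by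
    intro h1
    have h2 := congrArg Matrix.det hblock.self_of_nhds
    rw [Matrix.det_mul, h1, mul_zero, block_det] at h2
    have h3 := (hN.tGram_posDef hψ hu hr').det_pos
    exact (mul_pos (pow_pos (pow_pos h0 2) m) h3).ne' h2
  have hwe : ContDiffAt ℝ 2 (w ∘ expChart b) (r • (ψ.symm u : EuclideanSpace ℝ (Fin (m + 1)))) :=
    ContMDiffAt.contDiffAt (ContMDiffAt.comp _ hw
      ((hN.contMDiffAt_expChart hb).of_le (by norm_cast)))
  -- pass to normal coordinates, then to polar coordinates
  have h1 : laplaceBeltrami (metric (n := m + 1) (M := M)) w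
      (expChart b (r • (ψ.symm u : EuclideanSpace ℝ (Fin (m + 1))))) =
      coordLaplacian (expGram b) (w ∘ expChart b)
        (r • (ψ.symm u : EuclideanSpace ℝ (Fin (m + 1)))) := by
    rw [isRiemannianForm_metric.laplaceBeltrami_eq hN.mem_maximalAtlas hsrc hw,
      hN.apply_expChart hb]
    refine coordLaplacian_congr ?_ ?_
    · filter_upwards [Metric.isOpen_ball.mem_nhds hb] with z hz using (hN.expGram_eq hz).symm
    · filter_upwards [hN.eventuallyEq hb] with z hz using congrArg w hz
  have h2 := coordLaplacian_comp (Φ := T) (y := consL m (r, u)) (G' := expGram b)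
    (G := fun z => block (z 0 ^ 2) (tGram b ψ (unconsL m z).1 (unconsL m z).2))
    (f := w ∘ expChart b) (hTsm.of_le (by norm_cast)) hdetT
    (fun i j => ((hN.contDiffOn_expGram i j).contDiffAt
      (Metric.isOpen_ball.mem_nhds hb)).of_le (by norm_cast))
    (hN.expGram_posDef hb).det_pos hblock hwe
  have hopen : Ioo (-ε) ε ×ˢ ψ.target ∈ 𝓝 (r, u) :=
    (isOpen_Ioo.prod ψ.open_target).mem_nhds ⟨abs_lt.1 hr', hu⟩
  have h3 := coordLaplacian_polar (g := fun q => tGram b ψ q.1 q.2) (u := u) h0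
    (fun i j => ((hN.contDiffOn_tGram hψ i j).contDiffAt hopen).of_le (by norm_cast))
    (hN.tGram_posDef hψ hu hr').det_pos (F := (w ∘ expChart b) ∘ T)
    (ContDiffAt.comp _ hwe (hTsm.of_le (by norm_cast)))
  have h4 := hN.angularLaplacian_chart hψ hu h0.ne' hr'
    (f := fun θ' => w (expChart b (r • (θ' : EuclideanSpace ℝ (Fin (m + 1)))))) (by
      refine ContMDiffAt.comp (ψ.symm u) (g := w ∘ expChart b)
        (f := fun θ' : USphere m => r • (θ' : EuclideanSpace ℝ (Fin (m + 1)))) hwe.contMDiffAt ?_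
      exact (((contDiff_const_smul (𝕜 := ℝ) (n := 2) r).contMDiff).comp
        (contMDiff_coe_usphere (N := 2))).contMDiffAt)
  -- The computation produces ∂_r log √|g̃|, which equals ∂_r log J because α does not depend on r.
  rw [h1, h4, ← hN.deriv_log_sqrt_det_tGram hψ hu hr']
  exact (congrArg Neg.neg h2).symm.trans h3

end IsNormalChart

end AngularLaplacian
-- Uniform normal charts around a point.
lemma exists_orthonormal {n : ℕ} {M : Type*} [TopologicalSpace M]
    [ChartedSpace (EuclideanSpace ℝ (Fin n)) M]
    [RiemannianBundle (fun x : M => TangentSpace (𝓡 n) x)] (x : M) :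
    ∃ b : Fin n → TangentSpace (𝓡 n) x, Orthonormal ℝ b := by
  have hfin : FiniteDimensional ℝ (TangentSpace (𝓡 n) x) :=
    inferInstanceAs (FiniteDimensional ℝ (EuclideanSpace ℝ (Fin n)))
  have hrank : Module.finrank ℝ (TangentSpace (𝓡 n) x) = n :=
    finrank_euclideanSpace_fin (𝕜 := ℝ) (n := n)
  exact ⟨_, ((stdOrthonormalBasis ℝ (TangentSpace (𝓡 n) x)).reindex
    (finCongr hrank)).orthonormal⟩

/-- All centres near `x₀` have normal charts of a common radius, and these depend smoothly on the
centre. -/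
theorem exists_uniform_isNormalChart {n : ℕ} {M : Type*} [EMetricSpace M]
    [ChartedSpace (EuclideanSpace ℝ (Fin n)) M] [IsManifold (𝓡 n) ∞ M]
    [RiemannianBundle (fun x : M => TangentSpace (𝓡 n) x)]
    [IsContMDiffRiemannianBundle (𝓡 n) ∞ (EuclideanSpace ℝ (Fin n))
      (fun x : M => TangentSpace (𝓡 n) x)]
    {φ : OpenPartialHomeomorph M (EuclideanSpace ℝ (Fin n))}
    (hφ : φ ∈ IsManifold.maximalAtlas (𝓡 n) ∞ M) {x₀ : M} (hx₀ : x₀ ∈ φ.source) :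
    ∃ ε : ℝ, 0 < ε ∧
      (∀ (U : Set M) (s : Fin n → ∀ x : M, TangentSpace (𝓡 n) x),
        U ⊆ Metric.eball x₀ (ENNReal.ofReal ε) →
        (∀ i, ContMDiffOn (𝓡 n) (𝓡 n).tangent ∞
          (fun x => (⟨x, s i x⟩ : TangentBundle (𝓡 n) M)) U) →
        (∀ x ∈ U, Orthonormal ℝ (fun i => s i x)) →
        ContMDiffOn ((𝓡 n).prod (𝓡 n)) (𝓡 n) ∞
          (fun q : M × EuclideanSpace ℝ (Fin n) => expChart (fun i => s i q.1) q.2)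
          (U ×ˢ Metric.ball 0 ε) ∧
        ∀ k l, ContMDiffOn ((𝓡 n).prod (𝓡 n)) 𝓘(ℝ, ℝ) ∞
          (fun q : M × EuclideanSpace ℝ (Fin n) => expGram (fun i => s i q.1) q.2 k l)
          (U ×ˢ Metric.ball 0 ε)) ∧
      ∀ x ∈ Metric.eball x₀ (ENNReal.ofReal ε), ∀ b : Fin n → TangentSpace (𝓡 n) x,
        Orthonormal ℝ b → ∃ e, IsNormalChart b ε e ∧ e.source ⊆ φ.source := by
  obtain ⟨ρ, X, hX, ⟨Φ, hΦ, hsub, hsm⟩, ε₀, hε₀, hev⟩ := exists_uniform_chartExp hφ hx₀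
  obtain ⟨δ, hδ, hball⟩ := EMetric.mem_nhds_iff.1 hev
  -- The radius δ is extended and may be infinite; truncating it at 1 yields a real number to
  -- compare with ε₀.
  have hδ' : min δ 1 ≠ ⊤ := ((min_le_right _ _).trans_lt ENNReal.one_lt_top).ne
  have hδ0 : 0 < (min δ 1).toReal := ENNReal.toReal_pos (lt_min hδ one_pos).ne' hδ'
  have key : ∀ x ∈ Metric.eball x₀ (ENNReal.ofReal (min ε₀ (min δ 1).toReal)), x ∈ φ.source ∧
      φ x ∈ Metric.ball (φ x₀) ρ ∧ ∀ b : Fin n → TangentSpace (𝓡 n) x, Orthonormal ℝ b →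
        ∀ u ∈ Metric.ball 0 (min ε₀ (min δ 1).toReal), ‖frameCoord φ b u‖ < ρ := by
    intro x hx
    have hx' : x ∈ Metric.eball x₀ δ := by
      refine Metric.eball_subset_eball ?_ hx
      exact ((ENNReal.ofReal_le_ofReal (min_le_right _ _)).trans
        (ENNReal.ofReal_toReal hδ').le).trans (min_le_left _ _)
    obtain ⟨h1, h2, h3⟩ := hball hx'
    exact ⟨h1, h2, fun b hb u hu => h3 b hb u (Metric.ball_subset_ball (min_le_left _ _) hu)⟩
  refine ⟨min ε₀ (min δ 1).toReal, lt_min hε₀ hδ0, fun U s hU hs ho => ?_, fun x hx b hb => ?_⟩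
  · have h1 : ∀ x ∈ U, x ∈ φ.source ∧ φ x ∈ Metric.ball (φ x₀) ρ := fun x hx =>
      ⟨(key x (hU hx)).1, (key x (hU hx)).2.1⟩
    have h2 : ∀ x ∈ U, ∀ u ∈ Metric.ball 0 (min ε₀ (min δ 1).toReal),
        ‖frameCoord φ (fun i => s i x) u‖ < ρ := fun x hx =>
      (key x (hU hx)).2.2 _ (ho x hx)
    exact ⟨hX.contMDiffOn_expChart hφ h1 hs h2, hX.contMDiffOn_expGram hφ h1 hs h2⟩
  · obtain ⟨h1, h2, h3⟩ := key x hx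
    exact hX.exists_isNormalChart hφ hΦ hsub hsm h1 h2 hb (lt_min hε₀ hδ0) (h3 b hb)

end PolarGeo

/-! ### The main theorem. -/

theorem mainTheorem10 {m : ℕ} {M : Type*} [EMetricSpace M]
    [ChartedSpace (EuclideanSpace ℝ (Fin (m + 1))) M] [IsManifold (𝓡 (m + 1)) ∞ M]
    [RiemannianBundle (fun x : M => TangentSpace (𝓡 (m + 1)) x)]
    [IsContMDiffRiemannianBundle (𝓡 (m + 1)) ∞ (EuclideanSpace ℝ (Fin (m + 1)))
      (fun x : M => TangentSpace (𝓡 (m + 1)) x)]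
    [IsRiemannianManifold (𝓡 (m + 1)) M]
    (φ : OpenPartialHomeomorph M (EuclideanSpace ℝ (Fin (m + 1))))
    (hφ : φ ∈ IsManifold.maximalAtlas (𝓡 (m + 1)) ∞ M) (x₀ : M) (hx₀ : x₀ ∈ φ.source) :
    ∃ ε : ℝ, 0 < ε ∧
    -- smooth dependence on the centre, for any smooth field of orthonormal frames
    (∀ (U : Set M) (s : Fin (m + 1) → ∀ x : M, TangentSpace (𝓡 (m + 1)) x),
      IsOpen U → U ⊆ Metric.eball x₀ (ENNReal.ofReal ε) →
      (∀ i, ContMDiffOn (𝓡 (m + 1)) (𝓡 (m + 1)).tangent ∞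
        (fun x => (⟨x, s i x⟩ : TangentBundle (𝓡 (m + 1)) M)) U) →
      (∀ x ∈ U, Orthonormal ℝ (fun i => s i x)) →
      ContMDiffOn ((𝓡 (m + 1)).prod (𝓡 (m + 1))) (𝓡 (m + 1)) ∞
        (fun q : M × EuclideanSpace ℝ (Fin (m + 1)) => expChart (fun i => s i q.1) q.2)
        (U ×ˢ Metric.ball 0 ε) ∧
      (∀ k l, ContMDiffOn ((𝓡 (m + 1)).prod (𝓡 (m + 1))) 𝓘(ℝ, ℝ) ∞
        (fun q : M × EuclideanSpace ℝ (Fin (m + 1)) => expGram (fun i => s i q.1) q.2 k l)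
        (U ×ˢ Metric.ball 0 ε)) ∧
      ∀ ψ ∈ IsManifold.maximalAtlas (𝓡 m) ∞ (USphere m), ∀ i j,
        ContMDiffOn ((𝓡 (m + 1)).prod 𝓘(ℝ, ℝ × EuclideanSpace ℝ (Fin m))) 𝓘(ℝ, ℝ) ∞
          (fun q : M × (ℝ × EuclideanSpace ℝ (Fin m)) =>
            tGram (fun i => s i q.1) ψ q.2.1 q.2.2 i j)
          (U ×ˢ (Ioo (-ε) ε ×ˢ ψ.target))) ∧
    ∀ x ∈ Metric.eball x₀ (ENNReal.ofReal ε),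
    Metric.eball x (ENNReal.ofReal ε) ⊆ φ.source ∧
    ∀ b : Fin (m + 1) → TangentSpace (𝓡 (m + 1)) x, Orthonormal ℝ b →
    -- the exponential map gives a normal chart on the geodesic ball of radius `ε`
    (∃ e ∈ IsManifold.maximalAtlas (𝓡 (m + 1)) ∞ M,
      e.source = Metric.eball x (ENNReal.ofReal ε) ∧ e.target = Metric.ball 0 ε ∧
      EqOn e.symm (expChart b) (Metric.ball 0 ε)) ∧
    expChart b 0 = x ∧ expGram b 0 = 1 ∧
    (∀ k i j, pd k (fun y => expGram b y i j) 0 = 0) ∧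
    -- rays are minimizing geodesics; images of balls and spheres
    (∀ θ : USphere m,
      IsGeodesicOn (n := m + 1) (fun t : ℝ => expChart b (t • (θ : EuclideanSpace ℝ (Fin (m + 1)))))
        (Ioo (-ε) ε) ∧
      velocity (fun t : ℝ => expChart b (t • (θ : EuclideanSpace ℝ (Fin (m + 1))))) 0 =
        ⟨x, ∑ i, (θ : EuclideanSpace ℝ (Fin (m + 1))) i • b i⟩ ∧
      ∀ r, 0 ≤ r → r < ε →
        Manifold.pathELength (𝓡 (m + 1))
          (fun t : ℝ => expChart b (t • (θ : EuclideanSpace ℝ (Fin (m + 1))))) 0 r =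
            edist x (expChart b (r • (θ : EuclideanSpace ℝ (Fin (m + 1)))))) ∧
    (∀ r, 0 < r → r ≤ ε →
      expChart b '' Metric.ball 0 r = Metric.eball x (ENNReal.ofReal r)) ∧
    (∀ r, 0 ≤ r → r < ε →
      expChart b '' Metric.closedBall 0 r = Metric.closedEBall x (ENNReal.ofReal r) ∧
      expChart b '' Metric.sphere 0 r = {p | edist p x = ENNReal.ofReal r}) ∧
    -- the exponential chart orients the ball, coherently with the chart `φ`
    (IsDirect (coordFrame (d := m + 1) φ.symm (φ x)) b →
      ∀ y ∈ Metric.ball (0 : EuclideanSpace ℝ (Fin (m + 1))) ε,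
        IsDirect (coordFrame (d := m + 1) φ.symm (φ (expChart b y)))
          (coordFrame (expChart b) y)) ∧
    -- `L_θ(x, r)` is the Laplacian of the smooth Riemannian metric `g_{x,r}` on the sphere
    (∀ r, 0 < r → r < ε →
      (∃ H : ContMDiffRiemannianMetric (𝓡 m) ∞ (EuclideanSpace ℝ (Fin m))
          (fun θ : USphere m => TangentSpace (𝓡 m) θ),
        ∀ (θ : USphere m) (v w : TangentSpace (𝓡 m) θ), H.inner θ v w = sphForm b r θ v w) ∧
      ∀ (f : USphere m → ℝ) (θ : USphere m), ContMDiffAt (𝓡 m) 𝓘(ℝ, ℝ) 2 f θ →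
        angularLaplacian b r f θ = laplaceBeltrami (sphForm b r) f θ) ∧
    -- the Laplacian in geodesic polar coordinates
    (∀ r, 0 < r → r < ε → ∀ (θ : USphere m) (w : M → ℝ),
      ContMDiffAt (𝓡 (m + 1)) 𝓘(ℝ, ℝ) 2 w
        (expChart b (r • (θ : EuclideanSpace ℝ (Fin (m + 1))))) →
      -laplaceBeltrami (metric (n := m + 1) (M := M)) w
          (expChart b (r • (θ : EuclideanSpace ℝ (Fin (m + 1))))) =
        deriv (deriv fun ρ : ℝ =>
            w (expChart b (ρ • (θ : EuclideanSpace ℝ (Fin (m + 1)))))) r +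
          (m : ℝ) / r * deriv (fun ρ : ℝ =>
            w (expChart b (ρ • (θ : EuclideanSpace ℝ (Fin (m + 1)))))) r +
          deriv (fun ρ : ℝ =>
            Real.log (expJ b (ρ • (θ : EuclideanSpace ℝ (Fin (m + 1)))))) r *
            deriv (fun ρ : ℝ =>
              w (expChart b (ρ • (θ : EuclideanSpace ℝ (Fin (m + 1)))))) r -
          (r ^ 2)⁻¹ * angularLaplacian b r
            (fun θ' => w (expChart b (r • (θ' : EuclideanSpace ℝ (Fin (m + 1)))))) θ) ∧
    -- polar coordinates associated with a chart `ψ` of the sphere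
    ∀ ψ ∈ IsManifold.maximalAtlas (𝓡 m) ∞ (USphere m),
    (∀ i j, ContDiffOn ℝ ∞ (fun q : ℝ × EuclideanSpace ℝ (Fin m) => tGram b ψ q.1 q.2 i j)
      (Ioo (-ε) ε ×ˢ ψ.target)) ∧
    ∀ u ∈ ψ.target,
    0 < sphDensity ψ u ∧
    (∀ r, 0 < r → r < ε →
      -- Gauss's lemma
      metric (polarMap b ψ (r, u)) (dR b ψ r u) (dR b ψ r u) = 1 ∧
      (∀ i, metric (polarMap b ψ (r, u)) (dR b ψ r u) (dTheta b ψ r u i) = 0) ∧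
      -- the outward unit normal of the geodesic ball is `∂_r`
      (∀ ν : TangentSpace (𝓡 (m + 1)) (polarMap b ψ (r, u)),
        IsOutwardUnitNormal (Metric.eball x (ENNReal.ofReal r)) (polarMap b ψ (r, u)) ν ↔
          ν = dR b ψ r u) ∧
      -- the exponential chart preserves the orientation of polar frames
      (IsDirect (coordFrame (expChart b) (r • (ψ.symm u : EuclideanSpace ℝ (Fin (m + 1)))))
          (polarFrame b ψ r u (dR b ψ r u)) ↔
        IsDirect (fun i => (EuclideanSpace.single i 1 : EuclideanSpace ℝ (Fin (m + 1))))
          (euclPolarFrame ψ u)) ∧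
      -- `∂_r` is the unit normal that completes the angular frame to a direct one
      (IsDirect (fun i => (EuclideanSpace.single i 1 : EuclideanSpace ℝ (Fin (m + 1))))
          (euclPolarFrame ψ u) →
        (∀ ν : TangentSpace (𝓡 (m + 1)) (polarMap b ψ (r, u)),
          (‖ν‖ = 1 ∧ (∀ i, metric (polarMap b ψ (r, u)) ν (dTheta b ψ r u i) = 0) ∧
            IsDirect (coordFrame (expChart b)
              (r • (ψ.symm u : EuclideanSpace ℝ (Fin (m + 1))))) (polarFrame b ψ r u ν)) ↔
            ν = dR b ψ r u) ∧
        -- the volume form of the ball, evaluated on `(∂_r, ∂_θ)`, is the area form of the sphere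
        ∃ d : ℝ, HasDet (coordFrame (expChart b)
            (r • (ψ.symm u : EuclideanSpace ℝ (Fin (m + 1)))))
            (polarFrame b ψ r u (dR b ψ r u)) d ∧
          expJ b (r • (ψ.symm u : EuclideanSpace ℝ (Fin (m + 1)))) * d =
            √(polarGram b ψ r u).det) ∧
      -- angular components of the metric, and of `g_{x,r}`, in the chart
      polarGram b ψ r u = r ^ 2 • tGram b ψ r u ∧
      pullGram (sphForm b r) ψ.symm u = tGram b ψ r u ∧
      deriv (fun ρ : ℝ => Real.log √(tGram b ψ ρ u).det) r =
        deriv (fun ρ : ℝ =>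
          Real.log (expJ b (ρ • (ψ.symm u : EuclideanSpace ℝ (Fin (m + 1)))))) r ∧
      -- local expression of `L_θ(x, r)`
      ∀ f : USphere m → ℝ, ContMDiffAt (𝓡 m) 𝓘(ℝ, ℝ) 2 f (ψ.symm u) →
        angularLaplacian b r f (ψ.symm u) =
          coordLaplacian (tGram b ψ r) (f ∘ ψ.symm) u) ∧
    (∀ r, -ε < r → r < ε →
      (tGram b ψ r u).PosDef ∧
      √(tGram b ψ r u).det =
        sphDensity ψ u * expJ b (r • (ψ.symm u : EuclideanSpace ℝ (Fin (m + 1))))) ∧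
    -- vanishing derivatives at `r = 0`: metric components
    (∀ i j, HasDerivAt (fun r : ℝ => tGram b ψ r u i j) 0 0 ∧
      ∀ k, HasDerivAt (fun r : ℝ => pd k (fun u' => tGram b ψ r u' i j) u) 0 0) ∧
    -- determinant
    (HasDerivAt (fun r : ℝ => (tGram b ψ r u).det) 0 0 ∧
      ∀ k, HasDerivAt (fun r : ℝ => pd k (fun u' => (tGram b ψ r u').det) u) 0 0) ∧
    -- volume density
    HasDerivAt (fun r : ℝ => √(tGram b ψ r u).det / sphDensity ψ u) 0 0 ∧
    (∀ k, HasDerivAt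
      (fun r : ℝ => pd k (fun u' => √(tGram b ψ r u').det / sphDensity ψ u') u) 0 0) ∧
    ∀ k k', HasDerivAt
      (fun r : ℝ => pd k (fun u' => pd k' (fun u'' =>
        √(tGram b ψ r u'').det / sphDensity ψ u'') u') u) 0 0 := by
  obtain ⟨ε, hε, hsmooth, hchart⟩ := exists_uniform_isNormalChart hφ hx₀
  refine ⟨ε, hε, fun U s _ hUsub hs ho => ?_, fun x hx => ⟨?_, fun b hb => ?_⟩⟩
  · obtain ⟨h1, h2⟩ := hsmooth U s hUsub hs ho
    exact ⟨h1, h2, fun ψ hψ i j => contMDiffOn_tGram hψ h2 i j⟩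
  -- The inclusion of the ball does not mention a frame; any one will do, since the source of its
  -- normal chart is the metric ball.
  · obtain ⟨b, hb⟩ := exists_orthonormal (n := m + 1) x
    obtain ⟨e, hN, hsub⟩ := hchart x hx b hb
    rwa [hN.source_eq] at hsub
  obtain ⟨e, hN, hsub⟩ := hchart x hx b hb
  have habs : ∀ {r : ℝ}, 0 ≤ r → r < ε → |r| < ε := fun h0 hr => by rwa [abs_of_nonneg h0]
  refine ⟨⟨e, hN.mem_maximalAtlas, hN.source_eq, hN.target, hN.symm⟩, hN.zero, hN.expGram_zero,
    hN.pd_expGram_zero, fun θ => ⟨?_, hN.velocity θ, fun r h0 hr => ?_⟩,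
    fun r h0 hr => hN.image_ball h0 hr,
    fun r h0 hr => ⟨hN.image_closedBall h0 hr, hN.image_sphere h0 hr⟩,
    fun hdir y hy => hN.isDirect_coordFrame hφ hsub hdir hy,
    fun r h0 hr => ⟨⟨(hN.isRiemannianForm_sphForm h0.ne' (habs h0.le hr)).toMetric,
      (hN.isRiemannianForm_sphForm h0.ne' (habs h0.le hr)).innerAt_apply⟩,
      fun f θ _ => angularLaplacian_eq b h0.ne' f θ⟩,
    fun r h0 hr θ w hw => hN.laplaceBeltrami_polar h0 hr θ hw,
    fun ψ hψ => ⟨hN.contDiffOn_tGram hψ, fun u hu => ⟨hN.sphDensity_pos hψ hu,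
      fun r h0 hr => ?_,
      fun r hr hr' => ⟨hN.tGram_posDef hψ hu (abs_lt.2 ⟨hr, hr'⟩),
        hN.sqrt_det_tGram hψ hu (abs_lt.2 ⟨hr, hr'⟩)⟩,
      fun i j => ⟨hN.hasDerivAt_tGram u i j, hN.hasDerivAt_pd_tGram hψ hu i j⟩,
      ⟨hN.hasDerivAt_det_tGram hψ hu, hN.hasDerivAt_pd_det_tGram hψ hu⟩,
      hN.hasDerivAt_density hψ hu, hN.hasDerivAt_pd_density hψ hu,
      hN.hasDerivAt_pd_pd_density hψ hu⟩⟩⟩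
  -- Since ‖θ‖ = 1, the natural time domain of the ray is exactly (-ε, ε).
  · have hset : {t : ℝ | ‖t • (θ : EuclideanSpace ℝ (Fin (m + 1)))‖ < ε} = Ioo (-ε) ε := by
      ext t
      simp [norm_smul, abs_lt]
    exact hset ▸ hN.geodesic θ
  · rw [hN.pathELength_ray _ h0 (by simpa using hr),
      hN.edist_expChart (by simpa [norm_smul, abs_of_nonneg h0] using hr), norm_smul,
      Real.norm_of_nonneg h0]
  · have hr' := habs h0.le hr
    exact ⟨hN.metric_dR_dR hψ hu hr', hN.metric_dR_dTheta hψ hu hr',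
      fun ν => ⟨hN.eq_dR_of_isOutwardUnitNormal hψ hu h0 hr, by
        rintro rfl
        exact hN.isOutwardUnitNormal_dR hψ hu h0 hr⟩,
      hN.isDirect_polarFrame_iff hψ hu h0 hr',
      fun hdir => ⟨hN.normal_direct_iff hψ hu h0 hr' hdir,
        hN.exists_hasDet_polarFrame hψ hu h0 hr' hdir⟩,
      hN.polarGram_eq hψ hu hr', hN.pullGram_sphForm hψ hu hr' h0.ne',
      hN.deriv_log_sqrt_det_tGram hψ hu hr',
      fun f hf => hN.angularLaplacian_chart hψ hu h0.ne' hr' hf⟩
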